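/- **Setting.** Let $(\mathcal V,\otimes,I)$ be a bicomplete symmetric monoidal closed category and $U=\mathcal V(I,-):\mathcal V\to\mathrm{Set}$, with left adjoint $F$, $F(A)=\coprod_{A}I$. For a set $S$, a $\mathcal V$-quiver on $S$ is a family $Q=(Q(a,b))_{a,b\in S}$ of objects of $\mathcal V$. Quivers on $S$ form a monoidal category with $(P\otimes Q)(a,b)=\coprod_{c\in S}P(a,c)\otimes Q(c,b)$ and unit $I_S$, where $I_S(a,a)=I$ and $I_S(a,b)=0$ (initial) for $a\ne b$; $\mathcal V$-categories with object set $S$ are the monoids in it (small $\mathcal V$-categories form the category $\mathcal V\text{-}\mathrm{Cat}$). Let $\mathrm{fint}$ be the category of the posets $[n]=\{0<\dots<n\}$, $n\ge 0$, and the monotone maps that preserve both endpoints, monoidal by gluing: $[m]\otimes[n]=[m+n]$. A *templicial object* $X$ in $\mathcal V$ is a set $S$ of vertices with a strongly unital colax monoidal functor $X:\mathrm{fint}^{op}\to\mathcal V$-quivers on $S$; its comultiplications are written $\mu_{k,l}:X_{k+l}\to X_k\otimes X_l$. It has inner face maps $d_i$ $(0<i<n)$ on $X_n$ and degeneracy maps,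 and $s_0:I_S\cong X_0\to X_1$. A templicial morphism $X\to Y$ is a map $f$ of vertex sets with a monoidal natural transformation $f_!X\to Y$; equivalently, natural maps $X_n(a,b)\to Y_n(f(a),f(b))$ compatible with comultiplications and counits. The *templicial nerve* $N_{\mathcal V}(\mathcal C)$ of a small $\mathcal V$-category $\mathcal C$ has as vertices the objects of $\mathcal C$ and $N_{\mathcal V}(\mathcal C)_n=\mathcal C^{\otimes n}$, with inner faces given by composition and degeneracies by identities. For a templicial object $X$, its *homotopy category* $h_{\mathcal V}X$ is the value at $X$ of the left adjoint of $N_{\mathcal V}$, i.e. a small $\mathcal V$-category with a universal templicial morphism $X\to N_{\mathcal V}(h_{\mathcal V}X)$. For a simplicial set $K$ the templicial object $\tilde F(K)$ has vertex set $K_0$ and $\tilde F(K)_n(a,b)=F\{\sigma\in K_n \text{ with first vertex } a \text{ and last vertex } b\}$, with $\mu_{k,l}$ sending a simplex to its front $k$-face tensor its back $l$-face. The underlying simplicial set $\tilde U(X)$ has as $n$-simplices the templicial morphisms $\tilde F(\Delta^n)\to X$. The functor $h:\mathrm{SSet}\to\mathrm{Cat}$ is the left adjoint of the nerve, and $\mathcal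 U(\mathcal C)$ is the underlying category of a $\mathcal V$-category $\mathcal C$, with hom-sets $U(\mathcal C(a,b))$. A templicial morphism $\theta:X\to N_{\mathcal V}(\mathcal C)$ induces $\tilde U(X)\to\tilde U(N_{\mathcal V}(\mathcal C))\to N(\mathcal U(\mathcal C))$ and hence a functor $h\tilde U(X)\to\mathcal U(\mathcal C)$; for the unit $X\to N_{\mathcal V}(h_{\mathcal V}X)$ this is the canonical functor $h\tilde U(X)\to\mathcal U(h_{\mathcal V}X)$. A *necklace* is a pair $(T,p)$ with $\{0,p\}\subseteq T\subseteq[p]$; a map $(T,p)\to(T',q)$ is an endpoint preserving monotone map $f:[p]\to[q]$ with $T'\subseteq f(T)$. For $T=\{0=t_0<\dots<t_k=p\}$ put $X_T=X_{t_1}\otimes X_{t_2-t_1}\otimes\dots\otimes X_{t_k-t_{k-1}}$ (with $X_{\{0\}}=I_S$); the simplicial structure and the comultiplications make $X_\bullet(a,b):T\mapsto X_T(a,b)$ a contravariant functor from necklaces to $\mathcal V$. The templicial object $X$ is a *quasi-category in $\mathcal V$* if for all vertices $a,b$ and all $0<j<n$ every natural transformation $\tilde F(\Lambda^n_j)_\bullet(0,n)\to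 X_\bullet(a,b)$ extends to $\tilde F(\Delta^n)_\bullet(0,n)$. For vertices $a,b$ of a templicial object $X$, let $\mathrm{Hom}^L_X(a,b)_1$ be the pullback, with projections $\pi_1,\pi_2$, of $-\otimes s_0:X_1(a,b)\to(X_1\otimes X_1)(a,b)$ and $\mu_{1,1}:X_2(a,b)\to(X_1\otimes X_1)(a,b)$, and let $q:X_1(a,b)\to h'_{\mathcal V}X(a,b)$ be the coequaliser of $d_1\pi_2,\ \pi_1:\mathrm{Hom}^L_X(a,b)_1\rightrightarrows X_1(a,b)$. **Statement.** Assume that $U$ is faithful and preserves and reflects reflexive coequalisers. 1. For every quasi-category $X$ in $\mathcal V$ there is a unique quiver morphism $m:h'_{\mathcal V}X\otimes h'_{\mathcal V}X\to h'_{\mathcal V}X$ with $m\,(q\otimes q)\,\mu_{1,1}=q\,d_1$ on $X_2$; with $m$ as composition and $q s_0$ as unit, $h'_{\mathcal V}X$ is a $\mathcal V$-category. There is a unique templicial morphism $\eta_X:X\to N_{\mathcal V}(h'_{\mathcal V}X)$ that is the identity on vertices and $q$ on $X_1$. 2. Every $N_{\mathcal V}(\mathcal C)$ is a quasi-category in $\mathcal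 V$, and $X\mapsto h'_{\mathcal V}X$ extends to a functor $h'_{\mathcal V}$ from the full subcategory of quasi-categories in $\mathcal V$ to $\mathcal V\text{-}\mathrm{Cat}$ which is left adjoint to $N_{\mathcal V}$, with unit $\eta$. For every left adjoint $h_{\mathcal V}$ of $N_{\mathcal V}$ on all templicial objects there is a unique natural isomorphism $h_{\mathcal V}\cong h'_{\mathcal V}$ on quasi-categories in $\mathcal V$ that is compatible with the units. 3. For every quasi-category $X$ in $\mathcal V$, $\eta_X$ is universal among all templicial morphisms from $X$ to templicial nerves, so that $h_{\mathcal V}X$ exists and there is a unique isomorphism of $\mathcal V$-categories $h_{\mathcal V}X\cong h'_{\mathcal V}X$ compatible with the units; and the canonical functor $h\tilde U(X)\to\mathcal U(h_{\mathcal V}X)$ is an isomorphism of categories. -/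

import Mathlib

open CategoryTheory MonoidalCategory Limits Opposite

universe v u

noncomputable section

set_option linter.unusedSectionVars false
set_option linter.unusedSimpArgs false

/-- The underlying set functor `U = V(I, -)`. -/
abbrev underlying (V : Type u) [Category.{v} V] [MonoidalCategory V] : V ⥤ Type v :=
  coyoneda.obj (op (𝟙_ V))

/-- `V`-enriched quivers with vertex set `S`. -/
structure VQuiv (V : Type u) (S : Type v) : Type (max u v) where
  /-- the object of edges between two vertices -/
  obj : S → S → V

namespace VQuiv

section

variable {V : Type u} [Category.{v} V] {S : Type v}

instance : CoeFun (VQuiv V S) (fun _ => S → S → V) := ⟨VQuiv.obj⟩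

/-- Morphisms of `V`-enriched quivers with the same vertex set. -/
@[ext]
structure Hom (P Q : VQuiv V S) : Type v where
  /-- the components of a morphism of quivers -/
  app : ∀ a b, P a b ⟶ Q a b

instance : Category (VQuiv V S) where
  Hom P Q := Hom P Q
  id P := ⟨fun a b => 𝟙 (P a b)⟩
  comp f g := ⟨fun a b => f.app a b ≫ g.app a b⟩

@[ext]
theorem hom_ext {P Q : VQuiv V S} {f g : P ⟶ Q} (h : ∀ a b, f.app a b = g.app a b) : f = g :=
  Hom.ext (funext fun a => funext fun b => h a b)

@[simp]
theorem id_app (P : VQuiv V S) (a b : S) : (𝟙 P : P ⟶ P).app a b = 𝟙 (P a b) := rfl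

@[simp]
theorem comp_app {P Q R : VQuiv V S} (f : P ⟶ Q) (g : Q ⟶ R) (a b : S) :
    (f ≫ g).app a b = f.app a b ≫ g.app a b := rfl

/-- Restriction of quivers along a map of vertex sets. -/
def pullback {T : Type v} (f : S → T) : VQuiv V T ⥤ VQuiv V S where
  obj Q := ⟨fun a b => Q (f a) (f b)⟩
  map φ := ⟨fun a b => φ.app (f a) (f b)⟩

end

section Monoidal

variable {V : Type u} [Category.{v} V] [MonoidalCategory V] [HasColimits V] {S : Type v}

/-- `(P ⊗ Q)(a,b) = ∐_c P(a,c) ⊗ Q(c,b)`. -/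
def tensor (P Q : VQuiv V S) : VQuiv V S := ⟨fun a b => ∐ fun c : S => P a c ⊗ Q c b⟩

/-- The unit quiver: `I` on the diagonal and the initial object elsewhere, written as the
coproduct of copies of `I` over all proofs of `a = b`. -/
def unit (V : Type u) [Category.{v} V] [MonoidalCategory V] [HasColimits V] (S : Type v) :
    VQuiv V S :=
  ⟨fun a b => ∐ fun _ : ULift.{v} (PLift (a = b)) => 𝟙_ V⟩

/-- The coprojections into a tensor product of quivers. -/
def ι (P Q : VQuiv V S) (a c b : S) : P a c ⊗ Q c b ⟶ tensor P Q a b :=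
  Sigma.ι (fun c : S => P a c ⊗ Q c b) c

/-- The coprojection into the unit quiver. -/
def ιUnit {a b : S} (h : a = b) : 𝟙_ V ⟶ unit V S a b :=
  Sigma.ι (fun _ : ULift.{v} (PLift (a = b)) => 𝟙_ V) ⟨⟨h⟩⟩

/-- Morphisms out of a tensor product of quivers. -/
def desc {P Q : VQuiv V S} {a b : S} {Z : V} (f : ∀ c, P a c ⊗ Q c b ⟶ Z) :
    tensor P Q a b ⟶ Z :=
  Sigma.desc f

/-- Morphisms out of the unit quiver. -/
def descUnit {a b : S} {Z : V} (f : a = b → (𝟙_ V ⟶ Z)) : unit V S a b ⟶ Z :=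
  Sigma.desc fun h => f h.down.down

@[simp]
theorem ι_desc {P Q : VQuiv V S} {a b : S} {Z : V} (f : ∀ c, P a c ⊗ Q c b ⟶ Z) (c : S) :
    ι P Q a c b ≫ desc f = f c :=
  Sigma.ι_desc _ _

@[simp]
theorem ι_desc_assoc {P Q : VQuiv V S} {a b : S} {Z W : V} (f : ∀ c, P a c ⊗ Q c b ⟶ Z)
    (c : S) (g : Z ⟶ W) : ι P Q a c b ≫ desc f ≫ g = f c ≫ g := by
  rw [← Category.assoc, ι_desc]

@[simp]
theorem ιUnit_descUnit {a b : S} {Z : V} (f : a = b → (𝟙_ V ⟶ Z)) (h : a = b) :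
    ιUnit h ≫ descUnit f = f h :=
  Sigma.ι_desc (fun h : ULift.{v} (PLift (a = b)) => f h.down.down) ⟨⟨h⟩⟩

@[simp]
theorem ιUnit_descUnit_assoc {a b : S} {Z W : V} (f : a = b → (𝟙_ V ⟶ Z)) (h : a = b)
    (g : Z ⟶ W) : ιUnit h ≫ descUnit f ≫ g = f h ≫ g := by
  rw [← Category.assoc, ιUnit_descUnit]

theorem tensor_ext {P Q : VQuiv V S} {a b : S} {Z : V} {f g : tensor P Q a b ⟶ Z}
    (h : ∀ c, ι P Q a c b ≫ f = ι P Q a c b ≫ g) : f = g :=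
  Sigma.hom_ext _ _ h

theorem unit_ext {a b : S} {Z : V} {f g : unit V S a b ⟶ Z}
    (h : ∀ e : a = b, ιUnit e ≫ f = ιUnit e ≫ g) : f = g :=
  Sigma.hom_ext _ _ fun e => h e.down.down

section Closed

variable [SymmetricCategory V] [MonoidalClosed V]

/-- Tensoring on the left preserves coproducts, in the form of a copairing. -/
def descL {J : Type v} {A : V} {B : J → V} {Z : V} (f : ∀ j, A ⊗ B j ⟶ Z) :
    A ⊗ (∐ B) ⟶ Z :=
  MonoidalClosed.uncurry (Sigma.desc fun j => MonoidalClosed.curry (f j))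

/-- Tensoring on the right preserves coproducts, in the form of a copairing. -/
def descR {J : Type v} {A : V} {B : J → V} {Z : V} (f : ∀ j, B j ⊗ A ⟶ Z) :
    (∐ B) ⊗ A ⟶ Z :=
  (β_ _ _).hom ≫ descL fun j => (β_ _ _).hom ≫ f j

theorem whiskerLeft_ι_descL {J : Type v} {A : V} {B : J → V} {Z : V}
    (f : ∀ j, A ⊗ B j ⟶ Z) (j : J) : A ◁ Sigma.ι B j ≫ descL f = f j := by
  simp [descL, ← MonoidalClosed.uncurry_natural_left]

theorem ι_whiskerRight_descR {J : Type v} {A : V} {B : J → V} {Z : V}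
    (f : ∀ j, B j ⊗ A ⟶ Z) (j : J) : Sigma.ι B j ▷ A ≫ descR f = f j := by
  simp [descR, whiskerLeft_ι_descL]

theorem ext_left {J : Type v} {A : V} {B : J → V} {Z : V} {f g : A ⊗ (∐ B) ⟶ Z}
    (h : ∀ j, A ◁ Sigma.ι B j ≫ f = A ◁ Sigma.ι B j ≫ g) : f = g := by
  apply MonoidalClosed.curry_injective
  refine Sigma.hom_ext _ _ fun j => ?_
  rw [← MonoidalClosed.curry_natural_left, ← MonoidalClosed.curry_natural_left, h]

theorem ext_right {J : Type v} {A : V} {B : J → V} {Z : V} {f g : (∐ B) ⊗ A ⟶ Z}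
    (h : ∀ j, Sigma.ι B j ▷ A ≫ f = Sigma.ι B j ▷ A ≫ g) : f = g := by
  rw [← cancel_epi (β_ A (∐ B)).hom]
  refine ext_left fun j => ?_
  simp [h]

/-- Copairing out of `A ⊗ (P ⊗ Q)(a,b)`. -/
def descTL {P Q : VQuiv V S} {a b : S} {A Z : V} (f : ∀ c, A ⊗ (P a c ⊗ Q c b) ⟶ Z) :
    A ⊗ tensor P Q a b ⟶ Z :=
  descL f

/-- Copairing out of `(P ⊗ Q)(a,b) ⊗ A`. -/
def descTR {P Q : VQuiv V S} {a b : S} {A Z : V} (f : ∀ c, (P a c ⊗ Q c b) ⊗ A ⟶ Z) :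
    tensor P Q a b ⊗ A ⟶ Z :=
  descR f

/-- Copairing out of `A ⊗ I(a,b)`. -/
def descUL {a b : S} {A Z : V} (f : a = b → (A ⊗ 𝟙_ V ⟶ Z)) : A ⊗ unit V S a b ⟶ Z :=
  descL fun h => f h.down.down

/-- Copairing out of `I(a,b) ⊗ A`. -/
def descUR {a b : S} {A Z : V} (f : a = b → (𝟙_ V ⊗ A ⟶ Z)) : unit V S a b ⊗ A ⟶ Z :=
  descR fun h => f h.down.down

@[simp]
theorem ι_descTL {P Q : VQuiv V S} {a b : S} {A Z : V} (f : ∀ c, A ⊗ (P a c ⊗ Q c b) ⟶ Z)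
    (c : S) : A ◁ ι P Q a c b ≫ descTL f = f c :=
  whiskerLeft_ι_descL _ _

@[simp]
theorem ι_descTR {P Q : VQuiv V S} {a b : S} {A Z : V} (f : ∀ c, (P a c ⊗ Q c b) ⊗ A ⟶ Z)
    (c : S) : ι P Q a c b ▷ A ≫ descTR f = f c :=
  ι_whiskerRight_descR _ _

@[simp]
theorem ι_descUL {a b : S} {A Z : V} (f : a = b → (A ⊗ 𝟙_ V ⟶ Z)) (h : a = b) :
    A ◁ ιUnit h ≫ descUL f = f h :=
  whiskerLeft_ι_descL _ _

@[simp]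
theorem ι_descUR {a b : S} {A Z : V} (f : a = b → (𝟙_ V ⊗ A ⟶ Z)) (h : a = b) :
    ιUnit h ▷ A ≫ descUR f = f h :=
  ι_whiskerRight_descR _ _

@[simp]
theorem ι_descTL_assoc {P Q : VQuiv V S} {a b : S} {A Z W : V}
    (f : ∀ c, A ⊗ (P a c ⊗ Q c b) ⟶ Z) (c : S) (g : Z ⟶ W) :
    A ◁ ι P Q a c b ≫ descTL f ≫ g = f c ≫ g := by
  rw [← Category.assoc, ι_descTL]

@[simp]
theorem ι_descTR_assoc {P Q : VQuiv V S} {a b : S} {A Z W : V}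
    (f : ∀ c, (P a c ⊗ Q c b) ⊗ A ⟶ Z) (c : S) (g : Z ⟶ W) :
    ι P Q a c b ▷ A ≫ descTR f ≫ g = f c ≫ g := by
  rw [← Category.assoc, ι_descTR]

@[simp]
theorem ι_descUL_assoc {a b : S} {A Z W : V} (f : a = b → (A ⊗ 𝟙_ V ⟶ Z)) (h : a = b)
    (g : Z ⟶ W) : A ◁ ιUnit h ≫ descUL f ≫ g = f h ≫ g := by
  rw [← Category.assoc, ι_descUL]

@[simp]
theorem ι_descUR_assoc {a b : S} {A Z W : V} (f : a = b → (𝟙_ V ⊗ A ⟶ Z)) (h : a = b)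
    (g : Z ⟶ W) : ιUnit h ▷ A ≫ descUR f ≫ g = f h ≫ g := by
  rw [← Category.assoc, ι_descUR]

theorem ext_TL {P Q : VQuiv V S} {a b : S} {A Z : V} {f g : A ⊗ tensor P Q a b ⟶ Z}
    (h : ∀ c, A ◁ ι P Q a c b ≫ f = A ◁ ι P Q a c b ≫ g) : f = g :=
  ext_left h

theorem ext_TR {P Q : VQuiv V S} {a b : S} {A Z : V} {f g : tensor P Q a b ⊗ A ⟶ Z}
    (h : ∀ c, ι P Q a c b ▷ A ≫ f = ι P Q a c b ▷ A ≫ g) : f = g :=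
  ext_right h

theorem ext_UL {a b : S} {A Z : V} {f g : A ⊗ unit V S a b ⟶ Z}
    (h : ∀ e : a = b, A ◁ ιUnit e ≫ f = A ◁ ιUnit e ≫ g) : f = g :=
  ext_left fun e => h e.down.down

theorem ext_UR {a b : S} {A Z : V} {f g : unit V S a b ⊗ A ⟶ Z}
    (h : ∀ e : a = b, ιUnit e ▷ A ≫ f = ιUnit e ▷ A ≫ g) : f = g :=
  ext_right fun e => h e.down.down

/-- The associator of quivers. -/
def assocIso (P Q R : VQuiv V S) :
    tensor (tensor P Q) R ≅ tensor P (tensor Q R) where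
  hom := ⟨fun a b => desc fun c => descTR fun d =>
    (α_ _ _ _).hom ≫ P a d ◁ ι Q R d c b ≫ ι P (tensor Q R) a d b⟩
  inv := ⟨fun a b => desc fun d => descTL fun c =>
    (α_ _ _ _).inv ≫ ι P Q a d c ▷ R c b ≫ ι (tensor P Q) R a c b⟩
  hom_inv_id := by
    ext a b
    refine tensor_ext fun c => ext_TR fun d => ?_
    simp
  inv_hom_id := by
    ext a b
    refine tensor_ext fun c => ext_TL fun d => ?_
    simp

/-- The left unitor of quivers. -/
def leftIso (P : VQuiv V S) : tensor (unit V S) P ≅ P where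
  hom := ⟨fun a b => desc fun c => descUR fun h => (λ_ _).hom ≫ eqToHom (by rw [h])⟩
  inv := ⟨fun a b => (λ_ _).inv ≫ ιUnit rfl ▷ P a b ≫ ι (unit V S) P a a b⟩
  hom_inv_id := by
    ext a b
    refine tensor_ext fun c => ext_UR fun h => ?_
    subst h
    simp
  inv_hom_id := by
    ext a b
    simp

/-- The right unitor of quivers. -/
def rightIso (P : VQuiv V S) : tensor P (unit V S) ≅ P where
  hom := ⟨fun a b => desc fun c => descUL fun h => (ρ_ _).hom ≫ eqToHom (by rw [h])⟩
  inv := ⟨fun a b => (ρ_ _).inv ≫ P a b ◁ ιUnit rfl ≫ ι P (unit V S) a b b⟩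
  hom_inv_id := by
    ext a b
    refine tensor_ext fun c => ext_UL fun h => ?_
    subst h
    simp
  inv_hom_id := by
    ext a b
    simp

instance : MonoidalCategoryStruct (VQuiv V S) where
  tensorObj P Q := tensor P Q
  tensorUnit := unit V S
  tensorHom f g := ⟨fun a b => desc fun c => (f.app a c ⊗ₘ g.app c b) ≫ ι _ _ a c b⟩
  whiskerLeft P _ _ g := ⟨fun a b => desc fun c => (P a c ◁ g.app c b) ≫ ι _ _ a c b⟩
  whiskerRight f Q := ⟨fun a b => desc fun c => (f.app a c ▷ Q c b) ≫ ι _ _ a c b⟩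
  associator := assocIso
  leftUnitor := leftIso
  rightUnitor := rightIso

/-- The coprojections into a tensor product of quivers. -/
def inj (P Q : VQuiv V S) (a c b : S) : P a c ⊗ Q c b ⟶ (P ⊗ Q) a b := ι P Q a c b

/-- The coprojection into the unit quiver. -/
def injUnit {a b : S} (h : a = b) : 𝟙_ V ⟶ (𝟙_ (VQuiv V S)) a b := ιUnit h

/-- Morphisms out of a tensor product of quivers. -/
def descT {P Q : VQuiv V S} {a b : S} {Z : V} (f : ∀ c, P a c ⊗ Q c b ⟶ Z) :
    (P ⊗ Q) a b ⟶ Z :=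
  desc f

/-- Morphisms out of the unit quiver. -/
def descU {a b : S} {Z : V} (f : a = b → (𝟙_ V ⟶ Z)) : (𝟙_ (VQuiv V S)) a b ⟶ Z :=
  descUnit f

@[simp]
theorem inj_descT {P Q : VQuiv V S} {a b : S} {Z : V} (f : ∀ c, P a c ⊗ Q c b ⟶ Z) (c : S) :
    inj P Q a c b ≫ descT f = f c :=
  ι_desc f c

@[simp]
theorem inj_descT_assoc {P Q : VQuiv V S} {a b : S} {Z W : V} (f : ∀ c, P a c ⊗ Q c b ⟶ Z)
    (c : S) (g : Z ⟶ W) : inj P Q a c b ≫ descT f ≫ g = f c ≫ g :=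
  ι_desc_assoc f c g

@[simp]
theorem injUnit_descU {a b : S} {Z : V} (f : a = b → (𝟙_ V ⟶ Z)) (h : a = b) :
    injUnit (S := S) h ≫ descU f = f h :=
  ιUnit_descUnit f h

@[simp]
theorem injUnit_descU_assoc {a b : S} {Z W : V} (f : a = b → (𝟙_ V ⟶ Z)) (h : a = b)
    (g : Z ⟶ W) : injUnit (S := S) h ≫ descU f ≫ g = f h ≫ g :=
  ιUnit_descUnit_assoc f h g

theorem tensorObj_ext {P Q : VQuiv V S} {a b : S} {Z : V} {f g : (P ⊗ Q) a b ⟶ Z}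
    (h : ∀ c, inj P Q a c b ≫ f = inj P Q a c b ≫ g) : f = g :=
  tensor_ext h

theorem tensorUnit_ext {a b : S} {Z : V} {f g : (𝟙_ (VQuiv V S)) a b ⟶ Z}
    (h : ∀ e : a = b, injUnit e ≫ f = injUnit e ≫ g) : f = g :=
  unit_ext h

theorem whiskerLeft_tensorObj_ext {P Q : VQuiv V S} {a b : S} {A Z : V}
    {f g : A ⊗ (P ⊗ Q) a b ⟶ Z}
    (h : ∀ c, A ◁ inj P Q a c b ≫ f = A ◁ inj P Q a c b ≫ g) : f = g :=
  ext_TL h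

theorem tensorObj_whiskerRight_ext {P Q : VQuiv V S} {a b : S} {A Z : V}
    {f g : (P ⊗ Q) a b ⊗ A ⟶ Z}
    (h : ∀ c, inj P Q a c b ▷ A ≫ f = inj P Q a c b ▷ A ≫ g) : f = g :=
  ext_TR h

theorem whiskerLeft_tensorUnit_ext {a b : S} {A Z : V} {f g : A ⊗ (𝟙_ (VQuiv V S)) a b ⟶ Z}
    (h : ∀ e : a = b, A ◁ injUnit e ≫ f = A ◁ injUnit e ≫ g) : f = g :=
  ext_UL h

theorem tensorUnit_whiskerRight_ext {a b : S} {A Z : V} {f g : (𝟙_ (VQuiv V S)) a b ⊗ A ⟶ Z}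
    (h : ∀ e : a = b, injUnit e ▷ A ≫ f = injUnit e ▷ A ≫ g) : f = g :=
  ext_UR h

@[simp]
theorem inj_tensorHom {P P' Q Q' : VQuiv V S} (f : P ⟶ P') (g : Q ⟶ Q') (a c b : S) :
    inj P Q a c b ≫ (f ⊗ₘ g).app a b = (f.app a c ⊗ₘ g.app c b) ≫ inj P' Q' a c b :=
  ι_desc _ c

@[simp]
theorem inj_tensorHom_assoc {P P' Q Q' : VQuiv V S} (f : P ⟶ P') (g : Q ⟶ Q') (a c b : S) {Z : V}
    (k : (P' ⊗ Q') a b ⟶ Z) :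
    inj P Q a c b ≫ (f ⊗ₘ g).app a b ≫ k = (f.app a c ⊗ₘ g.app c b) ≫ inj P' Q' a c b ≫ k := by
  have h := inj_tensorHom f g a c b
  simp only [← Category.assoc] at h ⊢
  rw [h]

@[simp]
theorem inj_whiskerLeft (P : VQuiv V S) {Q Q' : VQuiv V S} (g : Q ⟶ Q') (a c b : S) :
    inj P Q a c b ≫ (P ◁ g).app a b = P a c ◁ g.app c b ≫ inj P Q' a c b :=
  ι_desc _ c

@[simp]
theorem inj_whiskerLeft_assoc (P : VQuiv V S) {Q Q' : VQuiv V S} (g : Q ⟶ Q') (a c b : S) {Z : V}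
    (k : (P ⊗ Q') a b ⟶ Z) :
    inj P Q a c b ≫ (P ◁ g).app a b ≫ k = P a c ◁ g.app c b ≫ inj P Q' a c b ≫ k := by
  have h := inj_whiskerLeft P g a c b
  simp only [← Category.assoc] at h ⊢
  rw [h]

@[simp]
theorem inj_whiskerRight {P P' : VQuiv V S} (f : P ⟶ P') (Q : VQuiv V S) (a c b : S) :
    inj P Q a c b ≫ (f ▷ Q).app a b = f.app a c ▷ Q c b ≫ inj P' Q a c b :=
  ι_desc _ c

@[simp]
theorem inj_whiskerRight_assoc {P P' : VQuiv V S} (f : P ⟶ P') (Q : VQuiv V S) (a c b : S) {Z : V}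
    (k : (P' ⊗ Q) a b ⟶ Z) :
    inj P Q a c b ≫ (f ▷ Q).app a b ≫ k = f.app a c ▷ Q c b ≫ inj P' Q a c b ≫ k := by
  have h := inj_whiskerRight f Q a c b
  simp only [← Category.assoc] at h ⊢
  rw [h]

@[simp]
theorem inj_associator_hom (P Q R : VQuiv V S) (a d c b : S) :
    inj P Q a d c ▷ R c b ≫ inj (P ⊗ Q) R a c b ≫ (α_ P Q R).hom.app a b = (α_ _ _ _).hom ≫ P a d ◁ inj Q R d c b ≫ inj P (Q ⊗ R) a d b :=
  (congrArg (ι P Q a d c ▷ R c b ≫ ·) (ι_desc _ c)).trans (ι_descTR _ d)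

@[simp]
theorem inj_associator_hom_assoc (P Q R : VQuiv V S) (a d c b : S) {Z : V}
    (k : (P ⊗ Q ⊗ R) a b ⟶ Z) :
    inj P Q a d c ▷ R c b ≫ inj (P ⊗ Q) R a c b ≫ (α_ P Q R).hom.app a b ≫ k = (α_ _ _ _).hom ≫ P a d ◁ inj Q R d c b ≫ inj P (Q ⊗ R) a d b ≫ k := by
  have h := inj_associator_hom P Q R a d c b
  simp only [← Category.assoc] at h ⊢
  rw [h]

@[simp]
theorem inj_associator_inv (P Q R : VQuiv V S) (a d c b : S) :
    P a d ◁ inj Q R d c b ≫ inj P (Q ⊗ R) a d b ≫ (α_ P Q R).inv.app a b = (α_ _ _ _).inv ≫ inj P Q a d c ▷ R c b ≫ inj (P ⊗ Q) R a c b :=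
  (congrArg (P a d ◁ ι Q R d c b ≫ ·) (ι_desc _ d)).trans (ι_descTL _ c)

@[simp]
theorem inj_associator_inv_assoc (P Q R : VQuiv V S) (a d c b : S) {Z : V}
    (k : ((P ⊗ Q) ⊗ R) a b ⟶ Z) :
    P a d ◁ inj Q R d c b ≫ inj P (Q ⊗ R) a d b ≫ (α_ P Q R).inv.app a b ≫ k = (α_ _ _ _).inv ≫ inj P Q a d c ▷ R c b ≫ inj (P ⊗ Q) R a c b ≫ k := by
  have h := inj_associator_inv P Q R a d c b
  simp only [← Category.assoc] at h ⊢
  rw [h]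

@[simp]
theorem inj_leftUnitor_hom (P : VQuiv V S) (a b : S) :
    injUnit rfl ▷ P a b ≫ inj (𝟙_ (VQuiv V S)) P a a b ≫ (λ_ P).hom.app a b = (λ_ (P a b)).hom :=
  ((congrArg (ιUnit rfl ▷ P a b ≫ ·) (ι_desc _ a)).trans (ι_descUR _ rfl)).trans (Category.comp_id _)

@[simp]
theorem inj_leftUnitor_hom_assoc (P : VQuiv V S) (a b : S) {Z : V}
    (k : P a b ⟶ Z) :
    injUnit rfl ▷ P a b ≫ inj (𝟙_ (VQuiv V S)) P a a b ≫ (λ_ P).hom.app a b ≫ k = (λ_ (P a b)).hom ≫ k := by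
  have h := inj_leftUnitor_hom P a b
  simp only [← Category.assoc] at h ⊢
  rw [h]

@[simp]
theorem inj_rightUnitor_hom (P : VQuiv V S) (a b : S) :
    P a b ◁ injUnit rfl ≫ inj P (𝟙_ (VQuiv V S)) a b b ≫ (ρ_ P).hom.app a b = (ρ_ (P a b)).hom :=
  ((congrArg (P a b ◁ ιUnit rfl ≫ ·) (ι_desc _ b)).trans (ι_descUL _ rfl)).trans (Category.comp_id _)

@[simp]
theorem inj_rightUnitor_hom_assoc (P : VQuiv V S) (a b : S) {Z : V}
    (k : P a b ⟶ Z) :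
    P a b ◁ injUnit rfl ≫ inj P (𝟙_ (VQuiv V S)) a b b ≫ (ρ_ P).hom.app a b ≫ k = (ρ_ (P a b)).hom ≫ k := by
  have h := inj_rightUnitor_hom P a b
  simp only [← Category.assoc] at h ⊢
  rw [h]

theorem leftUnitor_inv_app (P : VQuiv V S) (a b : S) :
    (λ_ P).inv.app a b = (λ_ (P a b)).inv ≫ injUnit rfl ▷ P a b ≫ inj (𝟙_ (VQuiv V S)) P a a b :=
  rfl

theorem rightUnitor_inv_app (P : VQuiv V S) (a b : S) :
    (ρ_ P).inv.app a b = (ρ_ (P a b)).inv ≫ P a b ◁ injUnit rfl ≫ inj P (𝟙_ (VQuiv V S)) a b b :=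
  rfl

theorem tensorObj_whiskerRight_whiskerRight_ext {P Q : VQuiv V S} {a b : S} {A B Z : V}
    {f g : ((P ⊗ Q) a b ⊗ A) ⊗ B ⟶ Z}
    (h : ∀ c, (inj P Q a c b ▷ A) ▷ B ≫ f = (inj P Q a c b ▷ A) ▷ B ≫ g) : f = g := by
  rw [← cancel_epi (α_ _ _ _).inv]
  refine tensorObj_whiskerRight_ext fun c => ?_
  have := h c
  rw [← cancel_epi (α_ _ _ _).inv] at this
  simpa using this

theorem whiskerLeft_tensorUnit_whiskerRight_ext {a b : S} {A B Z : V}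
    {f g : (A ⊗ (𝟙_ (VQuiv V S)) a b) ⊗ B ⟶ Z}
    (h : ∀ e : a = b, (A ◁ injUnit e) ▷ B ≫ f = (A ◁ injUnit e) ▷ B ≫ g) : f = g := by
  rw [← cancel_epi (α_ _ _ _).inv, ← cancel_epi (A ◁ (β_ _ _).hom), ← cancel_epi (α_ _ _ _).hom]
  refine whiskerLeft_tensorUnit_ext fun e => ?_
  have key : (A ⊗ B) ◁ injUnit e ≫ (α_ _ _ _).hom ≫ A ◁ (β_ _ _).hom ≫ (α_ _ _ _).inv =
      (α_ _ _ _).hom ≫ A ◁ (β_ _ _).hom ≫ (α_ _ _ _).inv ≫ (A ◁ injUnit e) ▷ B := by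
    rw [tensor_whiskerLeft, Category.assoc, Category.assoc, Iso.inv_hom_id_assoc,
      ← whiskerLeft_comp_assoc, BraidedCategory.braiding_naturality_right, whiskerLeft_comp_assoc,
      associator_inv_naturality_middle]
  have := congrArg (((α_ _ _ _).hom ≫ A ◁ (β_ _ _).hom ≫ (α_ _ _ _).inv) ≫ ·) (h e)
  simp only [Category.assoc] at this
  have key' := fun k : (A ⊗ (𝟙_ (VQuiv V S)) a b) ⊗ B ⟶ Z => congrArg (· ≫ k) key
  simp only [Category.assoc] at key'
  rw [key', key', this]

instance : MonoidalCategory (VQuiv V S) :=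
  MonoidalCategory.ofTensorHom
    (id_tensorHom_id := fun P Q => by
      ext a b
      refine tensorObj_ext fun c => ?_
      simp)
    (id_tensorHom := fun P {_ _} g => by
      ext a b
      refine tensorObj_ext fun c => ?_
      simp)
    (tensorHom_id := fun {_ _} f Q => by
      ext a b
      refine tensorObj_ext fun c => ?_
      simp)
    (tensorHom_comp_tensorHom := fun f g h k => by
      ext a b
      refine tensorObj_ext fun c => ?_
      simp)
    (associator_naturality := fun f g h => by
      ext a b
      refine tensorObj_ext fun c => tensorObj_whiskerRight_ext fun d => ?_
      simp only [comp_app, inj_tensorHom_assoc, inj_associator_hom_assoc]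
      simp only [whiskerRight_comp_tensorHom_assoc, inj_tensorHom]
      simp only [← tensorHom_comp_whiskerRight_assoc, inj_associator_hom, inj_tensorHom,
        whiskerLeft_comp_tensorHom_assoc]
      simp only [← tensorHom_comp_whiskerLeft, Category.assoc, associator_naturality_assoc])
    (leftUnitor_naturality := fun f => by
      ext a b
      refine tensorObj_ext fun c => tensorUnit_whiskerRight_ext fun h => ?_
      subst h
      simp [← whisker_exchange_assoc])
    (rightUnitor_naturality := fun f => by
      ext a b
      refine tensorObj_ext fun c => whiskerLeft_tensorUnit_ext fun h => ?_
      subst h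
      simp [whisker_exchange_assoc])
    (pentagon := fun P Q R T => by
      ext a b
      refine tensorObj_ext fun c => tensorObj_whiskerRight_ext fun d =>
        tensorObj_whiskerRight_whiskerRight_ext fun e => ?_
      simp only [comp_app, inj_tensorHom_assoc, inj_associator_hom_assoc, id_app, tensorHom_id]
      simp only [← MonoidalCategory.comp_whiskerRight_assoc, Category.assoc, inj_associator_hom]
      simp only [comp_whiskerRight, Category.assoc, inj_associator_hom_assoc,
        associator_naturality_left_assoc, whisker_exchange_assoc, inj_associator_hom,
        associator_naturality_middle_assoc, inj_tensorHom, id_app, id_tensorHom]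
      simp only [← MonoidalCategory.whiskerLeft_comp_assoc, Category.assoc, inj_associator_hom]
      rw [← whisker_exchange_assoc, inj_associator_hom]
      simp)
    (triangle := fun P Q => by
      ext a b
      refine tensorObj_ext fun c => tensorObj_whiskerRight_ext fun d =>
        whiskerLeft_tensorUnit_whiskerRight_ext fun h => ?_
      subst h
      simp only [comp_app, inj_tensorHom, inj_associator_hom_assoc, id_app, tensorHom_id,
        id_tensorHom]
      simp only [← MonoidalCategory.comp_whiskerRight_assoc, Category.assoc, inj_rightUnitor_hom]
      simp only [associator_naturality_middle_assoc, ← MonoidalCategory.whiskerLeft_comp_assoc,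
        Category.assoc, inj_leftUnitor_hom, triangle_assoc])

end Closed

end Monoidal

end VQuiv

/-- The category of finite intervals: its objects are the ordinals `[n] = {0 < ... < n}` and
its morphisms are the monotone maps preserving the endpoints. -/
structure FInt : Type where
  /-- the object `[n]` is determined by `n` -/
  len : ℕ

namespace FInt

/-- Endpoint preserving monotone maps. -/
@[ext]
structure Hom (m n : FInt) : Type where
  /-- the underlying monotone map -/
  toOrderHom : Fin (m.len + 1) →o Fin (n.len + 1)
  map_zero : toOrderHom 0 = 0
  map_last : toOrderHom (Fin.last _) = Fin.last _

instance : Category FInt where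
  Hom m n := Hom m n
  id m := ⟨OrderHom.id, rfl, rfl⟩
  comp f g := ⟨g.toOrderHom.comp f.toOrderHom,
    by rw [OrderHom.comp_coe, Function.comp_apply, f.map_zero, g.map_zero],
    by rw [OrderHom.comp_coe, Function.comp_apply, f.map_last, g.map_last]⟩

/-- The value of a morphism at a natural number, truncated to the source. -/
def val {m n : FInt} (f : m ⟶ n) (i : ℕ) : ℕ :=
  f.toOrderHom ⟨min i m.len, by omega⟩

theorem val_zero {m n : FInt} (f : m ⟶ n) : val f 0 = 0 := by
  have h := f.map_zero
  simp only [val, Nat.zero_min]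
  exact congrArg Fin.val h

theorem val_of_le {m n : FInt} (f : m ⟶ n) {i : ℕ} (h : m.len ≤ i) : val f i = n.len := by
  have h' := f.map_last
  have : (⟨min i m.len, by omega⟩ : Fin (m.len + 1)) = Fin.last _ := by
    ext
    simp [h]
  simp only [val, this]
  exact congrArg Fin.val h'

theorem val_mono {m n : FInt} (f : m ⟶ n) {i j : ℕ} (h : i ≤ j) : val f i ≤ val f j :=
  f.toOrderHom.monotone (by
    simp only [Fin.mk_le_mk]
    omega)

theorem val_monotone {m n : FInt} (f : m ⟶ n) : Monotone (val f) := fun _ _ h => val_mono f h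

theorem val_le {m n : FInt} (f : m ⟶ n) (i : ℕ) : val f i ≤ n.len := by
  have := (f.toOrderHom ⟨min i m.len, by omega⟩).isLt
  simp only [val]
  omega

theorem hom_ext {m n : FInt} {f g : m ⟶ n} (h : ∀ i, i ≤ m.len → val f i = val g i) :
    f = g := by
  apply Hom.ext
  ext ⟨i, hi⟩
  have := h i (by omega)
  simpa only [val, Nat.min_eq_left (show i ≤ m.len by omega)] using this

/-- A morphism of intervals from a function on natural numbers. -/
def mk' {m n : FInt} (w : ℕ → ℕ) (hw : ∀ i j, i ≤ j → j ≤ m.len → w i ≤ w j) (h0 : w 0 = 0)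
    (hm : w m.len = n.len) : m ⟶ n where
  toOrderHom :=
    { toFun := fun i => ⟨w i, by
        have := hw i m.len (by omega) le_rfl
        omega⟩
      monotone' := fun i j hij => hw i j hij (by omega) }
  map_zero := Fin.ext h0
  map_last := Fin.ext hm

theorem val_mk' {m n : FInt} (w : ℕ → ℕ) (hw : ∀ i j, i ≤ j → j ≤ m.len → w i ≤ w j)
    (h0 : w 0 = 0) (hm : w m.len = n.len) {i : ℕ} (hi : i ≤ m.len) :
    val (mk' (m := m) (n := n) w hw h0 hm) i = w i := by
  simp only [val, mk', Nat.min_eq_left hi]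
  rfl

theorem val_id (m : FInt) {i : ℕ} (hi : i ≤ m.len) : val (𝟙 m) i = i := by
  show min i m.len = i
  omega

theorem val_comp {m n k : FInt} (f : m ⟶ n) (g : n ⟶ k) (i : ℕ) :
    val (f ≫ g) i = val g (val f i) := by
  have : (⟨min (val f i) n.len, by omega⟩ : Fin (n.len + 1)) =
      f.toOrderHom ⟨min i m.len, by omega⟩ := by
    ext
    simp only [Nat.min_eq_left (val_le f i)]
    rfl
  simp only [val] at this ⊢
  rw [this]
  rfl

theorem val_eqToHom {m n : FInt} (h : m = n) {i : ℕ} (hi : i ≤ m.len) :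
    val (eqToHom h) i = i := by
  subst h
  exact val_id _ hi

theorem ext_len {m n : FInt} (h : m.len = n.len) : m = n := by
  cases m
  cases n
  simpa using h

/-- Concatenation of intervals, identifying the last point of the first interval with the first
point of the second one. -/
def add (m n : FInt) : FInt := ⟨m.len + n.len⟩

/-- Concatenation of morphisms of intervals. -/
def addHom {m n m' n' : FInt} (f : m ⟶ m') (g : n ⟶ n') : add m n ⟶ add m' n' :=
  mk' (fun i => if i ≤ m.len then val f i else m'.len + val g (i - m.len))
    (fun i j hij _ => by
      have h1 := val_le f i
      have h2 := val_mono f hij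
      have h3 := val_mono g (show i - m.len ≤ j - m.len by omega)
      split_ifs <;> omega)
    (by simp [val_zero])
    (by
      have h1 := val_of_le f (le_refl m.len)
      have h2 := val_of_le g (show n.len ≤ m.len + n.len - m.len by omega)
      have h3 := val_zero g
      change (if m.len + n.len ≤ m.len then val f (m.len + n.len) else
        m'.len + val g (m.len + n.len - m.len)) = m'.len + n'.len
      split_ifs with h
      · have h4 : n.len = 0 := by omega
        have h5 := val_of_le g (show n.len ≤ 0 by omega)
        have h6 := val_of_le f (show m.len ≤ m.len + n.len by omega)
        omega
      · omega)

theorem val_addHom {m n m' n' : FInt} (f : m ⟶ m') (g : n ⟶ n') {i : ℕ}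
    (hi : i ≤ m.len + n.len) :
    val (addHom f g) i = if i ≤ m.len then val f i else m'.len + val g (i - m.len) :=
  val_mk' _ _ _ _ hi

instance : MonoidalCategoryStruct FInt where
  tensorObj := add
  tensorUnit := ⟨0⟩
  tensorHom := addHom
  whiskerLeft m _ _ g := addHom (𝟙 m) g
  whiskerRight f n := addHom f (𝟙 n)
  associator m n k := eqToIso (ext_len (Nat.add_assoc m.len n.len k.len))
  leftUnitor m := eqToIso (ext_len (Nat.zero_add m.len))
  rightUnitor m := eqToIso (ext_len (Nat.add_zero m.len))

theorem len_tensor (m n : FInt) : (m ⊗ n).len = m.len + n.len := rfl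

theorem len_unit : (𝟙_ FInt).len = 0 := rfl

theorem val_tensorHom {m n m' n' : FInt} (f : m ⟶ m') (g : n ⟶ n') {i : ℕ}
    (hi : i ≤ m.len + n.len) :
    val (f ⊗ₘ g) i = if i ≤ m.len then val f i else m'.len + val g (i - m.len) :=
  val_addHom f g hi

theorem val_associator_hom (m n k : FInt) {i : ℕ} (hi : i ≤ m.len + n.len + k.len) :
    val (α_ m n k).hom i = i :=
  val_eqToHom (ext_len (Nat.add_assoc m.len n.len k.len)) hi

theorem val_associator_inv (m n k : FInt) {i : ℕ} (hi : i ≤ m.len + (n.len + k.len)) :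
    val (α_ m n k).inv i = i :=
  val_eqToHom (ext_len (Nat.add_assoc m.len n.len k.len).symm) hi

theorem val_leftUnitor_hom (m : FInt) {i : ℕ} (hi : i ≤ m.len) : val (λ_ m).hom i = i :=
  val_eqToHom (ext_len (Nat.zero_add m.len)) (hi.trans (Nat.zero_add m.len).ge)

theorem val_rightUnitor_hom (m : FInt) {i : ℕ} (hi : i ≤ m.len) : val (ρ_ m).hom i = i :=
  val_eqToHom (ext_len (Nat.add_zero m.len)) hi

instance : MonoidalCategory FInt :=
  MonoidalCategory.ofTensorHom
    (id_tensorHom_id := fun m n => by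
      refine hom_ext fun i hi => ?_
      rw [len_tensor] at hi
      rw [val_tensorHom _ _ hi, val_id (m ⊗ n) hi]
      split_ifs with h
      · rw [val_id _ h]
      · rw [val_id _ (by omega)]
        omega)
    (id_tensorHom := fun _ _ _ _ => rfl)
    (tensorHom_id := fun _ _ => rfl)
    (tensorHom_comp_tensorHom := fun {m₁ n₁ k₁ m₂ n₂ k₂} f g f' g' => by
      refine hom_ext fun i hi => ?_
      rw [len_tensor] at hi
      rw [val_comp, val_tensorHom _ _ hi, val_tensorHom _ _ hi]
      split_ifs with h
      · have := val_le f i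
        rw [val_tensorHom _ _ (by omega), if_pos this, val_comp]
      · have h1 := val_le g (i - m₁.len)
        rw [val_tensorHom _ _ (by omega)]
        split_ifs with h2
        · have h3 : val g (i - m₁.len) = 0 := by omega
          rw [h3, val_comp, h3, val_zero, val_of_le f' (by omega)]
          omega
        · rw [val_comp, Nat.add_sub_cancel_left])
    (associator_naturality := fun {m₁ m₂ m₃ n₁ n₂ n₃} f g h => by
      refine hom_ext fun i hi => ?_
      simp only [len_tensor] at hi
      rw [val_comp, val_comp, val_associator_hom _ _ _ (val_le ((f ⊗ₘ g) ⊗ₘ h) i),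
        val_associator_hom _ _ _ hi,
        val_tensorHom (f ⊗ₘ g) h hi,
        val_tensorHom f (g ⊗ₘ h) (by simp only [len_tensor]; omega)]
      by_cases h1 : i ≤ m₁.len + m₂.len
      · rw [if_pos (by exact h1), val_tensorHom _ _ h1]
        by_cases h2 : i ≤ m₁.len
        · rw [if_pos h2, if_pos h2]
        · rw [if_neg h2, if_neg h2, val_tensorHom _ _ (by omega), if_pos (by omega)]
      · rw [if_neg (by exact h1), if_neg (by omega), val_tensorHom _ _ (by omega),
          if_neg (by omega)]
        simp only [len_tensor, Nat.sub_sub, Nat.add_assoc])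
    (leftUnitor_naturality := fun {m n} f => by
      refine hom_ext fun i hi => ?_
      simp only [len_tensor, len_unit] at hi
      rw [val_comp, val_comp, val_leftUnitor_hom _ ((val_le (𝟙 (𝟙_ FInt) ⊗ₘ f) i).trans (Nat.zero_add _).le),
        val_leftUnitor_hom _ (by omega),
        val_tensorHom _ _ (by simp only [len_unit]; omega)]
      simp only [len_unit]
      split_ifs with h1
      · have : i = 0 := by omega
        subst this
        rw [val_zero, val_zero]
      · simp)
    (rightUnitor_naturality := fun {m n} f => by
      refine hom_ext fun i hi => ?_
      simp only [len_tensor, len_unit] at hi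
      rw [val_comp, val_comp, val_rightUnitor_hom n (val_le (f ⊗ₘ 𝟙 (𝟙_ FInt)) i),
        val_rightUnitor_hom _ (by omega),
        val_tensorHom _ _ (by simp only [len_unit]; omega), if_pos (by omega)])
    (pentagon := fun m n k l => by
      refine hom_ext fun i hi => ?_
      simp only [len_tensor] at hi
      have e1 : val ((α_ m n k).hom ⊗ₘ 𝟙 l) i = i := by
        rw [val_tensorHom _ _ (by simp only [len_tensor]; omega)]
        by_cases h : i ≤ m.len + n.len + k.len
        · rw [if_pos (by exact h), val_associator_hom _ _ _ h]
        · rw [if_neg (by exact h), val_id _ (by simp only [len_tensor]; omega)]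
          simp only [len_tensor]
          omega
      have e2 : val (𝟙 m ⊗ₘ (α_ n k l).hom) i = i := by
        rw [val_tensorHom _ _ (by simp only [len_tensor]; omega)]
        split_ifs with h
        · exact val_id _ h
        · rw [val_associator_hom _ _ _ (by omega)]
          omega
      rw [val_comp, val_comp, val_comp, e1,
        val_associator_hom _ _ _ (by simp only [len_tensor]; omega), e2,
        val_associator_hom (m ⊗ n) k l (by simp only [len_tensor]; omega),
        val_associator_hom _ _ _ (by simp only [len_tensor]; omega)])
    (triangle := fun m n => by
      refine hom_ext fun i hi => ?_
      simp only [len_tensor, len_unit] at hi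
      rw [val_comp, val_associator_hom _ _ _ (by simp only [len_unit]; omega),
        val_tensorHom _ _ (by simp only [len_tensor, len_unit]; omega),
        val_tensorHom _ _ (by simp only [len_tensor, len_unit]; omega)]
      by_cases h1 : i ≤ m.len
      · rw [if_pos h1, if_pos (by exact h1), val_id _ h1, val_rightUnitor_hom _ h1]
      · rw [if_neg h1, if_neg (by exact h1), val_id _ (by simp only [len_tensor, len_unit]; omega),
          val_leftUnitor_hom _ (by omega)]
        rfl)

/-- The inclusion of finite intervals into the simplex category. -/
def toSimplex : FInt ⥤ SimplexCategory where
  obj m := SimplexCategory.mk m.len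
  map f := SimplexCategory.Hom.mk f.toOrderHom
  map_id _ := rfl
  map_comp _ _ := rfl

end FInt

namespace VQuiv

variable {V : Type u} [Category.{v} V] [MonoidalCategory V] [HasColimits V]
  [SymmetricCategory V] [MonoidalClosed V] {S T : Type v}

theorem pullback_map_app (f : S → T) {P Q : VQuiv V T} (φ : P ⟶ Q) (a b : S) :
    ((pullback f).map φ).app a b = φ.app (f a) (f b) := rfl

/-- The comparison of units for restriction along a map of vertex sets. -/
def pullbackUnit (f : S → T) : 𝟙_ (VQuiv V S) ⟶ (pullback f).obj (𝟙_ (VQuiv V T)) :=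
  ⟨fun _ _ => descU fun h => injUnit (congrArg f h)⟩

/-- The comparison of tensor products for restriction along a map of vertex sets. -/
def pullbackTensor (f : S → T) (P Q : VQuiv V T) :
    (pullback f).obj P ⊗ (pullback f).obj Q ⟶ (pullback f).obj (P ⊗ Q) :=
  ⟨fun a b => descT fun c => inj P Q (f a) (f c) (f b)⟩

theorem injUnit_pullbackUnit (f : S → T) {a b : S} (h : a = b) :
    injUnit h ≫ (pullbackUnit (V := V) f).app a b = injUnit (congrArg f h) :=
  injUnit_descU (fun h => injUnit (congrArg f h)) h

theorem inj_pullbackTensor (f : S → T) (P Q : VQuiv V T) (a c b : S) :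
    inj ((pullback f).obj P) ((pullback f).obj Q) a c b ≫ (pullbackTensor f P Q).app a b =
      inj P Q (f a) (f c) (f b) :=
  inj_descT _ c

theorem inj_pullbackTensor_assoc (f : S → T) (P Q : VQuiv V T) (a c b : S) {Z : V}
    (k : (P ⊗ Q) (f a) (f b) ⟶ Z) :
    inj ((pullback f).obj P) ((pullback f).obj Q) a c b ≫ (pullbackTensor f P Q).app a b ≫ k =
      inj P Q (f a) (f c) (f b) ≫ k :=
  inj_descT_assoc _ c k

/-- Restriction along a map of vertex sets is lax monoidal. -/
instance (f : S → T) : (pullback (V := V) f).LaxMonoidal where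
  ε := pullbackUnit f
  μ P Q := pullbackTensor f P Q
  μ_natural_left := fun φ R => by
    ext a b
    refine tensorObj_ext fun c => ?_
    refine Eq.trans ?_ ((inj_pullbackTensor_assoc f _ _ a c b _).trans
      (inj_whiskerRight φ R (f a) (f c) (f b))).symm
    simp only [comp_app, inj_whiskerRight_assoc, inj_pullbackTensor]
    rfl
  μ_natural_right := fun R φ => by
    ext a b
    refine tensorObj_ext fun c => ?_
    refine Eq.trans ?_ ((inj_pullbackTensor_assoc f _ _ a c b _).trans
      (inj_whiskerLeft R φ (f a) (f c) (f b))).symm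
    simp only [comp_app, inj_whiskerLeft_assoc, inj_pullbackTensor]
    rfl
  associativity := fun P Q R => by
    ext a b
    refine tensorObj_ext fun c => tensorObj_whiskerRight_ext fun d => ?_
    simp only [comp_app, inj_whiskerRight_assoc, inj_pullbackTensor_assoc, inj_associator_hom_assoc,
      inj_pullbackTensor, inj_whiskerLeft_assoc, pullback_map_app]
    rw [← MonoidalCategory.comp_whiskerRight_assoc, inj_pullbackTensor]
    refine Eq.trans ?_ ((inj_associator_hom P Q R (f a) (f d) (f c) (f b)).trans
      (congrArg ((α_ _ _ _).hom ≫ ·) ?_))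
    · exact congrArg (inj P Q (f a) (f d) (f c) ▷ R (f c) (f b) ≫ ·)
        (inj_pullbackTensor_assoc f (P ⊗ Q) R a c b _)
    · refine Eq.trans ?_ (MonoidalCategory.whiskerLeft_comp_assoc _ _ _ _)
      exact congrArg (fun k => P (f a) (f d) ◁ k ≫ inj P (Q ⊗ R) (f a) (f d) (f b))
        (inj_pullbackTensor f Q R d c b).symm
  left_unitality := fun P => by
    ext a b
    refine tensorObj_ext fun c => tensorUnit_whiskerRight_ext fun h => ?_
    subst h
    refine (inj_leftUnitor_hom ((pullback f).obj P) a b).trans ?_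
    simp only [comp_app, inj_whiskerRight_assoc]
    rw [← MonoidalCategory.comp_whiskerRight_assoc, injUnit_pullbackUnit]
    refine (inj_leftUnitor_hom P (f a) (f b)).symm.trans ?_
    exact congrArg (injUnit rfl ▷ P (f a) (f b) ≫ ·) (inj_pullbackTensor_assoc f _ P a a b _).symm
  right_unitality := fun P => by
    ext a b
    refine tensorObj_ext fun c => whiskerLeft_tensorUnit_ext fun h => ?_
    subst h
    refine (inj_rightUnitor_hom ((pullback f).obj P) a c).trans ?_
    simp only [comp_app, inj_whiskerLeft_assoc]
    rw [← MonoidalCategory.whiskerLeft_comp_assoc, injUnit_pullbackUnit]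
    refine (inj_rightUnitor_hom P (f a) (f c)).symm.trans ?_
    exact congrArg (P (f a) (f c) ◁ injUnit rfl ≫ ·) (inj_pullbackTensor_assoc f P _ a c c _).symm

end VQuiv

/-- Templicial objects in `V`: a set of vertices and a strongly unital colax monoidal functor
from the opposite of the category of finite intervals to the category of `V`-enriched quivers
on that set. -/
structure Templicial (V : Type u) [Category.{v} V] [MonoidalCategory V] [HasColimits V]
    [SymmetricCategory V] [MonoidalClosed V] : Type (max u (v + 1)) where
  /-- the set of vertices -/
  Ob : Type v
  /-- the underlying functor -/
  fct : FIntᵒᵖ ⥤ VQuiv V Ob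
  /-- the comultiplications and the counit -/
  [oplax : fct.OplaxMonoidal]
  /-- strong unitality -/
  isIso_η : IsIso (Functor.OplaxMonoidal.η fct)

namespace Templicial

variable {V : Type u} [Category.{v} V] [MonoidalCategory V] [HasColimits V]
    [SymmetricCategory V] [MonoidalClosed V]

instance (X : Templicial V) : X.fct.OplaxMonoidal := X.oplax

instance (X : Templicial V) : IsIso (Functor.OplaxMonoidal.η X.fct) := X.isIso_η

/-- The quiver `X_n`. -/
def lvl (X : Templicial V) (n : ℕ) : VQuiv V X.Ob := X.fct.obj (op ⟨n⟩)

/-- The map `X_n ⟶ X_m` induced by an endpoint preserving monotone map `[m] ⟶ [n]`. -/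
def restr (X : Templicial V) {m n : ℕ} (f : FInt.mk m ⟶ FInt.mk n) : X.lvl n ⟶ X.lvl m :=
  X.fct.map f.op

/-- The comultiplication `X_{k+l} ⟶ X_k ⊗ X_l`. -/
def comul (X : Templicial V) (k l : ℕ) : X.lvl (k + l) ⟶ X.lvl k ⊗ X.lvl l :=
  Functor.OplaxMonoidal.δ X.fct (op ⟨k⟩) (op ⟨l⟩)

/-- The counit `X_0 ⟶ I`. -/
def counit (X : Templicial V) : X.lvl 0 ⟶ 𝟙_ (VQuiv V X.Ob) :=
  Functor.OplaxMonoidal.η X.fct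

/-- The inverse of the counit. -/
def counitInv (X : Templicial V) : 𝟙_ (VQuiv V X.Ob) ⟶ X.lvl 0 :=
  show 𝟙_ (VQuiv V X.Ob) ⟶ X.fct.obj (𝟙_ FIntᵒᵖ) from inv (Functor.OplaxMonoidal.η X.fct)

/-- A templicial morphism: a map `f` on vertices and a monoidal natural transformation
`f_! X ⟶ Y`, given by its transpose `X ⟶ f^* Y`. -/
@[ext]
structure Hom (X Y : Templicial V) : Type v where
  /-- the map on vertices -/
  base : X.Ob → Y.Ob
  /-- the components of the natural transformation -/
  app : ∀ n : FIntᵒᵖ, X.fct.obj n ⟶ (VQuiv.pullback base).obj (Y.fct.obj n)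
  naturality : ∀ {m n : FIntᵒᵖ} (h : m ⟶ n),
    X.fct.map h ≫ app n = app m ≫ (VQuiv.pullback base).map (Y.fct.map h)
  comp_δ : ∀ m n : FIntᵒᵖ, Functor.OplaxMonoidal.δ X.fct m n ≫ (app m ⊗ₘ app n) ≫
      Functor.LaxMonoidal.μ (VQuiv.pullback base) (Y.fct.obj m) (Y.fct.obj n) =
    app (m ⊗ n) ≫ (VQuiv.pullback base).map (Functor.OplaxMonoidal.δ Y.fct m n)
  comp_η : Functor.OplaxMonoidal.η X.fct ≫ Functor.LaxMonoidal.ε (VQuiv.pullback base) =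
    app (𝟙_ FIntᵒᵖ) ≫ (VQuiv.pullback base).map (Functor.OplaxMonoidal.η Y.fct)

theorem pullbackTensor_id {S : Type v} (P Q : VQuiv V S) :
    VQuiv.pullbackTensor id P Q = 𝟙 (P ⊗ Q) := by
  ext a b
  refine VQuiv.tensorObj_ext fun c => ?_
  exact (VQuiv.inj_pullbackTensor id P Q a c b).trans (Category.comp_id _).symm

theorem pullbackUnit_id {S : Type v} :
    VQuiv.pullbackUnit (V := V) (id : S → S) = 𝟙 (𝟙_ (VQuiv V S)) := by
  ext a b
  refine VQuiv.tensorUnit_ext fun h => ?_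
  exact (VQuiv.injUnit_pullbackUnit id h).trans (Category.comp_id _).symm

theorem pullbackTensor_comp {S T R : Type v} (f : S → T) (g : T → R) (P Q : VQuiv V R) :
    VQuiv.pullbackTensor (g ∘ f) P Q =
      VQuiv.pullbackTensor f ((VQuiv.pullback g).obj P) ((VQuiv.pullback g).obj Q) ≫
        (VQuiv.pullback f).map (VQuiv.pullbackTensor g P Q) := by
  ext a b
  refine VQuiv.tensorObj_ext fun c => ?_
  refine (VQuiv.inj_pullbackTensor (g ∘ f) P Q a c b).trans ?_
  exact ((VQuiv.inj_pullbackTensor_assoc f ((VQuiv.pullback g).obj P) ((VQuiv.pullback g).obj Q)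
    a c b ((VQuiv.pullbackTensor g P Q).app (f a) (f b))).trans
    (VQuiv.inj_pullbackTensor g P Q (f a) (f c) (f b))).symm

theorem pullbackUnit_comp {S T R : Type v} (f : S → T) (g : T → R) :
    VQuiv.pullbackUnit (V := V) (g ∘ f) =
      VQuiv.pullbackUnit f ≫ (VQuiv.pullback f).map (VQuiv.pullbackUnit g) := by
  ext a b
  refine VQuiv.tensorUnit_ext fun h => ?_
  refine (VQuiv.injUnit_pullbackUnit (g ∘ f) h).trans ?_
  exact ((Category.assoc _ _ _).symm.trans
    ((congrArg (· ≫ (VQuiv.pullbackUnit g).app (f a) (f b))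
      (VQuiv.injUnit_pullbackUnit f h)).trans
    (VQuiv.injUnit_pullbackUnit g (congrArg f h)))).symm

theorem comp_δ_aux {C D E : Type*} [Category C] [Category D] [Category E] [MonoidalCategory C]
    [MonoidalCategory D] [MonoidalCategory E] (F : D ⥤ C) [F.LaxMonoidal] (G : E ⥤ D)
    [G.LaxMonoidal] {x xm xn : C} {y ym yn : D} {z zm zn : E} (δx : x ⟶ xm ⊗ xn)
    (δy : y ⟶ ym ⊗ yn) (δz : z ⟶ zm ⊗ zn) (f : x ⟶ F.obj y) (fm : xm ⟶ F.obj ym)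
    (fn : xn ⟶ F.obj yn) (g : y ⟶ G.obj z) (gm : ym ⟶ G.obj zm) (gn : yn ⟶ G.obj zn)
    (hf : δx ≫ (fm ⊗ₘ fn) ≫ Functor.LaxMonoidal.μ F ym yn = f ≫ F.map δy)
    (hg : δy ≫ (gm ⊗ₘ gn) ≫ Functor.LaxMonoidal.μ G zm zn = g ≫ G.map δz) :
    δx ≫ ((fm ≫ F.map gm) ⊗ₘ (fn ≫ F.map gn)) ≫
      Functor.LaxMonoidal.μ F (G.obj zm) (G.obj zn) ≫ F.map (Functor.LaxMonoidal.μ G zm zn) =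
    (f ≫ F.map g) ≫ F.map (G.map δz) := by
  rw [Category.assoc, ← Functor.map_comp, ← hg, ← tensorHom_comp_tensorHom, Category.assoc,
    Functor.LaxMonoidal.μ_natural_assoc, Functor.map_comp, Functor.map_comp, ← reassoc_of% hf]

theorem comp_η_aux {C D E : Type*} [Category C] [Category D] [Category E] [MonoidalCategory C]
    [MonoidalCategory D] [MonoidalCategory E] (F : D ⥤ C) [F.LaxMonoidal] (G : E ⥤ D)
    [G.LaxMonoidal] {x : C} {y : D} {z : E} (ηx : x ⟶ 𝟙_ C)
    (ηy : y ⟶ 𝟙_ D) (ηz : z ⟶ 𝟙_ E) (f : x ⟶ F.obj y) (g : y ⟶ G.obj z)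
    (hf : ηx ≫ Functor.LaxMonoidal.ε F = f ≫ F.map ηy)
    (hg : ηy ≫ Functor.LaxMonoidal.ε G = g ≫ G.map ηz) :
    ηx ≫ Functor.LaxMonoidal.ε F ≫ F.map (Functor.LaxMonoidal.ε G) =
      (f ≫ F.map g) ≫ F.map (G.map ηz) := by
  rw [Category.assoc, ← Functor.map_comp, ← hg, Functor.map_comp, reassoc_of% hf]

theorem naturality_aux {C D E : Type*} [Category C] [Category D] [Category E] (F : D ⥤ C)
    (G : E ⥤ D) {x x' : C} {y y' : D} {z z' : E} {hx : x ⟶ x'} {hy : y ⟶ y'} {hz : z ⟶ z'}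
    {f : x ⟶ F.obj y} {f' : x' ⟶ F.obj y'} {g : y ⟶ G.obj z} {g' : y' ⟶ G.obj z'}
    (hf : hx ≫ f' = f ≫ F.map hy) (hg : hy ≫ g' = g ≫ G.map hz) :
    hx ≫ f' ≫ F.map g' = (f ≫ F.map g) ≫ F.map (G.map hz) := by
  rw [reassoc_of% hf, ← Functor.map_comp, hg, Functor.map_comp, Category.assoc]

/-- The identity of a templicial object. -/
def idHom (X : Templicial V) : Hom X X where
  base := id
  app n := 𝟙 (X.fct.obj n)
  naturality f := (Category.comp_id _).trans (Category.id_comp (X.fct.map f)).symm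
  comp_δ m n := by
    refine Eq.trans ?_ (Category.id_comp (Functor.OplaxMonoidal.δ X.fct m n)).symm
    refine (congrArg (Functor.OplaxMonoidal.δ X.fct m n ≫ ·) ?_).trans (Category.comp_id _)
    refine (congrArg (· ≫ VQuiv.pullbackTensor id (X.fct.obj m) (X.fct.obj n))
      (id_tensorHom_id _ _)).trans ?_
    exact (Category.id_comp _).trans (pullbackTensor_id _ _)
  comp_η := by
    refine Eq.trans ?_ (Category.id_comp (Functor.OplaxMonoidal.η X.fct)).symm
    exact (congrArg (Functor.OplaxMonoidal.η X.fct ≫ ·) pullbackUnit_id).trans (Category.comp_id _)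

/-- Composition of templicial morphisms. -/
def compHom {X Y Z : Templicial V} (f : Hom X Y) (g : Hom Y Z) : Hom X Z where
  base := g.base ∘ f.base
  app n := f.app n ≫ (VQuiv.pullback f.base).map (g.app n)
  naturality h := naturality_aux (VQuiv.pullback f.base) (VQuiv.pullback g.base)
    (f.naturality h) (g.naturality h)
  comp_δ m n :=
    (congrArg (Functor.OplaxMonoidal.δ X.fct m n ≫
      ((f.app m ≫ (VQuiv.pullback f.base).map (g.app m)) ⊗ₘ
        (f.app n ≫ (VQuiv.pullback f.base).map (g.app n))) ≫ ·)
      (pullbackTensor_comp f.base g.base (Z.fct.obj m) (Z.fct.obj n))).trans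
    (comp_δ_aux (VQuiv.pullback f.base) (VQuiv.pullback g.base) _ _ _ _ _ _ _ _ _
      (f.comp_δ m n) (g.comp_δ m n))
  comp_η :=
    (congrArg (Functor.OplaxMonoidal.η X.fct ≫ ·) (pullbackUnit_comp f.base g.base)).trans
    (comp_η_aux (VQuiv.pullback f.base) (VQuiv.pullback g.base) _ _ _ _ _ f.comp_η g.comp_η)

instance : Category (Templicial V) where
  Hom := Hom
  id := idHom
  comp := compHom
  id_comp f := by
    refine Hom.ext rfl (heq_of_eq ?_)
    ext n a b
    exact Category.id_comp _
  comp_id f := by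
    refine Hom.ext rfl (heq_of_eq ?_)
    ext n a b
    exact Category.comp_id _
  assoc f g h := by
    refine Hom.ext rfl (heq_of_eq ?_)
    ext n a b
    exact Category.assoc _ _ _

/-- The component `X_n(a,b) ⟶ Y_n(f(a),f(b))` of a templicial morphism. -/
def Hom.component {X Y : Templicial V} (f : X ⟶ Y) (n : ℕ) (a b : X.Ob) :
    (X.lvl n) a b ⟶ (Y.lvl n) (Hom.base f a) (Hom.base f b) :=
  (Hom.app f (op ⟨n⟩)).app a b

theorem Hom.component_restr {X Y : Templicial V} (f : X ⟶ Y) {m n : ℕ}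
    (g : FInt.mk m ⟶ FInt.mk n) (a b : X.Ob) :
    (X.restr g).app a b ≫ Hom.component f m a b =
      Hom.component f n a b ≫ (Y.restr g).app _ _ :=
  congrArg (fun z => z.app a b) (Hom.naturality f g.op)

theorem Hom.component_comul {X Y : Templicial V} (f : X ⟶ Y) (k l : ℕ) (a b : X.Ob) :
    Hom.component f (k + l) a b ≫ (Y.comul k l).app _ _ =
      (X.comul k l).app a b ≫ VQuiv.descT fun c =>
        (Hom.component f k a c ⊗ₘ Hom.component f l c b) ≫
          VQuiv.inj (Y.lvl k) (Y.lvl l) (Hom.base f a) (Hom.base f c) (Hom.base f b) := by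
  refine (congrArg (fun z => z.app a b) (Hom.comp_δ f (op ⟨k⟩) (op ⟨l⟩))).symm.trans ?_
  refine congrArg ((X.comul k l).app a b ≫ ·) ?_
  refine VQuiv.tensorObj_ext fun c => ?_
  refine (VQuiv.inj_tensorHom_assoc (Hom.app f (op ⟨k⟩)) (Hom.app f (op ⟨l⟩)) a c b _).trans ?_
  refine Eq.trans ?_ (VQuiv.inj_descT _ c).symm
  exact congrArg (((Hom.app f (op ⟨k⟩)).app a c ⊗ₘ (Hom.app f (op ⟨l⟩)).app c b) ≫ ·)
    (VQuiv.inj_pullbackTensor (Hom.base f) _ _ a c b)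

theorem Hom.component_counit {X Y : Templicial V} (f : X ⟶ Y) (a b : X.Ob) :
    Hom.component f 0 a b ≫ Y.counit.app _ _ =
      X.counit.app a b ≫ VQuiv.descU fun h => VQuiv.injUnit (congrArg (Hom.base f) h) :=
  (congrArg (fun z => z.app a b) (Hom.comp_η f)).symm

end Templicial

/-! Tensor powers of a monoid object, as a colax monoidal functor on the opposite of the
category of finite intervals. -/

namespace MonNerve

variable {W : Type*} [Category W] [MonoidalCategory W]

/-- The tensor powers of an object. -/
def pow (M : W) : ℕ → W
  | 0 => 𝟙_ W
  | n + 1 => pow M n ⊗ M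

/-- Transport along an equality of exponents. -/
def cast (M : W) {a b : ℕ} (h : a = b) : pow M a ⟶ pow M b := eqToHom (congrArg (pow M) h)

theorem cast_rfl (M : W) {a : ℕ} (h : a = a) : cast M h = 𝟙 _ := rfl

theorem cast_trans (M : W) {a b c : ℕ} (h : a = b) (k : b = c) :
    cast M h ≫ cast M k = cast M (h.trans k) := by
  subst h
  subst k
  simp [cast_rfl]

theorem cast_trans_assoc (M : W) {a b c : ℕ} (h : a = b) (k : b = c) {Z : W}
    (f : pow M c ⟶ Z) : cast M h ≫ cast M k ≫ f = cast M (h.trans k) ≫ f := by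
  rw [← Category.assoc, cast_trans]

/-- The canonical isomorphism between `M ^ (a + b)` and `M ^ a ⊗ M ^ b`. -/
def powIso (M : W) (a : ℕ) : ∀ b : ℕ, pow M (a + b) ≅ pow M a ⊗ pow M b
  | 0 => (ρ_ (pow M a)).symm
  | b + 1 => whiskerRightIso (powIso M a b) M ≪≫ α_ _ _ _

theorem powIso_zero (M : W) (a : ℕ) : (powIso M a 0).hom = (ρ_ (pow M a)).inv := rfl

theorem powIso_succ (M : W) (a b : ℕ) :
    (powIso M a (b + 1)).hom = (powIso M a b).hom ▷ M ≫ (α_ (pow M a) (pow M b) M).hom := rfl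

theorem cast_succ (M : W) {a b : ℕ} (h : a = b) (h' : a + 1 = b + 1) :
    cast M h' = cast M h ▷ M := by
  subst h
  simp only [cast_rfl, id_whiskerRight]
  rfl

theorem powIso_assoc (M : W) (a b c : ℕ) :
    (powIso M (a + b) c).hom ≫ (powIso M a b).hom ▷ pow M c ≫ (α_ _ _ _).hom =
      cast M (Nat.add_assoc a b c) ≫ (powIso M a (b + c)).hom ≫ pow M a ◁ (powIso M b c).hom := by
  induction c with
  | zero =>
    have h : cast M (Nat.add_assoc a b 0) = 𝟙 _ := rfl
    rw [h, powIso_zero, powIso_zero]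
    refine Eq.trans ?_ (Category.id_comp _).symm
    change (ρ_ (pow M (a + b))).inv ≫ (powIso M a b).hom ▷ 𝟙_ W ≫ (α_ _ _ (𝟙_ W)).hom =
      (powIso M a b).hom ≫ pow M a ◁ (ρ_ (pow M b)).inv
    rw [← rightUnitor_inv_naturality_assoc]
    simp
  | succ c ih =>
    have h : cast M (Nat.add_assoc a b (c + 1)) = cast M (Nat.add_assoc a b c) ▷ M :=
      cast_succ M (Nat.add_assoc a b c) _
    rw [h]
    change ((powIso M (a + b) c).hom ▷ M ≫ (α_ _ (pow M c) M).hom) ≫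
      (powIso M a b).hom ▷ (pow M c ⊗ M) ≫ (α_ _ _ (pow M c ⊗ M)).hom = cast M _ ▷ M ≫
      ((powIso M a (b + c)).hom ▷ M ≫ (α_ _ _ M).hom) ≫
        pow M a ◁ ((powIso M b c).hom ▷ M ≫ (α_ _ _ M).hom)
    have ih' := congrArg (fun k => k ▷ M ≫ (α_ _ _ _).hom ≫ pow M a ◁ (α_ _ _ _).hom) ih
    simp only [comp_whiskerRight, Category.assoc] at ih'
    simp only [whiskerLeft_comp, Category.assoc, associator_naturality_left_assoc,
      ← associator_naturality_middle_assoc]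
    rw [← ih']
    simp

theorem zero_powIso (M : W) (b : ℕ) :
    (powIso M 0 b).hom = cast M (Nat.zero_add b) ≫ (λ_ (pow M b)).inv := by
  induction b with
  | zero =>
    have h : cast M (Nat.zero_add 0) = 𝟙 _ := rfl
    rw [h, powIso_zero]
    refine Eq.trans ?_ (Category.id_comp _).symm
    exact unitors_inv_equal.symm
  | succ b ih =>
    have h : cast M (Nat.zero_add (b + 1)) = cast M (Nat.zero_add b) ▷ M :=
      cast_succ M (Nat.zero_add b) _
    rw [h, powIso_succ, ih]
    change (cast M _ ≫ (λ_ (pow M b)).inv) ▷ M ≫ (α_ (𝟙_ W) (pow M b) M).hom =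
      _ ≫ (λ_ (pow M b ⊗ M)).inv
    simp

section

variable (M : W) [MonObj M]

/-- The iterated multiplication `M ^ n ⟶ M`. -/
def mulN : ∀ n : ℕ, pow M n ⟶ M
  | 0 => MonObj.one
  | n + 1 => mulN n ▷ M ≫ MonObj.mul

theorem mulN_add (a b : ℕ) :
    (powIso M a b).hom ≫ (mulN M a ⊗ₘ mulN M b) ≫ MonObj.mul = mulN M (a + b) := by
  induction b with
  | zero =>
    change (ρ_ (pow M a)).inv ≫ (mulN M a ⊗ₘ MonObj.one) ≫ MonObj.mul = mulN M a
    simp [MonObj.mul_one_hom]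
  | succ b ih =>
    change ((powIso M a b).hom ▷ M ≫ (α_ (pow M a) (pow M b) M).hom) ≫
      (mulN M a ⊗ₘ (mulN M b ▷ M ≫ MonObj.mul)) ≫ MonObj.mul = mulN M (a + b) ▷ M ≫ MonObj.mul
    rw [← ih]
    simp only [MonoidalCategory.tensorHom_def, MonoidalCategory.whiskerLeft_comp, comp_whiskerRight,
      Category.assoc, MonObj.mul_assoc, whisker_exchange_assoc]
    simp only [associator_naturality_left_assoc, associator_naturality_middle_assoc,
      MonoidalCategory.whisker_exchange_assoc, tensor_whiskerLeft, Category.assoc,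
      Iso.inv_hom_id_assoc]

/-- Extend a map `M ^ a ⟶ M ^ m` to a map `M ^ b ⟶ M ^ (m + 1)` by multiplying the last `b - a`
factors. -/
def stepMap {a m : ℕ} (f : pow M a ⟶ pow M m) (b : ℕ) (h : a ≤ b) : pow M b ⟶ pow M m ⊗ M :=
  cast M (Nat.add_sub_cancel' h).symm ≫ (powIso M a (b - a)).hom ≫ (f ⊗ₘ mulN M (b - a))

/-- The map `M ^ (w m) ⟶ M ^ m` multiplying, for every `i < m`, the factors between `w i` and
`w (i + 1)`. -/
def nerveMap (w : ℕ → ℕ) (h0 : w 0 = 0) (hw : Monotone w) : ∀ m : ℕ, pow M (w m) ⟶ pow M m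
  | 0 => cast M h0
  | m + 1 => stepMap M (nerveMap w h0 hw m) (w (m + 1)) (hw (Nat.le_succ m))

theorem stepMap_eq {a m b s : ℕ} (f : pow M a ⟶ pow M m) (h : a ≤ b) (hs : b = a + s) :
    stepMap M f b h = cast M hs ≫ (powIso M a s).hom ≫ (f ⊗ₘ mulN M s) := by
  obtain rfl : s = b - a := by omega
  rfl

theorem stepMap_cast {a a' m b b' : ℕ} (ha : a = a') (hb : b = b') (f : pow M a' ⟶ pow M m)
    (h : a ≤ b) (h' : a' ≤ b') :
    stepMap M (cast M ha ≫ f) b h = cast M hb ≫ stepMap M f b' h' := by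
  subst ha
  subst hb
  simp [cast_rfl]

theorem stepMap_mulN {a m b : ℕ} (f : pow M a ⟶ pow M m) (h : a ≤ b)
    (hf : f ≫ mulN M m = mulN M a) : stepMap M f b h ≫ mulN M m ▷ M ≫ MonObj.mul = mulN M b := by
  obtain ⟨s, rfl⟩ := Nat.exists_eq_add_of_le h
  rw [stepMap_eq M f h rfl, cast_rfl, Category.id_comp, ← mulN_add M a, ← hf]
  have h1 : (f ⊗ₘ mulN M s) ≫ mulN M m ▷ M = (f ≫ mulN M m) ⊗ₘ mulN M s :=
    tensorHom_comp_whiskerRight _ _ _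
  rw [← h1]
  simp only [Category.assoc]

theorem nerveMap_congr (w w' : ℕ → ℕ) (h0 : w 0 = 0) (hw : Monotone w) (h0' : w' 0 = 0)
    (hw' : Monotone w') (m : ℕ) (h : ∀ i, i ≤ m → w i = w' i) :
    nerveMap M w h0 hw m = cast M (h m le_rfl) ≫ nerveMap M w' h0' hw' m := by
  induction m with
  | zero => exact (cast_trans M _ _).symm
  | succ m ih =>
    simp only [nerveMap]
    rw [ih fun i hi => h i (by omega)]
    exact stepMap_cast M _ _ _ _ _

theorem nerveMap_mulN (w : ℕ → ℕ) (h0 : w 0 = 0) (hw : Monotone w) (m : ℕ) :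
    nerveMap M w h0 hw m ≫ mulN M m = mulN M (w m) := by
  induction m with
  | zero =>
    simp only [nerveMap]
    generalize w 0 = k at h0
    subst h0
    simp [cast_rfl]
  | succ m ih => exact stepMap_mulN M _ _ ih

theorem nerveMap_id (w : ℕ → ℕ) (h0 : w 0 = 0) (hw : Monotone w) (m : ℕ)
    (h : ∀ i, i ≤ m → w i = i) : nerveMap M w h0 hw m = cast M (h m le_rfl) := by
  induction m with
  | zero => rfl
  | succ m ih =>
    simp only [nerveMap]
    rw [ih fun i hi => h i (by omega)]
    have := stepMap_cast M (h m (by omega)) (h (m + 1) le_rfl) (𝟙 (pow M m))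
      (hw (Nat.le_succ m)) (Nat.le_succ m)
    rw [Category.comp_id] at this
    rw [this, stepMap_eq M _ _ (s := 1) rfl, cast_rfl, Category.id_comp]
    refine (congrArg (cast M _ ≫ ·) ?_).trans (Category.comp_id _)
    change ((ρ_ (pow M m)).inv ▷ M ≫ (α_ _ (𝟙_ W) M).hom) ≫
      (𝟙 _ ⊗ₘ (MonObj.one ▷ M ≫ MonObj.mul)) = 𝟙 (pow M m ⊗ M)
    simp

/-- The tail of a monotone function. -/
def shift (w : ℕ → ℕ) (k i : ℕ) : ℕ := w (k + i) - w k

theorem shift_zero (w : ℕ → ℕ) (k : ℕ) : shift w k 0 = 0 := by simp [shift]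

theorem shift_mono {w : ℕ → ℕ} (hw : Monotone w) (k : ℕ) : Monotone (shift w k) := fun i j h => by
  have := hw (show k + i ≤ k + j by omega)
  simp only [shift]
  omega

theorem add_shift {w : ℕ → ℕ} (hw : Monotone w) (k i : ℕ) : w (k + i) = w k + shift w k i := by
  have := hw (show k ≤ k + i by omega)
  simp only [shift]
  omega

theorem stepMap_powIso {A a t k r b : ℕ} (hA : A = a + t) (f : pow M A ⟶ pow M (k + r))
    (fk : pow M a ⟶ pow M k) (fr : pow M t ⟶ pow M r) (h : A ≤ b) (s : ℕ) (hs : b = a + s)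
    (hts : t ≤ s)
    (hf : f ≫ (powIso M k r).hom = cast M hA ≫ (powIso M a t).hom ≫ (fk ⊗ₘ fr)) :
    stepMap M f b h ≫ (powIso M k r).hom ▷ M ≫ (α_ (pow M k) (pow M r) M).hom =
      cast M hs ≫ (powIso M a s).hom ≫ (fk ⊗ₘ stepMap M fr s hts) := by
  subst hA
  obtain ⟨c, rfl⟩ := Nat.exists_eq_add_of_le hts
  subst hs
  rw [stepMap_eq M f h (Nat.add_assoc a t c).symm, stepMap_eq M fr hts rfl, cast_rfl, cast_rfl]
  rw [cast_rfl] at hf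
  simp only [Category.id_comp, Category.assoc] at hf ⊢
  have h2 := congrArg (fun z => cast M (Nat.add_assoc a t c).symm ≫ z ≫
    (fk ⊗ₘ (fr ⊗ₘ mulN M c))) (powIso_assoc M a t c)
  simp only [Category.assoc, cast_trans_assoc] at h2
  rw [tensorHom_comp_whiskerRight_assoc, hf, cast_rfl, Category.id_comp,
    whiskerLeft_comp_tensorHom] at *
  rw [← h2, ← associator_naturality, whiskerRight_comp_tensorHom_assoc]

theorem nerveMap_powIso (w : ℕ → ℕ) (h0 : w 0 = 0) (hw : Monotone w) (k r : ℕ) :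
    nerveMap M w h0 hw (k + r) ≫ (powIso M k r).hom =
      cast M (add_shift hw k r) ≫ (powIso M (w k) (shift w k r)).hom ≫
        (nerveMap M w h0 hw k ⊗ₘ nerveMap M (shift w k) (shift_zero w k) (shift_mono hw k) r) := by
  induction r with
  | zero =>
    have aux : ∀ (t : ℕ) (ht : t = 0) (a m : ℕ) (b : ℕ) (hb : b = a + t) (hb' : b = a)
        (f : pow M a ⟶ pow M m), (cast M hb' ≫ f) ≫ (ρ_ (pow M m)).inv =
          cast M hb ≫ (powIso M a t).hom ≫ (f ⊗ₘ cast M ht) := by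
      intro t ht a m b hb hb' f
      subst ht
      subst hb'
      change (𝟙 _ ≫ f) ≫ _ = 𝟙 (pow M b) ≫ (ρ_ (pow M b)).inv ≫ (f ⊗ₘ 𝟙 (𝟙_ W))
      simp
    refine Eq.trans ?_ (aux _ (shift_zero w k) _ _ _ _ rfl (nerveMap M w h0 hw k))
    rw [cast_rfl, Category.id_comp]
    rfl
  | succ r ih =>
    exact stepMap_powIso M (add_shift hw k r) (nerveMap M w h0 hw (k + r)) _ _
      (hw (Nat.le_succ (k + r))) (shift w k (r + 1)) (add_shift hw k (r + 1))
      (shift_mono hw k (Nat.le_succ r)) ih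

theorem nerveMap_stepMap {A B m : ℕ} (f : pow M A ⟶ pow M m) (h : A ≤ B) (g : ℕ → ℕ)
    (g0 : g 0 = 0) (hg : Monotone g) :
    nerveMap M g g0 hg B ≫ stepMap M f B h =
      stepMap M (nerveMap M g g0 hg A ≫ f) (g B) (hg h) := by
  obtain ⟨s, rfl⟩ := Nat.exists_eq_add_of_le h
  rw [stepMap_eq M f h rfl, stepMap_eq M _ _ (add_shift hg A s), cast_rfl, Category.id_comp,
    ← Category.assoc, nerveMap_powIso, Category.assoc, Category.assoc, tensorHom_comp_tensorHom,
    nerveMap_mulN]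

theorem nerveMap_comp (f g : ℕ → ℕ) (f0 : f 0 = 0) (hf : Monotone f) (g0 : g 0 = 0)
    (hg : Monotone g) (m : ℕ) :
    nerveMap M g g0 hg (f m) ≫ nerveMap M f f0 hf m =
      nerveMap M (g ∘ f) (by simp [f0, g0]) (hg.comp hf) m := by
  induction m with
  | zero =>
    simp only [nerveMap]
    have aux : ∀ (k : ℕ) (hk : k = 0) (h : g k = 0),
        nerveMap M g g0 hg k ≫ cast M hk = cast M h := by
      intro k hk h
      subst hk
      exact Category.comp_id _
    exact aux (f 0) f0 _
  | succ m ih =>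
    simp only [nerveMap]
    refine (nerveMap_stepMap M (nerveMap M f f0 hf m) _ g g0 hg).trans ?_
    rw [ih]
    rfl

theorem powIso_cast {a a' b b' : ℕ} (ha : a = a') (hb : b = b') (h : a + b = a' + b') :
    (powIso M a b).hom ≫ (cast M ha ⊗ₘ cast M hb) = cast M h ≫ (powIso M a' b').hom := by
  subst ha
  subst hb
  simp [cast_rfl]

/-- The map of tensor powers induced by a morphism of finite intervals. -/
def nerveHom {m n : FInt} (f : m ⟶ n) : pow M n.len ⟶ pow M m.len :=
  cast M (FInt.val_of_le f le_rfl).symm ≫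
    nerveMap M (FInt.val f) (FInt.val_zero f) (FInt.val_monotone f) m.len

theorem nerveHom_eq_cast {m n : FInt} (f : m ⟶ n) (h : n.len = m.len)
    (hf : ∀ i, i ≤ m.len → FInt.val f i = i) : nerveHom M f = cast M h := by
  simp only [nerveHom]
  rw [nerveMap_id M _ _ _ _ hf, cast_trans]

theorem nerveHom_comp {m n k : FInt} (f : m ⟶ n) (g : n ⟶ k) :
    nerveHom M (f ≫ g) = nerveHom M g ≫ nerveHom M f := by
  have h1 : nerveMap M (FInt.val (f ≫ g)) (FInt.val_zero _) (FInt.val_monotone _) m.len =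
      cast M (FInt.val_comp f g m.len) ≫ nerveMap M (FInt.val g) (FInt.val_zero g)
        (FInt.val_monotone g) (FInt.val f m.len) ≫ nerveMap M (FInt.val f) (FInt.val_zero f)
        (FInt.val_monotone f) m.len := by
    rw [nerveMap_comp]
    exact nerveMap_congr M _ _ _ _ _ _ _ fun i _ => FInt.val_comp f g i
  simp only [nerveHom, h1, Category.assoc, cast_trans_assoc]
  have aux : ∀ (a b : ℕ) (hab : a = b) (h : k.len = FInt.val g b)
      (h' : k.len = FInt.val g a), cast M h' ≫ nerveMap M (FInt.val g) (FInt.val_zero g)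
        (FInt.val_monotone g) a ≫ cast M hab = cast M h ≫ nerveMap M (FInt.val g)
        (FInt.val_zero g) (FInt.val_monotone g) b := by
    intro a b hab h h'
    subst hab
    simp [cast_rfl]
  have := aux n.len (FInt.val f m.len) (FInt.val_of_le f le_rfl).symm
    (by rw [FInt.val_of_le f le_rfl, FInt.val_of_le g le_rfl])
    (FInt.val_of_le g le_rfl).symm
  simp only [← Category.assoc] at this ⊢
  rw [this]

theorem nerveHom_tensor {m n m' n' : FInt} (f : m ⟶ m') (g : n ⟶ n') :
    nerveHom M (f ⊗ₘ g) ≫ (powIso M m.len n.len).hom =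
      (powIso M m'.len n'.len).hom ≫ (nerveHom M f ⊗ₘ nerveHom M g) := by
  have e1 : ∀ i, i ≤ m.len → FInt.val (f ⊗ₘ g) i = FInt.val f i := fun i hi => by
    rw [FInt.val_tensorHom _ _ (by omega), if_pos hi]
  have e2 : ∀ i, i ≤ n.len → shift (FInt.val (f ⊗ₘ g)) m.len i = FInt.val g i := fun i hi => by
    have h1 := FInt.val_of_le f (le_refl m.len)
    simp only [shift]
    rw [e1 _ le_rfl, FInt.val_tensorHom _ _ (by omega), h1]
    split_ifs with h
    · have : i = 0 := by omega
      subst this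
      rw [FInt.val_zero, Nat.add_zero, h1, Nat.sub_self]
    · rw [Nat.add_sub_cancel_left, Nat.add_sub_cancel_left]
  have h := nerveMap_powIso M (FInt.val (f ⊗ₘ g)) (FInt.val_zero _) (FInt.val_monotone _)
    m.len n.len
  rw [nerveMap_congr M (FInt.val (f ⊗ₘ g)) (FInt.val f) _ _ (FInt.val_zero f)
      (FInt.val_monotone f) m.len e1,
    nerveMap_congr M (shift (FInt.val (f ⊗ₘ g)) m.len) (FInt.val g) _ _ (FInt.val_zero g)
      (FInt.val_monotone g) n.len e2, ← tensorHom_comp_tensorHom] at h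
  have hm := FInt.val_of_le f (le_refl m.len)
  have hn := FInt.val_of_le g (le_refl n.len)
  simp only [nerveHom, ← tensorHom_comp_tensorHom]
  have h3 := powIso_cast M (e1 m.len le_rfl) (e2 n.len le_rfl) (by
    rw [← add_shift (FInt.val_monotone _), hm, hn]
    exact FInt.val_of_le (f ⊗ₘ g) le_rfl)
  have h4 := powIso_cast M hm.symm hn.symm (by rw [hm, hn])
  refine (Category.assoc _ _ _).trans ((congrArg (cast M _ ≫ ·) h).trans ?_)
  have h3' := congrArg (· ≫ (nerveMap M (FInt.val f) (FInt.val_zero f) (FInt.val_monotone f) m.len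
    ⊗ₘ nerveMap M (FInt.val g) (FInt.val_zero g) (FInt.val_monotone g) n.len)) h3
  have h4' := congrArg (· ≫ (nerveMap M (FInt.val f) (FInt.val_zero f) (FInt.val_monotone f) m.len
    ⊗ₘ nerveMap M (FInt.val g) (FInt.val_zero g) (FInt.val_monotone g) n.len)) h4
  simp only [Category.assoc] at h3' h4'
  rw [h3', h4']
  exact (cast_trans_assoc M _ _ _).trans (cast_trans_assoc M _ _ _)

/-- The tensor powers of a monoid object, as a functor: inner face maps multiply adjacent factors
and degeneracy maps insert units. -/
def nerveFunctor : FIntᵒᵖ ⥤ W where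
  obj n := pow M n.unop.len
  map f := nerveHom M f.unop
  map_id n := (nerveHom_eq_cast M (𝟙 n.unop) rfl fun _ hi => FInt.val_id n.unop hi).trans
    (cast_rfl M rfl)
  map_comp f g := nerveHom_comp M g.unop f.unop

instance : (nerveFunctor M).OplaxMonoidal where
  η := 𝟙 (𝟙_ W)
  δ m n := (powIso M m.unop.len n.unop.len).hom
  δ_natural_left {m m'} f n := by
    have h := nerveHom_tensor M f.unop (𝟙 n.unop)
    have h1 : nerveHom M (𝟙 n.unop) = 𝟙 _ := (nerveFunctor M).map_id n
    rw [h1, tensorHom_id, tensorHom_id] at h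
    exact h.symm
  δ_natural_right {m m'} n f := by
    have h := nerveHom_tensor M (𝟙 n.unop) f.unop
    have h1 : nerveHom M (𝟙 n.unop) = 𝟙 _ := (nerveFunctor M).map_id n
    rw [h1, id_tensorHom, id_tensorHom] at h
    exact h.symm
  oplax_associativity a b c := by
    have h : (nerveFunctor M).map (α_ a b c).hom = cast M (Nat.add_assoc _ _ _) :=
      nerveHom_eq_cast M (α_ a.unop b.unop c.unop).inv (Nat.add_assoc _ _ _)
        fun i hi => FInt.val_associator_inv _ _ _ hi
    rw [h]
    exact powIso_assoc M _ _ _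
  oplax_left_unitality a := by
    have h : (nerveFunctor M).map (λ_ a).inv = cast M (Nat.zero_add _).symm :=
      nerveHom_eq_cast M (λ_ a.unop).hom (Nat.zero_add _).symm
        fun i hi => FInt.val_leftUnitor_hom _ (hi.trans (Nat.zero_add _).le)
    rw [h]
    refine Eq.symm ?_
    refine (congrArg (fun z => cast M (Nat.zero_add a.unop.len).symm ≫
      (powIso M 0 a.unop.len).hom ≫ z) (id_whiskerRight (𝟙_ W) (pow M a.unop.len))).trans ?_
    rw [zero_powIso]
    refine (congrArg (cast M _ ≫ ·) (Category.comp_id _)).trans ?_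
    rw [cast_trans_assoc, cast_rfl, Category.id_comp]
    rfl
  oplax_right_unitality a := by
    have h : (nerveFunctor M).map (ρ_ a).inv = cast M (Nat.add_zero _).symm :=
      nerveHom_eq_cast M (ρ_ a.unop).hom (Nat.add_zero _).symm
        fun i hi => FInt.val_rightUnitor_hom _ hi
    rw [h]
    refine Eq.symm ?_
    refine (congrArg (fun z => cast M (Nat.add_zero a.unop.len).symm ≫
      (ρ_ (pow M a.unop.len)).inv ≫ z) (MonoidalCategory.whiskerLeft_id (pow M a.unop.len)
        (𝟙_ W))).trans ?_
    refine (congrArg (cast M _ ≫ ·) (Category.comp_id _)).trans ?_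
    rw [cast_rfl]
    exact Category.id_comp _

end

end MonNerve

namespace MonNerve

section

variable {W : Type*} [Category W] [MonoidalCategory W] {W' : Type*} [Category W']
  [MonoidalCategory W'] (L : W' ⥤ W) [L.LaxMonoidal] {M : W} {M' : W'}

/-- The map of tensor powers induced by a map `M ⟶ L M'`, where `L` is lax monoidal. -/
def powMap (φ : M ⟶ L.obj M') : ∀ n : ℕ, pow M n ⟶ L.obj (pow M' n)
  | 0 => Functor.LaxMonoidal.ε L
  | n + 1 => (powMap φ n ⊗ₘ φ) ≫ Functor.LaxMonoidal.μ L (pow M' n) M'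

theorem powMap_cast (φ : M ⟶ L.obj M') {a b : ℕ} (h : a = b) :
    cast M h ≫ powMap L φ b = powMap L φ a ≫ L.map (cast M' h) := by
  subst h
  simp [cast_rfl]

theorem powMap_powIso (φ : M ⟶ L.obj M') (a b : ℕ) :
    (powIso M a b).hom ≫ (powMap L φ a ⊗ₘ powMap L φ b) ≫ Functor.LaxMonoidal.μ L _ _ =
      powMap L φ (a + b) ≫ L.map (powIso M' a b).hom := by
  induction b with
  | zero =>
    change (ρ_ (pow M a)).inv ≫ (powMap L φ a ⊗ₘ Functor.LaxMonoidal.ε L) ≫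
      Functor.LaxMonoidal.μ L (pow M' a) (𝟙_ W') = powMap L φ a ≫ L.map (ρ_ (pow M' a)).inv
    rw [← Functor.LaxMonoidal.right_unitality_inv, MonoidalCategory.tensorHom_def, Category.assoc,
      ← rightUnitor_inv_naturality_assoc]
  | succ b ih =>
    change ((powIso M a b).hom ▷ M ≫ (α_ (pow M a) (pow M b) M).hom) ≫
      (powMap L φ a ⊗ₘ ((powMap L φ b ⊗ₘ φ) ≫ Functor.LaxMonoidal.μ L (pow M' b) M')) ≫
        Functor.LaxMonoidal.μ L (pow M' a) (pow M' b ⊗ M') =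
      ((powMap L φ (a + b) ⊗ₘ φ) ≫ Functor.LaxMonoidal.μ L (pow M' (a + b)) M') ≫
        L.map ((powIso M' a b).hom ▷ M' ≫ (α_ (pow M' a) (pow M' b) M').hom)
    simp only [Functor.map_comp, Category.assoc]
    rw [← Functor.LaxMonoidal.μ_natural_left_assoc,
      tensorHom_comp_whiskerRight_assoc, ← ih]
    have h1 : ((powIso M a b).hom ≫ (powMap L φ a ⊗ₘ powMap L φ b) ≫
        Functor.LaxMonoidal.μ L (pow M' a) (pow M' b)) ⊗ₘ φ =
        (powIso M a b).hom ▷ M ≫ ((powMap L φ a ⊗ₘ powMap L φ b) ⊗ₘ φ) ≫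
          Functor.LaxMonoidal.μ L (pow M' a) (pow M' b) ▷ L.obj M' := by
      rw [tensorHom_comp_whiskerRight, whiskerRight_comp_tensorHom]
    have h2 : powMap L φ a ⊗ₘ ((powMap L φ b ⊗ₘ φ) ≫ Functor.LaxMonoidal.μ L (pow M' b) M') =
        (powMap L φ a ⊗ₘ (powMap L φ b ⊗ₘ φ)) ≫
          L.obj (pow M' a) ◁ Functor.LaxMonoidal.μ L (pow M' b) M' := by
      rw [tensorHom_comp_whiskerLeft]
    rw [h1, h2]
    simp only [Category.assoc, Functor.LaxMonoidal.associativity, associator_naturality_assoc]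

variable [MonObj M] [MonObj M']

theorem mulN_powMap (φ : M ⟶ L.obj M')
    (hone : (MonObj.one : 𝟙_ W ⟶ M) ≫ φ = Functor.LaxMonoidal.ε L ≫ L.map MonObj.one)
    (hmul : (MonObj.mul : M ⊗ M ⟶ M) ≫ φ =
      (φ ⊗ₘ φ) ≫ Functor.LaxMonoidal.μ L M' M' ≫ L.map MonObj.mul) (n : ℕ) :
    mulN M n ≫ φ = powMap L φ n ≫ L.map (mulN M' n) := by
  induction n with
  | zero => exact hone
  | succ n ih =>
    change (mulN M n ▷ M ≫ MonObj.mul) ≫ φ = ((powMap L φ n ⊗ₘ φ) ≫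
      Functor.LaxMonoidal.μ L (pow M' n) M') ≫ L.map (mulN M' n ▷ M' ≫ MonObj.mul)
    rw [Category.assoc, hmul, Functor.map_comp, Category.assoc,
      ← Functor.LaxMonoidal.μ_natural_left_assoc, tensorHom_comp_whiskerRight_assoc, ← ih,
      whiskerRight_comp_tensorHom_assoc]

theorem stepMap_powMap (φ : M ⟶ L.obj M')
    (hone : (MonObj.one : 𝟙_ W ⟶ M) ≫ φ = Functor.LaxMonoidal.ε L ≫ L.map MonObj.one)
    (hmul : (MonObj.mul : M ⊗ M ⟶ M) ≫ φ =
      (φ ⊗ₘ φ) ≫ Functor.LaxMonoidal.μ L M' M' ≫ L.map MonObj.mul) {a m : ℕ}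
    (f : pow M a ⟶ pow M m) (f' : pow M' a ⟶ pow M' m) (b : ℕ) (h : a ≤ b)
    (hf : f ≫ powMap L φ m = powMap L φ a ≫ L.map f') :
    stepMap M f b h ≫ (powMap L φ m ⊗ₘ φ) ≫ Functor.LaxMonoidal.μ L (pow M' m) M' =
      powMap L φ b ≫ L.map (stepMap M' f' b h) := by
  obtain ⟨s, rfl⟩ := Nat.exists_eq_add_of_le h
  rw [stepMap_eq M f h rfl, stepMap_eq M' f' h rfl, cast_rfl, cast_rfl, Category.id_comp,
    Category.id_comp, Functor.map_comp, ← Category.assoc (powMap L φ (a + s)),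
    ← powMap_powIso]
  simp only [Category.assoc]
  rw [← Functor.LaxMonoidal.μ_natural, tensorHom_comp_tensorHom_assoc,
    tensorHom_comp_tensorHom_assoc, hf, mulN_powMap L φ hone hmul]

theorem nerveMap_powMap (φ : M ⟶ L.obj M')
    (hone : (MonObj.one : 𝟙_ W ⟶ M) ≫ φ = Functor.LaxMonoidal.ε L ≫ L.map MonObj.one)
    (hmul : (MonObj.mul : M ⊗ M ⟶ M) ≫ φ =
      (φ ⊗ₘ φ) ≫ Functor.LaxMonoidal.μ L M' M' ≫ L.map MonObj.mul)
    (w : ℕ → ℕ) (h0 : w 0 = 0) (hw : Monotone w) (m : ℕ) :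
    nerveMap M w h0 hw m ≫ powMap L φ m = powMap L φ (w m) ≫ L.map (nerveMap M' w h0 hw m) := by
  induction m with
  | zero => exact powMap_cast L φ h0
  | succ m ih => exact stepMap_powMap L φ hone hmul _ _ _ _ ih

theorem nerveHom_powMap (φ : M ⟶ L.obj M')
    (hone : (MonObj.one : 𝟙_ W ⟶ M) ≫ φ = Functor.LaxMonoidal.ε L ≫ L.map MonObj.one)
    (hmul : (MonObj.mul : M ⊗ M ⟶ M) ≫ φ =
      (φ ⊗ₘ φ) ≫ Functor.LaxMonoidal.μ L M' M' ≫ L.map MonObj.mul)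
    {m n : FInt} (f : m ⟶ n) :
    nerveHom M f ≫ powMap L φ m.len = powMap L φ n.len ≫ L.map (nerveHom M' f) := by
  rw [nerveHom, nerveHom, Category.assoc, nerveMap_powMap L φ hone hmul, Functor.map_comp,
    ← Category.assoc, powMap_cast, Category.assoc]

end

theorem powMap_succ_aux {C D E : Type*} [Category C] [Category D] [Category E]
    [MonoidalCategory C] [MonoidalCategory D] [MonoidalCategory E] (F : D ⥤ C) [F.LaxMonoidal]
    (G : E ⥤ D) [G.LaxMonoidal] {x x' : C} {y y' : D} {z z' : E} (f : x ⟶ F.obj y)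
    (f' : x' ⟶ F.obj y') (g : y ⟶ G.obj z) (g' : y' ⟶ G.obj z') :
    ((f ≫ F.map g) ⊗ₘ (f' ≫ F.map g')) ≫ Functor.LaxMonoidal.μ F (G.obj z) (G.obj z') ≫
        F.map (Functor.LaxMonoidal.μ G z z') =
      ((f ⊗ₘ f') ≫ Functor.LaxMonoidal.μ F y y') ≫
        F.map ((g ⊗ₘ g') ≫ Functor.LaxMonoidal.μ G z z') := by
  rw [← tensorHom_comp_tensorHom, Category.assoc, Functor.LaxMonoidal.μ_natural_assoc,
    Functor.map_comp, Category.assoc]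

end MonNerve

/-- Small `V`-enriched categories. -/
structure VCat (V : Type u) [Category.{v} V] [MonoidalCategory V] : Type (max u (v + 1)) where
  /-- the set of objects -/
  Ob : Type v
  /-- the enriched category structure -/
  [enriched : EnrichedCategory V Ob]

namespace VCat

section

variable {V : Type u} [Category.{v} V] [MonoidalCategory V]

instance (C : VCat V) : EnrichedCategory V C.Ob := C.enriched

/-- The category of small `V`-enriched categories and `V`-enriched functors. -/
instance : Category (VCat V) where
  Hom C D := EnrichedFunctor V C.Ob D.Ob
  id C := EnrichedFunctor.id V C.Ob
  comp F G := EnrichedFunctor.comp V F G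
  id_comp F := EnrichedFunctor.ext V (fun _ => rfl) fun X Y => by
    simp only [EnrichedFunctor.comp_map, EnrichedFunctor.id_map]
    exact (Category.comp_id _).trans (Category.id_comp _)
  comp_id F := EnrichedFunctor.ext V (fun _ => rfl) fun X Y => by
    simp only [EnrichedFunctor.comp_map, EnrichedFunctor.id_map]
    exact (Category.comp_id _).trans (Category.comp_id _)
  assoc F G H := EnrichedFunctor.ext V (fun _ => rfl) fun X Y => by
    simp only [EnrichedFunctor.comp_map]
    exact (Category.comp_id _).trans (Category.assoc _ _ _)

/-- The quiver of hom-objects of a `V`-enriched category. -/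
def quiver (C : VCat V) : VQuiv V C.Ob := ⟨fun a b => EnrichedCategory.Hom a b⟩

/-- The map on objects of a morphism of `VCat V`. -/
def objMap {C D : VCat V} (F : C ⟶ D) : C.Ob → D.Ob := EnrichedFunctor.obj F

/-- The map on hom-objects of a morphism of `VCat V`. -/
def quiverMap {C D : VCat V} (F : C ⟶ D) : C.quiver ⟶ (VQuiv.pullback (objMap F)).obj D.quiver :=
  ⟨fun a b => EnrichedFunctor.map F a b⟩

end

variable {V : Type u} [Category.{v} V] [MonoidalCategory V] [HasColimits V]
    [SymmetricCategory V] [MonoidalClosed V]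

/-- The identities of a `V`-enriched category, as a morphism of quivers. -/
def unitHom (C : VCat V) : 𝟙_ (VQuiv V C.Ob) ⟶ C.quiver :=
  ⟨fun a _ => VQuiv.descU fun h => eId V a ≫ eqToHom (congrArg (C.quiver a) h)⟩

/-- The composition of a `V`-enriched category, as a morphism of quivers. -/
def multHom (C : VCat V) : C.quiver ⊗ C.quiver ⟶ C.quiver :=
  ⟨fun a b => VQuiv.descT fun c => eComp V a c b⟩

theorem inj_unitHom (C : VCat V) (a : C.Ob) :
    VQuiv.injUnit rfl ≫ C.unitHom.app a a = eId V a :=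
  (VQuiv.injUnit_descU (fun h => eId V a ≫ eqToHom (congrArg (C.quiver a) h)) rfl).trans
    (Category.comp_id _)

theorem inj_multHom (C : VCat V) (a c b : C.Ob) :
    VQuiv.inj C.quiver C.quiver a c b ≫ C.multHom.app a b = eComp V a c b :=
  VQuiv.inj_descT _ _

/-- A `V`-enriched category is a monoid in quivers. -/
instance (C : VCat V) : MonObj C.quiver where
  one := C.unitHom
  mul := C.multHom
  one_mul := by
    ext a b
    refine VQuiv.tensorObj_ext fun c => VQuiv.tensorUnit_whiskerRight_ext fun h => ?_
    subst h
    simp only [VQuiv.comp_app, VQuiv.inj_whiskerRight_assoc, VQuiv.inj_leftUnitor_hom]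
    rw [← comp_whiskerRight_assoc, inj_unitHom, inj_multHom]
    rw [← cancel_epi (λ_ _).inv, Iso.inv_hom_id]
    exact e_id_comp V a b
  mul_one := by
    ext a b
    refine VQuiv.tensorObj_ext fun c => VQuiv.whiskerLeft_tensorUnit_ext fun h => ?_
    subst h
    simp only [VQuiv.comp_app, VQuiv.inj_whiskerLeft_assoc, VQuiv.inj_rightUnitor_hom]
    rw [← whiskerLeft_comp_assoc, inj_unitHom, inj_multHom]
    rw [← cancel_epi (ρ_ _).inv, Iso.inv_hom_id]
    exact e_comp_id V a c
  mul_assoc := by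
    ext a b
    refine VQuiv.tensorObj_ext fun c => VQuiv.tensorObj_whiskerRight_ext fun d => ?_
    simp only [VQuiv.comp_app, VQuiv.inj_whiskerRight_assoc, VQuiv.inj_associator_hom_assoc,
      VQuiv.inj_whiskerLeft_assoc]
    rw [← comp_whiskerRight_assoc, ← whiskerLeft_comp_assoc]
    simp only [inj_multHom]
    exact (e_assoc' V a d c b).symm

theorem one_quiverMap {C D : VCat V} (F : C ⟶ D) :
    (MonObj.one : 𝟙_ _ ⟶ C.quiver) ≫ quiverMap F =
      Functor.LaxMonoidal.ε (VQuiv.pullback (objMap F)) ≫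
        (VQuiv.pullback (objMap F)).map MonObj.one := by
  ext a b
  refine VQuiv.tensorUnit_ext fun h => ?_
  subst h
  refine (Category.assoc _ _ _).symm.trans ?_
  refine (congrArg (· ≫ (quiverMap F).app a a) (inj_unitHom C a)).trans ?_
  refine Eq.trans ?_ (Category.assoc _ _ _)
  refine Eq.trans ?_ (congrArg (· ≫ D.unitHom.app (objMap F a) (objMap F a))
    (VQuiv.injUnit_pullbackUnit (objMap F) rfl)).symm
  exact (EnrichedFunctor.map_id F a).trans (inj_unitHom D (objMap F a)).symm

theorem mul_quiverMap {C D : VCat V} (F : C ⟶ D) :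
    (MonObj.mul : C.quiver ⊗ C.quiver ⟶ C.quiver) ≫ quiverMap F =
      (quiverMap F ⊗ₘ quiverMap F) ≫
        Functor.LaxMonoidal.μ (VQuiv.pullback (objMap F)) D.quiver D.quiver ≫
          (VQuiv.pullback (objMap F)).map MonObj.mul := by
  ext a b
  refine VQuiv.tensorObj_ext fun c => ?_
  refine (Category.assoc _ _ _).symm.trans ?_
  refine (congrArg (· ≫ (quiverMap F).app a b) (inj_multHom C a c b)).trans ?_
  refine (EnrichedFunctor.map_comp F a c b).trans ?_
  refine Eq.trans ?_ (VQuiv.inj_tensorHom_assoc (quiverMap F) (quiverMap F) a c b _).symm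
  refine congrArg (((quiverMap F).app a c ⊗ₘ (quiverMap F).app c b) ≫ ·) ?_
  refine Eq.trans ?_ (VQuiv.inj_pullbackTensor_assoc (objMap F) D.quiver D.quiver a c b
    (D.multHom.app (objMap F a) (objMap F b))).symm
  exact (inj_multHom D (objMap F a) (objMap F c) (objMap F b)).symm

/-- The templicial nerve of a `V`-enriched category `C`: its object of `n`-simplices is the
`n`-th tensor power of the quiver of `C`. -/
def nerve (C : VCat V) : Templicial V where
  Ob := C.Ob
  fct := MonNerve.nerveFunctor C.quiver
  isIso_η := inferInstanceAs (IsIso (𝟙 (𝟙_ (VQuiv V C.Ob))))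

/-- The map of tensor powers of quivers induced by a `V`-enriched functor. -/
def powMap {C D : VCat V} (F : C ⟶ D) (n : ℕ) :
    MonNerve.pow C.quiver n ⟶ (VQuiv.pullback (objMap F)).obj (MonNerve.pow D.quiver n) :=
  MonNerve.powMap (VQuiv.pullback (objMap F)) (quiverMap F) n

theorem powMap_id (C : VCat V) (n : ℕ) : powMap (𝟙 C) n = 𝟙 (MonNerve.pow C.quiver n) := by
  induction n with
  | zero => exact Templicial.pullbackUnit_id
  | succ n ih =>
    have h1 : quiverMap (𝟙 C) = 𝟙 C.quiver := rfl
    refine (congrArg₂ (· ≫ ·) (congrArg (· ⊗ₘ 𝟙 C.quiver) ih)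
      (Templicial.pullbackTensor_id (MonNerve.pow C.quiver n) C.quiver)).trans ?_
    exact (Category.comp_id _).trans (id_tensorHom_id _ _)

theorem powMap_comp {C D E : VCat V} (F : C ⟶ D) (G : D ⟶ E) (n : ℕ) :
    powMap (F ≫ G) n = powMap F n ≫ (VQuiv.pullback (objMap F)).map (powMap G n) := by
  induction n with
  | zero => exact Templicial.pullbackUnit_comp (objMap F) (objMap G)
  | succ n ih =>
    refine (congrArg₂ (· ≫ ·) (congrArg (· ⊗ₘ quiverMap (F ≫ G)) ih)
      (Templicial.pullbackTensor_comp (objMap F) (objMap G)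
        (MonNerve.pow E.quiver n) E.quiver)).trans ?_
    exact MonNerve.powMap_succ_aux (VQuiv.pullback (objMap F)) (VQuiv.pullback (objMap G))
      (powMap F n) (quiverMap F) (powMap G n) (quiverMap G)

/-- The templicial nerve of a `V`-enriched functor. -/
def nerveMap {C D : VCat V} (F : C ⟶ D) : C.nerve ⟶ D.nerve where
  base := objMap F
  app n := powMap F n.unop.len
  naturality f := MonNerve.nerveHom_powMap (VQuiv.pullback (objMap F)) (quiverMap F)
    (one_quiverMap F) (mul_quiverMap F) f.unop
  comp_δ m n := MonNerve.powMap_powIso (VQuiv.pullback (objMap F)) (quiverMap F) m.unop.len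
    n.unop.len
  comp_η := (Category.id_comp _).trans (Category.comp_id _).symm

end VCat

/-- The templicial nerve functor `N_V`. -/
def templicialNerve (V : Type u) [Category.{v} V] [MonoidalCategory V] [HasColimits V]
    [SymmetricCategory V] [MonoidalClosed V] : VCat V ⥤ Templicial V where
  obj C := C.nerve
  map F := VCat.nerveMap F
  map_id C := Templicial.Hom.ext rfl (heq_of_eq (funext fun n => VCat.powMap_id C n.unop.len))
  map_comp F G :=
    Templicial.Hom.ext rfl (heq_of_eq (funext fun n => VCat.powMap_comp F G n.unop.len))

/-! Necklaces. A necklace is given by the list of the dimensions of its beads, all of which are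
positive; the list `[n₁, ..., n_k]` stands for the pair `(T, p)` with `p = n₁ + ... + n_k` and
`T = {0, n₁, n₁ + n₂, ..., p}`. -/

namespace Necklace

/-- The tensor product of the objects `b n`, for `n` in a list. -/
def fold {C : Type*} [Category C] [MonoidalCategory C] (b : ℕ → C) : List ℕ → C
  | [] => 𝟙_ C
  | n :: L => b n ⊗ fold b L

/-- Tensor products over concatenated lists. -/
def foldAppend {C : Type*} [Category C] [MonoidalCategory C] (b : ℕ → C) :
    ∀ T₁ T₂ : List ℕ, fold b (T₁ ++ T₂) ≅ fold b T₁ ⊗ fold b T₂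
  | [], T₂ => (λ_ (fold b T₂)).symm
  | n :: T₁, T₂ => whiskerLeftIso (b n) (foldAppend b T₁ T₂) ≪≫ (α_ _ _ _).symm

/-- The vertices `[p]` of a necklace `(T, p)`. -/
abbrev total (T : List ℕ) : FInt := fold FInt.mk T

/-- The unique map to the interval `[0]`. -/
def toZero (m : FInt) : m ⟶ 𝟙_ FInt where
  toOrderHom := ⟨fun _ => 0, fun _ _ _ => le_rfl⟩
  map_zero := rfl
  map_last := rfl

/-- Necklace maps. A necklace map `(T, p) ⟶ (U, q)` is an endpoint preserving monotone map
`f : [p] ⟶ [q]` with `U ⊆ f(T)`; these are the maps obtained by cutting `T` into consecutive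
necklaces, each of which is mapped to one bead of `U` (`cons`). The last part of `T` may be
collapsed to the final vertex of `U` (`nil`). -/
inductive Map : List ℕ → List ℕ → Type
  | nil (T : List ℕ) : Map T []
  | cons (T₁ : List ℕ) {n : ℕ} (f : total T₁ ⟶ FInt.mk n) {T₂ U : List ℕ} (d : Map T₂ U) :
      Map (T₁ ++ T₂) (n :: U)

/-- The map on vertices underlying a necklace map. -/
def Map.toHom : ∀ {T U : List ℕ}, Map T U → (total T ⟶ total U)
  | _, _, .nil T => toZero (total T)
  | _, _, .cons T₁ f (T₂ := T₂) d => (foldAppend FInt.mk T₁ T₂).hom ≫ (f ⊗ₘ d.toHom)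

end Necklace

namespace Templicial

variable {V : Type u} [Category.{v} V] [MonoidalCategory V] [HasColimits V]
    [SymmetricCategory V] [MonoidalClosed V] (X : Templicial V)

/-- The quiver `X_T = X_{n₁} ⊗ ... ⊗ X_{n_k}` of a necklace `T`. -/
abbrev onNecklace (T : List ℕ) : VQuiv V X.Ob := Necklace.fold X.lvl T

/-- The iterated comultiplication `X_p ⟶ X_T` of a necklace `(T, p)`. -/
def iterComul : ∀ T : List ℕ, X.fct.obj (op (Necklace.total T)) ⟶ X.onNecklace T
  | [] => X.counit
  | n :: T => Functor.OplaxMonoidal.δ X.fct (op ⟨n⟩) (op (Necklace.total T)) ≫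
      X.lvl n ◁ iterComul T

/-- The map `X_U ⟶ X_T` induced by a necklace map `T ⟶ U`: on each bead of `U` it is given by
the simplicial structure of `X` followed by comultiplication. -/
def necklaceMap : ∀ {T U : List ℕ}, Necklace.Map T U → (X.onNecklace U ⟶ X.onNecklace T)
  | _, _, .nil T => X.counitInv ≫
      X.fct.map (Necklace.toZero (Necklace.total T)).op ≫ X.iterComul T
  | _, _, .cons T₁ f (T₂ := T₂) d =>
      ((X.fct.map f.op ≫ X.iterComul T₁) ⊗ₘ necklaceMap d) ≫
        (Necklace.foldAppend X.lvl T₁ T₂).inv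

end Templicial

namespace Necklace

/-- The necklace maps `T ⟶ [n]` that factor through the horn `Λ^n_j`: the image of every bead of
`T` misses some vertex of `[n]` different from `j`. -/
def InHorn (n j : ℕ) (T : List ℕ) (f : total T ⟶ FInt.mk n) : Prop :=
  ∀ (T₁ T₂ : List ℕ) (t : ℕ), T = T₁ ++ t :: T₂ →
    ∃ k, k ≤ n ∧ k ≠ j ∧ ∀ i, i ≤ t → FInt.val f (T₁.sum + i) ≠ k

end Necklace

namespace Templicial

variable {V : Type u} [Category.{v} V] [MonoidalCategory V] [HasColimits V]
    [SymmetricCategory V] [MonoidalClosed V] (X : Templicial V)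

/-- Let `K` be a subfunctor, given by the predicate `P`, of the functor `T ↦ {T ⟶ [n]}` on
necklaces. This is the type of natural transformations from `T ↦ F(K(T))` to `X_•(a,b)`; by the
adjunction between `F` and `U`, they are natural families of elements of `U(X_T(a,b))`. -/
structure NecklaceFamily (a b : X.Ob) (n : ℕ)
    (P : ∀ T : List ℕ, (Necklace.total T ⟶ FInt.mk n) → Prop) where
  /-- the elements of the family -/
  elt : ∀ (T : List ℕ), (∀ t ∈ T, 0 < t) → ∀ f : Necklace.total T ⟶ FInt.mk n, P T f →
    (𝟙_ V ⟶ (X.onNecklace T).obj a b)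
  naturality : ∀ (T U : List ℕ) (hT : ∀ t ∈ T, 0 < t) (hU : ∀ t ∈ U, 0 < t)
    (d : Necklace.Map T U) (f : Necklace.total U ⟶ FInt.mk n) (hf : P U f)
    (hdf : P T (d.toHom ≫ f)),
    elt U hU f hf ≫ (X.necklaceMap d).app a b = elt T hT (d.toHom ≫ f) hdf

/-- A templicial object `X` is a quasi-category in `V` if for all vertices `a` and `b` the functor
`X_•(a,b)` on necklaces lifts inner horns: every natural transformation from
`F(Λ^n_j)_•(0,n)` to `X_•(a,b)`, `0 < j < n`, extends to `F(Δ^n)_•(0,n)`. -/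
def IsQuasiCategory : Prop :=
  ∀ (a b : X.Ob) (n j : ℕ), 0 < j → j < n →
    ∀ x : X.NecklaceFamily a b n (Necklace.InHorn n j),
      ∃ y : X.NecklaceFamily a b n (fun _ _ => True),
        ∀ T hT f hf, y.elt T hT f trivial = x.elt T hT f hf

end Templicial

section

open Simplicial

/-! The underlying simplicial set of a templicial object. -/

namespace SSetAux

/-- The inclusion of the first `k + 1` vertices of `[k + l]`. -/
def front (k l : ℕ) : (⦋k⦌ : SimplexCategory) ⟶ ⦋k + l⦌ :=
  SimplexCategory.Hom.mk ⟨fun i => Fin.castLE (by simp) i, fun _ _ h => h⟩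

/-- The inclusion of the last `l + 1` vertices of `[k + l]`. -/
def back (k l : ℕ) : (⦋l⦌ : SimplexCategory) ⟶ ⦋k + l⦌ :=
  SimplexCategory.Hom.mk ⟨fun i : Fin (l + 1) => (⟨k + i, by omega⟩ : Fin (k + l + 1)), fun _ _ h =>
    Nat.add_le_add_left (Fin.le_iff_val_le_val.mp h) k⟩

variable (K : SSet.{v})

/-- The first vertex of a simplex. -/
def first {n : ℕ} (σ : K.obj (op ⦋n⦌)) : K.obj (op ⦋0⦌) :=
  K.map (SimplexCategory.const ⦋0⦌ ⦋n⦌ 0).op σ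

/-- The last vertex of a simplex. -/
def last {n : ℕ} (σ : K.obj (op ⦋n⦌)) : K.obj (op ⦋0⦌) :=
  K.map (SimplexCategory.const ⦋0⦌ ⦋n⦌ (Fin.last n)).op σ

/-- The first `k`-dimensional face of a simplex. -/
def frontFace (k l : ℕ) (σ : K.obj (op ⦋k + l⦌)) : K.obj (op ⦋k⦌) := K.map (front k l).op σ

/-- The last `l`-dimensional face of a simplex. -/
def backFace (k l : ℕ) (σ : K.obj (op ⦋k + l⦌)) : K.obj (op ⦋l⦌) := K.map (back k l).op σ

/-- Restriction of a simplex along an endpoint preserving map. -/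
def restrict {m n : ℕ} (f : FInt.mk m ⟶ FInt.mk n) (σ : K.obj (op ⦋n⦌)) : K.obj (op ⦋m⦌) :=
  K.map (FInt.toSimplex.map f).op σ

end SSetAux

open SSetAux in
/-- Templicial maps `F̃(K) ⟶ X` from the free templicial object on a simplicial set `K`.
Here `F̃(K)` has vertex set `K₀` and `F̃(K)_n(a,b)` is the coproduct of copies of `I` over the
`n`-simplices of `K` with first vertex `a` and last vertex `b`; its comultiplication sends a
simplex to its front and back faces. A templicial map out of it is therefore given by a map on
vertices and by an element of `U(X_n(a,b))` for each such simplex. -/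
@[ext]
structure TemplicialMap {V : Type u} [Category.{v} V] [MonoidalCategory V] [HasColimits V]
    [SymmetricCategory V] [MonoidalClosed V] (K : SSet.{v}) (X : Templicial V) : Type v where
  /-- the map on vertices -/
  vertex : K.obj (op ⦋0⦌) → X.Ob
  /-- the elements assigned to the simplices -/
  elt : ∀ {n : ℕ} (σ : K.obj (op ⦋n⦌)) (a b : K.obj (op ⦋0⦌)), first K σ = a → last K σ = b →
    (𝟙_ V ⟶ (X.lvl n).obj (vertex a) (vertex b))
  naturality : ∀ {m n : ℕ} (f : FInt.mk m ⟶ FInt.mk n) (σ : K.obj (op ⦋n⦌))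
    (a b : K.obj (op ⦋0⦌)) (ha : first K σ = a) (hb : last K σ = b)
    (ha' : first K (restrict K f σ) = a) (hb' : last K (restrict K f σ) = b),
    elt (restrict K f σ) a b ha' hb' = elt σ a b ha hb ≫ (X.restr f).app _ _
  comul : ∀ (k l : ℕ) (σ : K.obj (op ⦋k + l⦌)) (a c b : K.obj (op ⦋0⦌)) (ha : first K σ = a)
    (hb : last K σ = b) (ha' : first K (frontFace K k l σ) = a)
    (hc : last K (frontFace K k l σ) = c) (hc' : first K (backFace K k l σ) = c)
    (hb' : last K (backFace K k l σ) = b),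
    elt σ a b ha hb ≫ (X.comul k l).app _ _ =
      (λ_ (𝟙_ V)).inv ≫ (elt (frontFace K k l σ) a c ha' hc ⊗ₘ elt (backFace K k l σ) c b hc' hb') ≫
        VQuiv.inj (X.lvl k) (X.lvl l) (vertex a) (vertex c) (vertex b)
  counit : ∀ (σ : K.obj (op ⦋0⦌)) (a b : K.obj (op ⦋0⦌)) (ha : first K σ = a)
    (hb : last K σ = b) (h : vertex a = vertex b),
    elt σ a b ha hb ≫ X.counit.app _ _ = VQuiv.injUnit h

namespace TemplicialMap

open SSetAux

variable {V : Type u} [Category.{v} V] [MonoidalCategory V] [HasColimits V]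
    [SymmetricCategory V] [MonoidalClosed V] {K L : SSet.{v}} {X Y Z : Templicial V}

theorem first_app (g : K ⟶ L) {n : ℕ} (σ : K.obj (op ⦋n⦌)) :
    first L (g.app _ σ) = g.app _ (first K σ) :=
  (NatTrans.naturality_apply g (SimplexCategory.const ⦋0⦌ ⦋n⦌ 0).op σ).symm

theorem last_app (g : K ⟶ L) {n : ℕ} (σ : K.obj (op ⦋n⦌)) :
    last L (g.app _ σ) = g.app _ (last K σ) :=
  (NatTrans.naturality_apply g (SimplexCategory.const ⦋0⦌ ⦋n⦌ (Fin.last n)).op σ).symm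

/-- Precomposition with a map of simplicial sets. -/
def precomp (g : K ⟶ L) (φ : TemplicialMap L X) : TemplicialMap K X where
  vertex a := φ.vertex (g.app _ a)
  elt σ a b ha hb := φ.elt (g.app _ σ) (g.app _ a) (g.app _ b)
    ((first_app g σ).trans (congrArg _ ha)) ((last_app g σ).trans (congrArg _ hb))
  naturality {m n} f σ a b ha hb ha' hb' := by
    have h : g.app _ (restrict K f σ) = restrict L f (g.app _ σ) :=
      NatTrans.naturality_apply g (FInt.toSimplex.map f).op σ
    have h1 : first L (restrict L f (g.app _ σ)) = g.app _ a := by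
      rw [← h, first_app, ha']
    have h2 : last L (restrict L f (g.app _ σ)) = g.app _ b := by
      rw [← h, last_app, hb']
    refine Eq.trans ?_ (φ.naturality f (g.app _ σ) (g.app _ a) (g.app _ b) _ _ h1 h2)
    congr 1
  comul k l σ a c b ha hb ha' hc hc' hb' := by
    have h : g.app _ (frontFace K k l σ) = frontFace L k l (g.app _ σ) :=
      NatTrans.naturality_apply g (front k l).op σ
    have h' : g.app _ (backFace K k l σ) = backFace L k l (g.app _ σ) :=
      NatTrans.naturality_apply g (back k l).op σ
    have h1 : first L (frontFace L k l (g.app _ σ)) = g.app _ a := by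
      rw [← h, first_app, ha']
    have h2 : last L (frontFace L k l (g.app _ σ)) = g.app _ c := by
      rw [← h, last_app, hc]
    have h3 : first L (backFace L k l (g.app _ σ)) = g.app _ c := by
      rw [← h', first_app, hc']
    have h4 : last L (backFace L k l (g.app _ σ)) = g.app _ b := by
      rw [← h', last_app, hb']
    refine (φ.comul k l (g.app _ σ) (g.app _ a) (g.app _ c) (g.app _ b)
      ((first_app g σ).trans (congrArg _ ha)) ((last_app g σ).trans (congrArg _ hb))
      h1 h2 h3 h4).trans ?_
    congr 4
    · exact h.symm
    · exact h'.symm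
  counit σ a b ha hb h := φ.counit _ _ _ _ _ h

/-- Postcomposition with a templicial morphism. -/
def postcomp (φ : TemplicialMap K X) (f : X ⟶ Y) : TemplicialMap K Y where
  vertex a := Templicial.Hom.base f (φ.vertex a)
  elt {n} σ a b ha hb := φ.elt σ a b ha hb ≫ Templicial.Hom.component f n _ _
  naturality {m n} g σ a b ha hb ha' hb' := by
    rw [φ.naturality g σ a b ha hb ha' hb', Category.assoc, Category.assoc,
      Templicial.Hom.component_restr]
  comul k l σ a c b ha hb ha' hc hc' hb' := by
    rw [Category.assoc, Templicial.Hom.component_comul, ← Category.assoc,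
      φ.comul k l σ a c b ha hb ha' hc hc' hb']
    simp
  counit σ a b ha hb h := by
    have hab : first K σ = last K σ := rfl
    have h0 : φ.vertex a = φ.vertex b := by rw [← ha, ← hb, hab]
    rw [Category.assoc, Templicial.Hom.component_counit, ← Category.assoc,
      φ.counit σ a b ha hb h0, VQuiv.injUnit_descU]

theorem precomp_id (φ : TemplicialMap K X) {g : K ⟶ K} (h : g = 𝟙 K) : φ.precomp g = φ := by
  subst h
  rfl

theorem precomp_comp {M : SSet.{v}} (φ : TemplicialMap M X) {g : K ⟶ L} {h : L ⟶ M} {k : K ⟶ M}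
    (e : k = g ≫ h) : φ.precomp k = (φ.precomp h).precomp g := by
  subst e
  rfl

end TemplicialMap

/-- The underlying simplicial set `Ũ(X)` of a templicial object: its `n`-simplices are the
templicial maps `F̃(Δ^n) ⟶ X`. -/
def underlyingSSet {V : Type u} [Category.{v} V] [MonoidalCategory V] [HasColimits V]
    [SymmetricCategory V] [MonoidalClosed V] (X : Templicial V) : SSet.{v} where
  obj n := TemplicialMap (SSet.stdSimplex.obj n.unop) X
  map f := ↾fun φ : TemplicialMap _ X => φ.precomp (SSet.stdSimplex.map f.unop)
  map_id n := by
    refine ConcreteCategory.hom_ext _ _ fun φ => ?_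
    exact TemplicialMap.precomp_id φ (SSet.stdSimplex.map_id n.unop)
  map_comp f g := by
    refine ConcreteCategory.hom_ext _ _ fun φ => ?_
    exact TemplicialMap.precomp_comp φ (SSet.stdSimplex.map_comp g.unop f.unop)

/-- The map of underlying simplicial sets induced by a templicial morphism. -/
def underlyingSSetMap {V : Type u} [Category.{v} V] [MonoidalCategory V] [HasColimits V]
    [SymmetricCategory V] [MonoidalClosed V] {X Y : Templicial V} (f : X ⟶ Y) :
    underlyingSSet X ⟶ underlyingSSet Y where
  app _ := ↾fun φ : TemplicialMap _ X => φ.postcomp f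
  naturality _ _ _ := rfl

namespace SSetAux

/-- A vertex of the standard simplex. -/
def pt {n : ℕ} (i : Fin (n + 1)) : (SSet.stdSimplex.{v}.obj ⦋n⦌).obj (op ⦋0⦌) :=
  SSet.stdSimplex.objEquiv.symm (SimplexCategory.const ⦋0⦌ ⦋n⦌ i)

/-- An edge of the standard simplex. -/
def edge {n : ℕ} (i j : Fin (n + 1)) (h : i ≤ j) : (SSet.stdSimplex.{v}.obj ⦋n⦌).obj (op ⦋1⦌) :=
  SSet.stdSimplex.objEquiv.symm (SimplexCategory.mkOfLe i j h)

/-- A two-dimensional face of the standard simplex. -/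
def triangle {n : ℕ} (i j k : Fin (n + 1)) (h : i ≤ j) (h' : j ≤ k) :
    (SSet.stdSimplex.{v}.obj ⦋n⦌).obj (op ⦋2⦌) :=
  SSet.stdSimplex.objEquiv.symm (SimplexCategory.mkOfLeComp i j k h h')

theorem simplex_ext {n m : ℕ} {σ τ : (SSet.stdSimplex.{v}.obj ⦋n⦌).obj (op ⦋m⦌)}
    (h : ∀ i : Fin (m + 1), σ i = τ i) : σ = τ :=
  DFunLike.ext _ _ h

theorem first_edge {n : ℕ} (i j : Fin (n + 1)) (h : i ≤ j) :
    first _ (edge.{v} i j h) = pt i :=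
  simplex_ext fun _ => rfl

theorem last_edge {n : ℕ} (i j : Fin (n + 1)) (h : i ≤ j) :
    last _ (edge.{v} i j h) = pt j :=
  simplex_ext fun _ => rfl

theorem first_pt {n : ℕ} (i : Fin (n + 1)) : first _ (pt.{v} i) = pt i :=
  simplex_ext fun _ => rfl

theorem last_pt {n : ℕ} (i : Fin (n + 1)) : last _ (pt.{v} i) = pt i :=
  simplex_ext fun _ => rfl

theorem first_triangle {n : ℕ} (i j k : Fin (n + 1)) (h : i ≤ j) (h' : j ≤ k) :
    first _ (triangle.{v} i j k h h') = pt i :=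
  simplex_ext fun _ => rfl

theorem last_triangle {n : ℕ} (i j k : Fin (n + 1)) (h : i ≤ j) (h' : j ≤ k) :
    last _ (triangle.{v} i j k h h') = pt k :=
  simplex_ext fun _ => rfl

/-- The endpoint preserving map `[1] ⟶ [2]`. -/
def d₁ : FInt.mk 1 ⟶ FInt.mk 2 :=
  FInt.mk' (fun i => 2 * i) (fun _ _ h _ => Nat.mul_le_mul_left 2 h) rfl rfl

/-- The unique map `[1] ⟶ [0]`. -/
def s₀ : FInt.mk 1 ⟶ FInt.mk 0 := Necklace.toZero _

theorem restrict_pt {n : ℕ} (i : Fin (n + 1)) :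
    restrict _ s₀ (pt.{v} i) = edge i i le_rfl :=
  simplex_ext fun k => by
    fin_cases k <;> rfl

theorem restrict_triangle {n : ℕ} (i j k : Fin (n + 1)) (h : i ≤ j) (h' : j ≤ k) :
    restrict _ d₁ (triangle.{v} i j k h h') = edge i k (h.trans h') :=
  simplex_ext fun l => by
    fin_cases l <;> rfl

theorem frontFace_triangle {n : ℕ} (i j k : Fin (n + 1)) (h : i ≤ j) (h' : j ≤ k) :
    frontFace _ 1 1 (triangle.{v} i j k h h') = edge i j h :=
  simplex_ext fun l => by
    fin_cases l <;> rfl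

theorem backFace_triangle {n : ℕ} (i j k : Fin (n + 1)) (h : i ≤ j) (h' : j ≤ k) :
    backFace _ 1 1 (triangle.{v} i j k h h') = edge j k h' :=
  simplex_ext fun l => by
    fin_cases l <;> rfl

theorem map_pt {m n : ℕ} (f : (⦋m⦌ : SimplexCategory) ⟶ ⦋n⦌) (i : Fin (m + 1)) :
    (SSet.stdSimplex.{v}.map f).app _ (pt i) = pt (f.toOrderHom i) :=
  simplex_ext fun _ => rfl

theorem map_edge {m n : ℕ} (f : (⦋m⦌ : SimplexCategory) ⟶ ⦋n⦌) (i j : Fin (m + 1)) (h : i ≤ j)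
    (h' : f.toOrderHom i ≤ f.toOrderHom j) :
    (SSet.stdSimplex.{v}.map f).app _ (edge i j h) =
      edge (f.toOrderHom i) (f.toOrderHom j) h' :=
  simplex_ext fun l => by
    fin_cases l <;> rfl

end SSetAux

namespace MonNerve

variable {W : Type*} [Category W] [MonoidalCategory W] (M : W) [MonObj M]

theorem cast_mulN {a b : ℕ} (h : a = b) : cast M h ≫ mulN M b = mulN M a := by
  subst h
  exact Category.id_comp _

theorem nerveHom_mulN {m n : FInt} (f : m ⟶ n) : nerveHom M f ≫ mulN M m.len = mulN M n.len := by
  rw [nerveHom, Category.assoc, nerveMap_mulN, cast_mulN]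

end MonNerve

namespace VCat

open SSetAux

variable {V : Type u} [Category.{v} V] [MonoidalCategory V] [HasColimits V]
    [SymmetricCategory V] [MonoidalClosed V] {K : SSet.{v}} {C D : VCat V}

/-- The identification of the edges of the nerve of `C` with the quiver of `C`. -/
def lvlOne (C : VCat V) : C.nerve.lvl 1 ⟶ C.quiver := MonNerve.mulN C.quiver 1

/-- The objects of `C` given by the vertices of a simplicial set over the templicial nerve. -/
def vtx (φ : TemplicialMap K C.nerve) (a : K.obj (op ⦋0⦌)) : C.Ob := φ.vertex a

/-- The morphism of `C` given by an edge of a simplicial set over the templicial nerve of `C`. -/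
def edgeHom (φ : TemplicialMap K C.nerve) (e : K.obj (op ⦋1⦌)) (a b : K.obj (op ⦋0⦌))
    (ha : first K e = a) (hb : last K e = b) :
    𝟙_ V ⟶ C.quiver.obj (vtx φ a) (vtx φ b) :=
  φ.elt e a b ha hb ≫ C.lvlOne.app _ _

theorem restr_mulN {m n : ℕ} (f : FInt.mk m ⟶ FInt.mk n) :
    C.nerve.restr f ≫ MonNerve.mulN C.quiver m = MonNerve.mulN C.quiver n :=
  MonNerve.nerveHom_mulN C.quiver f

theorem comul_mulN (k l : ℕ) :
    C.nerve.comul k l ≫ (MonNerve.mulN C.quiver k ⊗ₘ MonNerve.mulN C.quiver l) ≫ C.multHom =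
      MonNerve.mulN C.quiver (k + l) :=
  MonNerve.mulN_add C.quiver k l

theorem edgeHom_degenerate (φ : TemplicialMap K C.nerve) (x : K.obj (op ⦋0⦌))
    (hx : first K x = x) (hx' : last K x = x) (e : K.obj (op ⦋1⦌)) (he : restrict K s₀ x = e)
    (h1 : first K e = x) (h2 : last K e = x) :
    edgeHom φ e x x h1 h2 = eId V (vtx φ x) := by
  subst he
  rw [edgeHom, φ.naturality s₀ x x x hx hx' h1 h2]
  refine (Category.assoc _ _ _).trans ?_
  have h := congrArg (fun z => z.app (φ.vertex x) (φ.vertex x)) (restr_mulN (C := C) s₀)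
  refine (congrArg (φ.elt x x x hx hx' ≫ ·) h).trans ?_
  have h' := φ.counit x x x hx hx' rfl
  have h3 : C.nerve.counit = 𝟙 _ := rfl
  rw [h3] at h'
  have h4 : φ.elt x x x hx hx' = VQuiv.injUnit rfl := (Category.comp_id _).symm.trans h'
  rw [h4]
  exact inj_unitHom C (vtx φ x)

theorem edgeHom_triangle (φ : TemplicialMap K C.nerve) (σ : K.obj (op ⦋2⦌))
    (a c b : K.obj (op ⦋0⦌)) (ha : first K σ = a) (hb : last K σ = b) (e e₁ e₂ : K.obj (op ⦋1⦌))
    (he : restrict K d₁ σ = e) (he₁ : frontFace K 1 1 σ = e₁) (he₂ : backFace K 1 1 σ = e₂)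
    (h1 : first K e = a) (h2 : last K e = b) (h3 : first K e₁ = a) (h4 : last K e₁ = c)
    (h5 : first K e₂ = c) (h6 : last K e₂ = b) :
    edgeHom φ e a b h1 h2 = (λ_ (𝟙_ V)).inv ≫ (edgeHom φ e₁ a c h3 h4 ⊗ₘ
      edgeHom φ e₂ c b h5 h6) ≫ eComp V (vtx φ a) (vtx φ c) (vtx φ b) := by
  subst he he₁ he₂
  rw [edgeHom, φ.naturality d₁ σ a b ha hb h1 h2]
  refine (Category.assoc _ _ _).trans ?_
  have h := congrArg (fun z => z.app (φ.vertex a) (φ.vertex b)) (restr_mulN (C := C) d₁)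
  refine (congrArg (φ.elt σ a b ha hb ≫ ·) h).trans ?_
  have h' := congrArg (fun z => z.app (φ.vertex a) (φ.vertex b)) (comul_mulN (C := C) 1 1)
  refine (congrArg (φ.elt σ a b ha hb ≫ ·) h').symm.trans ?_
  refine (Category.assoc _ _ _).symm.trans ?_
  refine (congrArg (· ≫ _) (φ.comul 1 1 σ a c b ha hb h3 h4 h5 h6)).trans ?_
  refine (Category.assoc _ _ _).trans (congrArg ((λ_ (𝟙_ V)).inv ≫ ·) ?_)
  refine (Category.assoc _ _ _).trans ?_
  rw [edgeHom, edgeHom, ← inj_multHom]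
  refine Eq.trans ?_ (congrArg (· ≫ _) (tensorHom_comp_tensorHom _ _ _ _))
  refine Eq.trans ?_ (Category.assoc _ _ _).symm
  refine congrArg (_ ≫ ·) ?_
  exact VQuiv.inj_tensorHom_assoc (C.lvlOne) (C.lvlOne) _ _ _ _

/-- The underlying ordinary category of a `V`-enriched category: its morphisms `a ⟶ b` are the
elements of `U(C(a,b))`. -/
abbrev underlyingCat (C : VCat V) : Cat.{v, v} := Cat.of (ForgetEnrichment V C.Ob)

/-- The composable arrows of the underlying category of `C` given by a simplex of the underlying
simplicial set of the templicial nerve of `C`. -/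
def toArrows {n : ℕ} (φ : TemplicialMap (SSet.stdSimplex.{v}.obj ⦋n⦌) C.nerve) :
    ComposableArrows (ForgetEnrichment V C.Ob) n where
  obj i := ForgetEnrichment.of V (vtx φ (pt i))
  map {i j} f := ForgetEnrichment.homOf V
    (edgeHom φ (edge i j (leOfHom f)) (pt i) (pt j) (first_edge _ _ _) (last_edge _ _ _))
  map_id i := by
    rw [edgeHom_degenerate φ (pt i) (first_pt i) (last_pt i) _ (restrict_pt i),
      ForgetEnrichment.homOf_eId]
  map_comp {i j k} f g := by
    rw [edgeHom_triangle φ (triangle i j k (leOfHom f) (leOfHom g)) (pt i) (pt j) (pt k)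
      (first_triangle _ _ _ _ _) (last_triangle _ _ _ _ _) _ _ _ (restrict_triangle _ _ _ _ _)
      (frontFace_triangle _ _ _ _ _) (backFace_triangle _ _ _ _ _) _ _ (first_edge _ _ _)
      (last_edge _ _ _) (first_edge _ _ _) (last_edge _ _ _)]
    exact ForgetEnrichment.homOf_comp V _ _

theorem edgeHom_congr (φ : TemplicialMap K C.nerve) {x x' y y' : K.obj (op ⦋0⦌)}
    {e e' : K.obj (op ⦋1⦌)} (hx : x = x') (hy : y = y') (he : e = e') (h1 : first K e = x)
    (h2 : last K e = y) (h3 : first K e' = x') (h4 : last K e' = y') :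
    ForgetEnrichment.homOf V (edgeHom φ e x y h1 h2) =
      eqToHom (congrArg (fun z => ForgetEnrichment.of V (vtx φ z)) hx) ≫
        ForgetEnrichment.homOf V (edgeHom φ e' x' y' h3 h4) ≫
          eqToHom (congrArg (fun z => ForgetEnrichment.of V (vtx φ z)) hy.symm) := by
  subst hx hy he
  simp

/-- The canonical map from the underlying simplicial set of the templicial nerve of `C` to the
nerve of the underlying category of `C`. -/
def toNerve (C : VCat V) : underlyingSSet C.nerve ⟶ CategoryTheory.nerve (ForgetEnrichment V C.Ob)
    where
  app n := ↾fun φ : TemplicialMap (SSet.stdSimplex.obj n.unop) C.nerve => toArrows φ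
  naturality m n f := by
    refine ConcreteCategory.hom_ext _ _ fun φ => ?_
    refine CategoryTheory.Functor.ext (fun i : Fin (n.unop.len + 1) => congrArg (vtx φ)
      (map_pt f.unop i)) fun (i j : Fin (n.unop.len + 1)) g => ?_
    exact edgeHom_congr φ (map_pt f.unop i) (map_pt f.unop j) (map_edge f.unop i j (leOfHom g)
      (f.unop.toOrderHom.monotone (leOfHom g))) _ _ _ _

/-- The functor `h(Ũ(X)) ⟶ U(C)` corresponding to a templicial morphism `X ⟶ N_V(C)`. -/
def homotopyFunctor {X : Templicial V} (θ : X ⟶ C.nerve) :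
    SSet.hoFunctor.obj (underlyingSSet X) ⟶ C.underlyingCat :=
  (nerveAdjunction.homEquiv (underlyingSSet X) C.underlyingCat).symm
    (underlyingSSetMap θ ≫ C.toNerve)

end VCat

section HomotopyCategory

variable {V : Type u} [Category.{v} V] [MonoidalCategory V] [HasColimits V]
    [SymmetricCategory V] [MonoidalClosed V]

/-- The `V`-enriched category with hom-objects `H a b`, for a monoid `H` in quivers. -/
def VCat.ofMonoid {S : Type v} (H : VQuiv V S) [MonObj H] : VCat V where
  Ob := S
  enriched :=
    { Hom := fun a b => H.obj a b
      id := fun a => VQuiv.injUnit rfl ≫ (MonObj.one : 𝟙_ _ ⟶ H).app a a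
      comp := fun a b c => VQuiv.inj H H a b c ≫ (MonObj.mul : H ⊗ H ⟶ H).app a c
      id_comp := fun a b => by
        have h := congrArg (fun z => (λ_ (H a b)).inv ≫ VQuiv.injUnit rfl ▷ H a b ≫
          VQuiv.inj _ H a a b ≫ z.app a b) (MonObj.one_mul H)
        simp only [VQuiv.comp_app, VQuiv.inj_whiskerRight_assoc, VQuiv.inj_leftUnitor_hom,
          Iso.inv_hom_id] at h
        rw [comp_whiskerRight_assoc]
        exact h
      comp_id := fun a b => by
        have h := congrArg (fun z => (ρ_ (H a b)).inv ≫ H a b ◁ VQuiv.injUnit rfl ≫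
          VQuiv.inj H _ a b b ≫ z.app a b) (MonObj.mul_one H)
        simp only [VQuiv.comp_app, VQuiv.inj_whiskerLeft_assoc, VQuiv.inj_rightUnitor_hom,
          Iso.inv_hom_id] at h
        rw [MonoidalCategory.whiskerLeft_comp_assoc]
        exact h
      assoc := fun a b c d => by
        have h := congrArg (fun z => (α_ (H a b) (H b c) (H c d)).inv ≫
          VQuiv.inj H H a b c ▷ H c d ≫ VQuiv.inj (H ⊗ H) H a c d ≫ z.app a d)
          (MonObj.mul_assoc H)
        simp only [VQuiv.comp_app, VQuiv.inj_whiskerRight_assoc, VQuiv.inj_associator_hom_assoc,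
          VQuiv.inj_whiskerLeft_assoc, Iso.inv_hom_id_assoc] at h
        rw [comp_whiskerRight_assoc, MonoidalCategory.whiskerLeft_comp_assoc]
        exact h }

namespace Templicial

variable (X : Templicial V)

/-- The degenerate edges `s₀ : I ⟶ X_1`. -/
def unitEdge : 𝟙_ (VQuiv V X.Ob) ⟶ X.lvl 1 := X.counitInv ≫ X.restr SSetAux.s₀

/-- The map `- ⊗ s₀ : X_1 ⟶ X_1 ⊗ X_1`. -/
def tensorUnitEdge : X.lvl 1 ⟶ X.lvl 1 ⊗ X.lvl 1 :=
  (ρ_ (X.lvl 1)).inv ≫ X.lvl 1 ◁ X.unitEdge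

variable [HasLimits V]

/-- The object of `1`-simplices of the left-pinched morphism space of `X`. -/
def pinched (a b : X.Ob) : V :=
  Limits.pullback (X.tensorUnitEdge.app a b) ((X.comul 1 1).app a b)

/-- The face map `d₁ = π₁`. -/
def pinchedFaceOne (a b : X.Ob) : X.pinched a b ⟶ (X.lvl 1).obj a b :=
  pullback.fst (X.tensorUnitEdge.app a b) ((X.comul 1 1).app a b)

/-- The face map `d₀ = d₁ π₂`. -/
def pinchedFaceZero (a b : X.Ob) : X.pinched a b ⟶ (X.lvl 1).obj a b :=
  pullback.snd (X.tensorUnitEdge.app a b) ((X.comul 1 1).app a b) ≫ (X.restr SSetAux.d₁).app a b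

/-- The quiver `h'X`: the coequaliser of the left-pinched `1`-simplices of `X`. -/
def homQuiver : VQuiv V X.Ob :=
  ⟨fun a b => coequalizer (X.pinchedFaceZero a b) (X.pinchedFaceOne a b)⟩

/-- The canonical morphism `q : X_1 ⟶ h'X`. -/
def homProj : X.lvl 1 ⟶ X.homQuiver :=
  ⟨fun a b => coequalizer.π (X.pinchedFaceZero a b) (X.pinchedFaceOne a b)⟩

/-- The unit `I ⟶ X_1 ⟶ h'X`. -/
def homUnit : 𝟙_ (VQuiv V X.Ob) ⟶ X.homQuiver := X.unitEdge ≫ X.homProj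

/-- A quiver morphism `m : h'X ⊗ h'X ⟶ h'X` is induced by the composition of `X` if
`m (q ⊗ q) μ_{1,1} = q d₁`. -/
def IsInducedComposition (m : X.homQuiver ⊗ X.homQuiver ⟶ X.homQuiver) : Prop :=
  X.comul 1 1 ≫ (X.homProj ⊗ₘ X.homProj) ≫ m = X.restr SSetAux.d₁ ≫ X.homProj

/-- The structure of a `V`-enriched category on `h'X` with the unit `q s₀`, whose composition is
induced by `X`. -/
structure HomotopyComposition where
  /-- the composition law -/
  mult : X.homQuiver ⊗ X.homQuiver ⟶ X.homQuiver
  induced : X.IsInducedComposition mult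
  unit_mult : X.homUnit ▷ X.homQuiver ≫ mult = (λ_ X.homQuiver).hom
  mult_unit : X.homQuiver ◁ X.homUnit ≫ mult = (ρ_ X.homQuiver).hom
  mult_assoc : mult ▷ X.homQuiver ≫ mult =
    (α_ X.homQuiver X.homQuiver X.homQuiver).hom ≫ X.homQuiver ◁ mult ≫ mult

variable {X}

/-- The `V`-enriched category `h'X`. -/
def HomotopyComposition.toVCat (E : X.HomotopyComposition) : VCat V :=
  @VCat.ofMonoid V _ _ _ _ _ X.Ob X.homQuiver
    { one := X.homUnit
      mul := E.mult
      one_mul := E.unit_mult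
      mul_one := E.mult_unit
      mul_assoc := E.mult_assoc }

/-- A templicial morphism `X ⟶ N(h'X)` extends `q` if it is the identity on vertices and if its
component `X_1 ⟶ h'X` is `q`. -/
def HomotopyComposition.Extends (E : X.HomotopyComposition) (θ : X ⟶ E.toVCat.nerve) : Prop :=
  ∃ h : ∀ a : X.Ob, Hom.base θ a = a, ∀ a b : X.Ob,
    Hom.component θ 1 a b ≫ E.toVCat.lvlOne.app (Hom.base θ a) (Hom.base θ b) ≫
        eqToHom (congrArg₂ X.homQuiver.obj (h a) (h b)) =
      X.homProj.app a b

end Templicial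

/-- The full subcategory of `Templicial V` on the quasi-categories in `V`. -/
abbrev QCat (V : Type u) [Category.{v} V] [MonoidalCategory V] [HasColimits V]
    [SymmetricCategory V] [MonoidalClosed V] : Type (max u (v + 1)) :=
  ObjectProperty.FullSubcategory (fun X : Templicial V => X.IsQuasiCategory)

/-- The templicial nerve, as a functor to quasi-categories in `V`. -/
def quasiNerve (hN : ∀ C : VCat V, C.nerve.IsQuasiCategory) : VCat V ⥤ QCat V :=
  ObjectProperty.lift _ (templicialNerve V) hN

/-- A `V`-enriched category `C` with a templicial morphism `θ : X ⟶ N(C)` is the homotopy category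
`h_V X` of `X`, i.e. the value at `X` of the left adjoint of the templicial nerve with the unit
`θ`, if every templicial morphism `X ⟶ N(D)` factors uniquely through `θ`. -/
def IsHomotopyCategory {X : Templicial V} {C : VCat V} (θ : X ⟶ (templicialNerve V).obj C) :
    Prop :=
  ∀ (D : VCat V) (f : X ⟶ (templicialNerve V).obj D),
    ∃! g : C ⟶ D, θ ≫ (templicialNerve V).map g = f

end HomotopyCategory

end

end

noncomputable section

set_option linter.unusedSectionVars false

/-! An element of an object `A` of `V` is a morphism `𝟙_ V ⟶ A`. The hypotheses on `U` make it
possible to chase elements in `V`. Equations are checked on elements (`el_ext`, faithfulness). A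
morphism that is surjective on elements is the coequaliser of its kernel pair
(`ElSurjective.isCoeq`, reflection), and a reflexive coequaliser is surjective on elements
(`IsCoeq.elSurjective`, preservation). As `V` is closed, tensoring preserves coequalisers, so
surjectivity on elements survives tensoring with a quiver (`ElSurjective.quiver_whiskerLeft`,
`ElSurjective.quiver_whiskerRight`). This matters because an element of `(X_1 ⊗ X_1)(a,b)` need not
be a pair of composable edges.

To build `h'X`, only two inner horns have to be filled. The necklaces in a horn factor through a few
maximal ones, so compatible elements on these suffice for a filler
(`IsQuasiCategory.exists_filler`). Filling `Λ^2_1` says that `μ_{1,1}` is surjective on elements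
(`IsQuasiCategory.comul_elSurjective`). Filling `Λ^3_1` produces the face 023 of a tetrahedron from
its other faces, where 012 and 123 enter as elements of `X_2 ⊗ X_1` and `X_1 ⊗ X_2`
(`IsQuasiCategory.exists_face`). A necklace map is encoded by a way of cutting its source; the
independence of this choice (`necklaceMap_congr`) and closure under composition (`exists_comp`) make
such gluing possible.

The classical argument for quasi-categories now applies. Tetrahedra with a degenerate edge or
triangle show that the class of `d₁ σ` depends only on `μ σ`, and then only on the classes of its
two factors (`IsQuasiCategory.homProj_congr_comul`, `IsQuasiCategory.homProj_congr_right`,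
`IsQuasiCategory.homProj_congr_left`). Since `μ_{1,1}` and `q` are coequalisers, `q d₁` descends to
a composition on `h'X`; degenerate triangles give the unit laws and a general tetrahedron gives
associativity.

Morphisms of finite intervals are generated by `[1] ⟶ [0]` and `[1] ⟶ [2]` under composition and
gluing (`FInt.hom_induction`). Hence a templicial morphism `X ⟶ N(C)` amounts to a map on vertices
and a map on edges that respects `s₀` and `d₁` (`homToNerve`, `hom_nerve_ext`). Such a map on edges
coequalises the pair defining `q`, and the induced map on `h'X` is a functor because `μ_{1,1}` and
`q ⊗ q` are epimorphisms, so `η` is universal. In a nerve all comultiplications are invertible, so a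
simplex is the same as an element on its spine; this yields the horn fillers
(`VCat.nerve_isQuasiCategory`). The universal arrows then assemble formally into the left adjoint.

For the comparison with `h Ũ(X)`: the vertices of `Ũ(X)` are those of `X`, its edges are elements of
`X_1`, and its triangles are elements `σ` of `X_2` together with edges `e`, `e'` such that `μ σ = e
⊗ e'`. Composable edges have a composite, so every morphism of `h Ũ(X)` is the class of one edge. As
`U` preserves the reflexive coequaliser `q`, the elements of `h'X(a,b)` are the elements of
`X_1(a,b)` modulo the relation generated by triangles with degenerate last edge, and these triangles
belong to `Ũ(X)`. So the comparison functor is bijective on objects, full and faithful. -/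

/-- `q` is a coequaliser of `k₁` and `k₂`. -/
structure IsCoeq {C : Type*} [Category C] {A B Q : C} (k₁ k₂ : A ⟶ B) (q : B ⟶ Q) : Prop where
  w : k₁ ≫ q = k₂ ≫ q
  exists_desc : ∀ {Z : C} (g : B ⟶ Z), k₁ ≫ g = k₂ ≫ g → ∃ h : Q ⟶ Z, q ≫ h = g
  epi : Epi q

/-! ### Coequalisers of reflexive pairs, and their behaviour under functors and tensoring -/

namespace IsCoeq

section

variable {C : Type*} [Category C] {A B Q : C} {k₁ k₂ : A ⟶ B}

theorem of_isColimit {c : Cofork k₁ k₂} (h : IsColimit c) : IsCoeq k₁ k₂ c.π where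
  w := c.condition
  exists_desc g hg := ⟨Cofork.IsColimit.desc h g hg, Cofork.IsColimit.π_desc' h g hg⟩
  epi := ⟨fun _ _ e => Cofork.IsColimit.hom_ext h e⟩

theorem isColimit {c : Cofork k₁ k₂} (h : IsCoeq k₁ k₂ c.π) : Nonempty (IsColimit c) :=
  ⟨Cofork.IsColimit.mk c (fun s => (h.exists_desc s.π s.condition).choose)
    (fun s => (h.exists_desc s.π s.condition).choose_spec)
    (fun s m hm => by
      have := h.epi
      rw [← cancel_epi c.π, hm, (h.exists_desc s.π s.condition).choose_spec])⟩

theorem coequalizer (k₁ k₂ : A ⟶ B) [HasCoequalizer k₁ k₂] :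
    IsCoeq k₁ k₂ (coequalizer.π k₁ k₂) :=
  of_isColimit (c := Cofork.ofπ (coequalizer.π k₁ k₂) (coequalizer.condition k₁ k₂))
    (coequalizerIsCoequalizer k₁ k₂)

variable {D : Type*} [Category D] (G : C ⥤ D)

/-- A common section of the pair imposes no condition on a cofork, so a coequaliser is also a
colimit over the walking reflexive pair; the preservation of colimits of that shape then applies. -/
theorem map [PreservesColimitsOfShape WalkingReflexivePair G] {q : B ⟶ Q} (h : IsCoeq k₁ k₂ q)
    (s : B ⟶ A) (h₁ : s ≫ k₁ = 𝟙 B) (h₂ : s ≫ k₂ = 𝟙 B) :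
    IsCoeq (G.map k₁) (G.map k₂) (G.map q) := by
  let R : ReflexiveCofork (reflexivePair k₁ k₂ s h₁ h₂) := ReflexiveCofork.mk q h.w
  obtain ⟨hR⟩ : Nonempty (IsColimit R.toCofork) := IsCoeq.isColimit (c := R.toCofork) h
  have hG := isColimitOfPreserves G (ReflexiveCofork.isColimitEquiv _ R hR)
  let R' : ReflexiveCofork (reflexivePair k₁ k₂ s h₁ h₂ ⋙ G) := G.mapCocone R
  exact of_isColimit ((ReflexiveCofork.isColimitEquiv _ R').symm hG)

/-- The equation `w` is needed separately: there must be a cofork in `C` before its universal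
property can be reflected. -/
theorem of_map [ReflectsColimitsOfShape WalkingReflexivePair G] {q : B ⟶ Q}
    (w : k₁ ≫ q = k₂ ≫ q) (h : IsCoeq (G.map k₁) (G.map k₂) (G.map q)) (s : B ⟶ A)
    (h₁ : s ≫ k₁ = 𝟙 B) (h₂ : s ≫ k₂ = 𝟙 B) : IsCoeq k₁ k₂ q := by
  let R : ReflexiveCofork (reflexivePair k₁ k₂ s h₁ h₂) := ReflexiveCofork.mk q w
  let R' : ReflexiveCofork (reflexivePair k₁ k₂ s h₁ h₂ ⋙ G) := G.mapCocone R
  obtain ⟨hR⟩ : Nonempty (IsColimit R'.toCofork) := IsCoeq.isColimit (c := R'.toCofork) h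
  have hG : IsColimit R := isColimitOfReflects G (ReflexiveCofork.isColimitEquiv _ R' hR)
  exact of_isColimit ((ReflexiveCofork.isColimitEquiv _ R).symm hG)

end

section

variable {V : Type u} [Category.{v} V] [MonoidalCategory V] [SymmetricCategory V]
  [MonoidalClosed V] {A B Q : V} {k₁ k₂ : A ⟶ B} {q : B ⟶ Q}

/-- By closedness `X ⊗ -` is a left adjoint; the universal property is transposed by currying. The
version on the other side follows by the symmetry. -/
theorem whiskerLeft (h : IsCoeq k₁ k₂ q) (X : V) : IsCoeq (X ◁ k₁) (X ◁ k₂) (X ◁ q) where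
  w := by rw [← MonoidalCategory.whiskerLeft_comp, h.w, MonoidalCategory.whiskerLeft_comp]
  exists_desc {Z} g hg := by
    obtain ⟨k, hk⟩ := h.exists_desc (MonoidalClosed.curry g) (by
      rw [← MonoidalClosed.curry_natural_left, hg, MonoidalClosed.curry_natural_left])
    refine ⟨MonoidalClosed.uncurry k, ?_⟩
    rw [← MonoidalClosed.uncurry_natural_left, hk, MonoidalClosed.uncurry_curry]
  epi := ⟨fun f g e => by
    have := h.epi
    apply MonoidalClosed.curry_injective
    rw [← cancel_epi q, ← MonoidalClosed.curry_natural_left, e,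
      MonoidalClosed.curry_natural_left]⟩

theorem whiskerRight (h : IsCoeq k₁ k₂ q) (X : V) : IsCoeq (k₁ ▷ X) (k₂ ▷ X) (q ▷ X) where
  w := by rw [← comp_whiskerRight, h.w, comp_whiskerRight]
  exists_desc {Z} g hg := by
    obtain ⟨k, hk⟩ := (h.whiskerLeft X).exists_desc ((β_ X B).hom ≫ g) (by
      simp [hg])
    exact ⟨(β_ Q X).hom ≫ k, by
      rw [BraidedCategory.braiding_naturality_left_assoc, hk,
        SymmetricCategory.symmetry_assoc]⟩
  epi := ⟨fun f g e => by
    have := (h.whiskerLeft X).epi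
    rw [← cancel_epi (β_ X Q).hom, ← cancel_epi (X ◁ q)]
    simp [e]⟩

end

end IsCoeq

/-! ### Tensoring with a quiver preserves coequalisers -/

namespace VQuiv

variable {V : Type u} [Category.{v} V] [MonoidalCategory V] [HasColimits V]
  [SymmetricCategory V] [MonoidalClosed V] {S : Type v} {H P Q : VQuiv V S}

/-- The hom-object at `(a, b)` is a coproduct over the middle vertex of coequalisers tensored with a
fixed object, and coproducts of coequalisers are coequalisers. -/
theorem isCoeq_whiskerLeft {k₁ k₂ : H ⟶ P} {q : P ⟶ Q}
    (h : ∀ a b, IsCoeq (k₁.app a b) (k₂.app a b) (q.app a b)) (R : VQuiv V S) (a b : S) :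
    IsCoeq ((R ◁ k₁).app a b) ((R ◁ k₂).app a b) ((R ◁ q).app a b) where
  w := by
    refine tensorObj_ext fun c => ?_
    simp only [inj_whiskerLeft_assoc, inj_whiskerLeft]
    rw [← MonoidalCategory.whiskerLeft_comp_assoc, (h c b).w,
      MonoidalCategory.whiskerLeft_comp_assoc]
  exists_desc {Z} g hg := by
    have := fun c => ((h c b).whiskerLeft (R a c)).exists_desc (inj R P a c b ≫ g) (by
      have := congrArg (inj R H a c b ≫ ·) hg
      simpa using this)
    choose k hk using this
    refine ⟨descT k, tensorObj_ext fun c => ?_⟩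
    simp [hk]
  epi := ⟨fun f g e => tensorObj_ext fun c => by
    have := ((h c b).whiskerLeft (R a c)).epi
    rw [← cancel_epi (R a c ◁ q.app c b)]
    have := congrArg (inj R P a c b ≫ ·) e
    simpa using this⟩

theorem isCoeq_whiskerRight {k₁ k₂ : H ⟶ P} {q : P ⟶ Q}
    (h : ∀ a b, IsCoeq (k₁.app a b) (k₂.app a b) (q.app a b)) (R : VQuiv V S) (a b : S) :
    IsCoeq ((k₁ ▷ R).app a b) ((k₂ ▷ R).app a b) ((q ▷ R).app a b) where
  w := by
    refine tensorObj_ext fun c => ?_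
    simp only [inj_whiskerRight_assoc, inj_whiskerRight]
    rw [← MonoidalCategory.comp_whiskerRight_assoc, (h a c).w,
      MonoidalCategory.comp_whiskerRight_assoc]
  exists_desc {Z} g hg := by
    have := fun c => ((h a c).whiskerRight (R c b)).exists_desc (inj P R a c b ≫ g) (by
      have := congrArg (inj H R a c b ≫ ·) hg
      simpa using this)
    choose k hk using this
    refine ⟨descT k, tensorObj_ext fun c => ?_⟩
    simp [hk]
  epi := ⟨fun f g e => tensorObj_ext fun c => by
    have := ((h a c).whiskerRight (R c b)).epi
    rw [← cancel_epi (q.app a c ▷ R c b)]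
    have := congrArg (inj P R a c b ≫ ·) e
    simpa using this⟩

end VQuiv

/-! ### Elements of objects and morphisms that are surjective on elements -/

section Elements

variable {V : Type u} [Category.{v} V] [MonoidalCategory V]

/-- A morphism `f : A ⟶ B` such that `U(f)` is surjective. -/
def ElSurjective {A B : V} (f : A ⟶ B) : Prop := ∀ y : 𝟙_ V ⟶ B, ∃ x : 𝟙_ V ⟶ A, x ≫ f = y

theorem el_ext (hfaithful : (underlying V).Faithful) {A B : V} {f g : A ⟶ B}
    (h : ∀ x : 𝟙_ V ⟶ A, x ≫ f = x ≫ g) : f = g :=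
  (underlying V).map_injective (by ext x; exact h x)

/-- `U` turns `q` into a coequaliser in the category of sets, in particular an epimorphism, and
epimorphisms of sets are surjective. -/
theorem IsCoeq.elSurjective [PreservesColimitsOfShape WalkingReflexivePair (underlying V)]
    {A B Q : V} {k₁ k₂ : A ⟶ B} {q : B ⟶ Q} (h : IsCoeq k₁ k₂ q)
    (s : B ⟶ A) (h₁ : s ≫ k₁ = 𝟙 B) (h₂ : s ≫ k₂ = 𝟙 B) : ElSurjective q := by
  have h' := (h.map (underlying V) s h₁ h₂).epi
  exact (CategoryTheory.epi_iff_surjective _).1 h'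

/-- A function on the elements of `B` which coequalises the elements of a reflexive pair is
determined by the classes in the coequaliser. -/
theorem IsCoeq.el_congr [PreservesColimitsOfShape WalkingReflexivePair (underlying V)]
    {A B Q : V} {k₁ k₂ : A ⟶ B} {q : B ⟶ Q} (h : IsCoeq k₁ k₂ q)
    (s : B ⟶ A) (h₁ : s ≫ k₁ = 𝟙 B) (h₂ : s ≫ k₂ = 𝟙 B) {Z : Type v} (g : (𝟙_ V ⟶ B) → Z)
    (hg : ∀ x : 𝟙_ V ⟶ A, g (x ≫ k₁) = g (x ≫ k₂)) {x y : 𝟙_ V ⟶ B} (hxy : x ≫ q = y ≫ q) :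
    g x = g y := by
  -- As `U(q)` is the coequaliser in the category of sets, the function `g` factors through it.
  obtain ⟨k, hk⟩ := (h.map (underlying V) s h₁ h₂).exists_desc (Z := Z) (↾g) (by
    ext x; exact hg x)
  have h1 := fun z : 𝟙_ V ⟶ B => ConcreteCategory.congr_hom hk z
  exact (h1 x).symm.trans ((congrArg k hxy).trans (h1 y))

/-- An element of the kernel pair is a pair of elements of `A` with the same image, and a surjection
of sets is the coequaliser of its kernel pair. The diagonal makes the kernel pair reflexive, so `U`
reflects this. -/
theorem ElSurjective.isCoeq [HasPullbacks V]
    [ReflectsColimitsOfShape WalkingReflexivePair (underlying V)]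
    {A B : V} {f : A ⟶ B} (hf : ElSurjective f) :
    IsCoeq (pullback.fst f f) (pullback.snd f f) f := by
  refine IsCoeq.of_map (underlying V) pullback.condition ?_ (pullback.lift (𝟙 A) (𝟙 A) rfl)
    (pullback.lift_fst _ _ _) (pullback.lift_snd _ _ _)
  refine ⟨by rw [← Functor.map_comp, pullback.condition, Functor.map_comp], fun {Z} g hg => ?_,
    (CategoryTheory.epi_iff_surjective _).2 hf⟩
  -- The function induced on the quotient evaluates `g` at a chosen preimage; the pair formed by the
  -- chosen preimage of the image of `x` and `x` itself lies in the kernel pair, so the choice does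
  -- not matter.
  choose r hr using hf
  refine ⟨↾fun y => g (r y), ?_⟩
  ext x
  have h1 := ConcreteCategory.congr_hom hg
    (pullback.lift (r (x ≫ f)) x (hr _) : 𝟙_ V ⟶ pullback f f)
  have h2 : (pullback.lift (r (x ≫ f)) x (hr _) : 𝟙_ V ⟶ pullback f f) ≫ pullback.fst f f =
    r (x ≫ f) := pullback.lift_fst _ _ _
  have h3 : (pullback.lift (r (x ≫ f)) x (hr _) : 𝟙_ V ⟶ pullback f f) ≫ pullback.snd f f =
    x := pullback.lift_snd _ _ _
  exact (congrArg g h2).symm.trans (h1.trans (congrArg g h3))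

theorem ElSurjective.epi (hfaithful : (underlying V).Faithful) {A B : V} {f : A ⟶ B}
    (hf : ElSurjective f) : Epi f :=
  ⟨fun g h e => el_ext hfaithful fun y => by
    obtain ⟨x, rfl⟩ := hf y
    simp only [Category.assoc, e]⟩

variable [HasColimits V] [SymmetricCategory V] [MonoidalClosed V] {S : Type v} {P Q : VQuiv V S}

/-- The kernel pair of a morphism of quivers. -/
def VQuiv.kernelPair [HasPullbacks V] (φ : P ⟶ Q) : VQuiv V S :=
  ⟨fun a b => Limits.pullback (φ.app a b) (φ.app a b)⟩

/-- The first projection of the kernel pair of a morphism of quivers. -/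
def VQuiv.kernelFst [HasPullbacks V] (φ : P ⟶ Q) : VQuiv.kernelPair φ ⟶ P :=
  ⟨fun a b => pullback.fst (φ.app a b) (φ.app a b)⟩

/-- The second projection of the kernel pair of a morphism of quivers. -/
def VQuiv.kernelSnd [HasPullbacks V] (φ : P ⟶ Q) : VQuiv.kernelPair φ ⟶ P :=
  ⟨fun a b => pullback.snd (φ.app a b) (φ.app a b)⟩

/-- The diagonal of the kernel pair of a morphism of quivers. -/
def VQuiv.kernelDiag [HasPullbacks V] (φ : P ⟶ Q) : P ⟶ VQuiv.kernelPair φ :=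
  ⟨fun a b => pullback.lift (𝟙 (P a b)) (𝟙 (P a b)) rfl⟩

theorem VQuiv.kernelDiag_fst [HasPullbacks V] (φ : P ⟶ Q) :
    kernelDiag φ ≫ kernelFst φ = 𝟙 P := by
  ext a b
  exact pullback.lift_fst _ _ _

theorem VQuiv.kernelDiag_snd [HasPullbacks V] (φ : P ⟶ Q) :
    kernelDiag φ ≫ kernelSnd φ = 𝟙 P := by
  ext a b
  exact pullback.lift_snd _ _ _

variable [HasPullbacks V] [PreservesColimitsOfShape WalkingReflexivePair (underlying V)]
    [ReflectsColimitsOfShape WalkingReflexivePair (underlying V)]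

/-- Surjectivity is turned into a coequaliser, which tensoring preserves, and is recovered from the
tensored coequaliser. The tensored diagonal keeps the pair reflexive, although it need no longer be
a kernel pair. -/
theorem ElSurjective.quiver_whiskerLeft {φ : P ⟶ Q} (hφ : ∀ a b, ElSurjective (φ.app a b))
    (R : VQuiv V S) (a b : S) : ElSurjective ((R ◁ φ).app a b) := by
  have h := VQuiv.isCoeq_whiskerLeft (k₁ := VQuiv.kernelFst φ) (k₂ := VQuiv.kernelSnd φ) (q := φ)
    (fun a b => (hφ a b).isCoeq) R a b
  refine h.elSurjective ((R ◁ VQuiv.kernelDiag φ).app a b) ?_ ?_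
  · rw [← VQuiv.comp_app, ← MonoidalCategory.whiskerLeft_comp, VQuiv.kernelDiag_fst,
      MonoidalCategory.whiskerLeft_id, VQuiv.id_app]
  · rw [← VQuiv.comp_app, ← MonoidalCategory.whiskerLeft_comp, VQuiv.kernelDiag_snd,
      MonoidalCategory.whiskerLeft_id, VQuiv.id_app]

theorem ElSurjective.quiver_whiskerRight {φ : P ⟶ Q} (hφ : ∀ a b, ElSurjective (φ.app a b))
    (R : VQuiv V S) (a b : S) : ElSurjective ((φ ▷ R).app a b) := by
  have h := VQuiv.isCoeq_whiskerRight (k₁ := VQuiv.kernelFst φ) (k₂ := VQuiv.kernelSnd φ) (q := φ)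
    (fun a b => (hφ a b).isCoeq) R a b
  refine h.elSurjective ((VQuiv.kernelDiag φ ▷ R).app a b) ?_ ?_
  · rw [← VQuiv.comp_app, ← MonoidalCategory.comp_whiskerRight, VQuiv.kernelDiag_fst,
      MonoidalCategory.id_whiskerRight, VQuiv.id_app]
  · rw [← VQuiv.comp_app, ← MonoidalCategory.comp_whiskerRight, VQuiv.kernelDiag_snd,
      MonoidalCategory.id_whiskerRight, VQuiv.id_app]

end Elements

/-! ### Generators of the category of finite intervals -/

namespace FInt

/-- A morphism which respects a decomposition of its source and target is a tensor product. -/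
theorem exists_tensorHom {m n k l : FInt} (f : m ⊗ n ⟶ k ⊗ l) (h : val f m.len = k.len) :
    ∃ (f₁ : m ⟶ k) (f₂ : n ⟶ l), f = f₁ ⊗ₘ f₂ := by
  have hl : val f (m.len + n.len) = k.len + l.len := val_of_le f le_rfl
  refine ⟨mk' (val f) (fun i j hij _ => val_mono f hij) (val_zero f) h,
    mk' (fun i => val f (m.len + i) - k.len) (fun i j hij _ => ?_) (by simp [h]) (by simp [hl]), ?_⟩
  · have := val_mono f (show m.len + i ≤ m.len + j by omega)
    omega
  · refine hom_ext fun i hi => ?_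
    rw [len_tensor] at hi
    rw [val_tensorHom _ _ hi]
    split_ifs with hm
    · rw [val_mk' _ _ _ _ hm]
    · rw [val_mk' _ _ _ _ (by omega)]
      have := val_mono f (show m.len ≤ i by omega)
      rw [show m.len + (i - m.len) = i by omega]
      omega

/-- Both vertices of `[1]` are endpoints, so their images are forced. -/
theorem hom_mk_one_ext {n : FInt} (f g : FInt.mk 1 ⟶ n) : f = g := by
  refine hom_ext fun i hi => ?_
  have : i = 0 ∨ i = 1 := by
    have : i ≤ 1 := hi
    omega
  rcases this with rfl | rfl
  · rw [val_zero, val_zero]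
  · rw [val_of_le f le_rfl, val_of_le g le_rfl]

/-- The morphisms of finite intervals are generated under composition and tensor products by
the degeneracy `[1] ⟶ [0]` and the inner face `[1] ⟶ [2]`. -/
theorem hom_induction {P : ∀ {m n : FInt}, (m ⟶ n) → Prop} (id : ∀ m, P (𝟙 m))
    (comp : ∀ {m n k : FInt} (f : m ⟶ n) (g : n ⟶ k), P f → P g → P (f ≫ g))
    (tensor : ∀ {m n m' n' : FInt} (f : m ⟶ m') (g : n ⟶ n'), P f → P g → P (f ⊗ₘ g))
    (hs : P SSetAux.s₀) (hd : P SSetAux.d₁) {m n : FInt} (f : m ⟶ n) : P f := by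
  have h1 : ∀ (s : ℕ) (f : FInt.mk 1 ⟶ FInt.mk s), P f := by
    intro s
    induction s with
    | zero =>
      intro f
      rw [hom_mk_one_ext f SSetAux.s₀]
      exact hs
    | succ s ih =>
      intro f
      obtain rfl | hs' := Nat.eq_zero_or_pos s
      · rw [hom_mk_one_ext f (𝟙 _)]
        exact id _
      -- The long edge of `[s + 1]` is obtained by subdividing once and mapping the first half onto
      -- the long edge of `[s]`.
      · let g : FInt.mk 1 ⟶ FInt.mk s := mk' (fun i => i * s)
          (fun i j h _ => Nat.mul_le_mul_right s h) (by simp) (by simp)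
        have : f = SSetAux.d₁ ≫ (g ⊗ₘ 𝟙 (FInt.mk 1) : FInt.mk 1 ⊗ FInt.mk 1 ⟶ _) :=
          hom_mk_one_ext _ _
        rw [this]
        exact comp _ _ hd (tensor _ _ (ih g) (id _))
  obtain ⟨m⟩ := m
  induction m generalizing n with
  | zero =>
    obtain ⟨n⟩ := n
    have h0 : n = 0 := by
      have h := val_of_le f (le_refl 0)
      rw [val_zero] at h
      exact h.symm
    subst h0
    have : f = 𝟙 _ := hom_ext fun i hi => by
      have : i = 0 := Nat.le_zero.1 hi
      subst this
      rw [val_zero, val_zero]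
    rw [this]
    exact id _
  | succ m ih =>
    obtain ⟨n⟩ := n
    -- Cut the source as `[m] ⊗ [1]` and the target at the image of the vertex `m`. In `key` that
    -- image is a variable `k`, so that the target is literally `[k] ⊗ [s]` after substitution.
    obtain ⟨s, hs⟩ := Nat.exists_eq_add_of_le (val_le f m)
    have key : ∀ (k : ℕ), n = k + s → val f m = k → P f := by
      intro k hk hkf
      subst hk
      obtain ⟨f₁, f₂, hf⟩ := exists_tensorHom (m := FInt.mk m) (n := FInt.mk 1) (k := FInt.mk k)
        (l := FInt.mk s) f hkf
      rw [hf]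
      exact tensor _ _ (ih f₁) (h1 s f₂)
    exact key _ hs rfl

end FInt

/-! ### Families of maps from a colax functor to the tensor powers of a monoid -/

namespace MonNerve

section

variable {W : Type*} [Category W] [MonoidalCategory W] {W' : Type*} [Category W']
  [MonoidalCategory W'] (L : W' ⥤ W) [L.LaxMonoidal] (F : FIntᵒᵖ ⥤ W) [F.OplaxMonoidal] {M : W'}

/-- The family of maps `F_n ⟶ L(M ^ n)` which is determined by the map `g` for `n = 1` and by
compatibility with the comultiplications. -/
def toNerve (g : F.obj (op ⟨1⟩) ⟶ L.obj M) : ∀ n : ℕ, F.obj (op ⟨n⟩) ⟶ L.obj (pow M n)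
  | 0 => show F.obj (𝟙_ FIntᵒᵖ) ⟶ L.obj (𝟙_ W') from
      Functor.OplaxMonoidal.η F ≫ Functor.LaxMonoidal.ε L
  | n + 1 => show F.obj (op ⟨n⟩ ⊗ op ⟨1⟩) ⟶ L.obj (pow M n ⊗ M) from
      Functor.OplaxMonoidal.δ F (op ⟨n⟩) (op ⟨1⟩) ≫ (toNerve g n ⊗ₘ g) ≫
        Functor.LaxMonoidal.μ L (pow M n) M

/-- As `n + 0` is `n` by definition, the right unitor of `[n]` is an identity and drops out of the
unitality axiom. -/
theorem oplax_right_unitality' (n : ℕ) :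
    Functor.OplaxMonoidal.δ F (op ⟨n⟩) (𝟙_ FIntᵒᵖ) ≫ F.obj (op ⟨n⟩) ◁ Functor.OplaxMonoidal.η F =
      (ρ_ (F.obj (op ⟨n⟩))).inv := by
  have h := Functor.OplaxMonoidal.right_unitality F (op (FInt.mk n))
  have h' : F.map (ρ_ (op (FInt.mk n))).inv = 𝟙 _ := F.map_id _
  rw [h'] at h
  exact (h.trans (Category.id_comp _)).symm

/-- This is the inductive step of `toNerve_comul`: coassociativity on the source against
associativity of the lax structure of `L`. The objects are variables because those in the
application are identified only by unfolding definitions. -/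
theorem toNerve_comul_aux {x a b b₁ ab e : W} {a' b' e' ab' : W'} (δ₁ : x ⟶ a ⊗ b₁)
    (δ₂ : b₁ ⟶ b ⊗ e) (δ₃ : x ⟶ ab ⊗ e) (δ₄ : ab ⟶ a ⊗ b)
    (h : δ₃ ≫ δ₄ ▷ e ≫ (α_ a b e).hom = δ₁ ≫ a ◁ δ₂) (θa : a ⟶ L.obj a') (θb : b ⟶ L.obj b')
    (g : e ⟶ L.obj e') (θab : ab ⟶ L.obj ab') (p : ab' ⟶ a' ⊗ b')
    (ih : δ₄ ≫ (θa ⊗ₘ θb) ≫ Functor.LaxMonoidal.μ L a' b' = θab ≫ L.map p) :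
    δ₁ ≫ (θa ⊗ₘ (δ₂ ≫ (θb ⊗ₘ g) ≫ Functor.LaxMonoidal.μ L b' e')) ≫
        Functor.LaxMonoidal.μ L a' (b' ⊗ e') =
      (δ₃ ≫ (θab ⊗ₘ g) ≫ Functor.LaxMonoidal.μ L ab' e') ≫ L.map (p ▷ e' ≫ (α_ a' b' e').hom) := by
  have h1 : (δ₄ ≫ (θa ⊗ₘ θb) ≫ Functor.LaxMonoidal.μ L a' b') ⊗ₘ g =
      δ₄ ▷ e ≫ ((θa ⊗ₘ θb) ⊗ₘ g) ≫ Functor.LaxMonoidal.μ L a' b' ▷ L.obj e' := by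
    rw [tensorHom_comp_whiskerRight, whiskerRight_comp_tensorHom]
  have h2 : θa ⊗ₘ (δ₂ ≫ (θb ⊗ₘ g) ≫ Functor.LaxMonoidal.μ L b' e') =
      a ◁ δ₂ ≫ (θa ⊗ₘ (θb ⊗ₘ g)) ≫ L.obj a' ◁ Functor.LaxMonoidal.μ L b' e' := by
    rw [tensorHom_comp_whiskerLeft, whiskerLeft_comp_tensorHom]
  simp only [Functor.map_comp, Category.assoc]
  rw [← Functor.LaxMonoidal.μ_natural_left_assoc, tensorHom_comp_whiskerRight_assoc, ← ih, h1, h2]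
  simp only [Category.assoc, Functor.LaxMonoidal.associativity, associator_naturality_assoc]
  rw [← reassoc_of% h]

theorem toNerve_comul_zero_aux {a i : W} {a' : W'} (δ : a ⟶ a ⊗ i) (η : i ⟶ 𝟙_ W)
    (h : δ ≫ a ◁ η = (ρ_ a).inv) (θ : a ⟶ L.obj a') :
    δ ≫ (θ ⊗ₘ (η ≫ Functor.LaxMonoidal.ε L)) ≫ Functor.LaxMonoidal.μ L a' (𝟙_ W') =
      θ ≫ L.map (ρ_ a').inv := by
  rw [← Functor.LaxMonoidal.right_unitality_inv, rightUnitor_inv_naturality_assoc, ← h,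
    MonoidalCategory.tensorHom_def']
  simp only [MonoidalCategory.whiskerLeft_comp, Category.assoc]
  rw [whisker_exchange_assoc, whisker_exchange_assoc]

/-- Naturality passes to glued morphisms: as `px` is invertible, the square may be compared after
comultiplication, where it becomes the tensor product of the squares for the two pieces. -/
theorem toNerve_naturality_aux {x y a b c d : W} {x' y' a' b' c' d' : W'} {Φ : y ⟶ x}
    {δx : x ⟶ a ⊗ b} {δy : y ⟶ c ⊗ d} {p : c ⟶ a} {q : d ⟶ b} (hδ : Φ ≫ δx = δy ≫ (p ⊗ₘ q))
    {θx : x ⟶ L.obj x'} {θy : y ⟶ L.obj y'} {θa : a ⟶ L.obj a'} {θb : b ⟶ L.obj b'}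
    {θc : c ⟶ L.obj c'} {θd : d ⟶ L.obj d'} {px : x' ⟶ a' ⊗ b'} [IsIso px] {py : y' ⟶ c' ⊗ d'}
    (hx : δx ≫ (θa ⊗ₘ θb) ≫ Functor.LaxMonoidal.μ L a' b' = θx ≫ L.map px)
    (hy : δy ≫ (θc ⊗ₘ θd) ≫ Functor.LaxMonoidal.μ L c' d' = θy ≫ L.map py)
    {p' : c' ⟶ a'} {q' : d' ⟶ b'} (hp : p ≫ θa = θc ≫ L.map p') (hq : q ≫ θb = θd ≫ L.map q')
    {N : y' ⟶ x'} (hN : N ≫ px = py ≫ (p' ⊗ₘ q')) : Φ ≫ θx = θy ≫ L.map N := by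
  rw [← cancel_mono (L.map px), Category.assoc, ← hx, reassoc_of% hδ,
    tensorHom_comp_tensorHom_assoc, hp, hq, Category.assoc, ← Functor.map_comp, hN,
    Functor.map_comp, ← reassoc_of% hy, ← Functor.LaxMonoidal.μ_natural,
    tensorHom_comp_tensorHom_assoc]

theorem eq_toNerve_aux {x a e : W} {a' e' e'' : W'} (δ : x ⟶ a ⊗ e) (θ : a ⟶ L.obj a')
    (g : e ⟶ L.obj e'') (m : e'' ⟶ e') (θx : x ⟶ L.obj (a' ⊗ e')) (p : a' ⊗ e' ⟶ a' ⊗ e'')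
    (h : δ ≫ (θ ⊗ₘ g) ≫ Functor.LaxMonoidal.μ L a' e'' = θx ≫ L.map p) (hp : p ≫ a' ◁ m = 𝟙 _) :
    θx = δ ≫ (θ ⊗ₘ (g ≫ L.map m)) ≫ Functor.LaxMonoidal.μ L a' e' := by
  rw [← tensorHom_comp_whiskerLeft_assoc, Functor.LaxMonoidal.μ_natural_right, reassoc_of% h,
    ← Functor.map_comp, hp, CategoryTheory.Functor.map_id, Category.comp_id]

/-- The family splits off edges at the right end, so induction on `b` needs only right counitality
and coassociativity. -/
theorem toNerve_comul (g : F.obj (op ⟨1⟩) ⟶ L.obj M) (a b : ℕ) :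
    Functor.OplaxMonoidal.δ F (op ⟨a⟩) (op ⟨b⟩) ≫ (toNerve L F g a ⊗ₘ toNerve L F g b) ≫
      Functor.LaxMonoidal.μ L (pow M a) (pow M b) =
        toNerve L F g (a + b) ≫ L.map (powIso M a b).hom := by
  induction b with
  | zero =>
    change Functor.OplaxMonoidal.δ F (op ⟨a⟩) (𝟙_ FIntᵒᵖ) ≫
      (toNerve L F g a ⊗ₘ (Functor.OplaxMonoidal.η F ≫ Functor.LaxMonoidal.ε L)) ≫
      Functor.LaxMonoidal.μ L (pow M a) (𝟙_ W') = toNerve L F g a ≫ L.map (ρ_ (pow M a)).inv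
    exact toNerve_comul_zero_aux L _ _ (oplax_right_unitality' F a) _
  | succ b ih =>
    have hα : F.map (α_ (op (FInt.mk a)) (op (FInt.mk b)) (op (FInt.mk 1))).hom = 𝟙 _ :=
      F.map_id _
    have h := Functor.OplaxMonoidal.associativity F (op (FInt.mk a)) (op (FInt.mk b))
      (op (FInt.mk 1))
    rw [hα] at h
    exact toNerve_comul_aux L _ _ _ _ (h.trans (Category.id_comp _)) _ _ _ _ _ ih

variable [MonObj M]

/-- The first tensor power is `𝟙_ ⊗ M` rather than `M`, so edges of a nerve are identified with `M`
along this isomorphism throughout. -/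
theorem mulN_one : mulN M 1 = (λ_ M).hom := by
  change MonObj.one ▷ M ≫ MonObj.mul = (λ_ M).hom
  exact MonObj.one_mul M

theorem toNerve_one (g : F.obj (op ⟨1⟩) ⟶ L.obj M) :
    toNerve L F g 1 ≫ L.map (mulN M 1) = g := by
  rw [mulN_one]
  change (Functor.OplaxMonoidal.δ F (𝟙_ FIntᵒᵖ) (op ⟨1⟩) ≫
    ((Functor.OplaxMonoidal.η F ≫ Functor.LaxMonoidal.ε L) ⊗ₘ g) ≫
        Functor.LaxMonoidal.μ L (𝟙_ W') M) ≫ L.map (λ_ M).hom = g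
  have h := Functor.OplaxMonoidal.left_unitality F (op (FInt.mk 1))
  have h' : F.map (λ_ (op (FInt.mk 1))).inv = 𝟙 _ := F.map_id _
  rw [h'] at h
  have h := h.trans (Category.id_comp _)
  rw [MonoidalCategory.tensorHom_def]
  simp only [comp_whiskerRight, Category.assoc]
  rw [← whisker_exchange_assoc, ← Functor.LaxMonoidal.left_unitality,
    leftUnitor_naturality]
  have h3 := congrArg (· ≫ (λ_ (F.obj (op (FInt.mk 1)))).hom ≫ g) h
  simp only [Iso.inv_hom_id_assoc] at h3
  exact ((Category.assoc _ _ _).symm.trans h3.symm)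

/-- A family of maps which is compatible with the counits and comultiplications is determined
by its member for `n = 1`. -/
theorem eq_toNerve (θ : ∀ n : ℕ, F.obj (op ⟨n⟩) ⟶ L.obj (pow M n))
    (h0 : θ 0 = Functor.OplaxMonoidal.η F ≫ Functor.LaxMonoidal.ε L)
    (hδ : ∀ n : ℕ, Functor.OplaxMonoidal.δ F (op ⟨n⟩) (op ⟨1⟩) ≫ (θ n ⊗ₘ θ 1) ≫
      Functor.LaxMonoidal.μ L (pow M n) (pow M 1) = θ (n + 1) ≫ L.map (powIso M n 1).hom)
    (n : ℕ) : θ n = toNerve L F (θ 1 ≫ L.map (mulN M 1)) n := by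
  induction n with
  | zero => exact h0
  | succ n ih =>
    have h1 : (powIso M n 1).hom ≫ pow M n ◁ mulN M 1 = 𝟙 _ := by
      rw [mulN_one]
      change ((ρ_ (pow M n)).inv ▷ M ≫ (α_ _ _ _).hom) ≫ pow M n ◁ (λ_ M).hom = 𝟙 (pow M n ⊗ M)
      simp
    refine (eq_toNerve_aux L _ _ _ (mulN M 1) _ _ (hδ n) h1).trans ?_
    rw [ih]
    rfl

/-- A map `g : F_1 ⟶ L(M)` which is compatible with units and multiplications induces a natural
family. -/
theorem toNerve_naturality (g : F.obj (op ⟨1⟩) ⟶ L.obj M)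
    (hs : F.map SSetAux.s₀.op ≫ g = Functor.OplaxMonoidal.η F ≫ Functor.LaxMonoidal.ε L ≫
      L.map MonObj.one)
    (hd : F.map SSetAux.d₁.op ≫ g = Functor.OplaxMonoidal.δ F (op ⟨1⟩) (op ⟨1⟩) ≫ (g ⊗ₘ g) ≫
      Functor.LaxMonoidal.μ L M M ≫ L.map MonObj.mul) {m n : FInt} (f : m ⟶ n) :
    F.map f.op ≫ toNerve L F g m.len = toNerve L F g n.len ≫ L.map (nerveHom M f) := by
  -- In the cases of the two generators the target is the first tensor power, and invertibility lets
  -- the comparison be made in `L.obj M`, where the hypotheses `hs` and `hd` live.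
  have hone : IsIso (L.map (mulN M 1)) := by
    have h : mulN M 1 = ((λ_ M).hom : 𝟙_ W' ⊗ M ⟶ M) := mulN_one
    rw [h]
    exact Functor.map_isIso L ((λ_ M).hom : 𝟙_ W' ⊗ M ⟶ M)
  refine FInt.hom_induction (P := fun {m n} f => F.map f.op ≫ toNerve L F g m.len =
    toNerve L F g n.len ≫ L.map (nerveHom M f)) ?_ ?_ ?_ ?_ ?_ f
  · intro m
    have h1 : nerveHom M (𝟙 m) = 𝟙 _ := (nerveFunctor M).map_id (op m)
    rw [h1, op_id]
    exact ((congrArg (· ≫ _) (F.map_id _)).trans (Category.id_comp _)).trans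
      ((congrArg (_ ≫ ·) (L.map_id _)).trans (Category.comp_id _)).symm
  · intro m n k f g' hf hg
    rw [nerveHom_comp, op_comp, Functor.map_comp, Functor.map_comp, Category.assoc, hf,
      ← Category.assoc, hg, Category.assoc]
  · intro m n m' n' f f' hf hf'
    exact toNerve_naturality_aux L (Functor.OplaxMonoidal.δ_natural F f.op f'.op).symm
      (toNerve_comul L F g m.len n.len) (toNerve_comul L F g m'.len n'.len) hf hf'
      (nerveHom_tensor M f f')
  · rw [← cancel_mono (L.map (mulN M 1))]
    refine (Category.assoc _ _ _).trans ((congrArg (_ ≫ ·) (toNerve_one L F g)).trans ?_)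
    rw [hs, Category.assoc, ← Functor.map_comp]
    have := nerveHom_mulN M SSetAux.s₀
    rw [this]
    exact (Category.assoc _ _ _).symm
  · rw [← cancel_mono (L.map (mulN M 1))]
    refine (Category.assoc _ _ _).trans ((congrArg (_ ≫ ·) (toNerve_one L F g)).trans ?_)
    rw [hd, Category.assoc, ← Functor.map_comp]
    have := nerveHom_mulN M SSetAux.d₁
    rw [this]
    have h2 : mulN M (FInt.mk 2).len = (powIso M 1 1).hom ≫ (mulN M 1 ⊗ₘ mulN M 1) ≫ MonObj.mul :=
      (mulN_add M 1 1).symm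
    rw [h2, Functor.map_comp, Functor.map_comp]
    refine Eq.trans ?_ (congrArg (· ≫ L.map (mulN M 1 ⊗ₘ mulN M 1) ≫ L.map MonObj.mul)
      (toNerve_comul L F g 1 1) |>.trans (Category.assoc _ _ _))
    simp only [Category.assoc]
    rw [← Functor.LaxMonoidal.μ_natural_assoc, tensorHom_comp_tensorHom_assoc, toNerve_one]

end

end MonNerve

/-! ### Templicial morphisms to a nerve are given by vertices and edges -/

namespace Templicial

variable {V : Type u} [Category.{v} V] [MonoidalCategory V] [HasColimits V]
  [SymmetricCategory V] [MonoidalClosed V] {X : Templicial V} {C D : VCat V}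

/-- The map on vertices of a templicial morphism `X ⟶ N(C)`. -/
def nerveBase (θ : X ⟶ C.nerve) : X.Ob → C.Ob := Hom.base θ

/-- The map on edges `X_1 ⟶ C` of a templicial morphism `X ⟶ N(C)`. -/
def edgePart (θ : X ⟶ C.nerve) : X.lvl 1 ⟶ (VQuiv.pullback (nerveBase θ)).obj C.quiver :=
  show X.fct.obj (op ⟨1⟩) ⟶ (VQuiv.pullback (nerveBase θ)).obj C.quiver from
  Hom.app θ (op ⟨1⟩) ≫ (VQuiv.pullback (nerveBase θ)).map (MonNerve.mulN C.quiver 1)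

theorem app_eq_toNerve (θ : X ⟶ C.nerve) (n : ℕ) :
    Hom.app θ (op ⟨n⟩) = MonNerve.toNerve (VQuiv.pullback (nerveBase θ)) X.fct (edgePart θ) n :=
  MonNerve.eq_toNerve (VQuiv.pullback (nerveBase θ)) X.fct (M := C.quiver)
    (fun n => Hom.app θ (op ⟨n⟩)) ((Category.comp_id _).symm.trans (Hom.comp_η θ).symm)
    (fun n => Hom.comp_δ θ (op ⟨n⟩) (op ⟨1⟩)) n

/-- Templicial morphisms to a nerve are determined by their values on vertices and edges. -/
theorem hom_nerve_ext {θ θ' : X ⟶ C.nerve} (h : ∀ a, nerveBase θ a = nerveBase θ' a)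
    (h' : ∀ a b, (edgePart θ).app a b ≫ eqToHom (congrArg₂ C.quiver.obj (h a) (h b)) =
      (edgePart θ').app a b) : θ = θ' := by
  have key := app_eq_toNerve θ
  have key' := app_eq_toNerve θ'
  -- The edge parts become variables, so that the two vertex maps can be identified without the
  -- casts obstructing the substitution.
  generalize edgePart θ = g at key h'
  generalize edgePart θ' = g' at key' h'
  obtain ⟨f, t, _, _, _⟩ := θ
  obtain ⟨f', t', _, _, _⟩ := θ'
  obtain rfl : f = f' := funext h
  obtain rfl : g = g' := by
    ext a b
    exact (Category.comp_id _).symm.trans (h' a b)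
  refine Hom.ext rfl (heq_of_eq (funext fun n => ?_))
  exact (key n.unop.len).trans (key' n.unop.len).symm

/-- Naturality for `[1] ⟶ [0]` and compatibility with counits: in dimension zero the nerve is the
unit quiver and its counit is the identity. -/
theorem restr_s₀_edgePart (θ : X ⟶ C.nerve) :
    X.restr SSetAux.s₀ ≫ edgePart θ = X.counit ≫
      Functor.LaxMonoidal.ε (VQuiv.pullback (nerveBase θ)) ≫
        (VQuiv.pullback (nerveBase θ)).map MonObj.one := by
  have h1 := Hom.naturality θ SSetAux.s₀.op
  have h2 := Hom.comp_η θ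
  have h3 : Hom.app θ (𝟙_ FIntᵒᵖ) = Functor.OplaxMonoidal.η X.fct ≫
      Functor.LaxMonoidal.ε (VQuiv.pullback (nerveBase θ)) :=
    (Category.comp_id _).symm.trans h2.symm
  have h4 : C.nerve.restr SSetAux.s₀ ≫ MonNerve.mulN C.quiver 1 = C.unitHom :=
    VCat.restr_mulN SSetAux.s₀
  refine (Category.assoc _ _ _).symm.trans ((congrArg (· ≫ _) h1).trans ?_)
  refine (Category.assoc _ _ _).trans ?_
  refine (congrArg (_ ≫ ·) (((VQuiv.pullback (nerveBase θ)).map_comp _ _).symm.trans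
    (congrArg _ h4))).trans ?_
  exact (congrArg (· ≫ _) h3).trans (Category.assoc _ _ _)

theorem unitEdge_edgePart (θ : X ⟶ C.nerve) :
    X.unitEdge ≫ edgePart θ = Functor.LaxMonoidal.ε (VQuiv.pullback (nerveBase θ)) ≫
        (VQuiv.pullback (nerveBase θ)).map MonObj.one := by
  rw [unitEdge, Category.assoc, restr_s₀_edgePart]
  exact IsIso.inv_hom_id_assoc (Functor.OplaxMonoidal.η X.fct) _

theorem edgePart_aux {W W' : Type*} [Category W] [MonoidalCategory W] [Category W']
    [MonoidalCategory W'] (L : W' ⥤ W) [L.LaxMonoidal] {x y : W} {p p' m : W'} {Φ : y ⟶ x}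
    {θ : x ⟶ L.obj p} {θ' : y ⟶ L.obj p'} {N : p' ⟶ p} (h₁ : Φ ≫ θ = θ' ≫ L.map N)
    {δ : y ⟶ x ⊗ x} {c : p' ⟶ p ⊗ p}
    (h₂ : δ ≫ (θ ⊗ₘ θ) ≫ Functor.LaxMonoidal.μ L p p = θ' ≫ L.map c) {t : p ⟶ m}
    {μ : m ⊗ m ⟶ m} (h : N ≫ t = c ≫ (t ⊗ₘ t) ≫ μ) :
    Φ ≫ θ ≫ L.map t = δ ≫ ((θ ≫ L.map t) ⊗ₘ (θ ≫ L.map t)) ≫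
      Functor.LaxMonoidal.μ L m m ≫ L.map μ := by
  rw [reassoc_of% h₁, ← Functor.map_comp, h, Functor.map_comp, ← reassoc_of% h₂, Functor.map_comp,
    ← Functor.LaxMonoidal.μ_natural_assoc, tensorHom_comp_tensorHom_assoc]

/-- In the nerve the long edge of a triangle is the product of its two short edges; the rest is
naturality and compatibility with `μ_{1,1}`. -/
theorem restr_d₁_edgePart (θ : X ⟶ C.nerve) :
    X.restr SSetAux.d₁ ≫ edgePart θ = X.comul 1 1 ≫ (edgePart θ ⊗ₘ edgePart θ) ≫
      Functor.LaxMonoidal.μ (VQuiv.pullback (nerveBase θ)) _ _ ≫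
        (VQuiv.pullback (nerveBase θ)).map MonObj.mul := by
  have h1 := Hom.naturality θ SSetAux.d₁.op
  have h2 := Hom.comp_δ θ (op ⟨1⟩) (op ⟨1⟩)
  have h4 : C.nerve.restr SSetAux.d₁ ≫ MonNerve.mulN C.quiver 1 = MonNerve.mulN C.quiver 2 :=
    VCat.restr_mulN SSetAux.d₁
  have h5 := VCat.comul_mulN (C := C) 1 1
  refine edgePart_aux (W' := VQuiv V C.Ob) (p := MonNerve.pow C.quiver 1)
    (θ' := Hom.app θ (op ⟨2⟩))
    (p' := MonNerve.pow C.quiver 2) (m := C.quiver) (N := MonNerve.nerveHom C.quiver SSetAux.d₁)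
    (c := (MonNerve.powIso C.quiver 1 1).hom) (VQuiv.pullback (nerveBase θ)) ?_ ?_ ?_
  · exact h1
  · exact h2
  · exact h4.trans h5.symm

/-- The templicial morphism `X ⟶ N(C)` given by its values on vertices and edges. -/
def homToNerve (f : X.Ob → C.Ob) (g : X.lvl 1 ⟶ (VQuiv.pullback f).obj C.quiver)
    (hs : X.unitEdge ≫ g = Functor.LaxMonoidal.ε (VQuiv.pullback f) ≫
      (VQuiv.pullback f).map MonObj.one)
    (hd : X.restr SSetAux.d₁ ≫ g = X.comul 1 1 ≫ (g ⊗ₘ g) ≫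
      Functor.LaxMonoidal.μ (VQuiv.pullback f) _ _ ≫ (VQuiv.pullback f).map MonObj.mul) :
    X ⟶ C.nerve where
  base := f
  app n := MonNerve.toNerve (VQuiv.pullback f) X.fct g n.unop.len
  naturality h := MonNerve.toNerve_naturality (VQuiv.pullback f) X.fct g (by
    rw [← hs]
    exact ((IsIso.hom_inv_id_assoc (Functor.OplaxMonoidal.η X.fct) _).symm.trans
      (congrArg (_ ≫ ·) (Category.assoc _ _ _).symm))) hd h.unop
  comp_δ m n := MonNerve.toNerve_comul (VQuiv.pullback f) X.fct g m.unop.len n.unop.len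
  comp_η := (Category.comp_id _).symm

theorem edgePart_homToNerve (f : X.Ob → C.Ob) (g : X.lvl 1 ⟶ (VQuiv.pullback f).obj C.quiver)
    (hs : X.unitEdge ≫ g = Functor.LaxMonoidal.ε (VQuiv.pullback f) ≫
      (VQuiv.pullback f).map MonObj.one)
    (hd : X.restr SSetAux.d₁ ≫ g = X.comul 1 1 ≫ (g ⊗ₘ g) ≫
      Functor.LaxMonoidal.μ (VQuiv.pullback f) _ _ ≫ (VQuiv.pullback f).map MonObj.mul) :
    edgePart (homToNerve f g hs hd) = g :=
  MonNerve.toNerve_one (VQuiv.pullback f) X.fct g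

theorem comp_map_congr {C D : Type*} [Category C] [Category D] (G : C ⥤ D) {x : D} {y z z' w : C}
    (θ : x ⟶ G.obj y) {a : y ⟶ z} {b : z ⟶ w} {c : y ⟶ z'} {d : z' ⟶ w} (h : a ≫ b = c ≫ d) :
    (θ ≫ G.map a) ≫ G.map b = (θ ≫ G.map c) ≫ G.map d := by
  simp only [Category.assoc, ← Functor.map_comp, h]

theorem edgePart_comp_nerveMap (θ : X ⟶ C.nerve) (F : C ⟶ D) :
    edgePart (θ ≫ VCat.nerveMap F) =
      edgePart θ ≫ (VQuiv.pullback (nerveBase θ)).map (VCat.quiverMap F) := by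
  have h := MonNerve.mulN_powMap (VQuiv.pullback (V := V) (VCat.objMap F)) (VCat.quiverMap F)
    (VCat.one_quiverMap F) (VCat.mul_quiverMap F) 1
  refine (comp_map_congr (VQuiv.pullback (nerveBase θ)) (Hom.app θ (op ⟨1⟩)) h).symm

end Templicial

/-! ### Necklace maps on vertices, and concatenation of necklaces -/

namespace Necklace

theorem len_total (T : List ℕ) : (total T).len = T.sum := by
  induction T with
  | nil => rfl
  | cons n T ih =>
    rw [List.sum_cons, ← ih]
    rfl

/-- The comparison is built from associators and unitors, which are identities on vertices. -/
theorem val_foldAppend_hom (T₁ T₂ : List ℕ) {i : ℕ} (hi : i ≤ T₁.sum + T₂.sum) :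
    FInt.val (foldAppend FInt.mk T₁ T₂).hom i = i := by
  induction T₁ generalizing i with
  | nil =>
    have hi' : i ≤ (total T₂).len := by
      rw [len_total]
      simpa using hi
    exact FInt.val_eqToHom (FInt.ext_len (Nat.zero_add (total T₂).len)).symm hi'
  | cons n T₁ ih =>
    rw [List.sum_cons] at hi
    have h1 : (foldAppend FInt.mk (n :: T₁) T₂).hom =
        FInt.mk n ◁ (foldAppend FInt.mk T₁ T₂).hom ≫ (α_ _ _ _).inv := rfl
    have h3 : FInt.val (FInt.mk n ◁ (foldAppend FInt.mk T₁ T₂).hom) i = i := by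
      rw [← id_tensorHom]
      have hl : (Necklace.fold FInt.mk (T₁ ++ T₂)).len = T₁.sum + T₂.sum := by
        rw [← List.sum_append]
        exact len_total _
      rw [FInt.val_tensorHom _ _ (by rw [hl]; change i ≤ n + _; omega)]
      split_ifs with h
      · exact FInt.val_id _ h
      · have h' : ¬ i ≤ n := h
        have := ih (i := i - n) (by omega)
        change n + FInt.val (foldAppend FInt.mk T₁ T₂).hom (i - n) = i
        omega
    rw [h1]
    refine (FInt.val_comp _ _ _).trans ((congrArg (FInt.val _) h3).trans ?_)
    refine FInt.val_associator_inv _ _ _ ?_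
    have h4 : (fold FInt.mk T₁).len = T₁.sum := len_total T₁
    have h5 : (fold FInt.mk T₂).len = T₂.sum := len_total T₂
    rw [h4, h5]
    change i ≤ n + _
    omega

theorem val_toHom_cons (T₁ : List ℕ) {n : ℕ} (f : total T₁ ⟶ FInt.mk n) {T₂ U : List ℕ}
    (d : Map T₂ U) {i : ℕ} (hi : i ≤ T₁.sum + T₂.sum) :
    FInt.val (Map.cons T₁ f d).toHom i =
      if i ≤ T₁.sum then FInt.val f i else n + FInt.val d.toHom (i - T₁.sum) := by
  refine (FInt.val_comp _ _ _).trans ((congrArg (FInt.val _) (val_foldAppend_hom _ _ hi)).trans ?_)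
  refine (FInt.val_tensorHom _ _ (by rw [len_total, len_total]; exact hi)).trans ?_
  rw [len_total]

theorem hom_zero_ext {m : FInt} (f g : m ⟶ 𝟙_ FInt) : f = g :=
  FInt.hom_ext fun i _ => by
    have h1 : FInt.val f i ≤ 0 := FInt.val_le f i
    have h2 : FInt.val g i ≤ 0 := FInt.val_le g i
    omega

theorem val_nil {T : List ℕ} (f : total T ⟶ total []) (i : ℕ) : FInt.val f i = 0 :=
  Nat.le_zero.1 (FInt.val_le f i)

theorem toHom_ext {T : List ℕ} {m : FInt} {f g : total T ⟶ m}
    (h : ∀ i, i ≤ T.sum → FInt.val f i = FInt.val g i) : f = g :=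
  FInt.hom_ext fun i hi => h i (by rwa [len_total] at hi)

theorem eqToHom_cons {C : Type*} [Category C] [MonoidalCategory C] (b : ℕ → C) (n : ℕ)
    {T T' : List ℕ} (h : T = T') (h' : fold b (n :: T) = fold b (n :: T')) :
    eqToHom h' = b n ◁ eqToHom (congrArg (fold b) h) := by
  subst h
  simp
  rfl

/-- Coherence for concatenation; the transport is needed because concatenation of lists is
associative only up to a propositional equality. -/
theorem foldAppend_assoc {C : Type*} [Category C] [MonoidalCategory C] (b : ℕ → C)
    (T₁ T₂ T₃ : List ℕ) :
    eqToHom (congrArg (fold b) (List.append_assoc T₁ T₂ T₃)) ≫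
      (foldAppend b T₁ (T₂ ++ T₃)).hom ≫ fold b T₁ ◁ (foldAppend b T₂ T₃).hom =
    (foldAppend b (T₁ ++ T₂) T₃).hom ≫ (foldAppend b T₁ T₂).hom ▷ fold b T₃ ≫
      (α_ _ _ _).hom := by
  induction T₁ with
  | nil =>
    refine (Category.id_comp _).trans ?_
    change (λ_ (fold b (T₂ ++ T₃))).inv ≫ 𝟙_ C ◁ (foldAppend b T₂ T₃).hom =
      (foldAppend b T₂ T₃).hom ≫ (λ_ (fold b T₂)).inv ▷ fold b T₃ ≫ (α_ _ _ _).hom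
    simp
  | cons n T₁ ih =>
    rw [eqToHom_cons b n (List.append_assoc T₁ T₂ T₃)]
    change b n ◁ eqToHom _ ≫ (b n ◁ (foldAppend b T₁ (T₂ ++ T₃)).hom ≫ (α_ _ _ _).inv) ≫
      (b n ⊗ fold b T₁) ◁ (foldAppend b T₂ T₃).hom =
      (b n ◁ (foldAppend b (T₁ ++ T₂) T₃).hom ≫ (α_ (b n) _ _).inv) ≫
      (b n ◁ (foldAppend b T₁ T₂).hom ≫ (α_ (b n) _ _).inv) ▷ fold b T₃ ≫
        (α_ (b n ⊗ fold b T₁) _ _).hom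
    have ih' := congrArg (fun z => b n ◁ z ≫ (α_ (b n) (fold b T₁) _).inv) ih
    simp only [MonoidalCategory.whiskerLeft_comp, Category.assoc] at ih'
    simp only [Category.assoc, comp_whiskerRight, tensor_whiskerLeft, Iso.inv_hom_id_assoc] at ih' ⊢
    rw [ih']
    simp

end Necklace

/-! ### The action of necklace maps on a templicial object -/

namespace Templicial

open Necklace

variable {V : Type u} [Category.{v} V] [MonoidalCategory V] [HasColimits V]
  [SymmetricCategory V] [MonoidalClosed V] (X : Templicial V)

theorem counit_counitInv : X.counit ≫ X.counitInv = 𝟙 _ :=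
  IsIso.hom_inv_id (Functor.OplaxMonoidal.η X.fct)

theorem counitInv_counit : X.counitInv ≫ X.counit = 𝟙 _ :=
  IsIso.inv_hom_id (Functor.OplaxMonoidal.η X.fct)

/-- This is counitality solved for the comultiplication, which is possible by strong unitality:
splitting off an interval `[0]` inserts the degenerate vertex. -/
theorem map_leftUnitor_comul (m : FInt) :
    X.fct.map (λ_ m).hom.op ≫ Functor.OplaxMonoidal.δ X.fct (op (𝟙_ FInt)) (op m) =
      (λ_ (X.fct.obj (op m))).inv ≫ X.counitInv ▷ X.fct.obj (op m) := by
  have h := Functor.OplaxMonoidal.left_unitality X.fct (op m)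
  have h1 : (X.counit ▷ X.fct.obj (op m)) ≫ X.counitInv ▷ X.fct.obj (op m) = 𝟙 _ := by
    rw [← comp_whiskerRight, counit_counitInv, id_whiskerRight]
  rw [h]
  refine (Eq.trans ?_ (Category.assoc _ _ _).symm)
  refine congrArg (X.fct.map (λ_ m).hom.op ≫ ·) ?_
  exact ((Category.comp_id _).symm.trans (congrArg (_ ≫ ·) h1.symm)).trans
    (Category.assoc _ _ _).symm

theorem map_rightUnitor_comul (m : FInt) :
    X.fct.map (ρ_ m).hom.op ≫ Functor.OplaxMonoidal.δ X.fct (op m) (op (𝟙_ FInt)) =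
      (ρ_ (X.fct.obj (op m))).inv ≫ X.fct.obj (op m) ◁ X.counitInv := by
  have h := Functor.OplaxMonoidal.right_unitality X.fct (op m)
  have h1 : (X.fct.obj (op m) ◁ X.counit) ≫ X.fct.obj (op m) ◁ X.counitInv = 𝟙 _ := by
    rw [← MonoidalCategory.whiskerLeft_comp, counit_counitInv, MonoidalCategory.whiskerLeft_id]
  rw [h]
  refine (Eq.trans ?_ (Category.assoc _ _ _).symm)
  refine congrArg (X.fct.map (ρ_ m).hom.op ≫ ·) ?_
  exact ((Category.comp_id _).symm.trans (congrArg (_ ≫ ·) h1.symm)).trans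
    (Category.assoc _ _ _).symm

theorem comul_natural {m n m' n' : FInt} (f : m ⟶ m') (g : n ⟶ n') :
    X.fct.map (f ⊗ₘ g).op ≫ Functor.OplaxMonoidal.δ X.fct (op m) (op n) =
      Functor.OplaxMonoidal.δ X.fct (op m') (op n') ≫ (X.fct.map f.op ⊗ₘ X.fct.map g.op) :=
  (Functor.OplaxMonoidal.δ_natural X.fct f.op g.op).symm

theorem comul_assoc (m n k : FInt) :
    X.fct.map (α_ m n k).hom.op ≫ Functor.OplaxMonoidal.δ X.fct (op (m ⊗ n)) (op k) ≫
      Functor.OplaxMonoidal.δ X.fct (op m) (op n) ▷ X.fct.obj (op k) =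
    Functor.OplaxMonoidal.δ X.fct (op m) (op (n ⊗ k)) ≫
      X.fct.obj (op m) ◁ Functor.OplaxMonoidal.δ X.fct (op n) (op k) ≫ (α_ _ _ _).inv := by
  have h := Functor.OplaxMonoidal.associativity X.fct (op m) (op n) (op k)
  have h1 : X.fct.map (α_ m n k).hom.op ≫ X.fct.map (α_ (op m) (op n) (op k)).hom = 𝟙 _ := by
    have h2 : (α_ m n k).hom.op ≫ (α_ (op m) (op n) (op k)).hom = 𝟙 _ :=
      (α_ (op m) (op n) (op k)).inv_hom_id
    exact (X.fct.map_comp _ _).symm.trans ((congrArg X.fct.map h2).trans (X.fct.map_id _))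
  have h3 := congrArg (fun z => X.fct.map (α_ m n k).hom.op ≫ z ≫ (α_ _ _ _).inv) h
  have h4 := congrArg (fun z => z ≫ Functor.OplaxMonoidal.δ X.fct (op m) (op n ⊗ op k) ≫
    X.fct.obj (op m) ◁ Functor.OplaxMonoidal.δ X.fct (op n) (op k) ≫ (α_ _ _ _).inv) h1
  simp only [Category.assoc, Iso.hom_inv_id, Category.comp_id] at h3 h4
  exact h3.trans (h4.trans (Category.id_comp _))

theorem iterComul_append_aux {W : Type*} [Category W] [MonoidalCategory W]
    {x y y' z n s t ns s' t' st st' : W} {Φ : x ⟶ y} {δ₁ : x ⟶ n ⊗ st} {δ₂ : y ⟶ n ⊗ y'}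
    {Ψ : st ⟶ y'} (h₁ : Φ ≫ δ₂ = δ₁ ≫ n ◁ Ψ) {δ₃ : y' ⟶ s ⊗ t}
    {A : y ⟶ z} {δ₄ : z ⟶ ns ⊗ t} {δ₅ : ns ⟶ n ⊗ s}
    (h₂ : A ≫ δ₄ ≫ δ₅ ▷ t = δ₂ ≫ n ◁ δ₃ ≫ (α_ _ _ _).inv) {i₁ : s ⟶ s'} {i₂ : t ⟶ t'}
    {i : st ⟶ st'} {fa : st' ⟶ s' ⊗ t'} (h : i ≫ fa = Ψ ≫ δ₃ ≫ (i₁ ⊗ₘ i₂)) :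
    (δ₁ ≫ n ◁ i) ≫ n ◁ fa ≫ (α_ n s' t').inv =
      (Φ ≫ A) ≫ δ₄ ≫ ((δ₅ ≫ n ◁ i₁) ⊗ₘ i₂) := by
  rw [← whiskerRight_comp_tensorHom, Category.assoc, Category.assoc, reassoc_of% h₂,
    reassoc_of% h₁, ← whiskerLeft_comp_assoc, h]
  simp only [MonoidalCategory.whiskerLeft_comp, Category.assoc]
  rw [MonoidalCategory.tensorHom_def, MonoidalCategory.tensorHom_def]
  simp

theorem iterComul_nil_append_aux {W : Type*} [Category W] [MonoidalCategory W]
    {x y z t' : W} {Λ : x ⟶ y} {δ : y ⟶ z ⊗ x} {η' : 𝟙_ W ⟶ z} {η : z ⟶ 𝟙_ W} {i : x ⟶ t'}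
    (h : Λ ≫ δ = (λ_ x).inv ≫ η' ▷ x) (h' : η' ≫ η = 𝟙 _) :
    i ≫ (λ_ t').inv = Λ ≫ δ ≫ (η ⊗ₘ i) := by
  rw [reassoc_of% h, whiskerRight_comp_tensorHom, h', id_tensorHom, leftUnitor_inv_naturality]

/-- By induction on the first necklace, with counitality as the base case and coassociativity as the
inductive step. -/
theorem iterComul_append (T₁ T₂ : List ℕ) :
    X.iterComul (T₁ ++ T₂) ≫ (foldAppend X.lvl T₁ T₂).hom =
      X.fct.map (foldAppend FInt.mk T₁ T₂).inv.op ≫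
        Functor.OplaxMonoidal.δ X.fct (op (total T₁)) (op (total T₂)) ≫
          (X.iterComul T₁ ⊗ₘ X.iterComul T₂) := by
  induction T₁ with
  | nil =>
    exact iterComul_nil_append_aux (X.map_leftUnitor_comul (total T₂)) X.counitInv_counit
  | cons n T₁ ih =>
    have h1 : X.fct.map (foldAppend FInt.mk (n :: T₁) T₂).inv.op =
        X.fct.map (𝟙 (FInt.mk n) ⊗ₘ (foldAppend FInt.mk T₁ T₂).inv).op ≫
          X.fct.map (α_ (FInt.mk n) (total T₁) (total T₂)).hom.op := by
      rw [← X.fct.map_comp, id_tensorHom]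
      rfl
    rw [h1]
    refine iterComul_append_aux ?_ (X.comul_assoc (FInt.mk n) (total T₁) (total T₂)) ih
    refine (comul_natural X _ _).trans (congrArg (_ ≫ ·) ?_)
    have h2 : X.fct.map (𝟙 (FInt.mk n)).op = 𝟙 _ := X.fct.map_id _
    rw [h2, id_tensorHom]

theorem necklaceMap_cons_foldAppend (T₁ : List ℕ) {n : ℕ} (f : total T₁ ⟶ FInt.mk n)
    {T₂ U : List ℕ} (d : Map T₂ U) :
    X.necklaceMap (Map.cons T₁ f d) ≫ (foldAppend X.lvl T₁ T₂).hom =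
      (X.fct.map f.op ≫ X.iterComul T₁) ⊗ₘ X.necklaceMap d :=
  (Category.assoc _ _ _).trans ((congrArg (_ ≫ ·) (Iso.inv_hom_id _)).trans (Category.comp_id _))

theorem iterComul_necklaceMap_aux {W : Type*} [Category W] [MonoidalCategory W]
    {q n u i₀ t₁ t₂ tt TT t₁' t₂' x : W} {δ : q ⟶ n ⊗ u} {iU : u ⟶ i₀} {nm : n ⊗ i₀ ⟶ TT}
    {fa : TT ⟶ t₁' ⊗ t₂'} {f : n ⟶ t₁} {i₁ : t₁ ⟶ t₁'} {d : i₀ ⟶ t₂'} {g : u ⟶ t₂}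
    {i₂ : t₂ ⟶ t₂'} {P : q ⟶ tt} {iT : tt ⟶ TT} {δ' : x ⟶ t₁ ⊗ t₂} {Φ : q ⟶ x} {fa' : tt ⟶ x}
    (h : nm ≫ fa = (f ≫ i₁) ⊗ₘ d) (h₁ : iU ≫ d = g ≫ i₂) (h₂ : iT ≫ fa = fa' ≫ δ' ≫ (i₁ ⊗ₘ i₂))
    (h₃ : P ≫ fa' = Φ) (h₄ : Φ ≫ δ' = δ ≫ (f ⊗ₘ g)) :
    ((δ ≫ n ◁ iU) ≫ nm) ≫ fa = (P ≫ iT) ≫ fa := by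
  simp only [Category.assoc]
  rw [h, h₂, reassoc_of% h₃, reassoc_of% h₄, whiskerLeft_comp_tensorHom, h₁,
    tensorHom_comp_tensorHom]

/-- The iterated comultiplications are natural in the necklace. -/
theorem iterComul_necklaceMap {T U : List ℕ} (d : Necklace.Map T U) :
    X.iterComul U ≫ X.necklaceMap d = X.fct.map d.toHom.op ≫ X.iterComul T := by
  induction d with
  | nil T => exact IsIso.hom_inv_id_assoc (Functor.OplaxMonoidal.η X.fct) _
  | @cons T₁ n f T₂ U d ih =>
    -- After the invertible comparison with a tensor product, the part over the first bead agrees by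
    -- naturality of the comultiplication and the rest by induction.
    refine (cancel_mono (foldAppend X.lvl T₁ T₂).hom).1 ?_
    have h2 : X.fct.map (Map.cons T₁ f d).toHom.op ≫ X.fct.map (foldAppend FInt.mk T₁ T₂).inv.op =
        X.fct.map (f ⊗ₘ d.toHom).op :=
      (X.fct.map_comp _ _).symm.trans
        (congrArg (fun z => X.fct.map (Quiver.Hom.op z)) (Iso.inv_hom_id_assoc _ _))
    exact iterComul_necklaceMap_aux (X.necklaceMap_cons_foldAppend T₁ f d) ih
      (X.iterComul_append T₁ T₂) h2 (X.comul_natural f d.toHom)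

theorem necklaceMap_nil_self : X.necklaceMap (Map.nil []) = 𝟙 _ := by
  have h : Necklace.toZero (Necklace.total []) = 𝟙 _ := hom_zero_ext _ _
  have h' : X.fct.map (Necklace.toZero (Necklace.total [])).op = 𝟙 _ := by
    rw [h]
    exact X.fct.map_id _
  refine (congrArg (fun z => X.counitInv ≫ z ≫ X.counit) h').trans ?_
  exact (congrArg (X.counitInv ≫ ·) (Category.id_comp _)).trans X.counitInv_counit

theorem nil_comp_necklaceMap {T U : List ℕ} (d : Necklace.Map T U) :
    X.necklaceMap (Map.nil U) ≫ X.necklaceMap d = X.necklaceMap (Map.nil T) := by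
  have h : d.toHom ≫ toZero (total U) = toZero (total T) := hom_zero_ext _ _
  have h' : X.fct.map (toZero (total U)).op ≫ X.fct.map d.toHom.op =
      X.fct.map (toZero (total T)).op := by
    rw [← Functor.map_comp, ← op_comp, h]
  have aux : ∀ {W : Type (max u v)} [Category.{v} W] {a b c d e g : W} {η : a ⟶ b} {z : b ⟶ c}
    {i : c ⟶ e} {nm : e ⟶ g} {D : c ⟶ d} {i' : d ⟶ g} {z' : b ⟶ d} (_ : i ≫ nm = D ≫ i')
    (_ : z ≫ D = z'), (η ≫ z ≫ i) ≫ nm = η ≫ z' ≫ i' := by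
    intros
    subst_vars
    simp [*]
  exact aux (X.iterComul_necklaceMap d) h'

theorem exists_cast {T T' U : List ℕ} (h : T = T') (d : Map T U) : ∃ d' : Map T' U,
    (∀ i, FInt.val d'.toHom i = FInt.val d.toHom i) ∧
      X.necklaceMap d = X.necklaceMap d' ≫ eqToHom (congrArg X.onNecklace h.symm) := by
  subst h
  exact ⟨d, fun _ => rfl, (Category.comp_id _).symm⟩

theorem map_collapse_left {W : Type*} [Category W] [MonoidalCategory W]
    {y z m s t s' t' ST ST' x : W} {F : m ⟶ ST} {Λ : m ⟶ y} {δ : y ⟶ z ⊗ m}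
    {η' : 𝟙_ W ⟶ z} {fa' : ST ⟶ x} {iST : ST ⟶ ST'} {fa : ST' ⟶ s' ⊗ t'}
    {δ' : x ⟶ s ⊗ t} {Z : z ⟶ s} {f : m ⟶ t} {i₁ : s ⟶ s'} {i₂ : t ⟶ t'} {Φ : y ⟶ x}
    (h : Λ ≫ δ = (λ_ m).inv ≫ η' ▷ m) (h₁ : iST ≫ fa = fa' ≫ δ' ≫ (i₁ ⊗ₘ i₂))
    (h₂ : F ≫ fa' = Λ ≫ Φ) (h₃ : Φ ≫ δ' = δ ≫ (Z ⊗ₘ f)) :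
    (F ≫ iST) ≫ fa = (λ_ m).inv ≫ ((η' ≫ Z ≫ i₁) ⊗ₘ (f ≫ i₂)) := by
  simp only [Category.assoc]
  rw [h₁, reassoc_of% h₂, reassoc_of% h₃, reassoc_of% h, tensorHom_comp_tensorHom,
    whiskerRight_comp_tensorHom]

theorem map_collapse_right {W : Type*} [Category W] [MonoidalCategory W]
    {y z m s t s' t' ST ST' x : W} {F : m ⟶ ST} {Λ : m ⟶ y} {δ : y ⟶ m ⊗ z}
    {η' : 𝟙_ W ⟶ z} {fa' : ST ⟶ x} {iST : ST ⟶ ST'} {fa : ST' ⟶ s' ⊗ t'}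
    {δ' : x ⟶ s ⊗ t} {Z : z ⟶ t} {f : m ⟶ s} {i₁ : s ⟶ s'} {i₂ : t ⟶ t'} {Φ : y ⟶ x}
    (h : Λ ≫ δ = (ρ_ m).inv ≫ m ◁ η') (h₁ : iST ≫ fa = fa' ≫ δ' ≫ (i₁ ⊗ₘ i₂))
    (h₂ : F ≫ fa' = Λ ≫ Φ) (h₃ : Φ ≫ δ' = δ ≫ (f ⊗ₘ Z)) :
    (F ≫ iST) ≫ fa = (ρ_ m).inv ≫ ((f ≫ i₁) ⊗ₘ (η' ≫ Z ≫ i₂)) := by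
  simp only [Category.assoc]
  rw [h₁, reassoc_of% h₂, reassoc_of% h₃, reassoc_of% h, tensorHom_comp_tensorHom,
    whiskerLeft_comp_tensorHom]

/-- By counitality, a necklace `S` sent to the first vertex of a bead contributes only a degenerate
factor. With its mirror image this permits a collapsed necklace to be moved across a joint. -/
theorem map_iterComul_collapse_left (S T : List ℕ) {m : FInt} (f : total T ⟶ m)
    (F : total (S ++ T) ⟶ m)
    (hF : F = (foldAppend FInt.mk S T).hom ≫ (toZero (total S) ⊗ₘ f) ≫ (λ_ m).hom) :
    (X.fct.map F.op ≫ X.iterComul (S ++ T)) ≫ (foldAppend X.lvl S T).hom =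
      (λ_ (X.fct.obj (op m))).inv ≫
        (X.necklaceMap (Map.nil S) ⊗ₘ (X.fct.map f.op ≫ X.iterComul T)) := by
  refine map_collapse_left (X.map_leftUnitor_comul m) (X.iterComul_append S T) ?_
    (X.comul_natural (toZero (total S)) f)
  rw [← Functor.map_comp, ← Functor.map_comp, ← op_comp, ← op_comp, hF, Iso.inv_hom_id_assoc]

theorem map_iterComul_collapse_right (T S : List ℕ) {m : FInt} (f : total T ⟶ m)
    (F : total (T ++ S) ⟶ m)
    (hF : F = (foldAppend FInt.mk T S).hom ≫ (f ⊗ₘ toZero (total S)) ≫ (ρ_ m).hom) :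
    (X.fct.map F.op ≫ X.iterComul (T ++ S)) ≫ (foldAppend X.lvl T S).hom =
      (ρ_ (X.fct.obj (op m))).inv ≫
        ((X.fct.map f.op ≫ X.iterComul T) ⊗ₘ X.necklaceMap (Map.nil S)) := by
  refine map_collapse_right (X.map_rightUnitor_comul m) (X.iterComul_append T S) ?_
    (X.comul_natural f (toZero (total S)))
  rw [← Functor.map_comp, ← Functor.map_comp, ← op_comp, ← op_comp, hF, Iso.inv_hom_id_assoc]

end Templicial

/-! ### Independence of the chosen cutting, and composition of necklace maps -/

namespace Templicial

open Necklace

variable {V : Type u} [Category.{v} V] [MonoidalCategory V] [HasColimits V]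
  [SymmetricCategory V] [MonoidalClosed V] (X : Templicial V)

theorem absorb_nil_aux {W : Type*} [Category W] [MonoidalCategory W] {z F F' s t : W}
    {e : 𝟙_ W ⟶ z} {Z : z ⟶ F} {i : F ⟶ F'} {fa : F' ⟶ s ⊗ t} {a : z ⟶ s} {b : z ⟶ t}
    (h : (Z ≫ i) ≫ fa = (λ_ z).inv ≫ ((e ≫ a) ⊗ₘ b)) :
    (e ≫ Z ≫ i) ≫ fa = (λ_ _).inv ≫ ((e ≫ a) ⊗ₘ (e ≫ b)) := by
  rw [Category.assoc, h, leftUnitor_inv_naturality_assoc, whiskerLeft_comp_tensorHom]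

theorem absorb_cons_aux {W : Type*} [Category W] [MonoidalCategory W]
    {n u A A' s t₁ t₂ st t₁t₂ : W} {nm : n ⊗ u ⟶ A'} {fa₁ : A' ⟶ st ⊗ t₂} {e : A' ⟶ A}
    {fa₂ : A ⟶ s ⊗ t₁t₂} {fa₃ : t₁t₂ ⟶ t₁ ⊗ t₂} {fa₄ : st ⟶ s ⊗ t₁} {F : n ⟶ st} {d : u ⟶ t₂}
    {Z : 𝟙_ W ⟶ s} {f : n ⟶ t₁} {nm' : n ⊗ u ⟶ t₁t₂} (h : e ≫ fa₂ ≫ s ◁ fa₃ =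
      fa₁ ≫ fa₄ ▷ t₂ ≫ (α_ _ _ _).hom) (h₁ : nm ≫ fa₁ = F ⊗ₘ d) (h₂ : nm' ≫ fa₃ = f ⊗ₘ d)
    (h₃ : F ≫ fa₄ = (λ_ n).inv ≫ (Z ⊗ₘ f)) [IsIso fa₃] :
    (nm ≫ e) ≫ fa₂ = (λ_ (n ⊗ u)).inv ≫ (Z ⊗ₘ nm') := by
  rw [← cancel_mono (s ◁ fa₃)]
  simp only [Category.assoc]
  rw [h, reassoc_of% h₁, tensorHom_comp_whiskerLeft, h₂, tensorHom_comp_whiskerRight_assoc, h₃]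
  simp [MonoidalCategory.tensorHom_def]

/-- A necklace mapping to the initial vertex may be added to the left of a necklace map. -/
theorem exists_absorb (S : List ℕ) {T U : List ℕ} (d : Map T U) : ∃ d' : Map (S ++ T) U,
    (∀ i, i ≤ S.sum → FInt.val d'.toHom i = 0) ∧
    (∀ i, i ≤ T.sum → FInt.val d'.toHom (S.sum + i) = FInt.val d.toHom i) ∧
      X.necklaceMap d' ≫ (foldAppend X.lvl S T).hom =
        (λ_ _).inv ≫ (X.necklaceMap (Map.nil S) ⊗ₘ X.necklaceMap d) := by
  cases d with
  | nil T =>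
    refine ⟨.nil (S ++ T), fun i _ => val_nil _ _, fun i _ => (val_nil _ _).trans (val_nil _ _).symm,
      ?_⟩
    exact absorb_nil_aux (X.map_iterComul_collapse_left S T (toZero (total T))
      (toZero (total (S ++ T))) (hom_zero_ext _ _))
  | @cons T₁ n f T₂ U d =>
    -- `S` is joined to the part of `T` over the first bead of `U`, and `F` sends it to the initial
    -- vertex of that bead.
    let F : total (S ++ T₁) ⟶ FInt.mk n :=
      (foldAppend FInt.mk S T₁).hom ≫ (toZero (total S) ⊗ₘ f) ≫ (λ_ (FInt.mk n)).hom
    have hF : ∀ i, i ≤ S.sum + T₁.sum → FInt.val F i =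
        if i ≤ S.sum then 0 else FInt.val f (i - S.sum) := by
      intro i hi
      refine (FInt.val_comp _ _ _).trans ?_
      rw [val_foldAppend_hom _ _ hi]
      refine (FInt.val_comp _ _ _).trans ?_
      rw [FInt.val_tensorHom _ _ (by rw [len_total, len_total]; exact hi), len_total]
      have h0 : FInt.val (toZero (total S)) i = 0 := Nat.le_zero.1 (FInt.val_le (toZero (total S)) i)
      have h1 : FInt.val f (i - S.sum) ≤ n := FInt.val_le f _
      have h2 : (𝟙_ FInt).len + FInt.val f (i - S.sum) = FInt.val f (i - S.sum) := Nat.zero_add _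
      rw [h0, h2, FInt.val_leftUnitor_hom _ (by split_ifs <;> simp [h1])]
    obtain ⟨d', hv, hd'⟩ := X.exists_cast (List.append_assoc S T₁ T₂) (Map.cons (S ++ T₁) F d)
    have hf0 := FInt.val_zero f
    have hfl : FInt.val f T₁.sum = n := FInt.val_of_le f (len_total T₁).le
    refine ⟨d', fun i hi => ?_, fun i hi => ?_, ?_⟩
    · rw [hv, val_toHom_cons _ _ _ (by rw [List.sum_append]; omega),
        if_pos (by rw [List.sum_append]; omega), hF _ (by omega), if_pos hi]
    · rw [List.sum_append] at hi
      rw [hv, val_toHom_cons _ _ _ (by rw [List.sum_append]; omega), val_toHom_cons _ _ _ hi,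
        List.sum_append]
      by_cases h : i ≤ T₁.sum
      · rw [if_pos (by omega), if_pos h, hF _ (by omega)]
        split_ifs with h'
        · obtain rfl : i = 0 := by omega
          exact hf0.symm
        · rw [Nat.add_sub_cancel_left]
      · rw [if_neg (by omega), if_neg h, show S.sum + i - (S.sum + T₁.sum) = i - T₁.sum by omega]
    · have h1 : X.necklaceMap d' = X.necklaceMap (Map.cons (S ++ T₁) F d) ≫
          eqToHom (congrArg X.onNecklace (List.append_assoc S T₁ T₂)) := by
        rw [hd']
        simp
      rw [h1]
      exact absorb_cons_aux (foldAppend_assoc X.lvl S T₁ T₂)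
        (X.necklaceMap_cons_foldAppend (S ++ T₁) F d) (X.necklaceMap_cons_foldAppend T₁ f d)
        (X.map_iterComul_collapse_left S T₁ f F rfl)

theorem unique_aux {W : Type*} [Category W] [MonoidalCategory W]
    {n u A A' s t₁ t₂ st t₁s : W} {nm : n ⊗ u ⟶ A'} {fa₁ : A' ⟶ t₁s ⊗ t₂} {e : A' ⟶ A}
    {fa₂ : A ⟶ t₁ ⊗ st} {fa₃ : st ⟶ s ⊗ t₂} {fa₄ : t₁s ⟶ t₁ ⊗ s} {F : n ⟶ t₁s} {d' : u ⟶ t₂}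
    {Z : 𝟙_ W ⟶ s} {f : n ⟶ t₁} {nm' : n ⊗ u ⟶ A} {d : u ⟶ st} (h : e ≫ fa₂ ≫ t₁ ◁ fa₃ =
      fa₁ ≫ fa₄ ▷ t₂ ≫ (α_ _ _ _).hom) (h₁ : nm ≫ fa₁ = F ⊗ₘ d') (h₂ : nm' ≫ fa₂ = f ⊗ₘ d)
    (h₃ : F ≫ fa₄ = (ρ_ n).inv ≫ (f ⊗ₘ Z)) (h₄ : d ≫ fa₃ = (λ_ u).inv ≫ (Z ⊗ₘ d'))
    [IsIso fa₃] [IsIso fa₂] :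
    nm ≫ e = nm' := by
  rw [← cancel_mono fa₂, ← cancel_mono (t₁ ◁ fa₃)]
  simp only [Category.assoc]
  rw [h, reassoc_of% h₁, reassoc_of% h₂, tensorHom_comp_whiskerLeft, h₄,
    tensorHom_comp_whiskerRight_assoc, h₃]
  simp [MonoidalCategory.tensorHom_def]

/-- The map `X_U ⟶ X_T` induced by a necklace map only depends on the underlying map on
vertices. -/
theorem necklaceMap_congr {T U : List ℕ} (d d' : Map T U)
    (h : ∀ i, i ≤ T.sum → FInt.val d.toHom i = FInt.val d'.toHom i) :
    X.necklaceMap d = X.necklaceMap d' := by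
  -- Two cuttings of the source over the first bead of the target differ by a middle necklace `S`.
  -- Both maps must send `S` to the joint at the end of that bead: one cutting puts it after the
  -- joint, the other before it. So `S` acts by a degenerate factor in either case and may be moved
  -- across the joint.
  have key : ∀ (U : List ℕ), (∀ {T : List ℕ} (d d' : Map T U),
      (∀ i, i ≤ T.sum → FInt.val d.toHom i = FInt.val d'.toHom i) →
        X.necklaceMap d = X.necklaceMap d') →
      ∀ (n : ℕ) (T₁ S T₂ : List ℕ) (f : total T₁ ⟶ FInt.mk n) (d : Map (S ++ T₂) U)
      (f' : total (T₁ ++ S) ⟶ FInt.mk n) (d' : Map T₂ U)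
      (_ : ∀ i, i ≤ T₁.sum + (S.sum + T₂.sum) → FInt.val (Map.cons T₁ f d).toHom i =
        FInt.val (Map.cons (T₁ ++ S) f' d').toHom i),
      X.necklaceMap (Map.cons (T₁ ++ S) f' d') ≫
        eqToHom (congrArg X.onNecklace (List.append_assoc T₁ S T₂)) =
          X.necklaceMap (Map.cons T₁ f d) := by
    intro U ih n T₁ S T₂ f d f' d' h
    obtain ⟨d'', h0, h1, h2⟩ := X.exists_absorb S d'
    have hf' : ∀ i, i ≤ T₁.sum → FInt.val f' i = FInt.val f i := fun i hi => by
      have := h i (by omega)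
      rwa [val_toHom_cons _ _ _ (by rw [List.sum_append]; omega),
        val_toHom_cons _ _ _ (by rw [List.sum_append]; omega), if_pos hi,
        if_pos (by rw [List.sum_append]; omega), eq_comm] at this
    have hfl : FInt.val f T₁.sum = n := FInt.val_of_le f (len_total T₁).le
    have hf'l : ∀ i, T₁.sum ≤ i → FInt.val f' i = n := fun i hi =>
      le_antisymm (FInt.val_le f' i) (by
        have := FInt.val_mono f' hi
        rwa [hf' _ le_rfl, hfl] at this)
    have hd : X.necklaceMap d = X.necklaceMap d'' := ih _ _ fun i hi => by
      rw [List.sum_append] at hi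
      have hi' := h (T₁.sum + i) (by omega)
      rw [val_toHom_cons _ _ _ (by rw [List.sum_append]; omega),
        val_toHom_cons _ _ _ (by rw [List.sum_append]; omega), List.sum_append] at hi'
      have hz := FInt.val_zero d.toHom
      by_cases h3 : i ≤ S.sum
      · rw [h0 i h3]
        rw [if_pos (show T₁.sum + i ≤ T₁.sum + S.sum by omega), hf'l _ (by omega)] at hi'
        by_cases h4 : i = 0
        · rw [h4, hz]
        · rw [if_neg (by omega), Nat.add_sub_cancel_left] at hi'
          omega
      · obtain ⟨k, rfl⟩ := Nat.exists_eq_add_of_le (le_of_not_ge h3)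
        rw [h1 k (by omega)]
        rw [if_neg (by omega), if_neg (by omega), Nat.add_sub_cancel_left,
          show T₁.sum + (S.sum + k) - (T₁.sum + S.sum) = k by omega] at hi'
        omega
    refine unique_aux (foldAppend_assoc X.lvl T₁ S T₂)
      (X.necklaceMap_cons_foldAppend (T₁ ++ S) f' d') (X.necklaceMap_cons_foldAppend T₁ f d)
      (X.map_iterComul_collapse_right T₁ S f f' ?_) ((congrArg (· ≫ _) hd).trans h2)
    refine toHom_ext fun i hi => ?_
    rw [List.sum_append] at hi
    refine Eq.trans ?_ (FInt.val_comp _ _ _).symm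
    rw [val_foldAppend_hom _ _ hi]
    refine Eq.trans ?_ (FInt.val_comp _ _ _).symm
    have h0 : FInt.val (toZero (total S)) (i - T₁.sum) = 0 :=
      Nat.le_zero.1 (FInt.val_le (toZero (total S)) _)
    have h5 : FInt.val f i ≤ n := FInt.val_le f _
    rw [FInt.val_tensorHom _ _ (by rw [len_total, len_total]; exact hi), len_total, h0,
      FInt.val_rightUnitor_hom _ (by split_ifs <;> simp [h5])]
    split_ifs with h6
    · exact hf' i h6
    · exact hf'l i (by omega)
  induction U generalizing T with
  | nil =>
    cases d
    cases d'
    rfl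
  | cons n U ih =>
    have aux : ∀ {T T' : List ℕ} (hT : T = T') (d : Map T (n :: U)) (d' : Map T' (n :: U))
        (_ : ∀ i, i ≤ T.sum → FInt.val d.toHom i = FInt.val d'.toHom i),
        X.necklaceMap d ≫ eqToHom (congrArg X.onNecklace hT) = X.necklaceMap d' := by
      intro T T' hT d d' h
      cases d with
      | @cons T₁ _ f T₂ _ d =>
      cases d' with
      | @cons T₁' _ f' T₂' _ d' =>
      -- Of the two initial parts of `T`, one is a prefix of the other, and the remainder is the
      -- necklace `S` of `key`.
      rcases List.append_eq_append_iff.1 hT with ⟨S, rfl, rfl⟩ | ⟨S, rfl, rfl⟩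
      · have := key U ih n T₁ S T₂' f d f' d' fun i hi => h i (by simpa using hi)
        rw [← this]
        simp
      · exact key U ih n T₁' S T₂ f' d' f d fun i hi => (h i (by simpa [add_assoc] using hi)).symm
    have := aux rfl d d' h
    rwa [eqToHom_refl, Category.comp_id] at this

theorem split_nil_aux {W : Type*} [Category W] [MonoidalCategory W] {u t : W} {z : 𝟙_ W ⟶ 𝟙_ W}
    (d : u ⟶ t) (h : z = 𝟙 _) : d ≫ (λ_ t).inv = (λ_ u).inv ≫ (z ⊗ₘ d) := by
  rw [h]
  simp

theorem split_cons_aux {W : Type*} [Category W] [MonoidalCategory W]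
    {n u₁ u₂ u A A' t₁ ta tb ts tas : W} {nm : n ⊗ u ⟶ A} {fa₁ : A ⟶ t₁ ⊗ ts} {f : n ⟶ t₁}
    {d : u ⟶ ts} {fb : ts ⟶ ta ⊗ tb} {fu : u ⟶ u₁ ⊗ u₂} {da : u₁ ⟶ ta} {db : u₂ ⟶ tb}
    {e : A' ⟶ A} {fa₃ : A' ⟶ tas ⊗ tb} {fa₄ : tas ⟶ t₁ ⊗ ta} {nm' : n ⊗ u₁ ⟶ tas}
    {e' : A ⟶ A'} (he : e ≫ e' = 𝟙 _) (he' : e' ≫ e = 𝟙 _)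
    (h : nm ≫ fa₁ = f ⊗ₘ d) (h₁ : d ≫ fb = fu ≫ (da ⊗ₘ db))
    (h₂ : e ≫ fa₁ ≫ t₁ ◁ fb = fa₃ ≫ fa₄ ▷ tb ≫ (α_ _ _ _).hom) (h₃ : nm' ≫ fa₄ = f ⊗ₘ da)
    [IsIso fa₄] :
    (nm ≫ e') ≫ fa₃ = (n ◁ fu ≫ (α_ _ _ _).inv) ≫ (nm' ⊗ₘ db) := by
  have : IsIso e := ⟨e', he, he'⟩
  rw [← cancel_mono (fa₄ ▷ tb), ← cancel_mono (α_ _ _ _).hom]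
  simp only [Category.assoc]
  rw [← h₂, reassoc_of% he', reassoc_of% h, tensorHom_comp_whiskerLeft, h₁,
    tensorHom_comp_whiskerRight_assoc, h₃]
  simp only [MonoidalCategory.tensorHom_def, Category.assoc, comp_whiskerRight,
    MonoidalCategory.whiskerLeft_comp, whisker_assoc, tensor_whiskerLeft, Iso.inv_hom_id_assoc,
    Iso.inv_hom_id, Category.comp_id]
  rw [← associator_inv_naturality_left_assoc, Iso.inv_hom_id_assoc, whisker_exchange_assoc]

/-- Necklace maps to a concatenation of two necklaces are concatenations. -/
theorem exists_split {T U : List ℕ} (d : Map T U) (U₁ U₂ : List ℕ) (hU : U = U₁ ++ U₂) :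
    ∃ (T₁ T₂ : List ℕ) (hT : T = T₁ ++ T₂) (d₁ : Map T₁ U₁) (d₂ : Map T₂ U₂),
      (∀ i, i ≤ T.sum → FInt.val d.toHom i = if i ≤ T₁.sum then FInt.val d₁.toHom i else
        U₁.sum + FInt.val d₂.toHom (i - T₁.sum)) ∧
      X.necklaceMap d ≫ eqToHom (congrArg X.onNecklace hT) ≫ (foldAppend X.lvl T₁ T₂).hom =
        eqToHom (congrArg X.onNecklace hU) ≫ (foldAppend X.lvl U₁ U₂).hom ≫
          (X.necklaceMap d₁ ⊗ₘ X.necklaceMap d₂) := by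
  induction U₁ generalizing T U with
  | nil =>
    obtain rfl : U₂ = U := hU.symm
    refine ⟨[], T, rfl, .nil [], d, fun i hi => ?_, ?_⟩
    · split_ifs with h
      · obtain rfl : i = 0 := by simpa using h
        rw [FInt.val_zero, FInt.val_zero]
      · simp
    · refine Eq.trans ?_ (Category.id_comp _).symm
      refine (congrArg (_ ≫ ·) (Category.id_comp _)).trans ?_
      exact split_nil_aux (X.necklaceMap d) X.necklaceMap_nil_self
  | cons n U₁ ih =>
    subst hU
    cases d with
    | @cons T₁ _ f T' _ d =>
    -- The part over the first bead stays in the left factor; only the map over the remaining beads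
    -- has to be split.
    obtain ⟨Ta, Tb, rfl, da, db, hv, hnm⟩ := ih d rfl
    refine ⟨T₁ ++ Ta, Tb, (List.append_assoc _ _ _).symm, .cons T₁ f da, db, fun i hi => ?_, ?_⟩
    · simp only [List.sum_append, List.sum_cons] at hi ⊢
      rw [val_toHom_cons _ _ _ (by simpa using hi)]
      by_cases h1 : i ≤ T₁.sum
      · rw [if_pos h1, if_pos (by omega), val_toHom_cons _ _ _ (by omega), if_pos h1]
      · rw [if_neg h1, hv _ (by simp only [List.sum_append]; omega)]
        by_cases h2 : i ≤ T₁.sum + Ta.sum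
        · rw [if_pos (by omega), if_pos h2, val_toHom_cons _ _ _ (by omega), if_neg h1]
        · rw [if_neg (by omega), if_neg h2, Nat.sub_sub, Nat.add_assoc]
    · refine Eq.trans ?_ (Category.id_comp _).symm
      refine (Category.assoc _ _ _).symm.trans ?_
      refine split_cons_aux (eqToHom_trans _ _) (eqToHom_trans _ _)
        (X.necklaceMap_cons_foldAppend T₁ f d)
        ((congrArg (_ ≫ ·) (Category.id_comp _).symm).trans (hnm.trans (Category.id_comp _)))
        (foldAppend_assoc X.lvl T₁ Ta Tb)
        (X.necklaceMap_cons_foldAppend T₁ f da)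

theorem comp_cons_aux {W : Type*} [Category W] [MonoidalCategory W]
    {n w u₁ u₂ a t t₁ t₂ U b : W} {e : n ⊗ w ⟶ U} {d : U ⟶ t} {fu : U ⟶ u₁ ⊗ u₂}
    {ft : t ⟶ t₁ ⊗ t₂} {f : n ⟶ a} {i : a ⟶ u₁} {e₂ : w ⟶ u₂} {d₁ : u₁ ⟶ t₁} {d₂ : u₂ ⟶ t₂}
    {c : n ⊗ w ⟶ t} {e₃ : w ⟶ t₂} {f' : a ⟶ b} {i' : b ⟶ t₁} {ff' : n ⟶ b}
    (h : e ≫ fu = (f ≫ i) ⊗ₘ e₂) (h₁ : d ≫ ft = fu ≫ (d₁ ⊗ₘ d₂)) (h₂ : c ≫ ft = (ff' ≫ i') ⊗ₘ e₃)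
    (h₃ : e₃ = e₂ ≫ d₂) (h₄ : i ≫ d₁ = f' ≫ i') (h₅ : f ≫ f' = ff') [IsIso ft] :
    c = e ≫ d := by
  rw [← cancel_mono ft, h₂, Category.assoc, h₁, reassoc_of% h, tensorHom_comp_tensorHom, h₃,
    Category.assoc, h₄, reassoc_of% h₅]

/-- Necklace maps are closed under composition. -/
theorem exists_comp {T U W : List ℕ} (e : Map U W) (d : Map T U) : ∃ c : Map T W,
    c.toHom = d.toHom ≫ e.toHom ∧ X.necklaceMap c = X.necklaceMap e ≫ X.necklaceMap d := by
  induction e generalizing T with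
  | nil U => exact ⟨.nil T, hom_zero_ext _ _, (X.nil_comp_necklaceMap d).symm⟩
  | @cons U₁ n f U₂ W e ih =>
    -- Cutting `d` where `e` is cut reduces the first bead to the naturality of iterated
    -- comultiplications and the rest to the induction hypothesis.
    obtain ⟨T₁, T₂, rfl, d₁, d₂, hv, hnm⟩ := X.exists_split d U₁ U₂ rfl
    obtain ⟨c, hc, hc'⟩ := ih d₂
    refine ⟨.cons T₁ (d₁.toHom ≫ f) c, ?_, ?_⟩
    · refine toHom_ext fun i hi => ?_
      have hd := FInt.val_le d.toHom i
      rw [len_total, List.sum_append] at hd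
      refine Eq.trans ?_ (FInt.val_comp _ _ _).symm
      rw [val_toHom_cons _ _ _ (by simpa using hi), val_toHom_cons _ _ _ hd, hv i hi, hc]
      have h1 := FInt.val_le d₁.toHom i
      have h2 : FInt.val f U₁.sum = n := FInt.val_of_le f (len_total U₁).le
      rw [len_total] at h1
      split_ifs with h3 h4
      · exact FInt.val_comp _ _ _
      · have h5 : FInt.val d₂.toHom (i - T₁.sum) = 0 := by omega
        rw [FInt.val_comp, h5, FInt.val_zero]
        simp [h2]
      · rw [FInt.val_comp, Nat.add_sub_cancel_left]
    · refine comp_cons_aux (X.necklaceMap_cons_foldAppend U₁ f e)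
        ((congrArg (_ ≫ ·) (Category.id_comp _).symm).trans (hnm.trans (Category.id_comp _)))
        (X.necklaceMap_cons_foldAppend T₁ (d₁.toHom ≫ f) c) hc' (X.iterComul_necklaceMap d₁)
        (X.fct.map_comp _ _).symm

end Templicial

/-! ### Joints of necklaces -/

namespace Necklace

/-- A necklace has a vertex at which a monotone function takes a given value, or a bead on which
it jumps over that value. -/
theorem exists_joint_or_bead (T : List ℕ) (g : ℕ → ℕ) (m : ℕ) (h0 : g 0 ≤ m) (h1 : m ≤ g T.sum) :
    (∃ T₁ T₂, T = T₁ ++ T₂ ∧ g T₁.sum = m) ∨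
      ∃ T₁ t T₂, T = T₁ ++ t :: T₂ ∧ g T₁.sum < m ∧ m < g (T₁.sum + t) := by
  induction T generalizing g with
  | nil => exact .inl ⟨[], [], rfl, le_antisymm h0 h1⟩
  | cons n T ih =>
    rcases h0.eq_or_lt with h0 | h0
    · exact .inl ⟨[], n :: T, rfl, h0⟩
    by_cases h2 : g n ≤ m
    · rcases ih (fun i => g (n + i)) h2 (by simpa using h1) with
        ⟨T₁, T₂, rfl, h⟩ | ⟨T₁, t, T₂, rfl, h, h'⟩
      · exact .inl ⟨n :: T₁, T₂, rfl, by simpa using h⟩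
      · exact .inr ⟨n :: T₁, t, T₂, rfl, by simpa using h, by simpa [add_assoc] using h'⟩
    · exact .inr ⟨[], n, T, rfl, h0, by simpa using h2⟩

/-- An endpoint preserving map underlies a necklace map if every joint of the target is the image
of a joint of the source. -/
theorem exists_map {T W : List ℕ} (f : total T ⟶ total W)
    (h : ∀ W₁ W₂, W = W₁ ++ W₂ → ∃ T₁ T₂, T = T₁ ++ T₂ ∧ FInt.val f T₁.sum = W₁.sum) :
    ∃ d : Map T W, d.toHom = f := by
  induction W generalizing T with
  | nil => exact ⟨.nil T, hom_zero_ext _ _⟩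
  | cons n W ih =>
    -- Cut the source at a joint lying over the end of the first bead of the target.
    obtain ⟨T₁, T₂, rfl, hT⟩ := h [n] W rfl
    have hT' : FInt.val f T₁.sum = n := by simpa using hT
    have hl : FInt.val f (T₁ ++ T₂).sum = n + W.sum := by
      have := FInt.val_of_le f (len_total (T₁ ++ T₂)).le
      rwa [len_total, List.sum_cons] at this
    rw [List.sum_append] at hl
    let f₁ : total T₁ ⟶ FInt.mk n := FInt.mk' (FInt.val f) (fun i j hij _ => FInt.val_mono f hij)
      (FInt.val_zero f) (by rw [len_total, hT'])
    let f₂ : total T₂ ⟶ total W := FInt.mk' (fun i => FInt.val f (T₁.sum + i) - n)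
      (fun i j hij _ => Nat.sub_le_sub_right (FInt.val_mono f (by omega)) n)
      (by simp [hT']) (by rw [len_total, len_total]; simp [hl])
    have hf₁ : ∀ i, i ≤ T₁.sum → FInt.val f₁ i = FInt.val f i :=
      fun i hi => FInt.val_mk' _ _ _ _ (by rwa [len_total])
    have hf₂ : ∀ i, i ≤ T₂.sum → FInt.val f₂ i = FInt.val f (T₁.sum + i) - n :=
      fun i hi => FInt.val_mk' _ _ _ _ (by rwa [len_total])
    obtain ⟨d, hd⟩ := ih f₂ fun W₁ W₂ hW => by
      obtain ⟨Ta, Tb, hab, hv⟩ := h (n :: W₁) W₂ (by rw [hW]; rfl)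
      rw [List.sum_cons] at hv
      rcases List.append_eq_append_iff.1 hab with ⟨S, rfl, rfl⟩ | ⟨S, rfl, rfl⟩
      · refine ⟨S, Tb, rfl, ?_⟩
        rw [List.sum_append] at hv
        rw [hf₂ _ (by simp), hv, Nat.add_sub_cancel_left]
      -- The joint found may lie in `T₁`. Its image is then at most `n`, so the prefix `W₁` has
      -- total length zero and the initial vertex of `T₂` serves instead.
      · refine ⟨[], _, rfl, ?_⟩
        have := FInt.val_mono f (show Ta.sum ≤ (Ta ++ S).sum by simp)
        have h0 : W₁.sum = 0 := by omega
        rw [h0]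
        exact FInt.val_zero f₂
    refine ⟨.cons T₁ f₁ d, toHom_ext fun i hi => ?_⟩
    rw [List.sum_append] at hi
    rw [val_toHom_cons _ _ _ hi, hd]
    split_ifs with h1
    · exact hf₁ i h1
    · rw [hf₂ _ (by omega), show T₁.sum + (i - T₁.sum) = i by omega]
      have := FInt.val_mono f (show T₁.sum ≤ i by omega)
      omega

/-- Every joint of the target of a necklace map is the image of a joint of the source. -/
theorem Map.exists_joint {T W : List ℕ} (d : Map T W) (W₁ W₂ : List ℕ) (hW : W = W₁ ++ W₂) :
    ∃ T₁ T₂, T = T₁ ++ T₂ ∧ FInt.val d.toHom T₁.sum = W₁.sum := by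
  induction d generalizing W₁ with
  | nil T =>
    refine ⟨[], T, rfl, ?_⟩
    obtain ⟨rfl, -⟩ := List.append_eq_nil_iff.1 hW.symm
    exact FInt.val_zero _
  | @cons T₁ n f T₂ U d ih =>
    rcases W₁ with _ | ⟨m, W₁⟩
    · exact ⟨[], _, rfl, FInt.val_zero _⟩
    · obtain ⟨rfl, hU⟩ := List.cons.inj hW
      obtain ⟨Ta, Tb, rfl, h⟩ := ih W₁ hU
      refine ⟨T₁ ++ Ta, Tb, by simp, ?_⟩
      rw [List.sum_append, val_toHom_cons _ _ _ (by simp), List.sum_cons]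
      have hl : FInt.val f T₁.sum = n := FInt.val_of_le f (len_total T₁).le
      split_ifs with h1
      · have h2 : Ta.sum = 0 := by omega
        rw [h2, FInt.val_zero] at h
        rw [h2, Nat.add_zero, hl]
        omega
      · rw [Nat.add_sub_cancel_left, h]

/-- A map on necklaces to a single bead. -/
theorem exists_map_singleton {T : List ℕ} {n : ℕ} (f : total T ⟶ FInt.mk n) :
    ∃ d : Map T [n], ∀ i, i ≤ T.sum → FInt.val d.toHom i = FInt.val f i := by
  let f' : total T ⟶ total [n] := f
  obtain ⟨d, hd⟩ := exists_map f' fun W₁ W₂ h => by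
    rcases W₁ with _ | ⟨m, W₁⟩
    · exact ⟨[], T, rfl, FInt.val_zero _⟩
    · refine ⟨T, [], by simp, ?_⟩
      obtain ⟨rfl, h'⟩ := List.cons.inj h
      obtain ⟨rfl, -⟩ := List.append_eq_nil_iff.1 h'.symm
      exact FInt.val_of_le f (len_total T).le
  exact ⟨d, fun i _ => congrArg (FInt.val · i) hd⟩

end Necklace

/-! ### Filling a horn from compatible elements on a cover -/

namespace Templicial

open Necklace

variable {V : Type u} [Category.{v} V] [MonoidalCategory V] [HasColimits V]
  [SymmetricCategory V] [MonoidalClosed V] (X : Templicial V)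

/-- Tensor products over lists end in the unit object, so the value on the necklace `[n]` is `X_n ⊗
𝟙_`. The final factor arises from splitting off `[0]`, where comultiplication and counit cancel. -/
theorem iterComul_singleton (n : ℕ) : X.iterComul [n] = (ρ_ (X.lvl n)).inv := by
  have h := X.map_rightUnitor_comul (FInt.mk n)
  have h1 : (ρ_ (FInt.mk n)).hom = 𝟙 (FInt.mk n) := FInt.hom_ext fun i hi =>
    (FInt.val_rightUnitor_hom _ hi).trans (FInt.val_id _ hi).symm
  have h2 : X.fct.map (ρ_ (FInt.mk n)).hom.op = 𝟙 (X.lvl n) := by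
    rw [h1]
    exact X.fct.map_id _
  rw [h2] at h
  have aux : ∀ {W : Type (max u v)} [Category.{v} W] [MonoidalCategory W] {x z : W} {δ : x ⟶ x ⊗ z}
      {η : z ⟶ 𝟙_ W} {η' : 𝟙_ W ⟶ z} (_ : 𝟙 x ≫ δ = (ρ_ x).inv ≫ x ◁ η') (_ : η' ≫ η = 𝟙 _),
      δ ≫ x ◁ η = (ρ_ x).inv := by
    intro W _ _ x z δ η η' h h'
    rw [← Category.id_comp δ, h, Category.assoc, ← MonoidalCategory.whiskerLeft_comp, h']
    simp
  exact aux h X.counitInv_counit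

theorem necklaceMap_cons_id (n : ℕ) {T U : List ℕ} (d : Map T U) :
    X.necklaceMap (Map.cons [n] (𝟙 (FInt.mk n)) d) = X.lvl n ◁ X.necklaceMap d := by
  have h := X.necklaceMap_cons_foldAppend [n] (𝟙 (FInt.mk n)) d
  have h1 : X.fct.map (𝟙 (FInt.mk n)).op ≫ X.iterComul [n] = (ρ_ (X.lvl n)).inv :=
    (congrArg (· ≫ X.iterComul [n]) (X.fct.map_id _)).trans
      ((Category.id_comp _).trans (X.iterComul_singleton n))
  have aux : ∀ {W : Type (max u v)} [Category.{v} W] [MonoidalCategory W] {x t u : W}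
      {nm : x ⊗ u ⟶ x ⊗ t} {d : u ⟶ t} (_ : nm ≫ (x ◁ (λ_ t).inv ≫ (α_ _ _ _).inv) =
        (ρ_ x).inv ⊗ₘ d), nm = x ◁ d := by
    intro W _ _ x t u nm d h
    rw [← cancel_mono (x ◁ (λ_ t).inv ≫ (α_ _ _ _).inv), h]
    simp [MonoidalCategory.tensorHom_def']
  exact aux (h.trans (congrArg (· ⊗ₘ X.necklaceMap d) h1))

/-- The identity necklace map. -/
theorem exists_id (T : List ℕ) : ∃ d : Map T T, d.toHom = 𝟙 _ ∧ X.necklaceMap d = 𝟙 _ := by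
  induction T with
  | nil => exact ⟨.nil [], hom_zero_ext _ _, X.necklaceMap_nil_self⟩
  | cons n T ih =>
    obtain ⟨d, hd, hd'⟩ := ih
    refine ⟨.cons [n] (𝟙 (FInt.mk n)) d, toHom_ext fun i hi => ?_, ?_⟩
    · refine Eq.trans ?_ (FInt.val_id _ (by rwa [len_total])).symm
      rw [List.sum_cons] at hi
      refine (val_toHom_cons [n] (𝟙 (FInt.mk n)) d (by simpa using hi)).trans ?_
      rw [List.sum_singleton]
      split_ifs with h
      · exact FInt.val_id _ h
      · rw [hd, FInt.val_id _ (by rw [len_total]; omega)]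
        omega
    · rw [necklaceMap_cons_id, hd', MonoidalCategory.whiskerLeft_id]
      rfl

/-- In a quasi-category in `V`, compatible elements on necklaces covering an inner horn are
restricted from a simplex. -/
theorem IsQuasiCategory.exists_filler {X : Templicial V} (hX : X.IsQuasiCategory) {n j : ℕ}
    (hj : 0 < j) (hjn : j < n) {ι : Type} (W : ι → List ℕ) (hW : ∀ i, ∀ t ∈ W i, 0 < t)
    (φ : ∀ i, total (W i) ⟶ FInt.mk n) (hφ : ∀ i, InHorn n j (W i) (φ i)) {a b : X.Ob}
    (w : ∀ i, 𝟙_ V ⟶ (X.onNecklace (W i)).obj a b)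
    (cover : ∀ (T : List ℕ) (f : total T ⟶ FInt.mk n), InHorn n j T f →
      ∃ (i : ι) (d : Map T (W i)), d.toHom ≫ φ i = f)
    (compat : ∀ (T : List ℕ) (i i' : ι) (d : Map T (W i)) (d' : Map T (W i')),
      d.toHom ≫ φ i = d'.toHom ≫ φ i' →
        w i ≫ (X.necklaceMap d).app a b = w i' ≫ (X.necklaceMap d').app a b) :
    ∃ x : 𝟙_ V ⟶ (X.lvl n).obj a b, ∀ i,
      x ≫ (X.fct.map (φ i).op ≫ X.iterComul (W i)).app a b = w i := by
  choose c d hd using cover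
  -- Every necklace in the horn gets the restriction of `w` along a chosen factorisation through the
  -- cover; `compat` removes the dependence on the choice and so gives naturality.
  let x : X.NecklaceFamily a b n (InHorn n j) :=
    { elt := fun T _ f hf => w (c T f hf) ≫ (X.necklaceMap (d T f hf)).app a b
      naturality := fun T U hT hU e f hf hdf => by
        obtain ⟨e', he, he'⟩ := X.exists_comp (d U f hf) e
        refine (Category.assoc _ _ _).trans ?_
        rw [← VQuiv.comp_app, ← he']
        refine compat _ _ _ _ _ ?_
        rw [he, Category.assoc, hd, hd] }
  obtain ⟨y, hy⟩ := hX a b n j hj hjn x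
  have hn : ∀ t ∈ [n], 0 < t := by
    intro t ht
    rw [List.mem_singleton] at ht
    omega
  let id' : total [n] ⟶ FInt.mk n := 𝟙 (FInt.mk n)
  -- The simplex is the value of the extension at the identity of the single bead, with the trailing
  -- unit factor removed.
  refine ⟨y.elt [n] hn id' trivial ≫ (ρ_ (X.lvl n)).hom.app a b, fun i => ?_⟩
  obtain ⟨e, he⟩ := exists_map_singleton (φ i)
  have he' : e.toHom ≫ id' = φ i := toHom_ext fun k hk =>
    (FInt.val_comp _ _ _).trans ((FInt.val_id (FInt.mk n) (FInt.val_le e.toHom k)).trans (he k hk))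
  have h1 := y.naturality (W i) [n] (hW i) hn e id' trivial trivial
  have h2 : y.elt (W i) (hW i) (e.toHom ≫ id') trivial = w i := by
    have h3 : InHorn n j (W i) (e.toHom ≫ id') := he' ▸ hφ i
    refine (hy _ _ _ h3).trans ?_
    obtain ⟨e₀, he₀, he₁⟩ := X.exists_id (W i)
    refine (compat _ _ i _ e₀ ?_).trans ?_
    · rw [hd, he₀, he', Category.id_comp]
    · rw [he₁]
      exact Category.comp_id _
  have h4 : X.iterComul [n] ≫ X.necklaceMap e = X.fct.map (φ i).op ≫ X.iterComul (W i) := by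
    rw [X.iterComul_necklaceMap e]
    exact congrArg (fun z : total (W i) ⟶ FInt.mk n => X.fct.map z.op ≫ X.iterComul (W i))
      (toHom_ext he)
  rw [← h4, iterComul_singleton]
  refine Eq.trans ?_ (h1.trans h2)
  have aux : ∀ {P Q R : VQuiv V X.Ob} (e : P ≅ Q) (g : P ⟶ R) (y : 𝟙_ V ⟶ P.obj a b),
      (y ≫ e.hom.app a b) ≫ (e.inv ≫ g).app a b = y ≫ g.app a b := by
    intro P Q R e g y
    rw [Category.assoc, ← VQuiv.comp_app, Iso.hom_inv_id_assoc]
  exact aux (ρ_ (X.lvl n)) (X.necklaceMap e) _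

end Templicial

/-! ### Necklaces with at most three beads -/

namespace Necklace

/-- A necklace map lies in a horn if every bead does. -/
theorem inHorn_pair {n j s t : ℕ} (f : total [s, t] ⟶ FInt.mk n)
    (hs : ∃ k, k ≤ n ∧ k ≠ j ∧ ∀ i, i ≤ s → FInt.val f i ≠ k)
    (ht : ∃ k, k ≤ n ∧ k ≠ j ∧ ∀ i, i ≤ t → FInt.val f (s + i) ≠ k) : InHorn n j [s, t] f := by
  rintro T₁ T₂ r hT
  rcases T₁ with _ | ⟨x, _ | ⟨y, _ | ⟨z, T₁⟩⟩⟩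
  · obtain ⟨rfl, -⟩ := List.cons.inj hT
    simpa using hs
  · obtain ⟨rfl, hT'⟩ := List.cons.inj hT
    obtain ⟨rfl, -⟩ := List.cons.inj hT'
    simpa using ht
  · simp at hT
  · simp at hT

theorem inHorn_singleton {n j s : ℕ} (f : total [s] ⟶ FInt.mk n)
    (hs : ∃ k, k ≤ n ∧ k ≠ j ∧ ∀ i, i ≤ s → FInt.val f i ≠ k) : InHorn n j [s] f := by
  rintro T₁ T₂ r hT
  rcases T₁ with _ | ⟨x, _ | ⟨y, T₁⟩⟩
  · obtain ⟨rfl, -⟩ := List.cons.inj hT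
    simpa using hs
  · simp at hT
  · simp at hT

theorem exists_map_pair {T : List ℕ} {s t : ℕ} (f : total T ⟶ total [s, t])
    (h : ∃ T₁ T₂, T = T₁ ++ T₂ ∧ FInt.val f T₁.sum = s) : ∃ d : Map T [s, t], d.toHom = f := by
  refine exists_map f fun W₁ W₂ hW => ?_
  rcases W₁ with _ | ⟨x, _ | ⟨y, _ | ⟨z, W₁⟩⟩⟩
  · exact ⟨[], T, rfl, FInt.val_zero _⟩
  · obtain ⟨rfl, -⟩ := List.cons.inj hW
    simpa using h
  · obtain ⟨rfl, hW'⟩ := List.cons.inj hW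
    obtain ⟨rfl, -⟩ := List.cons.inj hW'
    exact ⟨T, [], by simp, (FInt.val_of_le f (len_total T).le).trans (len_total _)⟩
  · simp at hW

theorem exists_map_triple {T : List ℕ} {s t r : ℕ} (f : total T ⟶ total [s, t, r])
    (h : ∃ T₁ T₂, T = T₁ ++ T₂ ∧ FInt.val f T₁.sum = s)
    (h' : ∃ T₁ T₂, T = T₁ ++ T₂ ∧ FInt.val f T₁.sum = s + t) :
    ∃ d : Map T [s, t, r], d.toHom = f := by
  refine exists_map f fun W₁ W₂ hW => ?_
  rcases W₁ with _ | ⟨x, _ | ⟨y, _ | ⟨z, _ | ⟨w, W₁⟩⟩⟩⟩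
  · exact ⟨[], T, rfl, FInt.val_zero _⟩
  · obtain ⟨rfl, -⟩ := List.cons.inj hW
    simpa using h
  · obtain ⟨rfl, hW'⟩ := List.cons.inj hW
    obtain ⟨rfl, -⟩ := List.cons.inj hW'
    simpa using h'
  · obtain ⟨rfl, hW'⟩ := List.cons.inj hW
    obtain ⟨rfl, hW''⟩ := List.cons.inj hW'
    obtain ⟨rfl, -⟩ := List.cons.inj hW''
    exact ⟨T, [], by simp, (FInt.val_of_le f (len_total T).le).trans (len_total _)⟩
  · simp at hW

theorem Map.exists_joint_pair {T : List ℕ} {s t : ℕ} (d : Map T [s, t]) :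
    ∃ T₁ T₂, T = T₁ ++ T₂ ∧ FInt.val d.toHom T₁.sum = s := by
  obtain ⟨T₁, T₂, h, h'⟩ := d.exists_joint [s] [t] rfl
  exact ⟨T₁, T₂, h, by simpa using h'⟩

/-- An inner horn contains a given map if it has a joint over the inner vertex. -/
theorem InHorn.exists_joint_or {n j : ℕ} {T : List ℕ} {f : total T ⟶ FInt.mk n}
    (h : InHorn n j T f) {m : ℕ} (hm : m ≤ n) :
    (∃ T₁ T₂, T = T₁ ++ T₂ ∧ FInt.val f T₁.sum = m) ∨
      ∃ T₁ t T₂, T = T₁ ++ t :: T₂ ∧ FInt.val f T₁.sum < m ∧ m < FInt.val f (T₁.sum + t) ∧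
        ∃ k, k ≤ n ∧ k ≠ j ∧ ∀ i, i ≤ t → FInt.val f (T₁.sum + i) ≠ k := by
  rcases exists_joint_or_bead T (FInt.val f) m (by rw [FInt.val_zero]; exact Nat.zero_le m)
    (by rw [FInt.val_of_le f (len_total T).le]; exact hm) with h1 | ⟨T₁, t, T₂, h1, h2, h3⟩
  · exact .inl h1
  · exact .inr ⟨T₁, t, T₂, h1, h2, h3, h T₁ T₂ t h1⟩

end Necklace

/-! ### Consequences of filling the horns `Λ^2_1` and `Λ^3_1` -/

namespace Templicial

open Necklace

variable {V : Type u} [Category.{v} V] [MonoidalCategory V] [HasColimits V]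
  [SymmetricCategory V] [MonoidalClosed V] {X : Templicial V}

theorem el_cancel_iso {S : Type v} {P Q : VQuiv V S} (e : P ⟶ Q) [IsIso e] {a b : S}
    {y z : 𝟙_ V ⟶ P.obj a b} (h : y ≫ e.app a b = z ≫ e.app a b) : y = z := by
  have h' := congrArg (· ≫ (inv e).app a b) h
  simp only [Category.assoc, ← VQuiv.comp_app, IsIso.hom_inv_id] at h'
  simpa using h'

theorem iterComul_pair (X : Templicial V) (s t : ℕ) :
    X.iterComul [s, t] = X.comul s t ≫ X.lvl s ◁ (ρ_ (X.lvl t)).inv :=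
  congrArg (X.comul s t ≫ X.lvl s ◁ ·) (X.iterComul_singleton t)

/-- In a quasi-category in `V`, composable edges have a composite. -/
theorem IsQuasiCategory.comul_elSurjective (hX : X.IsQuasiCategory) (a b : X.Ob) :
    ElSurjective ((X.comul 1 1).app a b) := by
  intro p
  let φ : total [1, 1] ⟶ FInt.mk 2 := 𝟙 (FInt.mk 2)
  have hφ : ∀ i, i ≤ 2 → FInt.val φ i = i := fun i hi => FInt.val_id (FInt.mk 2) hi
  -- For maps preserving the endpoints, `Λ^2_1` is covered by the one necklace 01 ∨ 12, whose beads
  -- miss 2 and 0 respectively.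
  obtain ⟨x, hx⟩ := hX.exists_filler (n := 2) (j := 1) one_pos one_lt_two (fun _ : Unit => [1, 1])
    (by simp) (fun _ => φ) (fun _ => inHorn_pair φ
      ⟨2, le_rfl, by omega, fun i hi => by rw [hφ _ (by omega)]; omega⟩
      ⟨0, by omega, by omega, fun i hi => by rw [hφ _ (by omega)]; omega⟩)
    (fun _ => p ≫ (X.lvl 1 ◁ (ρ_ (X.lvl 1)).inv).app a b)
    (fun T f hf => by
      -- A bead jumping over 1 runs from 0 to 2, so the only vertex it can miss is 1, which the horn
      -- does not allow. Hence there is a joint over 1.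
      rcases hf.exists_joint_or one_le_two with h | ⟨T₁, t, T₂, rfl, h1, h2, k, hk, hk', h3⟩
      · obtain ⟨d, hd⟩ := exists_map_pair (s := 1) (t := 1) f h
        exact ⟨(), d, by rw [hd]; exact Category.comp_id f⟩
      · have h4 := h3 0 (Nat.zero_le _)
        have h5 := h3 t le_rfl
        have h6 : FInt.val f (T₁.sum + t) ≤ 2 := FInt.val_le f _
        rw [Nat.add_zero] at h4
        omega)
    (fun T _ _ d d' h => by
      have h' : d.toHom = d'.toHom :=
        (Category.comp_id d.toHom).symm.trans (h.trans (Category.comp_id d'.toHom))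
      rw [X.necklaceMap_congr d d' fun i _ => by rw [h']])
  refine ⟨x, ?_⟩
  have h1 := hx ()
  have h2 : X.fct.map φ.op ≫ X.iterComul [1, 1] = X.comul 1 1 ≫ X.lvl 1 ◁ (ρ_ (X.lvl 1)).inv :=
    (congrArg (· ≫ X.iterComul [1, 1]) (X.fct.map_id _)).trans
      ((Category.id_comp _).trans (X.iterComul_pair 1 1))
  have h3 : x ≫ (X.comul 1 1 ≫ X.lvl 1 ◁ (ρ_ (X.lvl 1)).inv).app a b =
      p ≫ (X.lvl 1 ◁ (ρ_ (X.lvl 1)).inv).app a b :=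
    (congrArg (fun z : X.lvl 2 ⟶ X.onNecklace [1, 1] => x ≫ z.app a b) h2).symm.trans h1
  exact el_cancel_iso (X.lvl 1 ◁ (ρ_ (X.lvl 1)).inv) ((Category.assoc _ _ _).trans h3)

theorem rightUnitor_inv_necklaceMap (X : Templicial V) {T : List ℕ} {n : ℕ} (d : Map T [n])
    (f : total T ⟶ FInt.mk n) (h : ∀ i, i ≤ T.sum → FInt.val d.toHom i = FInt.val f i) :
    (ρ_ (X.lvl n)).inv ≫ X.necklaceMap d = X.fct.map f.op ≫ X.iterComul T := by
  have h1 := X.iterComul_necklaceMap d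
  rw [X.iterComul_singleton] at h1
  exact h1.trans (congrArg (fun z : total T ⟶ FInt.mk n => X.fct.map z.op ≫ X.iterComul T)
    (toHom_ext h))

theorem tensor_singleton_aux {W : Type*} [Category W] [MonoidalCategory W] {x y : W}
    {μ : x ⟶ y ⊗ y} {nm : x ⊗ (y ⊗ 𝟙_ W) ⟶ y ⊗ (y ⊗ (y ⊗ 𝟙_ W))} {i : x ⟶ y ⊗ (y ⊗ 𝟙_ W)}
    (h : nm ≫ (y ◁ (y ◁ (λ_ _).inv ≫ (α_ _ _ _).inv) ≫ (α_ _ _ _).inv) = i ⊗ₘ 𝟙 (y ⊗ 𝟙_ W))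
    (hi : i = μ ≫ y ◁ (ρ_ y).inv) :
    x ◁ (ρ_ y).inv ≫ nm = (μ ▷ y ≫ (α_ _ _ _).hom) ≫ y ◁ y ◁ (ρ_ y).inv := by
  rw [← cancel_mono (y ◁ (y ◁ (λ_ (y ⊗ 𝟙_ W)).inv ≫ (α_ _ _ _).inv) ≫ (α_ _ _ _).inv),
    Category.assoc, h, hi]
  monoidal

/-- Two members of a cover meet in a smaller necklace `R`. Elements that agree there agree on every
necklace whose maps to both members factor through `R`. -/
theorem el_square_aux {S : Type v} {P P' Q Q' R R₀ N : VQuiv V S} {a b : S} {x : 𝟙_ V ⟶ P.obj a b}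
    {z : 𝟙_ V ⟶ Q.obj a b} {r : P ⟶ P'} {n₀ : P' ⟶ R} {n : R ⟶ N} {s : Q ⟶ Q'} {m₀ : Q' ⟶ R}
    {μ : P ⟶ R₀} {ν : Q ⟶ R₀} {k : R₀ ⟶ R} {d : P' ⟶ N} {d' : Q' ⟶ N} (h₁ : r ≫ n₀ = μ ≫ k)
    (h₂ : s ≫ m₀ = ν ≫ k) (h : x ≫ μ.app a b = z ≫ ν.app a b) (hd : d = n₀ ≫ n)
    (hd' : d' = m₀ ≫ n) : (x ≫ r.app a b) ≫ d.app a b = (z ≫ s.app a b) ≫ d'.app a b := by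
  rw [Category.assoc, Category.assoc, ← VQuiv.comp_app, ← VQuiv.comp_app, hd, hd',
    reassoc_of% h₁, reassoc_of% h₂, VQuiv.comp_app, VQuiv.comp_app, reassoc_of% h]
  rfl

/-- In a quasi-category in `V`, three faces of a tetrahedron with a compatible splitting
determine a fourth one. -/
theorem IsQuasiCategory.exists_face (hX : X.IsQuasiCategory) {a b : X.Ob}
    (x : 𝟙_ V ⟶ (X.lvl 2).obj a b) (y : 𝟙_ V ⟶ (X.lvl 2 ⊗ X.lvl 1).obj a b)
    (z : 𝟙_ V ⟶ (X.lvl 1 ⊗ X.lvl 2).obj a b)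
    (hyz : y ≫ (X.comul 1 1 ▷ X.lvl 1 ≫ (α_ _ _ _).hom).app a b =
      z ≫ (X.lvl 1 ◁ X.comul 1 1).app a b)
    (hzx : z ≫ (X.lvl 1 ◁ X.restr SSetAux.d₁).app a b = x ≫ (X.comul 1 1).app a b) :
    ∃ x' : 𝟙_ V ⟶ (X.lvl 2).obj a b,
      x' ≫ (X.comul 1 1).app a b = y ≫ (X.restr SSetAux.d₁ ▷ X.lvl 1).app a b ∧
      x' ≫ (X.restr SSetAux.d₁).app a b = x ≫ (X.restr SSetAux.d₁).app a b := by
  -- The face 013.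
  let f : FInt.mk 2 ⟶ FInt.mk 3 := FInt.mk' (fun i => if i ≤ 1 then i else 3)
    (fun i j hij hj => by have : j ≤ 2 := hj; split_ifs <;> omega) rfl rfl
  have hf : ∀ i, i ≤ 2 → FInt.val f i = if i ≤ 1 then i else 3 := fun i hi =>
    FInt.val_mk' _ _ _ _ hi
  have hid : ∀ i, i ≤ 3 → FInt.val (𝟙 (FInt.mk 3)) i = i := fun i hi => FInt.val_id (FInt.mk 3) hi
  -- The horn `Λ^3_1` is covered by the triangle 013 and the necklaces 012 ∨ 23 and 01 ∨ 123, which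
  -- carry `x`, `y` and `z`.
  let W : Option Bool → List ℕ := fun i => match i with
    | none => [2]
    | some false => [2, 1]
    | some true => [1, 2]
  let φ : ∀ i, total (W i) ⟶ FInt.mk 3 := fun i => match i with
    | none => f
    | some false => 𝟙 (FInt.mk 3)
    | some true => 𝟙 (FInt.mk 3)
  let w : ∀ i, 𝟙_ V ⟶ (X.onNecklace (W i)).obj a b := fun i => match i with
    | none => x ≫ (ρ_ (X.lvl 2)).inv.app a b
    | some false => y ≫ (X.lvl 2 ◁ (ρ_ (X.lvl 1)).inv).app a b
    | some true => z ≫ (X.lvl 1 ◁ (ρ_ (X.lvl 2)).inv).app a b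
  -- The triangle 013 and 01 ∨ 123 meet in 01 ∨ 13, where the elements agree by `hzx`.
  have c02 : ∀ (T : List ℕ) (d : Map T [2]) (d' : Map T [1, 2]), d.toHom ≫ f = d'.toHom →
      w none ≫ (X.necklaceMap d).app a b = w (some true) ≫ (X.necklaceMap d').app a b := by
    intro T d d' h
    have h3 : ∀ i, FInt.val f (FInt.val d.toHom i) = FInt.val d'.toHom i := fun i =>
      (FInt.val_comp _ _ _).symm.trans (congrArg (FInt.val · i) h)
    have h2 : ∀ i, FInt.val d.toHom i ≤ 2 := fun i => FInt.val_le d.toHom i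
    obtain ⟨T₁, T₂, hT, h1⟩ := d'.exists_joint_pair
    have h4 : FInt.val d.toHom T₁.sum = 1 := by
      have h5 := h3 T₁.sum
      rw [h1, hf _ (h2 _)] at h5
      split_ifs at h5
      · exact h5
      · omega
    obtain ⟨e, he⟩ := exists_map_pair (s := 1) (t := 1) (show total T ⟶ total [1, 1] from d.toHom)
      ⟨T₁, T₂, hT, h4⟩
    have he' : ∀ i, FInt.val e.toHom i = FInt.val d.toHom i := fun i => congrArg (FInt.val · i) he
    obtain ⟨c, hc⟩ := exists_map_singleton (T := [1, 1]) (n := 2) (𝟙 (FInt.mk 2))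
    obtain ⟨c', hc'⟩ := exists_map_singleton (T := [1]) (n := 2) SSetAux.d₁
    obtain ⟨p, hp, hp'⟩ := X.exists_comp c e
    obtain ⟨p₂, hp₂, hp₂'⟩ := X.exists_comp (Map.cons [1] (𝟙 (FInt.mk 1)) c') e
    have k1 := (X.rightUnitor_inv_necklaceMap c (𝟙 (FInt.mk 2)) hc).trans
      ((congrArg (· ≫ X.iterComul [1, 1]) (X.fct.map_id _)).trans
        ((Category.id_comp _).trans (X.iterComul_pair 1 1)))
    have k2 := (X.rightUnitor_inv_necklaceMap c' SSetAux.d₁ hc').trans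
      (congrArg (X.restr SSetAux.d₁ ≫ ·) (X.iterComul_singleton 1))
    have k3 : X.lvl 1 ◁ (ρ_ (X.lvl 2)).inv ≫ X.necklaceMap (Map.cons [1] (𝟙 (FInt.mk 1)) c') =
        X.lvl 1 ◁ X.restr SSetAux.d₁ ≫ X.lvl 1 ◁ (ρ_ (X.lvl 1)).inv :=
      (congrArg (X.lvl 1 ◁ (ρ_ (X.lvl 2)).inv ≫ ·) (X.necklaceMap_cons_id 1 c')).trans
        ((MonoidalCategory.whiskerLeft_comp _ _ _).symm.trans
          ((congrArg (X.lvl 1 ◁ ·) k2).trans (MonoidalCategory.whiskerLeft_comp _ _ _)))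
    refine el_square_aux k1 k3 hzx.symm ((X.necklaceMap_congr d p fun i _ => ?_).trans hp')
      ((X.necklaceMap_congr d' p₂ fun i _ => ?_).trans hp₂')
    · rw [hp, FInt.val_comp, he', hc _ (h2 i)]
      exact (FInt.val_id (FInt.mk 2) (h2 i)).symm
    · rw [hp₂, FInt.val_comp, he', ← h3, hf _ (h2 i)]
      refine Eq.trans ?_ (val_toHom_cons [1] (𝟙 (FInt.mk 1)) c' (h2 i)).symm
      rw [List.sum_singleton]
      split_ifs with h5
      · exact (FInt.val_id (FInt.mk 1) h5).symm
      · rw [show FInt.val d.toHom i - 1 = 1 by have := h2 i; omega, hc' 1 le_rfl]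
        rfl
  -- The two necklaces with two beads meet in the spine 01 ∨ 12 ∨ 23, where the elements agree by
  -- `hyz`.
  have c12 : ∀ (T : List ℕ) (d : Map T [2, 1]) (d' : Map T [1, 2]), d.toHom = d'.toHom →
      w (some false) ≫ (X.necklaceMap d).app a b = w (some true) ≫ (X.necklaceMap d').app a b := by
    intro T d d' h
    have h2 : ∀ i, FInt.val d.toHom i ≤ 3 := fun i => FInt.val_le d.toHom i
    have h3 : ∀ i, FInt.val d.toHom i = FInt.val d'.toHom i := fun i => congrArg (FInt.val · i) h
    obtain ⟨T₁, T₂, hT, h1⟩ := d.exists_joint_pair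
    obtain ⟨T₁', T₂', hT', h1'⟩ := d'.exists_joint_pair
    obtain ⟨e, he⟩ := exists_map_triple (s := 1) (t := 1) (r := 1)
      (show total T ⟶ total [1, 1, 1] from d.toHom) ⟨T₁', T₂', hT', (h3 _).trans h1'⟩
      ⟨T₁, T₂, hT, h1⟩
    have he' : ∀ i, FInt.val e.toHom i = FInt.val d.toHom i := fun i => congrArg (FInt.val · i) he
    obtain ⟨c, hc⟩ := exists_map_singleton (T := [1, 1]) (n := 2) (𝟙 (FInt.mk 2))
    obtain ⟨c', hc', hc''⟩ := X.exists_id [1]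
    have hid2 : ∀ i, i ≤ 2 → FInt.val (𝟙 (FInt.mk 2)) i = i := fun i hi =>
      FInt.val_id (FInt.mk 2) hi
    let i2 : total [1, 1] ⟶ FInt.mk 2 := 𝟙 (FInt.mk 2)
    obtain ⟨p, hp, hp'⟩ := X.exists_comp (Map.cons [1, 1] i2 c') e
    obtain ⟨p₂, hp₂, hp₂'⟩ := X.exists_comp (Map.cons [1] (𝟙 (FInt.mk 1)) c) e
    have k0 : X.fct.map i2.op ≫ X.iterComul [1, 1] = X.comul 1 1 ≫ X.lvl 1 ◁ (ρ_ (X.lvl 1)).inv :=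
      (congrArg (· ≫ X.iterComul [1, 1]) (X.fct.map_id _)).trans
        ((Category.id_comp _).trans (X.iterComul_pair 1 1))
    have k1 := tensor_singleton_aux ((X.necklaceMap_cons_foldAppend [1, 1] i2 c').trans
      (congrArg (_ ⊗ₘ ·) hc'')) k0
    have k2 := (X.rightUnitor_inv_necklaceMap c i2 hc).trans k0
    have k3 : X.lvl 1 ◁ (ρ_ (X.lvl 2)).inv ≫ X.necklaceMap (Map.cons [1] (𝟙 (FInt.mk 1)) c) =
        X.lvl 1 ◁ X.comul 1 1 ≫ X.lvl 1 ◁ X.lvl 1 ◁ (ρ_ (X.lvl 1)).inv :=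
      (congrArg (X.lvl 1 ◁ (ρ_ (X.lvl 2)).inv ≫ ·) (X.necklaceMap_cons_id 1 c)).trans
        ((MonoidalCategory.whiskerLeft_comp _ _ _).symm.trans
          ((congrArg (X.lvl 1 ◁ ·) k2).trans (MonoidalCategory.whiskerLeft_comp _ _ _)))
    refine el_square_aux k1 k3 hyz ((X.necklaceMap_congr d p fun i _ => ?_).trans hp')
      ((X.necklaceMap_congr d' p₂ fun i _ => ?_).trans hp₂')
    · rw [hp, FInt.val_comp, he']
      refine Eq.trans ?_ (val_toHom_cons [1, 1] i2 c' (h2 i)).symm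
      rw [show [1, 1].sum = 2 from rfl]
      split_ifs with h5
      · exact (hid2 _ h5).symm
      · have h6 := h2 i
        rw [hc', FInt.val_id _ (by rw [len_total]; change _ ≤ 1; omega)]
        omega
    · rw [hp₂, FInt.val_comp, he', ← h3]
      refine Eq.trans ?_ (val_toHom_cons [1] (𝟙 (FInt.mk 1)) c (h2 i)).symm
      rw [List.sum_singleton]
      split_ifs with h5
      · exact (FInt.val_id (FInt.mk 1) h5).symm
      · have h6 := h2 i
        have h7 : FInt.val d.toHom i - 1 ≤ 2 := by omega
        have h8 := (hc _ h7).trans (hid2 _ h7)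
        omega
  -- There is no overlap here: a map to 012 ∨ 23 has a joint over 2, and 013 does not contain 2.
  have c01 : ∀ (T : List ℕ) (d : Map T [2]) (d' : Map T [2, 1]), d.toHom ≫ f = d'.toHom →
      False := by
    intro T d d' h
    obtain ⟨T₁, T₂, rfl, h1⟩ := d'.exists_joint_pair
    have h2 : FInt.val d.toHom T₁.sum ≤ 2 := FInt.val_le d.toHom _
    have h3 : FInt.val f (FInt.val d.toHom T₁.sum) = FInt.val d'.toHom T₁.sum :=
      (FInt.val_comp _ _ _).symm.trans (congrArg (FInt.val · T₁.sum) h)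
    rw [h1, hf _ h2] at h3
    split_ifs at h3 <;> omega
  obtain ⟨v, hv⟩ := hX.exists_filler (n := 3) (j := 1) one_pos (by omega) W
    (by rintro (_ | _ | _) <;> simp [W]) φ
    (by
      rintro (_ | _ | _)
      · exact inHorn_singleton _ ⟨2, by omega, by omega, fun i hi => by
          rw [show FInt.val (φ none) i = _ from hf i hi]; split_ifs <;> omega⟩
      · exact inHorn_pair _
          ⟨3, by omega, by omega, fun i hi => by
            rw [show FInt.val (φ (some false)) i = _ from hid i (by omega)]; omega⟩
          ⟨0, by omega, by omega, fun i hi => by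
            rw [show FInt.val (φ (some false)) (2 + i) = _ from hid _ (by omega)]; omega⟩
      · exact inHorn_pair _
          ⟨3, by omega, by omega, fun i hi => by
            rw [show FInt.val (φ (some true)) i = _ from hid i (by omega)]; omega⟩
          ⟨0, by omega, by omega, fun i hi => by
            rw [show FInt.val (φ (some true)) (1 + i) = _ from hid _ (by omega)]; omega⟩) w
    (by
      intro T g hg
      -- A joint over 1 gives a factorisation through 01 ∨ 123, and a joint over 2 one through 012 ∨
      -- 23. Without either, the map factors through 013.
      rcases hg.exists_joint_or (m := 1) (by omega) with h | ⟨T₁, t, T₂, hT, h1, h2, k, hk, hk', h3⟩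
      · obtain ⟨d, hd⟩ := exists_map_pair (s := 1) (t := 2) (show total T ⟶ total [1, 2] from g) h
        exact ⟨some true, d, (Category.comp_id _).trans hd⟩
      by_cases h : ∃ T₁ T₂, T = T₁ ++ T₂ ∧ FInt.val g T₁.sum = 2
      · obtain ⟨d, hd⟩ := exists_map_pair (s := 2) (t := 1) (show total T ⟶ total [2, 1] from g) h
        exact ⟨some false, d, (Category.comp_id _).trans hd⟩
      have hle : ∀ i, FInt.val g i ≤ 3 := fun i => FInt.val_le g i
      have h4 := h3 0 (Nat.zero_le _)
      have h5 := h3 t le_rfl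
      rw [Nat.add_zero] at h4
      have h6 : FInt.val g (T₁.sum + t) ≠ 2 := fun h' => h ⟨T₁ ++ [t], T₂, by simp [hT],
        by simpa using h'⟩
      have h7 := hle (T₁.sum + t)
      -- The bead starts at 0 and, having no joint over 2 at its end, stops at 3; the vertex it
      -- misses differs from 1, so it is 2. The remaining beads lie over 0 or 3, hence the whole map
      -- avoids 2.
      obtain rfl : k = 2 := by omega
      have h8 : ∀ i, FInt.val g i ≠ 2 := by
        intro i hi
        rcases le_total i T₁.sum with h9 | h9
        · have := FInt.val_mono g h9
          omega
        · obtain ⟨s, rfl⟩ := Nat.exists_eq_add_of_le h9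
          rcases le_total s t with h10 | h10
          · exact h3 s h10 hi
          · have := FInt.val_mono g (show T₁.sum + t ≤ T₁.sum + s by omega)
            omega
      let g' : total T ⟶ FInt.mk 2 := FInt.mk' (fun i => min (FInt.val g i) 2)
        (fun i j hij _ => min_le_min_right 2 (FInt.val_mono g hij)) (by simp [FInt.val_zero])
        (by rw [FInt.val_of_le g le_rfl]; rfl)
      obtain ⟨d, hd⟩ := exists_map_singleton g'
      refine ⟨none, d, toHom_ext fun i hi => ?_⟩
      rw [FInt.val_comp, hd i hi, show FInt.val g' i = _ from
        FInt.val_mk' _ _ _ _ (by rwa [len_total])]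
      refine (hf _ (min_le_right _ _)).trans ?_
      have h9 := h8 i
      have h10 := hle i
      split_ifs <;> omega)
    (by
      have hcongr : ∀ (T U : List ℕ) (d d' : Map T U) (v : 𝟙_ V ⟶ (X.onNecklace U).obj a b),
          (∀ i, i ≤ T.sum → FInt.val d.toHom i = FInt.val d'.toHom i) →
          v ≫ (X.necklaceMap d).app a b = v ≫ (X.necklaceMap d').app a b :=
        fun T U d d' v h => by rw [X.necklaceMap_congr d d' h]
      rintro T (_ | _ | _) (_ | _ | _) d d' h
      · refine hcongr T [2] d d' _ fun i _ => ?_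
        have h1 : FInt.val d.toHom i ≤ 2 := FInt.val_le d.toHom i
        have h2 : FInt.val d'.toHom i ≤ 2 := FInt.val_le d'.toHom i
        have h3 : FInt.val f (FInt.val d.toHom i) = FInt.val f (FInt.val d'.toHom i) :=
          (FInt.val_comp _ _ _).symm.trans ((congrArg (FInt.val · i) h).trans (FInt.val_comp _ _ _))
        rw [hf _ h1, hf _ h2] at h3
        split_ifs at h3 <;> omega
      · exact (c01 T d d' (h.trans (Category.comp_id _))).elim
      · exact c02 T d d' (h.trans (Category.comp_id _))
      · exact (c01 T d' d (h.symm.trans (Category.comp_id _))).elim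
      · exact hcongr T [2, 1] d d' _ fun i _ => congrArg (FInt.val · i)
          ((Category.comp_id _).symm.trans (h.trans (Category.comp_id _)))
      · exact c12 T d d' ((Category.comp_id _).symm.trans (h.trans (Category.comp_id _)))
      · exact (c02 T d' d (h.symm.trans (Category.comp_id _))).symm
      · exact (c12 T d' d ((Category.comp_id _).symm.trans (h.symm.trans (Category.comp_id _)))).symm
      · exact hcongr T [1, 2] d d' _ fun i _ => congrArg (FInt.val · i)
          ((Category.comp_id _).symm.trans (h.trans (Category.comp_id _))))
  have v0 : v ≫ (X.restr f).app a b = x := by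
    refine el_cancel_iso (ρ_ (X.lvl 2)).inv ?_
    refine Eq.trans ?_ (hv none)
    refine (Category.assoc _ _ _).trans ?_
    exact congrArg (fun z : X.lvl 2 ⟶ X.onNecklace [2] => v ≫ (X.restr f ≫ z).app a b)
      (X.iterComul_singleton 2).symm
  have v1 : v ≫ (X.comul 2 1).app a b = y := by
    refine el_cancel_iso (X.lvl 2 ◁ (ρ_ (X.lvl 1)).inv) ?_
    refine Eq.trans ?_ (hv (some false))
    refine (Category.assoc _ _ _).trans ?_
    refine congrArg (fun z : X.lvl 3 ⟶ X.onNecklace [2, 1] => v ≫ z.app a b)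
      (Eq.trans (X.iterComul_pair 2 1).symm ?_)
    exact (Category.id_comp _).symm.trans (congrArg (· ≫ X.iterComul [2, 1]) (X.fct.map_id _).symm)
  -- The face 023. It is composition on the first two edges of the tetrahedron, which yields its
  -- comultiplication; its long edge 03 is shared with the face 013.
  let δ : FInt.mk 2 ⟶ FInt.mk 3 := SSetAux.d₁ ⊗ₘ 𝟙 (FInt.mk 1)
  refine ⟨v ≫ (X.restr δ).app a b, ?_, ?_⟩
  · have h1 : X.restr δ ≫ X.comul 1 1 = X.comul 2 1 ≫ X.restr SSetAux.d₁ ▷ X.lvl 1 :=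
      (X.comul_natural SSetAux.d₁ (𝟙 (FInt.mk 1))).trans (congrArg (X.comul 2 1 ≫ ·)
        ((congrArg (X.restr SSetAux.d₁ ⊗ₘ ·) (X.fct.map_id _)).trans (tensorHom_id _ _)))
    rw [← v1]
    refine (Category.assoc _ _ _).trans ?_
    exact (congrArg (fun z : X.lvl 3 ⟶ X.lvl 1 ⊗ X.lvl 1 => v ≫ z.app a b) h1).trans
      (Category.assoc _ _ _).symm
  · have h1 : X.restr δ ≫ X.restr SSetAux.d₁ = X.restr f ≫ X.restr SSetAux.d₁ :=
      (X.fct.map_comp _ _).symm.trans ((congrArg (fun z : FInt.mk 1 ⟶ FInt.mk 3 => X.fct.map z.op)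
        (FInt.hom_mk_one_ext (SSetAux.d₁ ≫ δ) (SSetAux.d₁ ≫ f))).trans (X.fct.map_comp _ _))
    rw [← v0]
    refine (Category.assoc _ _ _).trans ?_
    exact (congrArg (fun z : X.lvl 3 ⟶ X.lvl 1 => v ≫ z.app a b) h1).trans
      (Category.assoc _ _ _).symm

end Templicial

/-! ### Necklaces over an interval, and inner faces -/

namespace Necklace

/-- The identification of the vertices of a necklace with an interval. -/
def totalHom (T : List ℕ) {n : ℕ} (h : T.sum = n) : total T ⟶ FInt.mk n :=
  eqToHom (FInt.ext_len ((len_total T).trans h))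

theorem val_totalHom (T : List ℕ) {n : ℕ} (h : T.sum = n) {i : ℕ} (hi : i ≤ n) :
    FInt.val (totalHom T h) i = i :=
  FInt.val_eqToHom _ (by rwa [len_total, h])

instance (T : List ℕ) {n : ℕ} (h : T.sum = n) : IsIso (totalHom T h) := by
  unfold totalHom
  infer_instance

/-- A necklace map to a necklace with two beads is given by a map with a joint over the joint of
the target. -/
theorem exists_map_pair_comp {T : List ℕ} {n k l : ℕ} (hkl : [k, l].sum = n)
    (f : total T ⟶ FInt.mk n) (h : ∃ T₁ T₂, T = T₁ ++ T₂ ∧ FInt.val f T₁.sum = k) :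
    ∃ d : Map T [k, l], d.toHom ≫ totalHom [k, l] hkl = f := by
  obtain ⟨T₁, T₂, hT, h⟩ := h
  obtain ⟨d, hd⟩ := exists_map_pair (f ≫ inv (totalHom [k, l] hkl)) ⟨T₁, T₂, hT, by
    have h1 : inv (totalHom [k, l] hkl) = eqToHom (FInt.ext_len ((len_total _).trans hkl)).symm := by
      unfold totalHom
      exact inv_eqToHom _
    rw [FInt.val_comp, h1, FInt.val_eqToHom _ (FInt.val_le f _), h]⟩
  exact ⟨d, by rw [hd, Category.assoc, IsIso.inv_hom_id, Category.comp_id]⟩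

theorem exists_map_singleton_comp {T : List ℕ} {m n : ℕ} (hm : [m].sum = m) (g : total T ⟶ FInt.mk m)
    (δ : FInt.mk m ⟶ FInt.mk n) (f : total T ⟶ FInt.mk n)
    (h : ∀ i, i ≤ T.sum → FInt.val δ (FInt.val g i) = FInt.val f i) :
    ∃ d : Map T [m], (∀ i, i ≤ T.sum → FInt.val d.toHom i = FInt.val g i) ∧
      d.toHom ≫ totalHom [m] hm ≫ δ = f := by
  obtain ⟨d, hd⟩ := exists_map_singleton g
  refine ⟨d, hd, toHom_ext fun i hi => ?_⟩
  have h1 : FInt.val g i ≤ m := FInt.val_le g i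
  rw [FInt.val_comp, FInt.val_comp, hd i hi, val_totalHom _ _ h1, h i hi]

/-- The map skipping the vertex `k`. -/
def face (n k : ℕ) (h0 : 0 < k) (hk : k < n + 1) : FInt.mk n ⟶ FInt.mk (n + 1) :=
  FInt.mk' (fun i => if i < k then i else i + 1) (fun i j _ _ => by split_ifs <;> omega)
    (if_pos h0) (by
      change (if n < k then n else n + 1) = n + 1
      rw [if_neg (by omega)])

theorem val_face (n k : ℕ) (h0 : 0 < k) (hk : k < n + 1) {i : ℕ} (hi : i ≤ n) :
    FInt.val (face n k h0 hk) i = if i < k then i else i + 1 :=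
  FInt.val_mk' _ _ _ _ hi

end Necklace

/-! ### Nerves are quasi-categories -/

namespace VCat

open Necklace Templicial

variable {V : Type u} [Category.{v} V] [MonoidalCategory V] [HasColimits V]
  [SymmetricCategory V] [MonoidalClosed V] (C : VCat V)

theorem isIso_comul (m n : FIntᵒᵖ) : IsIso (Functor.OplaxMonoidal.δ C.nerve.fct m n) :=
  inferInstanceAs (IsIso (MonNerve.powIso C.quiver m.unop.len n.unop.len).hom)

instance (T : List ℕ) : IsIso (C.nerve.iterComul T) := by
  induction T with
  | nil => exact C.nerve.isIso_η
  | cons n T ih =>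
    have h : IsIso (C.nerve.lvl n ◁ C.nerve.iterComul T) := inferInstance
    exact @IsIso.comp_isIso _ _ _ _ _ _ _ (C.isIso_comul (op ⟨n⟩) (op (total T))) h

/-- The iterated comultiplications of a nerve are invertible, and their naturality reduces the claim
to the underlying map of intervals. -/
theorem isIso_necklaceMap {T U : List ℕ} (d : Map T U) [IsIso d.toHom] :
    IsIso (C.nerve.necklaceMap d) := by
  have h := C.nerve.iterComul_necklaceMap d
  have : IsIso (C.nerve.iterComul U ≫ C.nerve.necklaceMap d) := by
    rw [h]
    infer_instance
  exact IsIso.of_isIso_comp_left (C.nerve.iterComul U) _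

variable {C} {a b : C.nerve.Ob} {n j : ℕ} (x : C.nerve.NecklaceFamily a b n (InHorn n j))
  (s : 𝟙_ V ⟶ (C.nerve.lvl n).obj a b)

/-- The element of a family on a horn is restricted from a given simplex. -/
def Extends (T : List ℕ) (f : total T ⟶ FInt.mk n) : Prop :=
  ∀ hT hf, x.elt T hT f hf = s ≫ (C.nerve.fct.map f.op ≫ C.nerve.iterComul T).app a b

variable {x s}

theorem restrict_aux {T U : List ℕ} (d : Map T U) (f : total U ⟶ FInt.mk n) :
    (s ≫ (C.nerve.fct.map f.op ≫ C.nerve.iterComul U).app a b) ≫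
      (C.nerve.necklaceMap d).app a b =
    s ≫ (C.nerve.fct.map (d.toHom ≫ f).op ≫ C.nerve.iterComul T).app a b := by
  rw [op_comp, Functor.map_comp, Category.assoc, ← C.nerve.iterComul_necklaceMap d]
  refine (Category.assoc _ _ _).trans (congrArg (s ≫ ·) ?_)
  exact congrArg (fun z : C.nerve.lvl n ⟶ C.nerve.onNecklace T => z.app a b) (Category.assoc _ _ _)

theorem Extends.restrict {T U : List ℕ} (d : Map T U) (f : total U ⟶ FInt.mk n)
    (hU : ∀ t ∈ U, 0 < t) (hf : InHorn n j U f) (h : Extends x s U f) :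
    Extends x s T (d.toHom ≫ f) := by
  intro hT hf'
  rw [← x.naturality T U hT hU d f hf hf', h hU hf]
  exact restrict_aux d f

/-- A necklace map that is bijective on vertices only refines the target, and on a nerve nothing is
lost by refining; so the value on `U` can be recovered from that on `T`. -/
theorem Extends.of_isIso {T U : List ℕ} (d : Map T U) [IsIso d.toHom] (f : total U ⟶ FInt.mk n)
    (hT : ∀ t ∈ T, 0 < t) (hf : InHorn n j T (d.toHom ≫ f)) (h : Extends x s T (d.toHom ≫ f)) :
    Extends x s U f := by
  intro hU hf'
  have := C.isIso_necklaceMap d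
  refine el_cancel_iso (C.nerve.necklaceMap d) ?_
  rw [x.naturality T U hT hU d f hf' hf, h hT hf]
  exact (restrict_aux d f).symm

/-- Templicial nerves are quasi-categories in `V`. -/
theorem nerve_isQuasiCategory (C : VCat V) : C.nerve.IsQuasiCategory := by
  intro a b n j hj hjn x
  have hsp : (List.replicate n 1).sum = n := by simp
  let ψ : total (List.replicate n 1) ⟶ FInt.mk n := totalHom _ hsp
  have hpos : ∀ t ∈ List.replicate n 1, 0 < t := fun t ht => by
    rw [List.eq_of_mem_replicate ht]; exact one_pos
  -- As `0 < j < n` forces `n ≥ 2`, the first edge of the spine misses `n` and every other edge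
  -- misses 0.
  have hψ : InHorn n j _ ψ := by
    intro T₁ T₂ t hT
    have ht : t = 1 := List.eq_of_mem_replicate (n := n) (by rw [hT]; simp)
    have hs := congrArg List.sum hT
    rw [hsp, List.sum_append, List.sum_cons] at hs
    subst ht
    by_cases h0 : T₁.sum = 0
    · exact ⟨n, le_rfl, by omega, fun i hi => by rw [val_totalHom _ _ (by omega)]; omega⟩
    · exact ⟨0, by omega, by omega, fun i hi => by rw [val_totalHom _ _ (by omega)]; omega⟩
  -- The only possible filler: the value on the spine, transported along the invertible iterated
  -- comultiplication.
  let s : 𝟙_ V ⟶ (C.nerve.lvl n).obj a b := x.elt _ hpos ψ hψ ≫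
    (inv (C.nerve.fct.map ψ.op ≫ C.nerve.iterComul (List.replicate n 1))).app a b
  have hs : Extends x s _ ψ := by
    intro _ _
    have aux : ∀ {P Q : VQuiv V C.nerve.Ob} (e : P ⟶ Q) [IsIso e] (y : 𝟙_ V ⟶ Q.obj a b),
        y = (y ≫ (inv e).app a b) ≫ e.app a b := by
      intro P Q e _ y
      rw [Category.assoc, ← VQuiv.comp_app, IsIso.inv_hom_id]
      exact (Category.comp_id _).symm
    exact aux _ _
  -- A necklace with a joint over an interior vertex `k` factors through the one on `[0, k]` and
  -- `[k, n]`, which lies in the horn and is refined by the spine.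
  have hjoint : ∀ (T : List ℕ) (f : total T ⟶ FInt.mk n) (k : ℕ), 0 < k → k < n →
      (∃ T₁ T₂, T = T₁ ++ T₂ ∧ FInt.val f T₁.sum = k) → Extends x s T f := by
    intro T f k hk hkn h
    have hkl : [k, n - k].sum = n := by simp; omega
    obtain ⟨d, rfl⟩ := exists_map_pair_comp hkl f h
    have hU : ∀ t ∈ [k, n - k], 0 < t := by
      intro t ht
      simp only [List.mem_cons, List.not_mem_nil, or_false] at ht
      omega
    have hf : InHorn n j [k, n - k] (totalHom [k, n - k] hkl) := inHorn_pair _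
      ⟨n, le_rfl, by omega, fun i hi => by rw [val_totalHom _ _ (by omega)]; omega⟩
      ⟨0, by omega, by omega, fun i hi => by rw [val_totalHom _ _ (by omega)]; omega⟩
    refine Extends.restrict d _ hU hf ?_
    obtain ⟨e, he⟩ := exists_map_pair_comp hkl ψ ⟨List.replicate k 1, List.replicate (n - k) 1,
      by rw [← List.replicate_add]; congr 1; omega, by simp [ψ, val_totalHom _ _ hkn.le]⟩
    have : IsIso e.toHom := by
      have : IsIso (e.toHom ≫ totalHom [k, n - k] hkl) := by rw [he]; infer_instance
      exact IsIso.of_isIso_comp_right _ (totalHom [k, n - k] hkl)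
    exact Extends.of_isIso e _ hpos (he.symm ▸ hψ) (he.symm ▸ hs)
  refine ⟨⟨fun T _ f _ => s ≫ (C.nerve.fct.map f.op ≫ C.nerve.iterComul T).app a b,
    fun T U _ _ d f _ _ => restrict_aux d f⟩, fun T hT f hf => Eq.symm ?_⟩
  suffices Extends x s T f from this hT hf
  by_cases h : ∃ k, 0 < k ∧ k < n ∧ ∃ T₁ T₂, T = T₁ ++ T₂ ∧ FInt.val f T₁.sum = k
  · obtain ⟨k, hk, hkn, h⟩ := h
    exact hjoint T f k hk hkn h
  -- Without interior joints, the bead jumping over 1 runs from 0 to `n`, and the others lie over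
  -- the endpoints. The vertex `k ≠ j` missed by this bead is then missed altogether, and `f`
  -- factors through the face opposite to it.
  rcases hf.exists_joint_or (m := 1) (by omega) with h' | ⟨T₁, t, T₂, hTT, h1, h2, k, hk, hk', h3⟩
  · exact (h ⟨1, one_pos, by omega, h'⟩).elim
  have hle : ∀ i, FInt.val f i ≤ n := fun i => FInt.val_le f i
  have h4 := h3 0 (Nat.zero_le _)
  have h5 := h3 t le_rfl
  rw [Nat.add_zero] at h4
  have h6 : ¬ FInt.val f (T₁.sum + t) < n := fun h' => h ⟨_, by omega, h', T₁ ++ [t], T₂,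
    by simp [hTT], by simp⟩
  have h7 := hle (T₁.sum + t)
  have h8 : ∀ i, FInt.val f i ≠ k := by
    intro i hi
    rcases le_total i T₁.sum with h9 | h9
    · have := FInt.val_mono f h9
      omega
    · obtain ⟨s, rfl⟩ := Nat.exists_eq_add_of_le h9
      rcases le_total s t with h10 | h10
      · exact h3 s h10 hi
      · have := FInt.val_mono f (show T₁.sum + t ≤ T₁.sum + s by omega)
        omega
  obtain ⟨m, rfl⟩ : ∃ m, n = m + 1 := ⟨n - 1, by omega⟩
  have hk0 : 0 < k := by omega
  have hkm : k < m + 1 := by omega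
  have hδ : ∀ i, i ≤ m → FInt.val (face m k hk0 hkm) i = if i < k then i else i + 1 :=
    fun i hi => val_face m k hk0 hkm hi
  let g : total T ⟶ FInt.mk m := FInt.mk'
    (fun i => if FInt.val f i < k then FInt.val f i else FInt.val f i - 1)
    (fun i i' hi _ => by have := FInt.val_mono f hi; split_ifs <;> omega)
    (by rw [FInt.val_zero, if_pos hk0]) (by
      rw [FInt.val_of_le f le_rfl]
      change (if m + 1 < k then m + 1 else m + 1 - 1) = m
      rw [if_neg (by omega)]
      rfl)
  have hm1 : [m].sum = m := by simp
  obtain ⟨d, -, hd⟩ := exists_map_singleton_comp hm1 g (face m k hk0 hkm) f fun i hi => by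
    have h9 := h8 i
    have h10 := hle i
    rw [show FInt.val g i = _ from FInt.val_mk' _ _ _ _ (by rwa [len_total]),
      hδ _ (by split_ifs <;> omega)]
    split_ifs <;> omega
  rw [← hd]
  have hmiss : ∀ i, FInt.val (face m k hk0 hkm) i ≠ k := by
    intro i
    by_cases hi : i ≤ m
    · rw [hδ i hi]
      split_ifs <;> omega
    · rw [FInt.val_of_le _ (show m ≤ i by omega)]
      change m + 1 ≠ k
      omega
  have hmem : ∀ i, i ∈ [m] → 0 < i := by
    intro i hi
    rw [List.mem_singleton] at hi
    omega
  refine Extends.restrict d _ hmem (inHorn_singleton _ ⟨k, hk, hk', fun i hi => by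
    rw [FInt.val_comp]; exact hmiss _⟩) ?_
  -- As `j` belongs to the face opposite to `k`, the face can be cut at the vertex `j'` over `j`.
  -- The resulting necklace has an interior joint, so `hjoint` applies to it, and its value
  -- determines that on the face.
  obtain ⟨j', hj'0, hj'm, hj'⟩ : ∃ j', 0 < j' ∧ j' < m ∧ FInt.val (face m k hk0 hkm) j' = j := by
    by_cases h9 : j < k
    · exact ⟨j, hj, by omega, by rw [hδ _ (by omega), if_pos h9]⟩
    · exact ⟨j - 1, by omega, by omega, by rw [hδ _ (by omega), if_neg (by omega)]; omega⟩
  have hjl : [j', m - j'].sum = m := by simp; omega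
  obtain ⟨e, he, he'⟩ := exists_map_singleton_comp hm1 (totalHom [j', m - j'] hjl) (𝟙 _)
    (totalHom [j', m - j'] hjl) fun i hi => FInt.val_id _ (FInt.val_le (totalHom _ hjl) i)
  rw [Category.comp_id] at he'
  have : IsIso e.toHom := by
    have : IsIso (e.toHom ≫ totalHom [m] hm1) := by rw [he']; infer_instance
    exact IsIso.of_isIso_comp_right _ (totalHom [m] hm1)
  have hval : ∀ i, i ≤ m → FInt.val (e.toHom ≫ totalHom [m] hm1 ≫ face m k hk0 hkm) i =
      FInt.val (face m k hk0 hkm) i := by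
    intro i hi
    rw [← Category.assoc, he', FInt.val_comp, val_totalHom _ _ hi]
  have hpos' : ∀ i, i ∈ [j', m - j'] → 0 < i := by
    intro i hi
    simp only [List.mem_cons, List.not_mem_nil, or_false] at hi
    omega
  refine Extends.of_isIso e _ hpos' (inHorn_pair _ ⟨k, hk, hk', fun i hi => ?_⟩
    ⟨k, hk, hk', fun i hi => ?_⟩) ?_
  · rw [hval _ (by omega)]
    exact hmiss _
  · rw [hval _ (by omega)]
    exact hmiss _
  · exact hjoint _ _ j hj hjn ⟨[j'], [m - j'], rfl, by
      rw [List.sum_singleton, hval _ (by omega), hj']⟩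

end VCat

/-! ### Componentwise criteria for morphisms of quivers -/

namespace VQuiv

variable {V : Type u} [Category.{v} V] {S : Type v}

theorem isCoeq_of_app {H P Q : VQuiv V S} {k₁ k₂ : H ⟶ P} {q : P ⟶ Q}
    (h : ∀ a b, IsCoeq (k₁.app a b) (k₂.app a b) (q.app a b)) : IsCoeq k₁ k₂ q where
  w := hom_ext fun a b => (h a b).w
  exists_desc g hg := by
    choose k hk using fun a b => (h a b).exists_desc (g.app a b) (congrArg (fun z => z.app a b) hg)
    exact ⟨⟨k⟩, hom_ext hk⟩
  epi := ⟨fun f g e => hom_ext fun a b => by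
    have := (h a b).epi
    rw [← cancel_epi (q.app a b)]
    exact congrArg (fun z => z.app a b) e⟩

theorem el_ext [MonoidalCategory V] (hfaithful : (underlying V).Faithful) {P Q : VQuiv V S}
    {f g : P ⟶ Q} (h : ∀ a b (x : 𝟙_ V ⟶ P.obj a b), x ≫ f.app a b = x ≫ g.app a b) : f = g :=
  hom_ext fun a b => _root_.el_ext hfaithful (h a b)

theorem epi_of_app {P Q : VQuiv V S} {f : P ⟶ Q} (h : ∀ a b, Epi (f.app a b)) : Epi f :=
  ⟨fun g k e => hom_ext fun a b => by
    have := h a b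
    rw [← cancel_epi (f.app a b)]
    exact congrArg (fun z => z.app a b) e⟩

end VQuiv

/-! ### The composition on the homotopy category of a quasi-category -/

namespace Templicial

variable {V : Type u} [Category.{v} V] [MonoidalCategory V] [HasColimits V]
  [SymmetricCategory V] [MonoidalClosed V] (X : Templicial V)

/-- The degenerate triangles with degenerate last edge. -/
def degenLast : X.lvl 1 ⟶ X.lvl 2 :=
  X.restr (show FInt.mk 2 ⟶ FInt.mk 1 from (𝟙 (FInt.mk 1) ⊗ₘ SSetAux.s₀) ≫ (ρ_ (FInt.mk 1)).hom)

/-- The degenerate triangles with degenerate first edge. -/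
def degenFirst : X.lvl 1 ⟶ X.lvl 2 :=
  X.restr (show FInt.mk 2 ⟶ FInt.mk 1 from (SSetAux.s₀ ⊗ₘ 𝟙 (FInt.mk 1)) ≫ (λ_ (FInt.mk 1)).hom)

theorem degenLast_restr : X.degenLast ≫ X.restr SSetAux.d₁ = 𝟙 _ :=
  (X.fct.map_comp _ _).symm.trans ((congrArg (fun z : FInt.mk 1 ⟶ FInt.mk 1 => X.fct.map z.op)
    (FInt.hom_mk_one_ext _ (𝟙 _))).trans (X.fct.map_id _))

theorem degenFirst_restr : X.degenFirst ≫ X.restr SSetAux.d₁ = 𝟙 _ :=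
  (X.fct.map_comp _ _).symm.trans ((congrArg (fun z : FInt.mk 1 ⟶ FInt.mk 1 => X.fct.map z.op)
    (FInt.hom_mk_one_ext _ (𝟙 _))).trans (X.fct.map_id _))

theorem degen_aux {W : Type*} [Category W] {a b c d e f : W} {x : a ⟶ b} {y : b ⟶ c} {z : c ⟶ d}
    {y' : b ⟶ e} {z' : e ⟶ d} {w : a ⟶ f} {w' : f ⟶ e} {v : f ⟶ d} (h : y ≫ z = y' ≫ z')
    (h' : x ≫ y' = w ≫ w') (h'' : w' ≫ z' = v) : (x ≫ y) ≫ z = w ≫ v := by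
  rw [Category.assoc, h, reassoc_of% h', h'']

theorem degenLast_comul : X.degenLast ≫ X.comul 1 1 = X.tensorUnitEdge := by
  have h : X.degenLast = X.fct.map (ρ_ (FInt.mk 1)).hom.op ≫
      X.fct.map (𝟙 (FInt.mk 1) ⊗ₘ SSetAux.s₀).op := X.fct.map_comp _ _
  rw [h]
  refine degen_aux (X.comul_natural (𝟙 (FInt.mk 1)) SSetAux.s₀)
    (X.map_rightUnitor_comul (FInt.mk 1)) ?_
  refine (whiskerLeft_comp_tensorHom _ _ _).trans ?_
  have h1 : X.fct.map (𝟙 (FInt.mk 1)).op = 𝟙 (X.lvl 1) := X.fct.map_id _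
  exact (congrArg (· ⊗ₘ _) h1).trans (id_tensorHom _ _)

theorem degenFirst_comul : X.degenFirst ≫ X.comul 1 1 =
    (λ_ (X.lvl 1)).inv ≫ X.unitEdge ▷ X.lvl 1 := by
  have h : X.degenFirst = X.fct.map (λ_ (FInt.mk 1)).hom.op ≫
      X.fct.map (SSetAux.s₀ ⊗ₘ 𝟙 (FInt.mk 1)).op := X.fct.map_comp _ _
  rw [h]
  refine degen_aux (X.comul_natural SSetAux.s₀ (𝟙 (FInt.mk 1)))
    (X.map_leftUnitor_comul (FInt.mk 1)) ?_
  refine (whiskerRight_comp_tensorHom _ _ _).trans ?_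
  have h1 : X.fct.map (𝟙 (FInt.mk 1)).op = 𝟙 (X.lvl 1) := X.fct.map_id _
  exact (congrArg (_ ⊗ₘ ·) h1).trans (tensorHom_id _ _)

variable [HasLimits V]

/-- The quiver of left-pinched `1`-simplices. -/
def pinchedQuiver : VQuiv V X.Ob := ⟨X.pinched⟩

/-- The first face of a left-pinched `1`-simplex. -/
def pinchedOne : X.pinchedQuiver ⟶ X.lvl 1 := ⟨X.pinchedFaceOne⟩

/-- The triangle underlying a left-pinched `1`-simplex. -/
def pinchedTriangle : X.pinchedQuiver ⟶ X.lvl 2 :=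
  ⟨fun a b => pullback.snd (X.tensorUnitEdge.app a b) ((X.comul 1 1).app a b)⟩

theorem pinched_condition :
    X.pinchedOne ≫ X.tensorUnitEdge = X.pinchedTriangle ≫ X.comul 1 1 :=
  VQuiv.hom_ext fun _ _ => pullback.condition

/-- The degenerate left-pinched `1`-simplices. -/
def pinchedDegen : X.lvl 1 ⟶ X.pinchedQuiver :=
  ⟨fun a b => pullback.lift (𝟙 _) (X.degenLast.app a b)
    ((Category.id_comp _).trans (congrArg (fun z => z.app a b) X.degenLast_comul).symm)⟩

theorem pinchedDegen_one : X.pinchedDegen ≫ X.pinchedOne = 𝟙 _ :=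
  VQuiv.hom_ext fun _ _ => pullback.lift_fst _ _ _

theorem pinchedDegen_triangle : X.pinchedDegen ≫ X.pinchedTriangle = X.degenLast :=
  VQuiv.hom_ext fun _ _ => pullback.lift_snd _ _ _

theorem pinchedDegen_zero :
    X.pinchedDegen ≫ X.pinchedTriangle ≫ X.restr SSetAux.d₁ = 𝟙 _ := by
  rw [← Category.assoc, pinchedDegen_triangle, degenLast_restr]

theorem isCoeq_homProj_app (a b : X.Ob) :
    IsCoeq ((X.pinchedTriangle ≫ X.restr SSetAux.d₁).app a b) (X.pinchedOne.app a b)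
      (X.homProj.app a b) :=
  IsCoeq.coequalizer (X.pinchedFaceZero a b) (X.pinchedFaceOne a b)

theorem isCoeq_homProj : IsCoeq (X.pinchedTriangle ≫ X.restr SSetAux.d₁) X.pinchedOne X.homProj :=
  VQuiv.isCoeq_of_app X.isCoeq_homProj_app

instance (R : VQuiv V X.Ob) : Epi (R ◁ X.homProj) :=
  (VQuiv.isCoeq_of_app (VQuiv.isCoeq_whiskerLeft X.isCoeq_homProj_app R)).epi

instance (R : VQuiv V X.Ob) : Epi (X.homProj ▷ R) :=
  (VQuiv.isCoeq_of_app (VQuiv.isCoeq_whiskerRight X.isCoeq_homProj_app R)).epi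

instance : Epi (X.homProj ⊗ₘ X.homProj) := by
  rw [MonoidalCategory.tensorHom_def]
  exact epi_comp _ _

/-- The degenerate triangles form a common section of the pair defining `q`, so this coequaliser is
reflexive. -/
theorem homProj_elSurjective [PreservesColimitsOfShape WalkingReflexivePair (underlying V)]
    (a b : X.Ob) : ElSurjective (X.homProj.app a b) :=
  (X.isCoeq_homProj_app a b).elSurjective (X.pinchedDegen.app a b)
    (congrArg (fun z => z.app a b) X.pinchedDegen_zero)
    (congrArg (fun z => z.app a b) X.pinchedDegen_one)

variable {X}

/-- Edges related by a triangle with degenerate last edge have the same class. -/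
theorem homProj_congr {a b : X.Ob} (e e' : 𝟙_ V ⟶ (X.lvl 1).obj a b)
    (σ : 𝟙_ V ⟶ (X.lvl 2).obj a b)
    (h : σ ≫ (X.comul 1 1).app a b = e ≫ X.tensorUnitEdge.app a b)
    (h' : σ ≫ (X.restr SSetAux.d₁).app a b = e') :
    e ≫ X.homProj.app a b = e' ≫ X.homProj.app a b := by
  let t : 𝟙_ V ⟶ X.pinched a b := pullback.lift e σ h.symm
  have h1 : t ≫ X.pinchedFaceOne a b = e := pullback.lift_fst _ _ _
  have h2 : t ≫ X.pinchedFaceZero a b = e' :=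
    (Category.assoc _ _ _).symm.trans ((congrArg (· ≫ _) (pullback.lift_snd _ _ _)).trans h')
  have h3 : X.pinchedFaceZero a b ≫ X.homProj.app a b = X.pinchedFaceOne a b ≫ X.homProj.app a b :=
    (X.isCoeq_homProj_app a b).w
  rw [← h1, ← h2, Category.assoc, Category.assoc, h3]

theorem tensorUnitEdge_aux {W : Type*} [Category W] [MonoidalCategory W] {x y : W}
    (s : 𝟙_ W ⟶ x) (μ : y ⟶ x ⊗ x) : ((ρ_ y).inv ≫ y ◁ s) ≫ μ ▷ x ≫ (α_ _ _ _).hom =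
      μ ≫ x ◁ ((ρ_ x).inv ≫ x ◁ s) := by
  rw [Category.assoc, whisker_exchange_assoc]
  simp

theorem tensorUnitEdge_whiskerRight {W : Type*} [Category W] [MonoidalCategory W] {x y : W}
    (s : 𝟙_ W ⟶ x) (d : y ⟶ x) : ((ρ_ y).inv ≫ y ◁ s) ≫ d ▷ x = d ≫ (ρ_ x).inv ≫ x ◁ s := by
  rw [Category.assoc, whisker_exchange]
  simp

/-- In the tetrahedron take `σ` as the face 012, a degenerate edge 23, `z` as 01 with 123, and `τ`
as the face 013. The new face 023 has a degenerate last edge and relates the long edges of `σ` and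
`τ`. -/
theorem IsQuasiCategory.homProj_congr_right (hX : X.IsQuasiCategory) {a b : X.Ob}
    (σ τ : 𝟙_ V ⟶ (X.lvl 2).obj a b) (z : 𝟙_ V ⟶ (X.lvl 1 ⊗ X.lvl 2).obj a b)
    (h : σ ≫ (X.comul 1 1 ≫ X.lvl 1 ◁ X.tensorUnitEdge).app a b =
      z ≫ (X.lvl 1 ◁ X.comul 1 1).app a b)
    (h' : z ≫ (X.lvl 1 ◁ X.restr SSetAux.d₁).app a b = τ ≫ (X.comul 1 1).app a b) :
    σ ≫ (X.restr SSetAux.d₁ ≫ X.homProj).app a b =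
      τ ≫ (X.restr SSetAux.d₁ ≫ X.homProj).app a b := by
  obtain ⟨x, hx, hx'⟩ := hX.exists_face τ (σ ≫ ((ρ_ (X.lvl 2)).inv ≫ X.lvl 2 ◁ X.unitEdge).app a b)
    z (by
      rw [← h, Category.assoc, ← VQuiv.comp_app, tensorUnitEdge_aux]
      rfl) h'
  have := homProj_congr (σ ≫ (X.restr SSetAux.d₁).app a b) (τ ≫ (X.restr SSetAux.d₁).app a b) x (by
    rw [hx, Category.assoc, Category.assoc, ← VQuiv.comp_app, tensorUnitEdge_whiskerRight]
    rfl) hx'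
  rw [VQuiv.comp_app, ← Category.assoc, this, Category.assoc]

/-- The class of a composite of two edges is unique. -/
theorem IsQuasiCategory.homProj_congr_comul (hX : X.IsQuasiCategory) {a b : X.Ob}
    (σ τ : 𝟙_ V ⟶ (X.lvl 2).obj a b)
    (h : σ ≫ (X.comul 1 1).app a b = τ ≫ (X.comul 1 1).app a b) :
    σ ≫ (X.restr SSetAux.d₁ ≫ X.homProj).app a b =
      τ ≫ (X.restr SSetAux.d₁ ≫ X.homProj).app a b := by
  -- Take the triangle in `z` to be the degenerate one on the last edge of `σ`.
  refine hX.homProj_congr_right σ τ (σ ≫ (X.comul 1 1 ≫ X.lvl 1 ◁ X.degenLast).app a b) ?_ ?_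
  · rw [Category.assoc, ← VQuiv.comp_app, Category.assoc, ← MonoidalCategory.whiskerLeft_comp,
      degenLast_comul]
  · rw [← h, Category.assoc, ← VQuiv.comp_app, Category.assoc, ← MonoidalCategory.whiskerLeft_comp,
      degenLast_restr, MonoidalCategory.whiskerLeft_id, Category.comp_id]

theorem tensorUnitEdge_assoc_aux {W : Type*} [Category W] [MonoidalCategory W] {x p t : W}
    {π : p ⟶ x} {τ : p ⟶ t} {s : 𝟙_ W ⟶ x} {μ : t ⟶ x ⊗ x}
    (h : π ≫ (ρ_ x).inv ≫ x ◁ s = τ ≫ μ) :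
    τ ▷ x ≫ μ ▷ x ≫ (α_ _ _ _).hom = π ▷ x ≫ x ◁ ((λ_ x).inv ≫ s ▷ x) := by
  rw [← comp_whiskerRight_assoc, ← h]
  simp

/-- In the tetrahedron the pinched triangle of `w` is the face 012 and `τ` is the face 013; the face
123 is degenerate on the edge of `w`. The new face 023 has the comultiplication of `σ` and the long
edge of `τ`, so the uniqueness of composites applies. -/
theorem IsQuasiCategory.homProj_congr_left (hX : X.IsQuasiCategory) {a b : X.Ob}
    (σ τ : 𝟙_ V ⟶ (X.lvl 2).obj a b) (w : 𝟙_ V ⟶ (X.pinchedQuiver ⊗ X.lvl 1).obj a b)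
    (h : σ ≫ (X.comul 1 1).app a b =
      w ≫ ((X.pinchedTriangle ≫ X.restr SSetAux.d₁) ▷ X.lvl 1).app a b)
    (h' : τ ≫ (X.comul 1 1).app a b = w ≫ (X.pinchedOne ▷ X.lvl 1).app a b) :
    σ ≫ (X.restr SSetAux.d₁ ≫ X.homProj).app a b =
      τ ≫ (X.restr SSetAux.d₁ ≫ X.homProj).app a b := by
  obtain ⟨x, hx, hx'⟩ := hX.exists_face τ (w ≫ (X.pinchedTriangle ▷ X.lvl 1).app a b)
    (w ≫ (X.pinchedOne ▷ X.lvl 1 ≫ X.lvl 1 ◁ X.degenFirst).app a b)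
    (by
      rw [Category.assoc, Category.assoc, ← VQuiv.comp_app, ← VQuiv.comp_app,
        tensorUnitEdge_assoc_aux X.pinched_condition, Category.assoc,
        ← MonoidalCategory.whiskerLeft_comp, degenFirst_comul])
    (by
      rw [h', Category.assoc, ← VQuiv.comp_app, Category.assoc,
        ← MonoidalCategory.whiskerLeft_comp, degenFirst_restr, MonoidalCategory.whiskerLeft_id,
        Category.comp_id])
  have h1 : x ≫ (X.comul 1 1).app a b = σ ≫ (X.comul 1 1).app a b := by
    rw [hx, h, Category.assoc, ← VQuiv.comp_app, ← MonoidalCategory.comp_whiskerRight]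
  rw [← hX.homProj_congr_comul x σ h1, VQuiv.comp_app, ← Category.assoc, hx', Category.assoc]

variable [PreservesColimitsOfShape WalkingReflexivePair (underlying V)]
  [ReflectsColimitsOfShape WalkingReflexivePair (underlying V)]

/-- The composition of a quasi-category, up to homotopy. -/
theorem IsQuasiCategory.exists_mult_lvl (hfaithful : (underlying V).Faithful)
    (hX : X.IsQuasiCategory) :
    ∃ m : X.lvl 1 ⊗ X.lvl 1 ⟶ X.homQuiver,
      X.comul 1 1 ≫ m = X.restr SSetAux.d₁ ≫ X.homProj := by
  -- Being surjective on elements, `μ_{1,1}` is the coequaliser of its kernel pair; uniqueness of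
  -- composites says exactly that `q d₁` coequalises this pair.
  have h := VQuiv.isCoeq_of_app (k₁ := VQuiv.kernelFst (X.comul 1 1))
    (k₂ := VQuiv.kernelSnd (X.comul 1 1)) (q := X.comul 1 1)
    fun a b => (hX.comul_elSurjective a b).isCoeq
  refine h.exists_desc _ (VQuiv.el_ext hfaithful fun a b x => ?_)
  have h1 : (VQuiv.kernelFst (X.comul 1 1)).app a b ≫ (X.comul 1 1).app a b =
    (VQuiv.kernelSnd (X.comul 1 1)).app a b ≫ (X.comul 1 1).app a b := pullback.condition
  have := hX.homProj_congr_comul (x ≫ (VQuiv.kernelFst (X.comul 1 1)).app a b)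
    (x ≫ (VQuiv.kernelSnd (X.comul 1 1)).app a b) (by rw [Category.assoc, h1, Category.assoc])
  rw [Category.assoc, Category.assoc] at this
  exact this

/-- The composition defined on `X_1 ⊗ X_1` is descended to classes one factor at a time, the right
factor before the left. Each descent is checked on elements, by choosing triangles that fill both
sides. -/
theorem IsQuasiCategory.exists_mult (hfaithful : (underlying V).Faithful)
    (hX : X.IsQuasiCategory) :
    ∃ m : X.homQuiver ⊗ X.homQuiver ⟶ X.homQuiver, X.IsInducedComposition m := by
  obtain ⟨m, hm⟩ := hX.exists_mult_lvl hfaithful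
  have hm' : ∀ {a b : X.Ob} (σ : 𝟙_ V ⟶ (X.lvl 2).obj a b),
      σ ≫ (X.restr SSetAux.d₁ ≫ X.homProj).app a b = (σ ≫ (X.comul 1 1).app a b) ≫ m.app a b := by
    intro a b σ
    rw [← hm, Category.assoc]
    rfl
  obtain ⟨m₁, hm₁⟩ := (VQuiv.isCoeq_of_app
    (VQuiv.isCoeq_whiskerLeft X.isCoeq_homProj_app (X.lvl 1))).exists_desc m
      (VQuiv.el_ext hfaithful fun a b w => by
        obtain ⟨σ, hσ⟩ := hX.comul_elSurjective a b (w ≫ (X.lvl 1 ◁ X.pinchedOne).app a b)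
        obtain ⟨τ, hτ⟩ := hX.comul_elSurjective a b
          (w ≫ (X.lvl 1 ◁ (X.pinchedTriangle ≫ X.restr SSetAux.d₁)).app a b)
        have := hX.homProj_congr_right σ τ (w ≫ (X.lvl 1 ◁ X.pinchedTriangle).app a b) (by
          rw [VQuiv.comp_app, ← Category.assoc, hσ, Category.assoc, Category.assoc,
            ← VQuiv.comp_app, ← VQuiv.comp_app, ← MonoidalCategory.whiskerLeft_comp,
            ← MonoidalCategory.whiskerLeft_comp, pinched_condition]) (by
          rw [hτ, Category.assoc, ← VQuiv.comp_app, ← MonoidalCategory.whiskerLeft_comp])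
        rw [hm', hm', hσ, hτ] at this
        simp only [VQuiv.comp_app, ← Category.assoc]
        exact this.symm)
  obtain ⟨m₂, hm₂⟩ := (VQuiv.isCoeq_of_app
    (VQuiv.isCoeq_whiskerRight X.isCoeq_homProj_app X.homQuiver)).exists_desc m₁ (by
      -- The right factor consists of classes; precomposing with the projection, an epimorphism,
      -- replaces it by actual edges.
      rw [← cancel_epi (X.pinchedQuiver ◁ X.homProj), whisker_exchange_assoc,
        whisker_exchange_assoc, hm₁]
      refine VQuiv.el_ext hfaithful fun a b w => ?_
      obtain ⟨σ, hσ⟩ := hX.comul_elSurjective a b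
        (w ≫ ((X.pinchedTriangle ≫ X.restr SSetAux.d₁) ▷ X.lvl 1).app a b)
      obtain ⟨τ, hτ⟩ := hX.comul_elSurjective a b (w ≫ (X.pinchedOne ▷ X.lvl 1).app a b)
      have := hX.homProj_congr_left σ τ w hσ hτ
      rw [hm', hm', hσ, hτ] at this
      simp only [VQuiv.comp_app, ← Category.assoc]
      exact this)
  refine ⟨m₂, ?_⟩
  rw [IsInducedComposition, MonoidalCategory.tensorHom_def', Category.assoc, hm₂, hm₁, hm]

theorem IsQuasiCategory.induced_unique (hfaithful : (underlying V).Faithful)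
    (hX : X.IsQuasiCategory)
    {m m' : X.homQuiver ⊗ X.homQuiver ⟶ X.homQuiver} (hm : X.IsInducedComposition m)
    (hm' : X.IsInducedComposition m') : m = m' := by
  have : Epi (X.comul 1 1) := VQuiv.epi_of_app fun a b =>
    (hX.comul_elSurjective a b).epi hfaithful
  rw [← cancel_epi (X.homProj ⊗ₘ X.homProj), ← cancel_epi (X.comul 1 1)]
  exact hm.trans hm'.symm

/-- The `V`-enriched category structure on `h'X`. -/
theorem IsQuasiCategory.nonempty_homotopyComposition (hfaithful : (underlying V).Faithful)
    (hX : X.IsQuasiCategory) :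
    Nonempty X.HomotopyComposition := by
  obtain ⟨m, hm⟩ := hX.exists_mult hfaithful
  have hm' := hm
  rw [IsInducedComposition] at hm'
  have hmel : ∀ {a b : X.Ob} (σ : 𝟙_ V ⟶ (X.lvl 2).obj a b),
      σ ≫ (X.restr SSetAux.d₁ ≫ X.homProj).app a b =
        (σ ≫ (X.comul 1 1).app a b) ≫ ((X.homProj ⊗ₘ X.homProj) ≫ m).app a b := by
    intro a b σ
    rw [← hm', Category.assoc]
    rfl
  refine ⟨⟨m, hm, ?_, ?_, ?_⟩⟩
  -- The unit laws are read off from the degenerate triangles, whose long edge is the given one.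
  · rw [← cancel_epi (𝟙_ (VQuiv V X.Ob) ◁ X.homProj), leftUnitor_naturality,
      ← cancel_epi (λ_ (X.lvl 1)).inv, Iso.inv_hom_id_assoc]
    have h1 : 𝟙_ (VQuiv V X.Ob) ◁ X.homProj ≫ X.homUnit ▷ X.homQuiver =
        X.unitEdge ▷ X.lvl 1 ≫ (X.homProj ⊗ₘ X.homProj) := by
      rw [homUnit, whiskerRight_comp_tensorHom, whisker_exchange, ← MonoidalCategory.tensorHom_def]
    rw [reassoc_of% h1, ← Category.assoc, ← degenFirst_comul, Category.assoc, hm',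
      ← Category.assoc, degenFirst_restr, Category.id_comp]
  · rw [← cancel_epi (X.homProj ▷ 𝟙_ (VQuiv V X.Ob)), rightUnitor_naturality,
      ← cancel_epi (ρ_ (X.lvl 1)).inv, Iso.inv_hom_id_assoc]
    have h1 : X.homProj ▷ 𝟙_ (VQuiv V X.Ob) ≫ X.homQuiver ◁ X.homUnit =
        X.lvl 1 ◁ X.unitEdge ≫ (X.homProj ⊗ₘ X.homProj) := by
      rw [homUnit, whiskerLeft_comp_tensorHom, ← MonoidalCategory.tensorHom_def]
    have h2 := X.degenLast_comul
    rw [tensorUnitEdge] at h2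
    rw [reassoc_of% h1, ← Category.assoc, ← h2, Category.assoc, hm',
      ← Category.assoc, degenLast_restr, Category.id_comp]
  · have : Epi ((X.homProj ⊗ₘ X.homProj) ⊗ₘ X.homProj) := by
      rw [MonoidalCategory.tensorHom_def (X.homProj ⊗ₘ X.homProj),
        MonoidalCategory.tensorHom_def X.homProj, comp_whiskerRight]
      have : Epi ((X.homQuiver ◁ X.homProj) ▷ X.lvl 1) :=
        (VQuiv.isCoeq_of_app (VQuiv.isCoeq_whiskerRight
          (VQuiv.isCoeq_whiskerLeft X.isCoeq_homProj_app _) _)).epi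
      have : Epi ((X.homProj ▷ X.lvl 1) ▷ X.lvl 1) :=
        (VQuiv.isCoeq_of_app (VQuiv.isCoeq_whiskerRight
          (VQuiv.isCoeq_whiskerRight X.isCoeq_homProj_app _) _)).epi
      exact epi_comp' (epi_comp' inferInstance inferInstance) inferInstance
    rw [← cancel_epi ((X.homProj ⊗ₘ X.homProj) ⊗ₘ X.homProj),
      associator_naturality_assoc]
    refine VQuiv.el_ext hfaithful fun a b p => ?_
    -- An element of the triple tensor product is lifted to triangles 012 with an edge 23, these to
    -- an edge 01 with triangles 123, and finally to 013. The tetrahedron provides 023. The two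
    -- bracketings are then the classes of the long edges of 023 and 013, which coincide.
    obtain ⟨y, rfl⟩ := ElSurjective.quiver_whiskerRight hX.comul_elSurjective (X.lvl 1) a b p
    obtain ⟨z, hz⟩ := ElSurjective.quiver_whiskerLeft hX.comul_elSurjective (X.lvl 1) a b
      (y ≫ (X.comul 1 1 ▷ X.lvl 1 ≫ (α_ _ _ _).hom).app a b)
    obtain ⟨x, hx⟩ := hX.comul_elSurjective a b (z ≫ (X.lvl 1 ◁ X.restr SSetAux.d₁).app a b)
    obtain ⟨x', hx', hx''⟩ := hX.exists_face x y z hz.symm hx.symm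
    have h1 : X.comul 1 1 ▷ X.lvl 1 ≫ ((X.homProj ⊗ₘ X.homProj) ⊗ₘ X.homProj) ≫
        m ▷ X.homQuiver ≫ m = X.restr SSetAux.d₁ ▷ X.lvl 1 ≫ (X.homProj ⊗ₘ X.homProj) ≫ m := by
      rw [tensorHom_comp_whiskerRight_assoc, whiskerRight_comp_tensorHom_assoc, hm',
        whiskerRight_comp_tensorHom_assoc]
    have h2 : X.lvl 1 ◁ X.comul 1 1 ≫ (X.homProj ⊗ₘ (X.homProj ⊗ₘ X.homProj)) ≫
        X.homQuiver ◁ m ≫ m = X.lvl 1 ◁ X.restr SSetAux.d₁ ≫ (X.homProj ⊗ₘ X.homProj) ≫ m := by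
      rw [tensorHom_comp_whiskerLeft_assoc, whiskerLeft_comp_tensorHom_assoc, hm',
        whiskerLeft_comp_tensorHom_assoc]
    have h3 := congrArg (fun w => y ≫ w.app a b) h1
    have h4 := congrArg (fun w => z ≫ w.app a b) h2
    have e1 := hmel x'
    have e2 := hmel x
    rw [hx'] at e1
    rw [hx] at e2
    simp only [VQuiv.comp_app, Category.assoc] at h3 h4 e1 e2 hx'' hz ⊢
    rw [h3, ← e1, reassoc_of% hx'', e2, ← h4, reassoc_of% hz]

end Templicial

/-! ### Enriched functors as morphisms of monoids in quivers -/

namespace VCat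

variable {V : Type u} [Category.{v} V] [MonoidalCategory V] [HasColimits V]
  [SymmetricCategory V] [MonoidalClosed V]

theorem unitHom_ofMonoid {S : Type v} (H : VQuiv V S) [MonObj H] :
    (ofMonoid H).unitHom = (MonObj.one : 𝟙_ (VQuiv V S) ⟶ H) := by
  ext a b
  refine VQuiv.tensorUnit_ext fun h => ?_
  subst h
  exact inj_unitHom (ofMonoid H) a

theorem multHom_ofMonoid {S : Type v} (H : VQuiv V S) [MonObj H] :
    (ofMonoid H).multHom = (MonObj.mul : H ⊗ H ⟶ H) := by
  ext a b
  refine VQuiv.tensorObj_ext fun c => ?_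
  exact inj_multHom (ofMonoid H) a c b

/-- The `V`-enriched functor given by a morphism of quivers which respects the monoid
structures. -/
def homOfQuiver {C D : VCat V} (f : C.Ob → D.Ob) (k : C.quiver ⟶ (VQuiv.pullback f).obj D.quiver)
    (hone : C.unitHom ≫ k = Functor.LaxMonoidal.ε (VQuiv.pullback f) ≫
      (VQuiv.pullback f).map D.unitHom)
    (hmul : C.multHom ≫ k = (k ⊗ₘ k) ≫ Functor.LaxMonoidal.μ (VQuiv.pullback f) _ _ ≫
      (VQuiv.pullback f).map D.multHom) : C ⟶ D :=
  show EnrichedFunctor V C.Ob D.Ob from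
  { obj := f
    map := fun a b => k.app a b
    map_id := fun a => by
      have h := congrArg (fun z => VQuiv.injUnit rfl ≫ z.app a a) hone
      refine (congrArg (· ≫ k.app a a) (inj_unitHom C a)).symm.trans ?_
      refine (Category.assoc _ _ _).trans (h.trans ?_)
      refine (Category.assoc _ _ _).symm.trans ?_
      refine (congrArg (· ≫ D.unitHom.app (f a) (f a)) (VQuiv.injUnit_pullbackUnit f rfl)).trans ?_
      exact inj_unitHom D (f a)
    map_comp := fun a c b => by
      have h := congrArg (fun z => VQuiv.inj C.quiver C.quiver a c b ≫ z.app a b) hmul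
      refine (congrArg (· ≫ k.app a b) (inj_multHom C a c b)).symm.trans ?_
      refine (Category.assoc _ _ _).trans (h.trans ?_)
      refine (VQuiv.inj_tensorHom_assoc k k a c b _).trans ?_
      refine congrArg ((k.app a c ⊗ₘ k.app c b) ≫ ·) ?_
      exact (VQuiv.inj_pullbackTensor_assoc f D.quiver D.quiver a c b _).trans
        (inj_multHom D (f a) (f c) (f b)) }

end VCat

/-! ### The universal property of the homotopy category -/

namespace Templicial

variable {V : Type u} [Category.{v} V] [MonoidalCategory V] [HasColimits V]
  [SymmetricCategory V] [MonoidalClosed V] {X : Templicial V}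

theorem edgePart_congr {C : VCat V} {θ θ' : X ⟶ C.nerve} (h : θ = θ') (a b : X.Ob) :
    (edgePart θ).app a b ≫ eqToHom (congrArg₂ C.quiver.obj
      (congrArg (fun z => nerveBase z a) h) (congrArg (fun z => nerveBase z b) h)) =
      (edgePart θ').app a b := by
  subst h
  exact Category.comp_id _

variable [HasLimits V]

theorem HomotopyComposition.unitHom_toVCat (E : X.HomotopyComposition) :
    E.toVCat.unitHom = X.homUnit :=
  letI : MonObj X.homQuiver :=
    { one := X.homUnit
      mul := E.mult
      one_mul := E.unit_mult
      mul_one := E.mult_unit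
      mul_assoc := E.mult_assoc }
  VCat.unitHom_ofMonoid X.homQuiver

theorem HomotopyComposition.multHom_toVCat (E : X.HomotopyComposition) :
    E.toVCat.multHom = E.mult :=
  letI : MonObj X.homQuiver :=
    { one := X.homUnit
      mul := E.mult
      one_mul := E.unit_mult
      mul_one := E.mult_unit
      mul_assoc := E.mult_assoc }
  VCat.multHom_ofMonoid X.homQuiver

/-- The templicial morphism `X ⟶ N(h'X)` which extends the projection `X_1 ⟶ h'X`. -/
def HomotopyComposition.toNerve (E : X.HomotopyComposition) : X ⟶ E.toVCat.nerve :=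
  homToNerve (C := E.toVCat) (id : X.Ob → X.Ob) X.homProj
    (by
      refine Eq.trans ?_ ((congrArg (· ≫ _) pullbackUnit_id).trans (Category.id_comp _)).symm
      exact E.unitHom_toVCat.symm)
    (by
      refine E.induced.symm.trans (congrArg (fun z => X.comul 1 1 ≫ (X.homProj ⊗ₘ X.homProj) ≫ z) ?_)
      refine Eq.trans ?_ ((congrArg (· ≫ _) (pullbackTensor_id _ _)).trans
        (Category.id_comp _)).symm
      exact E.multHom_toVCat.symm)

theorem HomotopyComposition.edgePart_toNerve (E : X.HomotopyComposition) :
    edgePart E.toNerve = X.homProj :=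
  edgePart_homToNerve _ _ _ _

theorem HomotopyComposition.extends_iff (E : X.HomotopyComposition) (θ : X ⟶ E.toVCat.nerve) :
    E.Extends θ ↔ θ = E.toNerve := by
  constructor
  · rintro ⟨h, h'⟩
    refine hom_nerve_ext h fun a b => ?_
    refine Eq.trans ?_ ((h' a b).trans (congrArg (fun z => z.app a b) E.edgePart_toNerve).symm)
    exact Category.assoc _ _ _
  · rintro rfl
    refine ⟨fun _ => rfl, fun a b => ?_⟩
    refine Eq.trans ?_ (congrArg (fun z => z.app a b) E.edgePart_toNerve)
    exact congrArg (_ ≫ ·) (Category.comp_id _)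

/-- A pinched triangle `T` and the degenerate triangle `l` on its first edge have the same
comultiplication. As `d ≫ g` depends only on the comultiplication, their long edges have the same
image under `g`. -/
theorem coeq_aux {W : Type*} [Category W] {P x t y z : W} {T : P ⟶ t} {O : P ⟶ x} {d : t ⟶ x}
    {μ : t ⟶ y} {s : x ⟶ y} {l : x ⟶ t} {g : x ⟶ z} {m : y ⟶ z} (h : O ≫ s = T ≫ μ)
    (hl : l ≫ μ = s) (hd : l ≫ d = 𝟙 _) (hg : d ≫ g = μ ≫ m) : (T ≫ d) ≫ g = O ≫ g := by
  rw [Category.assoc, hg, ← reassoc_of% h, ← hl, Category.assoc, ← hg, reassoc_of% hd]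

theorem exists_homProj_desc {D : VCat V} (f : X ⟶ D.nerve) :
    ∃ k : X.homQuiver ⟶ (VQuiv.pullback (nerveBase f)).obj D.quiver,
      X.homProj ≫ k = edgePart f :=
  X.isCoeq_homProj.exists_desc (edgePart f)
    (coeq_aux X.pinched_condition X.degenLast_comul X.degenLast_restr (restr_d₁_edgePart f))

/-- Multiplicativity holds on triangles by hypothesis, and it descends because `μ` and `q ⊗ q` are
epimorphisms. -/
theorem mul_aux {W : Type*} [Category W] [MonoidalCategory W] {t x h w : W} {μ : t ⟶ x ⊗ x}
    [Epi μ] {q : x ⟶ h} [Epi (q ⊗ₘ q)] {m : h ⊗ h ⟶ h} {d : t ⟶ x} (hm : μ ≫ (q ⊗ₘ q) ≫ m = d ≫ q)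
    {k : h ⟶ w} {g : x ⟶ w} (hk : q ≫ k = g) {n : w ⊗ w ⟶ w}
    (hg : d ≫ g = μ ≫ (g ⊗ₘ g) ≫ n) : m ≫ k = (k ⊗ₘ k) ≫ n := by
  rw [← cancel_epi (q ⊗ₘ q), ← cancel_epi μ, tensorHom_comp_tensorHom_assoc, hk, ← hg,
    reassoc_of% hm, hk]

/-- The templicial morphism from a quasi-category to the nerve of its homotopy category is
universal. -/
theorem HomotopyComposition.isHomotopyCategory_toNerve (hfaithful : (underlying V).Faithful)
    [PreservesColimitsOfShape WalkingReflexivePair (underlying V)]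
    (hX : X.IsQuasiCategory) (E : X.HomotopyComposition) : IsHomotopyCategory E.toNerve := by
  intro D f
  have hepi : Epi (X.comul 1 1) := VQuiv.epi_of_app fun a b =>
    (hX.comul_elSurjective a b).epi hfaithful
  obtain ⟨k, hk⟩ := exists_homProj_desc f
  -- The map on edges descends to classes, and it respects units and composition because `f`
  -- respects degenerate edges and long edges of triangles.
  let G : E.toVCat ⟶ D := VCat.homOfQuiver (C := E.toVCat) (nerveBase f) k
    (by
      refine (congrArg (· ≫ k) E.unitHom_toVCat).trans ?_
      refine (Category.assoc _ _ _).trans ((congrArg (_ ≫ ·) hk).trans ?_)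
      exact unitEdge_edgePart f)
    (by
      refine (congrArg (· ≫ k) E.multHom_toVCat).trans ?_
      exact mul_aux E.induced hk (restr_d₁_edgePart f))
  have hG : E.toNerve ≫ VCat.nerveMap G = f := by
    refine hom_nerve_ext (fun a => rfl) fun a b => ?_
    refine (Category.comp_id _).trans ?_
    refine (congrArg (fun z => z.app a b) (edgePart_comp_nerveMap E.toNerve G)).trans ?_
    refine Eq.trans ?_ (congrArg (fun z => z.app a b) hk)
    exact congrArg (fun z => z.app a b ≫ k.app a b) E.edgePart_toNerve
  refine ⟨G, hG, fun G' hG' => ?_⟩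
  -- Uniqueness: two such functors agree after the epimorphism `q`, up to the identification of
  -- their values on objects.
  have h := (show E.toNerve ≫ VCat.nerveMap G' = f from hG').trans hG.symm
  refine EnrichedFunctor.ext V (fun a => congrArg (fun z => nerveBase z a) h) fun a b => ?_
  have h1 := edgePart_congr h a b
  rw [edgePart_comp_nerveMap, edgePart_comp_nerveMap, E.edgePart_toNerve] at h1
  have : Epi (X.homProj.app a b) := (X.isCoeq_homProj_app a b).epi
  exact (cancel_epi (X.homProj.app a b)).1 ((Category.assoc _ _ _).symm.trans h1)

end Templicial

/-! ### Adjunctions from universal arrows, and their uniqueness -/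

namespace UniversalArrow

variable {A B : Type*} [Category* A] [Category* B]

/-- A functor has a left adjoint, with a prescribed unit, if it has universal arrows. -/
theorem exists_leftAdjoint (N : B ⥤ A) (F : A → B) (η : ∀ X, X ⟶ N.obj (F X))
    (h : ∀ (X : A) (Y : B) (f : X ⟶ N.obj Y), ∃! g : F X ⟶ Y, η X ≫ N.map g = f) :
    ∃ (L : A ⥤ B) (hobj : ∀ X, L.obj X = F X) (adj : L ⊣ N),
      ∀ X, adj.unit.app X ≫ N.map (eqToHom (hobj X)) = η X := by
  let e : ∀ X Y, (F X ⟶ Y) ≃ (X ⟶ N.obj Y) := fun X Y =>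
    Equiv.ofBijective (fun g => η X ≫ N.map g)
      ⟨fun g g' hg => (h X Y _).unique hg rfl, fun f => (h X Y f).exists⟩
  have he : ∀ X Y Y' g h, e X Y' (h ≫ g) = e X Y h ≫ N.map g := fun X Y Y' g h =>
    (congrArg (η X ≫ ·) (N.map_comp h g)).trans (Category.assoc _ _ _).symm
  refine ⟨Adjunction.leftAdjointOfEquiv e he, fun _ => rfl, Adjunction.adjunctionOfEquivLeft e he,
    fun X => ?_⟩
  refine (congrArg (_ ≫ ·) (N.map_id _)).trans ((Category.comp_id _).trans ?_)
  rw [Adjunction.adjunctionOfEquivLeft_unit_app]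
  exact (congrArg (η X ≫ ·) (N.map_id _)).trans (Category.comp_id _)

/-- The restriction to a full subcategory of a left adjoint is the left adjoint of the
corestriction. -/
theorem existsUnique_iso (P : ObjectProperty A) (N : B ⥤ A) (hN : ∀ Y, P (N.obj Y))
    {L' : P.FullSubcategory ⥤ B} (adj' : L' ⊣ P.lift N hN) {L : A ⥤ B} (adj : L ⊣ N) :
    ∃! α : P.ι ⋙ L ≅ L',
      ∀ X, adj.unit.app X.obj ≫ N.map (α.hom.app X) = (adj'.unit.app X).hom := by
  -- As the values of `N` lie in the full subcategory, the restricted functor is left adjoint to the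
  -- corestriction of `N`; uniqueness of left adjoints then gives the isomorphism.
  let adj₁ : P.ι ⋙ L ⊣ P.lift N hN := adj.restrictFullyFaithful P.fullyFaithfulι
    (Functor.FullyFaithful.id B) (Iso.refl _) (Iso.refl _)
  have h1 : ∀ X, (adj₁.unit.app X).hom = adj.unit.app X.obj := fun X => by
    have h := adj.map_restrictFullyFaithful_unit_app P.fullyFaithfulι
      (Functor.FullyFaithful.id B) (L := P.ι ⋙ L) (Iso.refl _) (R := P.lift N hN) (Iso.refl _) X
    refine (h : (adj₁.unit.app X).hom = _).trans ?_
    refine (congrArg (adj.unit.app X.obj ≫ ·) ((congrArg (· ≫ _) (N.map_id _)).trans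
      (Category.comp_id _))).trans (Category.comp_id _)
  refine ⟨adj₁.leftAdjointUniq adj', fun X => ?_, fun β hβ => ?_⟩
  · rw [← h1]
    exact congrArg (fun z => z.hom) (Adjunction.unit_leftAdjointUniq_hom_app adj₁ adj' X)
  · ext X
    refine (adj.homEquiv X.obj (L'.obj X)).injective ?_
    rw [Adjunction.homEquiv_unit, Adjunction.homEquiv_unit]
    refine (hβ X).trans ?_
    rw [← h1]
    exact (congrArg (fun z => z.hom)
      (Adjunction.unit_leftAdjointUniq_hom_app adj₁ adj' X)).symm

/-- Universal arrows are unique up to a unique isomorphism. -/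
theorem existsUnique_iso_of_universal (N : B ⥤ A) {X : A} {Y Y' : B} (η : X ⟶ N.obj Y)
    (η' : X ⟶ N.obj Y') (h : ∀ (Z : B) (f : X ⟶ N.obj Z), ∃! g : Y ⟶ Z, η ≫ N.map g = f)
    (h' : ∀ (Z : B) (f : X ⟶ N.obj Z), ∃! g : Y' ⟶ Z, η' ≫ N.map g = f) :
    ∃! e : Y ≅ Y', η ≫ N.map e.hom = η' := by
  obtain ⟨g, hg, -⟩ := h Y' η'
  obtain ⟨g', hg', -⟩ := h' Y η
  refine ⟨⟨g, g', (h Y η).unique (y₁ := g ≫ g') (y₂ := 𝟙 Y) ?_ ?_,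
    (h' Y' η').unique (y₁ := g' ≫ g) (y₂ := 𝟙 Y') ?_ ?_⟩, hg,
    fun e he => Iso.ext ((h Y' η').unique he hg)⟩
  all_goals simp [reassoc_of% hg, reassoc_of% hg', hg, hg']

end UniversalArrow

/-! ### Templicial maps out of a standard simplex -/

section

open Simplicial

namespace SSetAux

variable {n m : ℕ}

/-- The values of a simplex of a standard simplex, as natural numbers. -/
def sval (σ : (SSet.stdSimplex.{v}.obj ⦋n⦌).obj (op ⦋m⦌)) (t : ℕ) : ℕ :=
  σ ⟨min t m, by omega⟩

theorem sval_le (σ : (SSet.stdSimplex.{v}.obj ⦋n⦌).obj (op ⦋m⦌)) (t : ℕ) : sval σ t ≤ n :=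
  Nat.le_of_lt_succ (σ ⟨min t m, by omega⟩).isLt

theorem sval_mono (σ : (SSet.stdSimplex.{v}.obj ⦋n⦌).obj (op ⦋m⦌)) {s t : ℕ} (h : s ≤ t) :
    sval σ s ≤ sval σ t :=
  SSet.stdSimplex.monotone_apply σ (by
    simp only [Fin.mk_le_mk]
    omega)

theorem sval_ext {σ τ : (SSet.stdSimplex.{v}.obj ⦋n⦌).obj (op ⦋m⦌)}
    (h : ∀ t, t ≤ m → sval σ t = sval τ t) : σ = τ :=
  simplex_ext fun i => Fin.ext (by
    have := h i (by omega)
    simpa only [sval, Nat.min_eq_left (show (i : ℕ) ≤ m by omega)] using this)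

theorem sval_eq (σ : (SSet.stdSimplex.{v}.obj ⦋n⦌).obj (op ⦋m⦌)) {t : ℕ} (i : Fin (m + 1))
    (h : min t m = i) : sval σ t = σ i :=
  congrArg (fun z : Fin (m + 1) => (σ z : ℕ)) (Fin.ext h)

theorem sval_restrict {k : ℕ} (f : FInt.mk k ⟶ FInt.mk m)
    (σ : (SSet.stdSimplex.{v}.obj ⦋n⦌).obj (op ⦋m⦌)) (t : ℕ) :
    sval (restrict _ f σ) t = sval σ (FInt.val f t) :=
  (sval_eq σ (f.toOrderHom ⟨min t k, Nat.lt_succ_of_le (Nat.min_le_right t k)⟩) (Nat.min_eq_left (FInt.val_le f t))).symm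

theorem sval_frontFace {k l : ℕ} (σ : (SSet.stdSimplex.{v}.obj ⦋n⦌).obj (op ⦋k + l⦌)) {t : ℕ}
    (h : t ≤ k) : sval (frontFace _ k l σ) t = sval σ t :=
  (sval_eq σ _ (show min t (k + l) = min t k by omega)).symm

theorem sval_backFace {k l : ℕ} (σ : (SSet.stdSimplex.{v}.obj ⦋n⦌).obj (op ⦋k + l⦌)) {t : ℕ}
    (h : t ≤ l) : sval (backFace _ k l σ) t = sval σ (k + t) :=
  (sval_eq σ _ (show min (k + t) (k + l) = k + min t l by omega)).symm

theorem sval_first (σ : (SSet.stdSimplex.{v}.obj ⦋n⦌).obj (op ⦋m⦌)) :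
    sval (first _ σ) 0 = sval σ 0 :=
  (sval_eq σ 0 (by simp)).symm

theorem sval_last (σ : (SSet.stdSimplex.{v}.obj ⦋n⦌).obj (op ⦋m⦌)) :
    sval (last _ σ) 0 = sval σ m :=
  (sval_eq σ (Fin.last m) (by simp)).symm

/-- The simplex of `Δ^n` with the vertices `i, i + 1, ..., i + m`. -/
def seg (i m : ℕ) (h : i + m ≤ n) : (SSet.stdSimplex.{v}.obj ⦋n⦌).obj (op ⦋m⦌) :=
  SSet.stdSimplex.objEquiv.symm (SimplexCategory.Hom.mk
    ⟨fun t : Fin (m + 1) => (⟨i + t, by omega⟩ : Fin (n + 1)), fun _ _ h =>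
      Nat.add_le_add_left (Fin.le_iff_val_le_val.mp h) i⟩)

theorem sval_seg (i m : ℕ) (h : i + m ≤ n) {t : ℕ} (ht : t ≤ m) :
    sval (seg.{v} i m h) t = i + t :=
  congrArg (i + ·) (Nat.min_eq_left ht)

/-- The endpoint preserving map underlying a simplex of `Δ^n`. -/
def shape (σ : (SSet.stdSimplex.{v}.obj ⦋n⦌).obj (op ⦋m⦌)) (i k : ℕ) (h0 : sval σ 0 = i)
    (hm : sval σ m = i + k) : FInt.mk m ⟶ FInt.mk k :=
  FInt.mk' (fun t => sval σ t - i) (fun _ _ h _ => Nat.sub_le_sub_right (sval_mono σ h) i)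
    (by simp [h0]) (by simp [hm])

theorem val_shape (σ : (SSet.stdSimplex.{v}.obj ⦋n⦌).obj (op ⦋m⦌)) (i k : ℕ) (h0 : sval σ 0 = i)
    (hm : sval σ m = i + k) {t : ℕ} (ht : t ≤ m) : FInt.val (shape σ i k h0 hm) t = sval σ t - i :=
  FInt.val_mk' _ _ _ _ ht

theorem restrict_shape (σ : (SSet.stdSimplex.{v}.obj ⦋n⦌).obj (op ⦋m⦌)) (i k : ℕ)
    (h0 : sval σ 0 = i) (hm : sval σ m = i + k) (h : i + k ≤ n) :
    restrict _ (shape σ i k h0 hm) (seg i k h) = σ :=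
  sval_ext fun t ht => by
    have h1 := sval_mono σ (Nat.zero_le t)
    have h2 := sval_mono σ ht
    rw [sval_restrict, val_shape _ _ _ _ _ ht, sval_seg _ _ _ (by omega)]
    omega

end SSetAux

namespace Templicial

open SSetAux

variable {V : Type u} [Category.{v} V] [MonoidalCategory V] [HasColimits V]
  [SymmetricCategory V] [MonoidalClosed V] (X : Templicial V)

/-- The degenerate `0`-simplex at a vertex. -/
def idElt {a b : X.Ob} (h : a = b) : 𝟙_ V ⟶ (X.lvl 0).obj a b :=
  VQuiv.injUnit h ≫ X.counitInv.app a b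

theorem idElt_counit {a b : X.Ob} (h : a = b) : X.idElt h ≫ X.counit.app a b = VQuiv.injUnit h := by
  rw [idElt, Category.assoc]
  exact (congrArg (fun z => VQuiv.injUnit h ≫ z.app a b) X.counitInv_counit).trans
    (Category.comp_id _)

theorem eq_idElt {a b : X.Ob} (h : a = b) (w : 𝟙_ V ⟶ (X.lvl 0).obj a b)
    (hw : w ≫ X.counit.app a b = VQuiv.injUnit h) : w = X.idElt h := by
  rw [idElt, ← hw, Category.assoc]
  exact ((congrArg (fun z => w ≫ z.app a b) X.counit_counitInv).trans
    (Category.comp_id _)).symm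

/-- The tensor product of two composable elements. -/
def tensorElt {P Q : VQuiv V X.Ob} {a c b : X.Ob} (x : 𝟙_ V ⟶ P.obj a c) (y : 𝟙_ V ⟶ Q.obj c b) :
    𝟙_ V ⟶ (P ⊗ Q).obj a b :=
  (λ_ (𝟙_ V)).inv ≫ (x ⊗ₘ y) ≫ VQuiv.inj P Q a c b

theorem tensorElt_tensorHom {P Q P' Q' : VQuiv V X.Ob} {a c b : X.Ob} (x : 𝟙_ V ⟶ P.obj a c)
    (y : 𝟙_ V ⟶ Q.obj c b) (f : P ⟶ P') (g : Q ⟶ Q') :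
    X.tensorElt x y ≫ (f ⊗ₘ g).app a b = X.tensorElt (x ≫ f.app a c) (y ≫ g.app c b) := by
  rw [tensorElt, tensorElt, Category.assoc, Category.assoc, VQuiv.inj_tensorHom,
    tensorHom_comp_tensorHom_assoc]

theorem injUnit_tensorElt {P : VQuiv V X.Ob} {a b : X.Ob} (w : 𝟙_ V ⟶ P.obj a b) :
    X.tensorElt (VQuiv.injUnit rfl) w = w ≫ (λ_ P).inv.app a b := by
  have h : (λ_ P).inv.app a b = (λ_ _).inv ≫ VQuiv.injUnit rfl ▷ P a b ≫ VQuiv.inj _ P a a b := rfl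
  rw [h, tensorElt, leftUnitor_inv_naturality_assoc, MonoidalCategory.tensorHom_def',
    Category.assoc]

theorem tensorElt_injUnit {P : VQuiv V X.Ob} {a b : X.Ob} (w : 𝟙_ V ⟶ P.obj a b) :
    X.tensorElt w (VQuiv.injUnit rfl) = w ≫ (ρ_ P).inv.app a b := by
  have h : (ρ_ P).inv.app a b = (ρ_ _).inv ≫ P a b ◁ VQuiv.injUnit rfl ≫ VQuiv.inj P _ a b b := rfl
  rw [h, tensorElt, rightUnitor_inv_naturality_assoc, MonoidalCategory.tensorHom_def,
    Category.assoc, unitors_inv_equal]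

theorem idElt_tensorElt {P : VQuiv V X.Ob} {a b : X.Ob} (w : 𝟙_ V ⟶ P.obj a b) :
    X.tensorElt (X.idElt rfl) w = w ≫ ((λ_ P).inv ≫ X.counitInv ▷ P).app a b := by
  rw [VQuiv.comp_app, ← Category.assoc, ← injUnit_tensorElt, ← tensorHom_id, tensorElt_tensorHom]
  exact congrArg (X.tensorElt (X.idElt rfl)) (Category.comp_id w).symm

theorem tensorElt_idElt {P : VQuiv V X.Ob} {a b : X.Ob} (w : 𝟙_ V ⟶ P.obj a b) :
    X.tensorElt w (X.idElt rfl) = w ≫ ((ρ_ P).inv ≫ P ◁ X.counitInv).app a b := by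
  rw [VQuiv.comp_app, ← Category.assoc, ← tensorElt_injUnit, ← id_tensorHom, tensorElt_tensorHom]
  exact congrArg (fun z => X.tensorElt z (X.idElt rfl)) (Category.comp_id w).symm

variable {X}

theorem restr_comp {m n k : ℕ} (f : FInt.mk m ⟶ FInt.mk n) (g : FInt.mk n ⟶ FInt.mk k) :
    X.restr (f ≫ g) = X.restr g ≫ X.restr f :=
  X.fct.map_comp g.op f.op

/-- The end `j` of an interval is an index of its own, tied to `i + m` only by a proof, so that the
vertex `v j` in the types does not depend on how the length is written. The length may therefore be
replaced by any equal one. -/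
theorem seg_restr_congr {n : ℕ} {v : ℕ → X.Ob}
    (x : ∀ i m j, i + m = j → j ≤ n → (𝟙_ V ⟶ (X.lvl m).obj (v i) (v j))) {i m m' j k : ℕ}
    (h : i + m = j) (h' : i + m' = j) (hj : j ≤ n) (f : FInt.mk k ⟶ FInt.mk m)
    (f' : FInt.mk k ⟶ FInt.mk m') (hf : ∀ t, t ≤ k → FInt.val f t = FInt.val f' t) :
    x i m j h hj ≫ (X.restr f).app _ _ = x i m' j h' hj ≫ (X.restr f').app _ _ := by
  obtain rfl : m = m' := by omega
  rw [FInt.hom_ext hf]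

theorem seg_restr_cast {n : ℕ} {v : ℕ → X.Ob}
    (x : ∀ i m j, i + m = j → j ≤ n → (𝟙_ V ⟶ (X.lvl m).obj (v i) (v j))) {i m m' j : ℕ}
    (h : i + m = j) (h' : i + m' = j) (hj : j ≤ n) (f : FInt.mk m ⟶ FInt.mk m')
    (hf : ∀ t, t ≤ m → FInt.val f t = t) :
    x i m j h hj = x i m' j h' hj ≫ (X.restr f).app _ _ := by
  rw [← seg_restr_congr x h h' hj (𝟙 _) f fun t ht => (FInt.val_id _ ht).trans (hf t ht).symm]
  have h1 : X.restr (𝟙 (FInt.mk m)) = 𝟙 _ := X.fct.map_id _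
  rw [h1]
  exact (Category.comp_id _).symm

/-- Compatibility has to be assumed only for pieces of positive length; a piece of length zero is
degenerate and is handled by counitality. -/
theorem seg_comul {n : ℕ} {v : ℕ → X.Ob}
    (x : ∀ i m j, i + m = j → j ≤ n → (𝟙_ V ⟶ (X.lvl m).obj (v i) (v j)))
    (hid : ∀ i j h hj, x i 0 j h hj = X.idElt (congrArg v h))
    (hcomul : ∀ i k c l j h hj (h' : i + k = c) hc (h'' : c + l = j), 0 < k → 0 < l →
      x i (k + l) j h hj ≫ (X.comul k l).app _ _ =
        X.tensorElt (x i k c h' hc) (x c l j h'' hj)) (i k c l j : ℕ) (h : i + (k + l) = j)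
    (hj : j ≤ n) (h' : i + k = c) (hc : c ≤ n) (h'' : c + l = j) :
    x i (k + l) j h hj ≫ (X.comul k l).app _ _ = X.tensorElt (x i k c h' hc) (x c l j h'' hj) := by
  obtain rfl | hk := Nat.eq_zero_or_pos k
  · obtain rfl : c = i := h'.symm
    rw [hid, idElt_tensorElt, seg_restr_cast x h h'' hj (λ_ (FInt.mk l)).hom fun t ht =>
      FInt.val_leftUnitor_hom (FInt.mk l) (ht.trans (Nat.zero_add l).le), Category.assoc]
    exact congrArg (fun z => x c l j h'' hj ≫ z.app _ _) (X.map_leftUnitor_comul (FInt.mk l))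
  · obtain rfl | hl := Nat.eq_zero_or_pos l
    · obtain rfl : c = j := h''
      rw [hid, tensorElt_idElt, seg_restr_cast x h h' hj (ρ_ (FInt.mk k)).hom fun t ht =>
        FInt.val_rightUnitor_hom (FInt.mk k) ht, Category.assoc]
      exact congrArg (fun z => x i k c h' hj ≫ z.app _ _) (X.map_rightUnitor_comul (FInt.mk k))
    · exact hcomul _ _ _ _ _ _ _ _ _ _ hk hl

/-- The value of the templicial map on `Δ^n` determined by the simplices `x` at a simplex `σ`. -/
def segElt {n m : ℕ} {v : ℕ → X.Ob}
    (x : ∀ i m j, i + m = j → j ≤ n → (𝟙_ V ⟶ (X.lvl m).obj (v i) (v j)))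
    (σ : (SSet.stdSimplex.{v}.obj ⦋n⦌).obj (op ⦋m⦌)) (i j : ℕ) (hi : sval σ 0 = i)
    (hj : sval σ m = j) : 𝟙_ V ⟶ (X.lvl m).obj (v i) (v j) :=
  have h : i + (j - i) = j := by
    have := sval_mono σ (Nat.zero_le m)
    omega
  x i (j - i) j h (hj ▸ sval_le σ m) ≫
    (X.restr (shape σ i (j - i) hi (hj.trans h.symm))).app _ _

section

variable {n m : ℕ} {v : ℕ → X.Ob}
  (x : ∀ i m j, i + m = j → j ≤ n → (𝟙_ V ⟶ (X.lvl m).obj (v i) (v j)))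
  (σ : (SSet.stdSimplex.{v}.obj ⦋n⦌).obj (op ⦋m⦌)) (i j : ℕ)

theorem segElt_eq {k : ℕ} (hi : sval σ 0 = i) (hj : sval σ m = j) (h : i + k = j) (hn : j ≤ n)
    (f : FInt.mk m ⟶ FInt.mk k) (hf : ∀ t, t ≤ m → sval σ t = i + FInt.val f t) :
    segElt x σ i j hi hj = x i k j h hn ≫ (X.restr f).app _ _ :=
  seg_restr_congr x _ _ _ _ _ fun t ht => by
    rw [val_shape _ _ _ _ _ ht, hf t ht, Nat.add_sub_cancel_left]

theorem segElt_restrict {k : ℕ} (f : FInt.mk k ⟶ FInt.mk m) (hi : sval σ 0 = i)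
    (hj : sval σ m = j) (hi' : sval (restrict _ f σ) 0 = i) (hj' : sval (restrict _ f σ) k = j) :
    segElt x (restrict _ f σ) i j hi' hj' = segElt x σ i j hi hj ≫ (X.restr f).app _ _ := by
  have h0 := sval_mono σ (Nat.zero_le m)
  have h : i + (j - i) = j := by omega
  have hs : ∀ t, t ≤ m → sval σ t = i + FInt.val (shape σ i (j - i) hi (hj.trans h.symm)) t := by
    intro t ht
    have := sval_mono σ (Nat.zero_le t)
    rw [val_shape _ _ _ _ _ ht]
    omega
  rw [segElt_eq x σ i j hi hj h (hj ▸ sval_le σ m) _ hs,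
    segElt_eq x (restrict _ f σ) i j hi' hj' h (hj ▸ sval_le σ m)
      (f ≫ shape σ i (j - i) hi (hj.trans h.symm)) fun t ht => by
        rw [sval_restrict, FInt.val_comp, hs _ (FInt.val_le f t)], Category.assoc]
  rw [restr_comp]
  rfl

/-- Cutting a simplex cuts its shape into the tensor product of the shapes of its front and back
faces, so the claim is naturality of the comultiplication applied to the case of intervals. -/
theorem segElt_comul (hid : ∀ i j h hj, x i 0 j h hj = X.idElt (congrArg v h))
    (hcomul : ∀ i k c l j h hj (h' : i + k = c) hc (h'' : c + l = j), 0 < k → 0 < l →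
      x i (k + l) j h hj ≫ (X.comul k l).app _ _ =
        X.tensorElt (x i k c h' hc) (x c l j h'' hj)) {k l : ℕ} (c : ℕ)
    (σ : (SSet.stdSimplex.{v}.obj ⦋n⦌).obj (op ⦋k + l⦌)) (hi : sval σ 0 = i)
    (hj : sval σ (k + l) = j) (hi' : sval (frontFace _ k l σ) 0 = i)
    (hc : sval (frontFace _ k l σ) k = c) (hc' : sval (backFace _ k l σ) 0 = c)
    (hj' : sval (backFace _ k l σ) l = j) :
    segElt x σ i j hi hj ≫ (X.comul k l).app _ _ =
      X.tensorElt (segElt x (frontFace _ k l σ) i c hi' hc)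
        (segElt x (backFace _ k l σ) c j hc' hj') := by
  have h0 := sval_mono (frontFace _ k l σ) (Nat.zero_le k)
  have h0' := sval_mono (backFace _ k l σ) (Nat.zero_le l)
  have hjn : j ≤ n := hj ▸ sval_le σ _
  have h1 : i + (c - i) = c := by omega
  have h2 : c + (j - c) = j := by omega
  have h3 : i + ((c - i) + (j - c)) = j := by omega
  let f₁ := shape (frontFace _ k l σ) i (c - i) hi' (hc.trans h1.symm)
  let f₂ := shape (backFace _ k l σ) c (j - c) hc' (hj'.trans h2.symm)
  have hf₁ : ∀ t, t ≤ k → sval (frontFace _ k l σ) t = i + FInt.val f₁ t := fun t ht => by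
    have := sval_mono (frontFace _ k l σ) (Nat.zero_le t)
    rw [val_shape _ _ _ _ _ ht]
    omega
  have hf₂ : ∀ t, t ≤ l → sval (backFace _ k l σ) t = c + FInt.val f₂ t := fun t ht => by
    have := sval_mono (backFace _ k l σ) (Nat.zero_le t)
    rw [val_shape _ _ _ _ _ ht]
    omega
  have hf : ∀ t, t ≤ k + l → sval σ t = i + FInt.val (f₁ ⊗ₘ f₂) t := fun t ht => by
    rw [FInt.val_tensorHom _ _ (show t ≤ (FInt.mk k).len + (FInt.mk l).len from ht)]
    split_ifs with h
    · rw [← hf₁ t h, sval_frontFace σ h]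
    · have h5 : t - k ≤ l := by omega
      have h4 : k + (t - k) = t := by
        have : ¬ t ≤ k := h
        omega
      have h6 := hf₂ (t - k) h5
      rw [sval_backFace σ h5, h4] at h6
      change sval σ t = i + ((c - i) + FInt.val f₂ (t - k))
      omega
  rw [segElt_eq x σ i j hi hj h3 hjn (f₁ ⊗ₘ f₂) hf, Category.assoc]
  refine (congrArg (fun z => x i _ j h3 hjn ≫ z.app _ _) (X.comul_natural f₁ f₂)).trans ?_
  refine (Category.assoc _ _ _).symm.trans ?_
  refine (congrArg (· ≫ _) (seg_comul x hid hcomul i (c - i) c (j - c) j h3 hjn h1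
    (by omega) h2)).trans ?_
  exact X.tensorElt_tensorHom _ _ _ _

theorem segElt_counit (hid : ∀ i j h hj, x i 0 j h hj = X.idElt (congrArg v h))
    (σ : (SSet.stdSimplex.{v}.obj ⦋n⦌).obj (op ⦋0⦌)) (hi : sval σ 0 = i) (hj : sval σ 0 = j)
    (h : v i = v j) : segElt x σ i j hi hj ≫ X.counit.app _ _ = VQuiv.injUnit h := by
  obtain rfl : i = j := hi.symm.trans hj
  have hn : i ≤ n := hi ▸ sval_le σ 0
  rw [segElt_eq x σ i i hi hj (Nat.add_zero i) hn (𝟙 _) fun t ht => by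
    obtain rfl : t = 0 := Nat.le_zero.1 ht
    rw [FInt.val_zero]
    exact hi, hid, Category.assoc]
  have h1 : X.restr (𝟙 (FInt.mk 0)) = 𝟙 _ := X.fct.map_id _
  rw [h1]
  exact (congrArg (X.idElt rfl ≫ ·) (Category.id_comp _)).trans (X.idElt_counit rfl)

end

end Templicial

namespace TemplicialMap

open SSetAux Templicial

variable {V : Type u} [Category.{v} V] [MonoidalCategory V] [HasColimits V]
  [SymmetricCategory V] [MonoidalClosed V] {X : Templicial V}

theorem sval_of_first {n m : ℕ} {σ : (SSet.stdSimplex.{v}.obj ⦋n⦌).obj (op ⦋m⦌)}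
    {a : (SSet.stdSimplex.{v}.obj ⦋n⦌).obj (op ⦋0⦌)} (h : first _ σ = a) :
    sval σ 0 = sval a 0 := by
  rw [← h, sval_first]

theorem sval_of_last {n m : ℕ} {σ : (SSet.stdSimplex.{v}.obj ⦋n⦌).obj (op ⦋m⦌)}
    {a : (SSet.stdSimplex.{v}.obj ⦋n⦌).obj (op ⦋0⦌)} (h : last _ σ = a) :
    sval σ m = sval a 0 := by
  rw [← h, sval_last]

/-- The templicial map `F̃(Δ^n) ⟶ X` determined by a compatible family of simplices. -/
def ofSeg {n : ℕ} (v : ℕ → X.Ob)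
    (x : ∀ i m j, i + m = j → j ≤ n → (𝟙_ V ⟶ (X.lvl m).obj (v i) (v j)))
    (hid : ∀ i j h hj, x i 0 j h hj = X.idElt (congrArg v h))
    (hcomul : ∀ i k c l j h hj (h' : i + k = c) hc (h'' : c + l = j), 0 < k → 0 < l →
      x i (k + l) j h hj ≫ (X.comul k l).app _ _ =
        X.tensorElt (x i k c h' hc) (x c l j h'' hj)) :
    TemplicialMap (SSet.stdSimplex.{v}.obj ⦋n⦌) X where
  vertex a := v (sval a 0)
  elt σ a b ha hb := segElt x σ (sval a 0) (sval b 0) (sval_of_first ha) (sval_of_last hb)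
  naturality f σ _ _ _ _ _ _ := segElt_restrict x σ _ _ f _ _ _ _
  comul _ _ σ _ _ _ _ _ _ _ _ _ := segElt_comul x _ _ hid hcomul _ σ _ _ _ _ _ _
  counit σ _ _ _ _ h := segElt_counit x _ _ hid σ _ _ h

/-- Templicial maps on `Δ^n` are determined by their values on intervals. -/
theorem ext_seg {n : ℕ} {φ φ' : TemplicialMap (SSet.stdSimplex.{v}.obj ⦋n⦌) X}
    (hv : ∀ a, φ.vertex a = φ'.vertex a)
    (h : ∀ i m (him : i + m ≤ n) a b (ha : first _ (seg i m him) = a)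
      (hb : last _ (seg i m him) = b), 0 < m →
      φ.elt (seg i m him) a b ha hb ≫ eqToHom (congrArg₂ (X.lvl m).obj (hv a) (hv b)) =
        φ'.elt (seg i m him) a b ha hb) : φ = φ' := by
  obtain ⟨w, e, h1, h2, h3⟩ := φ
  obtain ⟨w', e', h1', h2', h3'⟩ := φ'
  obtain rfl : w = w' := funext hv
  obtain rfl : @e = @e' := by
    funext m σ a b ha hb
    have hi := sval_of_first ha
    have hj := sval_of_last hb
    have hm := sval_mono σ (Nat.zero_le m)
    have hn := sval_le σ m
    have hij : sval σ m = sval σ 0 + (sval σ m - sval σ 0) := by omega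
    have hle : sval σ 0 + (sval σ m - sval σ 0) ≤ n := by omega
    -- Every simplex is the restriction, along an endpoint preserving map, of the interval between
    -- its first and last vertex, so naturality reduces the claim to intervals.
    have hσ := restrict_shape σ _ _ rfl hij hle
    have hfa : first _ (seg (sval σ 0) (sval σ m - sval σ 0) hle) = a := sval_ext fun t ht => by
      obtain rfl : t = 0 := Nat.le_zero.1 ht
      rw [sval_first, sval_seg _ _ _ (Nat.zero_le _), ← hi]
      rfl
    have hlb : last _ (seg (sval σ 0) (sval σ m - sval σ 0) hle) = b := sval_ext fun t ht => by
      obtain rfl : t = 0 := Nat.le_zero.1 ht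
      rw [sval_last, sval_seg _ _ _ le_rfl, ← hj, ← hij]
    have key : ∀ (τ : (SSet.stdSimplex.{v}.obj ⦋n⦌).obj (op ⦋m⦌)) (hτ : τ = σ)
        (hτa : first _ τ = a) (hτb : last _ τ = b), e τ a b hτa hτb = e' τ a b hτa hτb →
        e σ a b ha hb = e' σ a b ha hb := by
      rintro _ rfl _ _ h
      exact h
    refine key _ hσ (by rw [hσ, ha]) (by rw [hσ, hb]) ?_
    rw [h1 _ _ a b hfa hlb, h1' _ _ a b hfa hlb]
    refine congrArg (· ≫ _) ?_
    -- For an interval of length zero the value is forced by the counit, which is invertible.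
    obtain h0 | h0 := Nat.eq_zero_or_pos (sval σ m - sval σ 0)
    · have key' : ∀ (p : ℕ) (hp : p = 0) (τ : (SSet.stdSimplex.{v}.obj ⦋n⦌).obj (op ⦋p⦌)) hτa hτb,
          e τ a b hτa hτb = e' τ a b hτa hτb := by
        rintro p rfl τ hτa hτb
        have hab : w a = w b := congrArg w (hτa.symm.trans hτb)
        rw [X.eq_idElt hab _ (h3 τ a b hτa hτb hab), X.eq_idElt hab _ (h3' τ a b hτa hτb hab)]
      exact key' _ h0 _ _ _
    · exact (Category.comp_id _).symm.trans (h _ _ hle a b hfa hlb h0)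
  rfl

end TemplicialMap

end

/-! ### Simplices of dimension at most two in the underlying simplicial set -/

namespace TemplicialMap

open SSetAux Templicial

variable {V : Type u} [Category.{v} V] [MonoidalCategory V] [HasColimits V]
  [SymmetricCategory V] [MonoidalClosed V] {X : Templicial V}

/-- The vertices of a `1`-simplex. -/
def lineVertex (a b : X.Ob) : ℕ → X.Ob
  | 0 => a
  | _ + 1 => b

/-- The simplices of a `1`-simplex. -/
def lineSeg {a b : X.Ob} (e : 𝟙_ V ⟶ (X.lvl 1).obj a b) : ∀ i m : ℕ, i + m ≤ 1 →
    (𝟙_ V ⟶ (X.lvl m).obj (lineVertex a b i) (lineVertex a b (i + m)))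
  | _, 0, _ => X.idElt rfl
  | 0, 1, _ => e
  | 0, (_ + 2), h => absurd h (by omega)
  | (_ + 1), (_ + 1), h => absurd h (by omega)

/-- The simplices of a `1`-simplex. -/
def lineFam {a b : X.Ob} (e : 𝟙_ V ⟶ (X.lvl 1).obj a b) (i m j : ℕ) (h : i + m = j) (hj : j ≤ 1) :
    𝟙_ V ⟶ (X.lvl m).obj (lineVertex a b i) (lineVertex a b j) := by
  subst h
  exact lineSeg e i m hj

/-- The vertices of a `2`-simplex. -/
def triVertex (a b c : X.Ob) : ℕ → X.Ob
  | 0 => a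
  | 1 => b
  | _ + 2 => c

/-- The simplices of a `2`-simplex. -/
def triSeg {a b c : X.Ob} (e : 𝟙_ V ⟶ (X.lvl 1).obj a b) (e' : 𝟙_ V ⟶ (X.lvl 1).obj b c)
    (σ : 𝟙_ V ⟶ (X.lvl 2).obj a c) : ∀ i m : ℕ, i + m ≤ 2 →
    (𝟙_ V ⟶ (X.lvl m).obj (triVertex a b c i) (triVertex a b c (i + m)))
  | _, 0, _ => X.idElt rfl
  | 0, 1, _ => e
  | 1, 1, _ => e'
  | 0, 2, _ => σ
  | 0, (_ + 3), h => absurd h (by omega)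
  | 1, (_ + 2), h => absurd h (by omega)
  | (_ + 2), (_ + 1), h => absurd h (by omega)

/-- The simplices of a `2`-simplex. -/
def triFam {a b c : X.Ob} (e : 𝟙_ V ⟶ (X.lvl 1).obj a b) (e' : 𝟙_ V ⟶ (X.lvl 1).obj b c)
    (σ : 𝟙_ V ⟶ (X.lvl 2).obj a c) (i m j : ℕ) (h : i + m = j) (hj : j ≤ 2) :
    𝟙_ V ⟶ (X.lvl m).obj (triVertex a b c i) (triVertex a b c j) := by
  subst h
  exact triSeg e e' σ i m hj

end TemplicialMap

section

open Simplicial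

namespace TemplicialMap

open SSetAux Templicial

variable {V : Type u} [Category.{v} V] [MonoidalCategory V] [HasColimits V]
  [SymmetricCategory V] [MonoidalClosed V] {X : Templicial V}

/-- The `0`-simplex at a vertex. -/
def point (a : X.Ob) : TemplicialMap (SSet.stdSimplex.{v}.obj ⦋0⦌) X :=
  ofSeg (fun _ => a)
    (fun i m j h hj => by
      obtain rfl : m = 0 := by omega
      exact X.idElt rfl)
    (fun _ _ _ _ => rfl) (fun _ _ _ _ _ _ _ _ _ _ _ _ => by omega)

/-- The `1`-simplex given by an edge. -/
def line {a b : X.Ob} (e : 𝟙_ V ⟶ (X.lvl 1).obj a b) :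
    TemplicialMap (SSet.stdSimplex.{v}.obj ⦋1⦌) X :=
  ofSeg (lineVertex a b)
    (lineFam e)
    (fun i j h hj => by
      obtain rfl : i = j := h
      exact lineSeg.eq_1 e _ hj) (fun _ _ _ _ _ _ _ _ _ _ _ _ => by omega)

/-- The `2`-simplex given by a triangle and its edges. -/
def tri {a b c : X.Ob} (e : 𝟙_ V ⟶ (X.lvl 1).obj a b) (e' : 𝟙_ V ⟶ (X.lvl 1).obj b c)
    (σ : 𝟙_ V ⟶ (X.lvl 2).obj a c) (h : σ ≫ (X.comul 1 1).app a c = X.tensorElt e e') :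
    TemplicialMap (SSet.stdSimplex.{v}.obj ⦋2⦌) X :=
  ofSeg (triVertex a b c)
    (triFam e e' σ)
    (fun i j h hj => by
      obtain rfl : i = j := h
      exact triSeg.eq_1 e e' σ _ hj) (fun i k c l j h1 hj h2 hc h3 hk hl => by
      obtain rfl : i = 0 := by omega
      obtain rfl : k = 1 := by omega
      obtain rfl : l = 1 := by omega
      obtain rfl : c = 1 := h2.symm
      obtain rfl : j = 2 := h1.symm
      exact h)

/-- The edge underlying a `1`-simplex. -/
def edgeElt (f : TemplicialMap (SSet.stdSimplex.{v}.obj ⦋1⦌) X) :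
    𝟙_ V ⟶ (X.lvl 1).obj (f.vertex (pt 0)) (f.vertex (pt 1)) :=
  f.elt (edge 0 1 (Fin.zero_le _)) (pt 0) (pt 1) (first_edge _ _ _) (last_edge _ _ _)

theorem eq_pt {n : ℕ} (a : (SSet.stdSimplex.{v}.obj ⦋n⦌).obj (op ⦋0⦌)) : a = pt (a 0) :=
  simplex_ext fun i => by
    obtain rfl : i = 0 := Fin.ext (by omega)
    rfl

theorem point_ext {x y : TemplicialMap (SSet.stdSimplex.{v}.obj ⦋0⦌) X}
    (h : x.vertex (pt 0) = y.vertex (pt 0)) : x = y :=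
  ext_seg (fun a => by
    rw [eq_pt a, show a 0 = 0 from Fin.ext (by omega)]
    exact h) fun _ _ _ _ _ _ _ _ => by omega

theorem line_ext {f f' : TemplicialMap (SSet.stdSimplex.{v}.obj ⦋1⦌) X}
    (h₀ : f.vertex (pt 0) = f'.vertex (pt 0)) (h₁ : f.vertex (pt 1) = f'.vertex (pt 1))
    (h : edgeElt f ≫ eqToHom (congrArg₂ (X.lvl 1).obj h₀ h₁) = edgeElt f') : f = f' := by
  refine ext_seg (fun a => ?_) fun i m him a b ha hb hm => ?_
  · rw [eq_pt a]
    generalize a 0 = k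
    fin_cases k
    · exact h₀
    · exact h₁
  · obtain rfl : m = 1 := by omega
    obtain rfl : i = 0 := by omega
    have hs : seg.{v} (n := 1) 0 1 him = edge 0 1 (Fin.zero_le _) :=
      simplex_ext fun t => by fin_cases t <;> rfl
    obtain rfl : a = pt 0 := ha.symm.trans ((congrArg (first _) hs).trans (first_edge 0 1 _))
    obtain rfl : b = pt 1 := hb.symm.trans ((congrArg (last _) hs).trans (last_edge 0 1 _))
    generalize seg.{v} (n := 1) 0 1 him = s at hs ha hb ⊢
    subst hs
    exact h

theorem edgeElt_line {a b : X.Ob} (e : 𝟙_ V ⟶ (X.lvl 1).obj a b) : edgeElt (line e) = e := by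
  refine (segElt_eq (lineFam e) (edge 0 1 (Fin.zero_le _)) 0 1 rfl rfl (k := 1) rfl
    le_rfl (𝟙 _) fun t ht => ?_).trans ?_
  · obtain rfl | rfl : t = 0 ∨ t = 1 := by omega
    · rfl
    · rfl
  · have h1 : X.restr (𝟙 (FInt.mk 1)) = 𝟙 _ := X.fct.map_id _
    rw [h1]
    exact Category.comp_id _

section

variable {a b c : X.Ob} (e : 𝟙_ V ⟶ (X.lvl 1).obj a b) (e' : 𝟙_ V ⟶ (X.lvl 1).obj b c)
    (σ : 𝟙_ V ⟶ (X.lvl 2).obj a c) (h : σ ≫ (X.comul 1 1).app a c = X.tensorElt e e')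

theorem edgeElt_tri_two :
    edgeElt ((tri e e' σ h).precomp (SSet.stdSimplex.map (SimplexCategory.δ 2))) = e := by
  refine (segElt_eq (triFam e e' σ) ((SSet.stdSimplex.map (SimplexCategory.δ 2)).app _
    (edge 0 1 (Fin.zero_le _))) 0 1 rfl rfl (k := 1) rfl
    (by omega) (𝟙 _) fun t ht => ?_).trans ?_
  · obtain rfl | rfl : t = 0 ∨ t = 1 := by omega
    · rfl
    · rfl
  · have h1 : X.restr (𝟙 (FInt.mk 1)) = 𝟙 _ := X.fct.map_id _
    rw [h1]
    exact Category.comp_id _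

theorem edgeElt_tri_zero :
    edgeElt ((tri e e' σ h).precomp (SSet.stdSimplex.map (SimplexCategory.δ 0))) = e' := by
  refine (segElt_eq (triFam e e' σ) ((SSet.stdSimplex.map (SimplexCategory.δ 0)).app _
    (edge 0 1 (Fin.zero_le _))) 1 2 rfl rfl (k := 1) rfl
    (by omega) (𝟙 _) fun t ht => ?_).trans ?_
  · obtain rfl | rfl : t = 0 ∨ t = 1 := by omega
    · rfl
    · rfl
  · have h1 : X.restr (𝟙 (FInt.mk 1)) = 𝟙 _ := X.fct.map_id _
    rw [h1]
    exact Category.comp_id _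

theorem edgeElt_tri_one :
    edgeElt ((tri e e' σ h).precomp (SSet.stdSimplex.map (SimplexCategory.δ 1))) =
      σ ≫ (X.restr d₁).app a c := by
  refine (segElt_eq (triFam e e' σ) ((SSet.stdSimplex.map (SimplexCategory.δ 1)).app _
    (edge 0 1 (Fin.zero_le _))) 0 2 rfl rfl (k := 2) rfl
    (by omega) d₁ fun t ht => ?_)
  obtain rfl | rfl : t = 0 ∨ t = 1 := by omega
  · rfl
  · rfl

end

end TemplicialMap

end

/-! ### The nerve adjunction in terms of truncated simplicial sets -/

theorem homEquiv_symm_ofNatIsoRight_comp {A B C : Type*} [Category A] [Category B] [Category C]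
    {L : A ⥤ B} {R : B ⥤ A} (adj : L ⊣ R) {L' : B ⥤ C} {R' : C ⥤ B} (adj' : L' ⊣ R') {H : C ⥤ A}
    (i : R' ⋙ R ≅ H) {X : A} {Y : C} (φ : X ⟶ H.obj Y) (f : L'.obj (L.obj X) ⟶ Y)
    (ψ : L.obj X ⟶ R'.obj Y) (hf : adj'.homEquiv _ _ f = ψ)
    (h : φ ≫ i.inv.app Y = adj.unit.app X ≫ R.map ψ) :
    (((adj.comp adj').ofNatIsoRight i).homEquiv X Y).symm φ = f := by
  rw [Equiv.symm_apply_eq, Adjunction.homEquiv_ofNatIsoRight_apply, Adjunction.comp_homEquiv]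
  change φ = (adj.homEquiv _ _ (adj'.homEquiv _ _ f)) ≫ _
  rw [hf, adj.homEquiv_unit, ← h, Category.assoc, Iso.inv_hom_id_app, Category.comp_id]

/-- The functor on homotopy categories adjoint to a map into a nerve, on the level of
`2`-truncated simplicial sets. -/
theorem nerveAdjunction_homEquiv_symm {K : SSet.{v}} {C : Type v} [SmallCategory C]
    (φ : K ⟶ CategoryTheory.nerve C) :
    (nerveAdjunction.homEquiv K (Cat.of C)).symm φ =
      (SSet.Truncated.HomotopyCategory.descOfTruncation
        ((SSet.truncation 2).map φ)).toCatHom := by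
  -- The nerve adjunction is composed of truncation with coskeleton and of the adjunction for the
  -- 2-truncated nerve, corrected by the isomorphism of a nerve with its 2-coskeleton. The transpose
  -- along it is thus determined by the truncation of `φ`.
  refine homEquiv_symm_ofNatIsoRight_comp (SSet.coskAdj 2) SSet.Truncated.nerve₂Adj
    Nerve.cosk₂Iso.symm (Y := Cat.of C) φ _ ((SSet.truncation 2).map φ) ?_ ?_
  · rw [SSet.Truncated.nerve₂Adj, Adjunction.mkOfHomEquiv_homEquiv]
    exact SSet.Truncated.HomotopyCategory.functorEquiv.right_inv _
  · exact (SSet.coskAdj 2).unit.naturality φ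

/-! ### The homotopy category of the underlying simplicial set -/

section

open Simplicial

namespace Templicial

open SSetAux TemplicialMap SimplexCategory.Truncated SSet.Truncated

variable {V : Type u} [Category.{v} V] [MonoidalCategory V] [HasColimits V]
  [SymmetricCategory V] [MonoidalClosed V] (X : Templicial V)

/-- The `2`-truncation of the underlying simplicial set. -/
abbrev truncatedSSet : SSet.Truncated.{v} 2 := (SSet.truncation 2).obj (underlyingSSet X)

variable {X}

/-- The vertex of `X` given by a `0`-simplex of the underlying simplicial set. -/
def vert (x : X.truncatedSSet.obj (op ⦋0⦌₂)) : X.Ob := TemplicialMap.vertex x (pt 0)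

theorem vertex_src {x y : X.truncatedSSet.obj (op ⦋0⦌₂)} (e : Edge x y) :
    TemplicialMap.vertex e.edge (pt 0) = vert x := by
  exact (congrArg (TemplicialMap.vertex e.edge) (map_pt (SimplexCategory.δ 1) 0).symm).trans
    (congrArg vert e.src_eq)

theorem vertex_tgt {x y : X.truncatedSSet.obj (op ⦋0⦌₂)} (e : Edge x y) :
    TemplicialMap.vertex e.edge (pt 1) = vert y := by
  exact (congrArg (TemplicialMap.vertex e.edge) (map_pt (SimplexCategory.δ 0) 0).symm).trans
    (congrArg vert e.tgt_eq)

/-- The edge of `X` given by an edge of the underlying simplicial set. -/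
def el {x y : X.truncatedSSet.obj (op ⦋0⦌₂)} (e : Edge x y) :
    𝟙_ V ⟶ (X.lvl 1).obj (vert x) (vert y) :=
  edgeElt e.edge ≫ eqToHom (congrArg₂ (X.lvl 1).obj (vertex_src e) (vertex_tgt e))

theorem eq_of_vert_eq {x y : X.truncatedSSet.obj (op ⦋0⦌₂)} (h : vert x = vert y) : x = y :=
  point_ext h

theorem exists_vert (a : X.Ob) : ∃ x : X.truncatedSSet.obj (op ⦋0⦌₂), vert x = a :=
  ⟨point a, rfl⟩

theorem edge_eq {x y : X.truncatedSSet.obj (op ⦋0⦌₂)} (e : Edge x y)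
    (f : TemplicialMap (SSet.stdSimplex.{v}.obj ⦋1⦌) X) (h₀ : f.vertex (pt 0) = vert x)
    (h₁ : f.vertex (pt 1) = vert y)
    (h : edgeElt f ≫ eqToHom (congrArg₂ (X.lvl 1).obj h₀ h₁) = el e) : f = e.edge := by
  refine line_ext (h₀.trans (vertex_src e).symm) (h₁.trans (vertex_tgt e).symm) ?_
  rw [el] at h
  rw [← cancel_mono (eqToHom (congrArg₂ (X.lvl 1).obj (vertex_src e) (vertex_tgt e))), ← h,
    Category.assoc, eqToHom_trans]

/-- Together with `el_injective` this identifies the edges of `Ũ(X)` between two vertices with the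
elements of the corresponding component of `X_1`. -/
theorem exists_edge {x y : X.truncatedSSet.obj (op ⦋0⦌₂)}
    (w : 𝟙_ V ⟶ (X.lvl 1).obj (vert x) (vert y)) : ∃ e : Edge x y, el e = w := by
  refine ⟨⟨line w, eq_of_vert_eq ?_, eq_of_vert_eq ?_⟩, ?_⟩
  · exact congrArg (line w).vertex (map_pt (SimplexCategory.δ 1) 0)
  · exact congrArg (line w).vertex (map_pt (SimplexCategory.δ 0) 0)
  · exact (congrArg (· ≫ _) (edgeElt_line w)).trans (Category.comp_id _)

theorem el_injective {x y : X.truncatedSSet.obj (op ⦋0⦌₂)} {e e' : Edge x y}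
    (h : el e = el e') : e = e' :=
  Edge.ext (edge_eq e' e.edge (vertex_src e) (vertex_tgt e) h)

/-- Triangles of `Ũ(X)` come from elements of `X_2` whose comultiplication is the tensor product of
two actual edges. A general element of `X_1 ⊗ X_1` is not of this form, but for composing two given
edges it suffices. -/
theorem nonempty_compStruct {x y z : X.truncatedSSet.obj (op ⦋0⦌₂)} (e : Edge x y) (e' : Edge y z)
    (e'' : Edge x z) (σ : 𝟙_ V ⟶ (X.lvl 2).obj (vert x) (vert z))
    (h : σ ≫ (X.comul 1 1).app _ _ = X.tensorElt (el e) (el e'))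
    (h' : σ ≫ (X.restr d₁).app _ _ = el e'') : Nonempty (Edge.CompStruct e e' e'') :=
  ⟨{ simplex := tri (el e) (el e') σ h
     d₂ := edge_eq e _ rfl rfl ((Category.comp_id _).trans (edgeElt_tri_two _ _ _ _))
     d₀ := edge_eq e' _ rfl rfl ((Category.comp_id _).trans (edgeElt_tri_zero _ _ _ _))
     d₁ := edge_eq e'' _ rfl rfl ((Category.comp_id _).trans
      ((edgeElt_tri_one _ _ _ _).trans h')) }⟩

theorem elt_degenerate (x : TemplicialMap (SSet.stdSimplex.{v}.obj ⦋0⦌) X)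
    (σ : (SSet.stdSimplex.{v}.obj ⦋0⦌).obj (op ⦋1⦌))
    (a b : (SSet.stdSimplex.{v}.obj ⦋0⦌).obj (op ⦋0⦌)) (ha : first _ σ = a) (hb : last _ σ = b)
    (h : (X.lvl 1).obj (x.vertex a) (x.vertex b) =
      (X.lvl 1).obj (x.vertex (pt 0)) (x.vertex (pt 0))) :
    x.elt σ a b ha hb ≫ eqToHom h =
      VQuiv.injUnit rfl ≫ X.unitEdge.app (x.vertex (pt 0)) (x.vertex (pt 0)) := by
  obtain rfl : σ = restrict _ s₀ (pt 0) := simplex_ext fun i => Fin.ext (by omega)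
  obtain rfl : a = pt 0 := simplex_ext fun i => Fin.ext (by omega)
  obtain rfl : b = pt 0 := simplex_ext fun i => Fin.ext (by omega)
  rw [x.naturality s₀ (pt 0) (pt 0) (pt 0) (first_pt 0) (last_pt 0),
    X.eq_idElt rfl _ (x.counit (pt 0) (pt 0) (pt 0) (first_pt 0) (last_pt 0) rfl)]
  exact (Category.comp_id _).trans (Category.assoc _ _ _)

theorem el_id (x : X.truncatedSSet.obj (op ⦋0⦌₂)) :
    el (Edge.id x) = VQuiv.injUnit rfl ≫ X.unitEdge.app (vert x) (vert x) :=
  elt_degenerate x _ _ _ _ _ _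

/-- In the homotopy category of the underlying simplicial set of a quasi-category in `V`, every
morphism is the class of an edge. -/
theorem IsQuasiCategory.exists_homMk (hX : X.IsQuasiCategory)
    {a b : X.truncatedSSet.HomotopyCategory} (f : a ⟶ b) :
    ∃ e : Edge a.as.as b.as.as, HomotopyCategory.homMk e = f := by
  -- The morphisms represented by one edge contain the generators. They are closed under composition
  -- because the tensor product of two edges lifts along the comultiplication to a triangle.
  let W : MorphismProperty X.truncatedSSet.HomotopyCategory :=
    fun a b f => ∃ e : Edge a.as.as b.as.as, HomotopyCategory.homMk e = f
  have : W.IsMultiplicative :=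
    { id_mem := fun a => ⟨Edge.id _, HomotopyCategory.homMk_id _⟩
      comp_mem := by
        rintro a b c _ _ ⟨e, rfl⟩ ⟨e', rfl⟩
        obtain ⟨σ, hσ⟩ := hX.comul_elSurjective _ _ (X.tensorElt (el e) (el e'))
        obtain ⟨e'', he''⟩ := exists_edge (σ ≫ (X.restr d₁).app _ _)
        obtain ⟨h⟩ := nonempty_compStruct e e' e'' σ hσ he''.symm
        exact ⟨e'', (HomotopyCategory.homMk_comp_homMk h).symm⟩ }
  have hW : W = ⊤ := HomotopyCategory.morphismProperty_eq_top fun e => ⟨e, rfl⟩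
  have hf : W f := by
    rw [hW]
    trivial
  exact hf

variable [HasLimits V]

/-- Edges with the same class in `h'X` have the same class in the homotopy category of the
underlying simplicial set. -/
theorem homMk_congr [PreservesColimitsOfShape WalkingReflexivePair (underlying V)]
    {x y : X.truncatedSSet.obj (op ⦋0⦌₂)} (e e' : Edge x y)
    (h : el e ≫ X.homProj.app _ _ = el e' ≫ X.homProj.app _ _) :
    HomotopyCategory.homMk e = HomotopyCategory.homMk e' := by
  choose edgeOf hedgeOf using fun w => exists_edge (X := X) (x := x) (y := y) w
  have hel : ∀ e : Edge x y, edgeOf (el e) = e := fun e => el_injective (hedgeOf _)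
  rw [← hel e, ← hel e']
  -- Since `U` preserves the reflexive coequaliser `q`, it suffices to compare the two faces of a
  -- single pinched triangle. This is a triangle of `Ũ(X)` whose last edge is an identity, so its
  -- faces become equal in the homotopy category.
  refine (X.isCoeq_homProj_app (vert x) (vert y)).el_congr (X.pinchedDegen.app (vert x) (vert y))
    (congrArg (fun z => z.app (vert x) (vert y)) X.pinchedDegen_zero)
    (congrArg (fun z => z.app (vert x) (vert y)) X.pinchedDegen_one)
    (fun w => HomotopyCategory.homMk (edgeOf w)) (fun t => ?_) h
  obtain ⟨hc⟩ := nonempty_compStruct (edgeOf (t ≫ X.pinchedOne.app _ _)) (Edge.id y)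
    (edgeOf (t ≫ (X.pinchedTriangle ≫ X.restr d₁).app _ _)) (t ≫ X.pinchedTriangle.app _ _) (by
      rw [hedgeOf, el_id, Category.assoc]
      have h1 := congrArg (fun z => t ≫ z.app (vert x) (vert y)) X.pinched_condition
      refine h1.symm.trans ?_
      refine (Category.assoc _ _ _).symm.trans ?_
      rw [tensorUnitEdge, VQuiv.comp_app, ← Category.assoc, ← X.tensorElt_injUnit,
        ← id_tensorHom, tensorElt_tensorHom]
      exact congrArg (fun z => X.tensorElt z _) (Category.comp_id _)) (by
      rw [hedgeOf, Category.assoc]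
      rfl)
  have h2 := HomotopyCategory.homMk_comp_homMk hc
  rw [HomotopyCategory.homMk_id, Category.comp_id] at h2
  exact h2.symm

end Templicial

end

/-! ### The comparison functor of a templicial morphism to a nerve -/

section

open Simplicial

namespace Templicial

open SSetAux TemplicialMap SimplexCategory.Truncated SSet.Truncated

variable {V : Type u} [Category.{v} V] [MonoidalCategory V] [HasColimits V]
  [SymmetricCategory V] [MonoidalClosed V] {X : Templicial V} {C : VCat V}

/-- The functor from the homotopy category of the underlying simplicial set to the underlying
category of `C` given by a templicial morphism `X ⟶ N(C)`. -/
def edgeFunctor (θ : X ⟶ C.nerve) :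
    X.truncatedSSet.HomotopyCategory ⥤ ForgetEnrichment V C.Ob :=
  HomotopyCategory.descOfTruncation
    ((SSet.truncation 2).map (underlyingSSetMap θ ≫ C.toNerve))

theorem homotopyFunctor_eq (θ : X ⟶ C.nerve) :
    VCat.homotopyFunctor θ = (edgeFunctor θ).toCatHom :=
  nerveAdjunction_homEquiv_symm _

theorem homOf_edgePart_aux (θ : X ⟶ C.nerve) {a b a' b' : X.Ob}
    (w : 𝟙_ V ⟶ (X.lvl 1).obj a b) {g : 𝟙_ V ⟶ C.quiver.obj (nerveBase θ a) (nerveBase θ b)}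
    (hg : g = w ≫ (edgePart θ).app a b) (ha : a = a') (hb : b = b') :
    eqToHom (congrArg (fun z => ForgetEnrichment.of V (nerveBase θ z)) ha.symm) ≫
      ForgetEnrichment.homOf V g ≫
        eqToHom (congrArg (fun z => ForgetEnrichment.of V (nerveBase θ z)) hb) =
      ForgetEnrichment.homOf V ((w ≫ eqToHom (congrArg₂ (X.lvl 1).obj ha hb)) ≫
        (edgePart θ).app a' b') := by
  subst ha hb hg
  simp
  rfl

theorem edgeFunctor_map_homMk (θ : X ⟶ C.nerve) {x y : X.truncatedSSet.obj (op ⦋0⦌₂)}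
    (e : Edge x y) : (edgeFunctor θ).map (HomotopyCategory.homMk e) =
      ForgetEnrichment.homOf V (el e ≫ (edgePart θ).app (vert x) (vert y)) := by
  refine (HomotopyCategory.descOfTruncation_map_homMk _ e).trans ?_
  exact homOf_edgePart_aux θ (edgeElt e.edge) (Category.assoc _ _ _) (vertex_src e) (vertex_tgt e)

theorem homOf_injective {a b : C.Ob} {f g : 𝟙_ V ⟶ C.quiver.obj a b}
    (h : ForgetEnrichment.homOf V f = ForgetEnrichment.homOf V g) : f = g := h

/-- The inverse must be strict: its map on objects is the inverse bijection, and the resulting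
equalities of objects are absorbed by transports. -/
theorem isIso_of_bijective {A B : Type v} [SmallCategory A] [SmallCategory B] (F : A ⥤ B)
    [F.Full] [F.Faithful] (h : Function.Bijective F.obj) : IsIso F.toCatHom := by
  choose r hr using h.2
  have hr' : ∀ a, r (F.obj a) = a := fun a => h.1 (hr _)
  let G : B ⥤ A :=
    { obj := r
      map := fun {b b'} f => F.preimage (eqToHom (hr b) ≫ f ≫ eqToHom (hr b').symm)
      map_id := fun b => F.map_injective (by simp)
      map_comp := fun f g => F.map_injective (by simp) }
  have hG : ∀ (a a' : A) (f : a ⟶ a'),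
      G.map (F.map f) = eqToHom (hr' a) ≫ f ≫ eqToHom (hr' a').symm := fun a a' f =>
    F.map_injective ((F.map_preimage _).trans (by simp [eqToHom_map]))
  refine ⟨G.toCatHom, ?_, ?_⟩
  · ext1
    exact CategoryTheory.Functor.ext hr' hG
  · ext1
    exact CategoryTheory.Functor.ext hr fun b b' f => F.map_preimage _

section

variable [HasLimits V] [PreservesColimitsOfShape WalkingReflexivePair (underlying V)]

/-- Morphisms of the source are classes of edges, so it is enough that edges with the same image in
`C` already have the same class in `h'X`. -/
theorem IsQuasiCategory.faithful_edgeFunctor (hX : X.IsQuasiCategory) (θ : X ⟶ C.nerve)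
    (h : ∀ (a b : X.Ob) (w w' : 𝟙_ V ⟶ (X.lvl 1).obj a b),
      w ≫ (edgePart θ).app a b = w' ≫ (edgePart θ).app a b →
        w ≫ X.homProj.app a b = w' ≫ X.homProj.app a b) : (edgeFunctor θ).Faithful where
  map_injective {a b} f g hfg := by
    obtain ⟨e, rfl⟩ := hX.exists_homMk f
    obtain ⟨e', rfl⟩ := hX.exists_homMk g
    refine homMk_congr e e' (h _ _ _ _ (homOf_injective ?_))
    exact (edgeFunctor_map_homMk θ e).symm.trans (hfg.trans (edgeFunctor_map_homMk θ e'))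

/-- A morphism of the underlying category is an element of a hom-object of `C`; it lifts to an
element of `X_1`, hence to an edge of `Ũ(X)`. -/
theorem full_edgeFunctor (θ : X ⟶ C.nerve)
    (h : ∀ a b : X.Ob, ElSurjective ((edgePart θ).app a b)) : (edgeFunctor θ).Full where
  map_surjective {a b} f := by
    obtain ⟨w, hw⟩ := h (vert a.as.as) (vert b.as.as) (ForgetEnrichment.homTo V f)
    obtain ⟨e, rfl⟩ := exists_edge w
    exact ⟨HomotopyCategory.homMk e, (edgeFunctor_map_homMk θ e).trans hw⟩

theorem bijective_edgeFunctor_obj (θ : X ⟶ C.nerve) (h : Function.Bijective (nerveBase θ)) :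
    Function.Bijective (edgeFunctor θ).obj := by
  constructor
  · intro a b hab
    exact HomotopyCategory.ext (eq_of_vert_eq (h.1 hab))
  · intro c
    obtain ⟨a, ha⟩ := h.2 (ForgetEnrichment.to V c)
    obtain ⟨x, rfl⟩ := exists_vert a
    exact ⟨HomotopyCategory.mk x, ha⟩

end

end Templicial

end

/-! ### Invariance under isomorphism, and the comparison for a universal arrow -/

theorem isIso_of_isIso_comp {C : Type*} [Category C] {a b c d : C} (f : a ⟶ b) (g : b ⟶ c)
    (h : c ⟶ d) (_ : IsIso (f ≫ g)) (_ : IsIso (g ≫ h)) : IsIso f := by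
  have : IsSplitEpi g := ⟨⟨inv (f ≫ g) ≫ f, by rw [Category.assoc, IsIso.inv_hom_id]⟩⟩
  have : Mono g := mono_of_mono g h
  have : IsIso g := isIso_of_mono_of_isSplitEpi g
  exact IsIso.of_isIso_comp_right f g

theorem comp_map_inv {C D : Type*} [Category C] [Category D] (F : C ⥤ D) {X : D} {A B : C}
    (e : A ≅ B) {f : X ⟶ F.obj A} {g : X ⟶ F.obj B} (h : f ≫ F.map e.hom = g) :
    g ≫ F.map e.inv = f := by
  rw [← h, Category.assoc, ← Functor.map_comp, e.hom_inv_id, CategoryTheory.Functor.map_id,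
    Category.comp_id]

theorem ElSurjective.comp_isIso {V : Type u} [Category.{v} V] [MonoidalCategory V] {A B D : V}
    {p : A ⟶ B} (hp : ElSurjective p) (m : B ⟶ D) (_ : IsIso m) {q : A ⟶ D} (hq : q = p ≫ m) :
    ElSurjective q := fun y => by
  obtain ⟨x, hx⟩ := hp (y ≫ inv m)
  exact ⟨x, by rw [hq, reassoc_of% hx, IsIso.inv_hom_id, Category.comp_id]⟩

theorem comp_eq_of_comp_isIso {C : Type*} [Category C] {Z A B D : C} {p : A ⟶ B} {m : B ⟶ D}
    (_ : IsIso m) {q : A ⟶ D} (hq : q = p ≫ m) {w w' : Z ⟶ A} (h : w ≫ q = w' ≫ q) :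
    w ≫ p = w' ≫ p := by
  rw [← cancel_mono m, Category.assoc, Category.assoc, ← hq, h]

namespace VCat

variable {V : Type u} [Category.{v} V] [MonoidalCategory V]

theorem isIso_quiverMap_of_eq_id {C : VCat V} {F : C ⟶ C} (h : F = 𝟙 C) (a b : C.Ob) :
    IsIso ((quiverMap F).app a b) := by
  subst h
  exact inferInstanceAs (IsIso (𝟙 _))

/-- The round trip along `F` and its inverse returns to `a` and `b` only up to equality of objects.
The two-out-of-six argument of `isIso_of_isIso_comp` avoids transporting the inverse. -/
theorem isIso_quiverMap {C D : VCat V} (F : C ⟶ D) [IsIso F] (a b : C.Ob) :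
    IsIso ((quiverMap F).app a b) := by
  have h1 : IsIso ((quiverMap F).app a b ≫ (quiverMap (inv F)).app (objMap F a) (objMap F b)) :=
    isIso_quiverMap_of_eq_id (IsIso.hom_inv_id F) a b
  have h2 : IsIso ((quiverMap (inv F)).app (objMap F a) (objMap F b) ≫
      (quiverMap F).app (objMap (inv F) (objMap F a)) (objMap (inv F) (objMap F b))) :=
    isIso_quiverMap_of_eq_id (IsIso.inv_hom_id F) _ _
  exact isIso_of_isIso_comp _ _ _ h1 h2

theorem bijective_objMap {C D : VCat V} (F : C ⟶ D) [IsIso F] :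
    Function.Bijective (objMap F) :=
  Function.bijective_iff_has_inverse.2 ⟨objMap (inv F),
    fun a => congrArg (fun G => objMap G a) (IsIso.hom_inv_id F),
    fun a => congrArg (fun G => objMap G a) (IsIso.inv_hom_id F)⟩

end VCat

namespace Templicial

variable {V : Type u} [Category.{v} V] [MonoidalCategory V] [HasColimits V]
  [SymmetricCategory V] [MonoidalClosed V] {X : Templicial V} [HasLimits V]
  [PreservesColimitsOfShape WalkingReflexivePair (underlying V)]

/-- The map on edges is `q` followed by an isomorphism, so it is surjective on elements and
identifies no more edges than `q` does. -/
theorem HomotopyComposition.isIso_homotopyFunctor_comp (E : X.HomotopyComposition)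
    (hX : X.IsQuasiCategory) {C : VCat V} (g : E.toVCat ⟶ C) [IsIso g] :
    IsIso (VCat.homotopyFunctor (E.toNerve ≫ VCat.nerveMap g)) := by
  have key : ∀ a b : X.Ob, (edgePart (E.toNerve ≫ VCat.nerveMap g)).app a b =
      X.homProj.app a b ≫ (VCat.quiverMap g).app a b := fun a b => by
    rw [edgePart_comp_nerveMap]
    exact congrArg (fun z => z.app a b ≫ (VCat.quiverMap g).app a b) E.edgePart_toNerve
  have := full_edgeFunctor (E.toNerve ≫ VCat.nerveMap g) fun a b =>
    (X.homProj_elSurjective a b).comp_isIso _ (VCat.isIso_quiverMap g a b) (key a b)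
  have := hX.faithful_edgeFunctor (E.toNerve ≫ VCat.nerveMap g) fun a b _ _ =>
    comp_eq_of_comp_isIso (VCat.isIso_quiverMap g a b) (key a b)
  rw [homotopyFunctor_eq]
  exact isIso_of_bijective _ (bijective_edgeFunctor_obj _ (VCat.bijective_objMap g))

/-- For a quasi-category `X` in `V`, the canonical functor from the homotopy category of the
underlying simplicial set to the underlying category of the homotopy category is an isomorphism. -/
theorem HomotopyComposition.isIso_homotopyFunctor (hfaithful : (underlying V).Faithful)
    (E : X.HomotopyComposition) (hX : X.IsQuasiCategory) {C : VCat V}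
    (θ : X ⟶ (templicialNerve V).obj C) (hθ : IsHomotopyCategory θ) :
    IsIso (VCat.homotopyFunctor θ) := by
  -- Any universal `θ` is the constructed one followed by the nerve of an isomorphism of
  -- `V`-enriched categories.
  obtain ⟨e, he, -⟩ := UniversalArrow.existsUnique_iso_of_universal (templicialNerve V) θ
    E.toNerve hθ (E.isHomotopyCategory_toNerve hfaithful hX)
  obtain rfl : E.toNerve ≫ (templicialNerve V).map e.inv = θ :=
    comp_map_inv _ e he
  exact E.isIso_homotopyFunctor_comp hX e.inv

end Templicial

end

/-! ### The main theorem -/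

theorem mainTheorem5 {V : Type u} [Category.{v} V] [MonoidalCategory V] [HasColimits V]
    [SymmetricCategory V] [MonoidalClosed V] [HasLimits V]
    (hfaithful : (underlying V).Faithful)
    (hpreserves : PreservesColimitsOfShape WalkingReflexivePair (underlying V))
    (hreflects : ReflectsColimitsOfShape WalkingReflexivePair (underlying V)) :
    -- `h'X` is a `V`-enriched category for every quasi-category `X` in `V`, with the unique
    -- composition induced by `X`
    ∃ E : ∀ X : QCat V, X.obj.HomotopyComposition,
      (∀ (X : QCat V) (m : X.obj.homQuiver ⊗ X.obj.homQuiver ⟶ X.obj.homQuiver),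
        X.obj.IsInducedComposition m → m = (E X).mult) ∧
      -- there is a unique templicial morphism `η_X : X ⟶ N(h'X)` extending `q`
      ∃ η : ∀ X : QCat V, X.obj ⟶ (templicialNerve V).obj (E X).toVCat,
        (∀ (X : QCat V) (θ : X.obj ⟶ (templicialNerve V).obj (E X).toVCat),
          (E X).Extends θ ↔ θ = η X) ∧
        -- `X ↦ h'X` extends to a functor which is left adjoint to the templicial nerve, as a functor
        -- to the full subcategory of quasi-categories in `V`, with unit `η`
        (∃ (hN : ∀ C : VCat V, ((templicialNerve V).obj C).IsQuasiCategory)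
          (h' : QCat V ⥤ VCat V) (hobj : ∀ X : QCat V, h'.obj X = (E X).toVCat)
          (adj : h' ⊣ quasiNerve hN),
          (∀ X : QCat V, (adj.unit.app X).hom ≫ (templicialNerve V).map (eqToHom (hobj X)) = η X) ∧
          -- any left adjoint `h_V` of the templicial nerve is canonically isomorphic to `h'` on
          -- quasi-categories in `V`
          ∀ (hV : Templicial V ⥤ VCat V) (adjV : hV ⊣ templicialNerve V),
            ∃! α : ObjectProperty.ι (fun X : Templicial V => X.IsQuasiCategory) ⋙ hV ≅ h',
              ∀ X : QCat V, adjV.unit.app X.obj ≫ (templicialNerve V).map (α.hom.app X) =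
                (adj.unit.app X).hom) ∧
        -- for every quasi-category `X` in `V`, the homotopy category `h_V X` exists, it is
        -- canonically isomorphic to `h'X`, and `h Ũ(X) ⟶ U(h_V X)` is an isomorphism of categories
        ∀ X : QCat V, IsHomotopyCategory (η X) ∧
          ∀ (C : VCat V) (θ : X.obj ⟶ (templicialNerve V).obj C), IsHomotopyCategory θ →
            (∃! e : C ≅ (E X).toVCat, θ ≫ (templicialNerve V).map e.hom = η X) ∧
            IsIso (VCat.homotopyFunctor θ) := by
  have hN : ∀ C : VCat V, ((templicialNerve V).obj C).IsQuasiCategory :=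
    fun C => VCat.nerve_isQuasiCategory C
  have hE : ∀ X : QCat V, Nonempty X.obj.HomotopyComposition :=
    fun X => X.property.nonempty_homotopyComposition hfaithful
  -- The choice is harmless, since the induced composition is unique.
  let E : ∀ X : QCat V, X.obj.HomotopyComposition := fun X => (hE X).some
  have hη : ∀ X : QCat V, IsHomotopyCategory (E X).toNerve :=
    fun X => (E X).isHomotopyCategory_toNerve hfaithful X.property
  refine ⟨E, fun X m hm => X.property.induced_unique hfaithful hm (E X).induced,
    fun X => (E X).toNerve, fun X θ => (E X).extends_iff θ, ?_, fun X => ⟨hη X, fun C θ hθ => ⟨?_, ?_⟩⟩⟩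
  -- Since all nerves are quasi-categories, the arrows `η` remain universal for the nerve viewed as
  -- a functor to the full subcategory.
  · obtain ⟨h', hobj, adj, h⟩ := UniversalArrow.exists_leftAdjoint (quasiNerve hN)
      (fun X => (E X).toVCat) (fun X => ⟨(E X).toNerve⟩) fun X D f => by
        obtain ⟨g, hg, hg'⟩ := hη X D f.hom
        exact ⟨g, InducedCategory.hom_ext hg,
          fun g' h => hg' g' (congrArg (fun z => z.hom) h)⟩
    exact ⟨hN, h', hobj, adj, fun X => congrArg (fun z => z.hom) (h X),
      fun hV adjV => UniversalArrow.existsUnique_iso _ (templicialNerve V) hN adj adjV⟩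
  · exact UniversalArrow.existsUnique_iso_of_universal (templicialNerve V) θ (E X).toNerve hθ (hη X)
  · exact (E X).isIso_homotopyFunctor hfaithful X.property θ hθ
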